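/- **Setting.** Let $f$ be a nonlinearity with $f(s)=s^2+o(s^2)$ as $s\to0^+$, and let $Q>0$ be the even $H^1(\mathbb R)$ solution of $Q''+f(Q)=Q$. Put $\mathcal L w=-w''+w-f'(Q)w$ and $\varphi=-Q'/Q$. Let $\mathcal Y$ be the class of functions $g$ such that for every $j$ there are $K_j,r_j$ with $|g^{(j)}(x)|\le K_j(1+|x|)^{r_j}e^{-|x|}$ on $\mathbb R$; here $g\in C^\infty$ and $j$ is arbitrary if $f\in C^\infty$, while $g\in C^n$ and $j\le n$ are meant if $f$ is only of class $C^n$. For an odd $F$, an even $G$ and $\gamma\in\mathbb R$, consider the system $$(\mathcal L A)'+a(3Q-2f(Q))'=F,\qquad (\mathcal L B)'+3aQ''-3A''-f'(Q)A=G,\qquad (\Omega)$$ with $A$ even, $A-\gamma\in\mathcal Y$, $B$ odd, $B-b\varphi\in\mathcal Y$, $a,b\in\mathbb R$. Let $(A_{1,0},B_{1,0},a_{1,0},b_{1,0})$ be its solution for $F=(f'(Q))'$, $G=f'(Q)$, $\gamma=0$ with $\int Q'B_{1,0}=0$, and, writing $A,B,a$ for $A_{1,0},B_{1,0},a_{1,0}$,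 let $(A_{2,0},B_{2,0},a_{2,0},b_{2,0})$ be a solution for $\gamma=-\tfrac12b_{1,0}^2$ and $$F=-(3A'+3B''+f'(Q)B)+\tfrac12\big(f''(Q)(2A+A^2)\big)'-a\big(3A''-Q+f'(Q)(1+A)\big)'+3a^2Q'''+\tfrac12(f''(Q)-2)',$$ $$G=\tfrac12(f''(Q)-2)-(A+3B')+\tfrac12f''(Q)(2A+A^2)+\tfrac32a^2Q''-\tfrac12a\big(9A'+3B''+f'(Q)B\big)'+\tfrac12\big(f''(Q)(B+AB)\big)'.$$ The *defect* of $f$ is $d(f):=b_{2,0}+\tfrac16b_{1,0}^3$. For real $p\ge3$ let $d_{\tilde\mu,\nu}$ be the defect of $f_{\tilde\mu,\nu}(s)=s^2-\tilde\mu s^3+\nu s^p$, and for $\hat\mu\in\mathbb R$ put $\mu(\varepsilon)=\hat\mu|\varepsilon|^{1/(p-2)}$. **Statement.** 1. For every $\tilde\mu<\frac29$ and all small $\nu$ (that is, on an open neighbourhood of $\{(\tilde\mu,0):\tilde\mu<\frac29\}$ in $\mathbb R^2$), the number $d_{\tilde\mu,\nu}$ is well defined, i.e. it exists and does not depend on the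 choice of the solutions, and it is a $C^\infty$ function of $(\tilde\mu,\nu)$. Moreover $d_{\tilde\mu,0}=0$ for all $\tilde\mu<\frac29$. 2. For every real $p\ge3$ and every $\hat\mu\in\mathbb R$, as $\varepsilon\to0$, $$d_{\mu(\varepsilon),\varepsilon}=-\varepsilon\,\frac{(p-3)(2p-1)(48-46p+6p^2+4p^3)}{72(p^2-1)(p-2)}\int_{\mathbb R}\Big[\frac{3}{2\cosh^2(x/2)}\Big]^p\,dx+o(\varepsilon).$$ 3. Let $p\ge3$ be an integer, $\hat\mu\in\mathbb R$, and $$f_\varepsilon(u)=u^2+\mu(\varepsilon)u^3+\varepsilon u^p+|\varepsilon|^{1+\frac1{p-2}}f_1(\varepsilon,u),$$ where, for small $\varepsilon\ne0$, $f_1(\varepsilon,\cdot)\in C^{p+1}(\mathbb R)$, $\lim_{s\to0}f_1(\varepsilon,s)/|s|^p=0$, and $\partial_s^{p+1}f_1(\varepsilon,s)$ is bounded uniformly in $\varepsilon$ for $s$ in bounded sets (which is automatic if $f_1$ does not depend on $\varepsilon$). Then for all small $\varepsilon$ the defect $d(\varepsilon):=d(f_\varepsilon)$ is well defined, and, as $\varepsilon\to0$,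 $$d(\varepsilon)=d_{\mu(\varepsilon),\varepsilon}+o(\varepsilon)\qquad\text{and}\qquad d(\varepsilon)=d_{-\mu(\varepsilon),\varepsilon}+o(\varepsilon).$$ -/

import Mathlib

open Filter Topology MeasureTheory Asymptotics
open scoped ContDiff

namespace GKdV

/-- `Q` is the soliton profile of unit speed of `u_t + (u_xx + f(u))_x = 0`: the positive even
`H¹` solution of `Q'' + f(Q) = Q`. -/
structure IsSoliton (f Q : ℝ → ℝ) : Prop where
  contDiff : ContDiff ℝ 2 Q
  pos : ∀ x, 0 < Q x
  even : ∀ x, Q (-x) = Q x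
  memLp : MemLp Q 2 volume
  memLp_deriv : MemLp (deriv Q) 2 volume
  eqn : ∀ x, deriv (deriv Q) x + f (Q x) = Q x

/-- The class `𝒴` of localized functions `g`: for every admissible order `j` of differentiation
there are `K, r` with `|g⁽ʲ⁾(x)| ≤ K (1 + |x|) ^ r * exp (-|x|)` for all `x`.  The function `g` has
to be as smooth as the nonlinearity `f`: when `f` is `C^∞`, this is the usual class of `C^∞`
functions all of whose derivatives decay in this way; when `f` is of class `C^n` only, the solutions
considered below are of finite smoothness as well, and orders up to `n` are taken. -/
def ClassY (f g : ℝ → ℝ) : Prop :=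
  ∀ n : ℕ, ContDiff ℝ n f →
    ContDiff ℝ n g ∧
      ∀ j : ℕ, j ≤ n → ∃ (K : ℝ) (r : ℕ), ∀ x : ℝ,
        |iteratedDeriv j g x| ≤ K * (1 + |x|) ^ r * Real.exp (-|x|)

/-- The linearized operator `ℒ w = -w'' + w - f'(Q) w`. -/
noncomputable def linOp (f Q w : ℝ → ℝ) (x : ℝ) : ℝ :=
  -deriv (deriv w) x + w x - deriv f (Q x) * w x

/-- The resonance function `φ = -Q' / Q`. -/
noncomputable def resonance (Q : ℝ → ℝ) (x : ℝ) : ℝ := -deriv Q x / Q x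

/-- `(A, B, a)` solves the linear system `(Ω)` with source terms `F, G`,

* `(ℒ A)' + a (3 Q - 2 f(Q))' = F`,
* `(ℒ B)' + 3 a Q'' - 3 A'' - f'(Q) A = G`,

where `A` is even, `A - γ ∈ 𝒴`, and `B` is odd, `B - b φ ∈ 𝒴`
(so `γ` and `b` are the limits of `A` and `B` at `+∞`). -/
structure IsOmegaSolution (f Q F G A B : ℝ → ℝ) (γ a b : ℝ) : Prop where
  even : ∀ x, A (-x) = A x
  odd : ∀ x, B (-x) = -B x
  classY_A : ClassY f (fun x => A x - γ)
  classY_B : ClassY f (fun x => B x - b * resonance Q x)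
  eqA : ∀ x, deriv (linOp f Q A) x + a * deriv (fun y => 3 * Q y - 2 * f (Q y)) x = F x
  eqB : ∀ x, deriv (linOp f Q B) x + 3 * a * deriv (deriv Q) x - 3 * deriv (deriv A) x
    - deriv f (Q x) * A x = G x

/-- The source term `F_{1,0} = (f'(Q))'`. -/
noncomputable def F10 (f Q : ℝ → ℝ) : ℝ → ℝ := deriv (fun y => deriv f (Q y))

/-- The source term `G_{1,0} = f'(Q)`. -/
noncomputable def G10 (f Q : ℝ → ℝ) : ℝ → ℝ := fun x => deriv f (Q x)

/-- The source term `F_{2,0}` in the quadratic case, where `(A, B, a)` solves `(Ω_{1,0})`: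

`F_{2,0} = -(3 A' + 3 B'' + f'(Q) B) + ½ (f''(Q) (2 A + A²))'
  - a (3 A'' - Q + f'(Q) (1 + A))' + 3 a² Q''' + ½ (f''(Q) - 2)'`. -/
noncomputable def F20 (f Q A B : ℝ → ℝ) (a : ℝ) (x : ℝ) : ℝ :=
  -(3 * deriv A x + 3 * deriv (deriv B) x + deriv f (Q x) * B x)
    + 1 / 2 * deriv (fun y => deriv (deriv f) (Q y) * (2 * A y + A y ^ 2)) x
    - a * deriv (fun y => 3 * deriv (deriv A) y - Q y + deriv f (Q y) * (1 + A y)) x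
    + 3 * a ^ 2 * deriv (deriv (deriv Q)) x
    + 1 / 2 * deriv (fun y => deriv (deriv f) (Q y) - 2) x

/-- The source term `G_{2,0}` in the quadratic case, where `(A, B, a)` solves `(Ω_{1,0})`:

`G_{2,0} = ½ (f''(Q) - 2) - (A + 3 B') + ½ f''(Q) (2 A + A²) + (3/2) a² Q''
  - ½ a (9 A' + 3 B'' + f'(Q) B)' + ½ (f''(Q) (B + A B))'`. -/
noncomputable def G20 (f Q A B : ℝ → ℝ) (a : ℝ) (x : ℝ) : ℝ :=
  1 / 2 * (deriv (deriv f) (Q x) - 2) - (A x + 3 * deriv B x)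
    + 1 / 2 * (deriv (deriv f) (Q x) * (2 * A x + A x ^ 2))
    + 3 / 2 * a ^ 2 * deriv (deriv Q) x
    - 1 / 2 * a * deriv (fun y => 9 * deriv A y + 3 * deriv (deriv B) y + deriv f (Q y) * B y) x
    + 1 / 2 * deriv (fun y => deriv (deriv f) (Q y) * (B y + A y * B y)) x

/-- `d = b_{2,0} + b_{1,0}³ / 6`, where `Q` is the soliton of the (quadratic at leading order)
nonlinearity `f`, `(A_{1,0}, B_{1,0}, a_{1,0}, b_{1,0})` solves `(Ω_{1,0})` with `γ_{1,0} = 0` and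
`∫ Q' B_{1,0} = 0`, and `(A_{2,0}, B_{2,0}, a_{2,0}, b_{2,0})` solves `(Ω_{2,0})` with
`γ_{2,0} = -b_{1,0}² / 2`. -/
def IsDefect (f : ℝ → ℝ) (d : ℝ) : Prop :=
  ∃ (Q A₁ B₁ A₂ B₂ : ℝ → ℝ) (a₁ b₁ a₂ b₂ : ℝ),
    IsSoliton f Q ∧
    IsOmegaSolution f Q (F10 f Q) (G10 f Q) A₁ B₁ 0 a₁ b₁ ∧
    ∫ x, deriv Q x * B₁ x = 0 ∧
    IsOmegaSolution f Q (F20 f Q A₁ B₁ a₁) (G20 f Q A₁ B₁ a₁) A₂ B₂ (-(1 / 2) * b₁ ^ 2) a₂ b₂ ∧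
    d = b₂ + 1 / 6 * b₁ ^ 3

/-- The defect of the nonlinearity `f` (an arbitrary real number unless some `d` satisfies
`IsDefect f d`). -/
noncomputable def defect (f : ℝ → ℝ) : ℝ := Classical.epsilon (IsDefect f)

/-- The model nonlinearity `f_{μ,ν}(s) = s² - μ s³ + ν s^p`, with a real exponent `p`.  Only its
values at `s ≥ 0` matter, because solitons are positive. -/
noncomputable def modelNonlin (p μ ν : ℝ) (s : ℝ) : ℝ := s ^ 2 - μ * s ^ 3 + ν * s ^ p

/-- `μ(ε) = μ₀ |ε| ^ (1 / (p - 2))`. -/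
noncomputable def muEps (p μ₀ ε : ℝ) : ℝ := μ₀ * |ε| ^ (1 / (p - 2))

/-- The reduced nonlinearity `f_ε(u) = u² + μ(ε) u³ + ε u^p + |ε| ^ (1 + 1 / (p - 2)) f₁(ε, u)`. -/
noncomputable def reducedNonlin (p : ℕ) (μ₀ : ℝ) (f₁ : ℝ → ℝ → ℝ) (ε u : ℝ) : ℝ :=
  u ^ 2 + muEps p μ₀ ε * u ^ 3 + ε * u ^ p + |ε| ^ (1 + 1 / ((p : ℝ) - 2)) * f₁ ε u

/-- The rational function `(p-3)(2p-1)(48-46p+6p²+4p³) / (72(p²-1)(p-2))`. -/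
noncomputable def defectCoeff (p : ℝ) : ℝ :=
  (p - 3) * (2 * p - 1) * (48 - 46 * p + 6 * p ^ 2 + 4 * p ^ 3) / (72 * (p ^ 2 - 1) * (p - 2))

end GKdV

namespace GKdV

/-! ### Functions with exponential weights -/

/-! The defect is rewritten as an explicit smooth function on a Banach space of data describing the
nonlinearity, and all three assertions are read off from that function. Write `L` for the linearized
operator, `F` for the primitive of `f`, `P = Q'B' - Q''B` and `M = ∫₀ˣ (A + aQ)`, where `(A, B, a,
b)` is the first solution.

Elimination of the second system. Both systems are integrated once. The first one says `L(1 + A) = 1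
- a(3Q - 2f(Q))`. Hence, when the integrated equation for `B₂` is tested against `1 - aQ`, the
unknown `A₂` gets paired with `L(1 + A)`; Green's formula moves `L` onto `A₂` and inserts its
equation. The terms in `B₂` are boundary terms because `LQ' = 0`, and the coefficient of `a₂`
integrates to zero by the solvability condition of the first system. So `b₂` is an integral in the
first solution only (`hasDerivAt_Xi`). Adding the boundary term `PB/Q'` replaces `B` by `(P/Q')²`
(`hasDerivAt_Defun`), and `P` does not change when a multiple of `Q'` is added to `B`. The defect is
thus independent of all choices.

Passage to fixed function spaces. With `m = Q(0)` and `Q = m(1 - t²)` the energy identity becomes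
`Q'² = Q² t² R`, and reduction of order writes `A = λQ + Q'W` with `W'` algebraic in the data. Every
quantity becomes a combination of products and of a few bounded operators on bounded continuous
functions of `t` in `(0, 1)`. The data `(m, g₁, dg, dk, ζ)` are difference quotients of `f`, `F` and
`f''`. `Rlz.isDefect_iff` identifies the defect with `Dat.dd`, and `Reg.contDiffAt_dd` gives its
smoothness; the nondegeneracy needed is `jj D 0 1 ≠ 0`.

Model nonlinearities. Using `(m, ν)` as parameters instead of `(μ, ν)` makes the data explicit and
smooth. At `ν = 0` the values `μ < 2/9` correspond to `0 < m < 3`; there `jj` is computed in closed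
form and `m ↦ μ` has positive derivative, so the inverse function theorem returns to `(μ, ν)`. On `ν
= 0` the solutions are polynomials in `Q` and multiples of `φ`, with `b = -2` and `b₂ = 4/3`, so the
defect vanishes.

Expansion. Since the defect vanishes on `ν = 0`, strict differentiability at `(3/2, 0)` reduces the
expansion to the derivative in `ν` at fixed `m = 3/2` (`dd_dat_isLittleO`). That derivative is
computed by linearizing each functional, removing the nonlocal operators by integration by parts,
and reducing the remaining integrals to one Beta integral (`int_first_variation`); the unknown
variation of `a` cancels against the linearized solvability condition.

Reduced nonlinearities. The maximum `m` of the soliton of `f_ε` is found by the intermediate value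
theorem, and `f_ε` is compared with the model nonlinearity whose soliton has the same maximum. Their
data differ by `O(|ε|^(1 + 1/(p-2)))`, so the Lipschitz property of `Dat.dd` gives an error `o(ε)`.
The first order term does not depend on the cubic coefficient, hence either sign of it is allowed.
-/

theorem poly_exp_bound {k : ℝ} (hk : 0 < k) (n : ℕ) :
    ∃ C : ℝ, 0 < C ∧ ∀ x : ℝ, 0 ≤ x → (1 + x) ^ n * Real.exp (-(k * x)) ≤ C := by
  refine ⟨n.factorial * Real.exp k / k ^ n, by positivity, fun x hx => ?_⟩
  have h := Real.pow_div_factorial_le_exp (k * (1 + x)) (by positivity) n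
  rw [div_le_iff₀ (by positivity), mul_pow] at h
  rw [le_div_iff₀ (by positivity), Real.exp_neg, ← div_eq_mul_inv, div_mul_eq_mul_div,
    div_le_iff₀ (Real.exp_pos _)]
  have h2 : Real.exp (k * (1 + x)) = Real.exp k * Real.exp (k * x) := by
    rw [← Real.exp_add]; ring_nf
  rw [h2] at h
  linarith

/-- `g` is bounded by a polynomial times `exp (-k|x|)`. -/
def ExpBdd (k : ℝ) (g : ℝ → ℝ) : Prop :=
  ∃ (K : ℝ) (r : ℕ), ∀ x : ℝ, |g x| ≤ K * (1 + |x|) ^ r * Real.exp (-(k * |x|))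

theorem ExpBdd.exists_pos {k : ℝ} {g : ℝ → ℝ} (h : ExpBdd k g) :
    ∃ (K : ℝ) (r : ℕ), 0 < K ∧ ∀ x : ℝ, |g x| ≤ K * (1 + |x|) ^ r * Real.exp (-(k * |x|)) := by
  obtain ⟨K, r, h⟩ := h
  refine ⟨max K 1, r, by positivity, fun x => (h x).trans ?_⟩
  gcongr
  exact le_max_left _ _

theorem ExpBdd.mono {k k' : ℝ} {g : ℝ → ℝ} (h : ExpBdd k g) (hk : k' ≤ k) : ExpBdd k' g := by
  obtain ⟨K, r, hK, h⟩ := h.exists_pos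
  refine ⟨K, r, fun x => (h x).trans ?_⟩
  gcongr

theorem ExpBdd.mul {k l : ℝ} {g h : ℝ → ℝ} (hg : ExpBdd k g) (hh : ExpBdd l h) :
    ExpBdd (k + l) (fun x => g x * h x) := by
  obtain ⟨K, r, hK, hg⟩ := hg.exists_pos
  obtain ⟨L, s, hL, hh⟩ := hh.exists_pos
  refine ⟨K * L, r + s, fun x => ?_⟩
  rw [abs_mul]
  refine (mul_le_mul (hg x) (hh x) (abs_nonneg _) (by positivity)).trans (le_of_eq ?_)
  rw [pow_add, add_mul, neg_add, Real.exp_add]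
  ring

theorem ExpBdd.add {k : ℝ} {g h : ℝ → ℝ} (hg : ExpBdd k g) (hh : ExpBdd k h) :
    ExpBdd k (fun x => g x + h x) := by
  obtain ⟨K, r, hK, hg⟩ := hg.exists_pos
  obtain ⟨L, s, hL, hh⟩ := hh.exists_pos
  refine ⟨K + L, r + s, fun x => ?_⟩
  have h1 : (1:ℝ) ≤ 1 + |x| := by linarith [abs_nonneg x]
  have e1 : K * (1 + |x|) ^ r * Real.exp (-(k * |x|)) ≤
      K * (1 + |x|) ^ (r + s) * Real.exp (-(k * |x|)) := by
    gcongr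
    · omega
  have e2 : L * (1 + |x|) ^ s * Real.exp (-(k * |x|)) ≤
      L * (1 + |x|) ^ (r + s) * Real.exp (-(k * |x|)) := by
    gcongr
    · omega
  calc |g x + h x| ≤ |g x| + |h x| := abs_add_le _ _
    _ ≤ K * (1 + |x|) ^ (r + s) * Real.exp (-(k * |x|)) +
        L * (1 + |x|) ^ (r + s) * Real.exp (-(k * |x|)) :=
        add_le_add ((hg x).trans e1) ((hh x).trans e2)
    _ = _ := by ring

theorem ExpBdd.const (c : ℝ) : ExpBdd 0 (fun _ => c) := ⟨|c|, 0, fun x => by simp⟩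

theorem ExpBdd.of_bound {k : ℝ} {g : ℝ → ℝ} {C : ℝ}
    (h : ∀ x, |g x| ≤ C * Real.exp (-(k * |x|))) : ExpBdd k g := ⟨C, 0, fun x => by simpa using h x⟩

theorem ExpBdd.tendsto_zero {k : ℝ} {g : ℝ → ℝ} (h : ExpBdd k g) (hk : 0 < k) :
    Tendsto g atTop (𝓝 0) := by
  obtain ⟨K, r, hK, h⟩ := h.exists_pos
  obtain ⟨C, hC, hb⟩ := poly_exp_bound hk (r + 1)
  have ht : Tendsto (fun x : ℝ => K * C * (1 + x)⁻¹) atTop (𝓝 0) := by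
    have : Tendsto (fun x : ℝ => (1 + x)⁻¹) atTop (𝓝 0) :=
      tendsto_inv_atTop_zero.comp (tendsto_atTop_add_const_left _ _ tendsto_id)
    simpa using this.const_mul (K * C)
  refine squeeze_zero_norm' ?_ ht
  filter_upwards [eventually_ge_atTop 0] with x hx
  have h1 := h x
  rw [abs_of_nonneg hx] at h1
  have h2 := hb x hx
  rw [pow_succ] at h2
  rw [Real.norm_eq_abs]
  refine h1.trans ?_
  rw [← div_eq_mul_inv, le_div_iff₀ (by linarith)]
  nlinarith

theorem ExpBdd.integrable {k : ℝ} {g : ℝ → ℝ} (h : ExpBdd k g) (hk : 0 < k)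
    (hg : Continuous g) : Integrable g := by
  obtain ⟨K, r, hK, h⟩ := h.exists_pos
  obtain ⟨C, hC, hb⟩ := poly_exp_bound hk (r + 2)
  have hi : Integrable (fun x : ℝ => K * C * (1 + ‖x‖) ^ (-(2:ℝ))) :=
    (integrable_one_add_norm (by simp)).const_mul _
  refine hi.mono' hg.aestronglyMeasurable (Eventually.of_forall fun x => ?_)
  have h2 := hb |x| (abs_nonneg x)
  have hp : (0:ℝ) < 1 + |x| := by positivity
  rw [Real.norm_eq_abs, Real.norm_eq_abs, Real.rpow_neg hp.le, ← div_eq_mul_inv,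
    le_div_iff₀ (by positivity)]
  rw [show (1 + |x|) ^ (2:ℝ) = (1 + |x|) ^ 2 by norm_cast]
  rw [pow_add] at h2
  calc |g x| * (1 + |x|) ^ 2 ≤ K * (1 + |x|) ^ r * Real.exp (-(k * |x|)) * (1 + |x|) ^ 2 := by
        gcongr; exact h x
    _ = K * ((1 + |x|) ^ r * (1 + |x|) ^ 2 * Real.exp (-(k * |x|))) := by ring
    _ ≤ K * C := by gcongr

/-- A function tending to zero at `+∞` inherits the exponential decay of its derivative. -/
theorem exp_tail_bound {k : ℝ} (hk : 0 < k) {g g' : ℝ → ℝ} {K : ℝ} {r : ℕ} (hK : 0 < K)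
    (hd : ∀ x, 0 < x → HasDerivAt g (g' x) x) (hc : ContinuousOn g (Set.Ici 0))
    (hb : ∀ x, 0 < x → |g' x| ≤ K * (1 + x) ^ r * Real.exp (-(k * x)))
    (h0 : Tendsto g atTop (𝓝 0)) :
    ∃ K' : ℝ, ∀ x, 0 ≤ x → |g x| ≤ K' * (1 + x) ^ r * Real.exp (-(k * x)) := by
  -- The shift `N` makes the derivative of the polynomial factor cost at most half of the
  -- exponential gain: `r (N + x)^(r-1) ≤ (k/2) (N + x)^r`. The barrier `H` then satisfies `H' ≤ -K
  -- (1 + x)^r exp(-kx)`.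
  set N : ℝ := 1 + 2 * r / k with hN
  have hN1 : 1 ≤ N := by rw [hN]; have : 0 ≤ 2 * (r:ℝ) / k := by positivity
                         linarith
  set H : ℝ → ℝ := fun x => K * (2 / k) * ((N + x) ^ r * Real.exp (-(k * x))) with hH
  set H' : ℝ → ℝ := fun x => K * (2 / k) * ((r * (N + x) ^ (r - 1)) * Real.exp (-(k * x)) +
    (N + x) ^ r * (Real.exp (-(k * x)) * -k)) with hH'
  have hHd : ∀ x, HasDerivAt H (H' x) x := by
    intro x
    have h1 : HasDerivAt (fun x : ℝ => (N + x) ^ r) (r * (N + x) ^ (r - 1)) x := by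
      simpa using ((hasDerivAt_id x).const_add N).fun_pow r
    have h2 : HasDerivAt (fun x : ℝ => Real.exp (-(k * x))) (Real.exp (-(k * x)) * -k) x := by
      simpa using (((hasDerivAt_id x).const_mul k).neg).exp
    exact (h1.mul h2).const_mul _
  have hH'le : ∀ x, 0 < x → H' x ≤ -(K * (1 + x) ^ r * Real.exp (-(k * x))) := by
    intro x hx
    have hNx : 0 < N + x := by linarith
    have key : (r:ℝ) * (N + x) ^ (r - 1) ≤ k / 2 * (N + x) ^ r := by
      rcases Nat.eq_zero_or_pos r with h | h
      · subst h; simp; positivity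
      · obtain ⟨s, rfl⟩ : ∃ s, r = s + 1 := ⟨r - 1, by omega⟩
        rw [Nat.add_sub_cancel, pow_succ]
        have : ((s + 1 : ℕ) : ℝ) ≤ k / 2 * (N + x) := by
          have : k / 2 * N = k / 2 + ((s + 1 : ℕ) : ℝ) := by rw [hN]; field_simp
          nlinarith
        calc ((s + 1 : ℕ) : ℝ) * (N + x) ^ s ≤ (k / 2 * (N + x)) * (N + x) ^ s := by gcongr
          _ = _ := by ring
    have hpw : (1 + x) ^ r ≤ (N + x) ^ r := by gcongr
    have he := Real.exp_pos (-(k * x))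
    have : H' x ≤ K * (2 / k) * ((k / 2 * (N + x) ^ r) * Real.exp (-(k * x)) +
        (N + x) ^ r * (Real.exp (-(k * x)) * -k)) := by
      simp only [hH']; gcongr
    refine this.trans ?_
    have e : K * (2 / k) * ((k / 2 * (N + x) ^ r) * Real.exp (-(k * x)) +
        (N + x) ^ r * (Real.exp (-(k * x)) * -k)) = -(K * (N + x) ^ r * Real.exp (-(k * x))) := by
      field_simp; ring
    rw [e]
    gcongr
  have hHle : ∀ x, 0 ≤ x → H x ≤ K * (2 / k) * N ^ r * (1 + x) ^ r * Real.exp (-(k * x)) := by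
    intro x hx
    have : (N + x) ^ r ≤ (N * (1 + x)) ^ r := by
      gcongr; nlinarith
    rw [mul_pow] at this
    calc H x ≤ K * (2 / k) * ((N ^ r * (1 + x) ^ r) * Real.exp (-(k * x))) := by
          simp only [hH]; gcongr
      _ = _ := by ring
  have hH0 : Tendsto H atTop (𝓝 0) := by
    have hG : ExpBdd k (fun x => K * (2 / k) * N ^ r * (1 + |x|) ^ r * Real.exp (-(k * |x|))) :=
      ⟨K * (2 / k) * N ^ r, r, fun x => le_of_eq (abs_of_nonneg (by positivity))⟩
    refine squeeze_zero' ?_ ?_ (hG.tendsto_zero hk)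
    · filter_upwards [eventually_ge_atTop 0] with x hx
      have : 0 ≤ N + x := by linarith
      simp only [hH]; positivity
    · filter_upwards [eventually_ge_atTop 0] with x hx
      exact (hHle x hx).trans (by rw [abs_of_nonneg hx])
  have hHc : Continuous H := by simp only [hH]; fun_prop
  -- Both `H - g` and `H + g` are nonincreasing and tend to zero, so both are nonnegative.
  have hanti : AntitoneOn (fun x => H x - g x) (Set.Ici 0) := by
    refine antitoneOn_of_deriv_nonpos (convex_Ici 0) (hHc.continuousOn.sub hc) ?_ ?_
    · intro x hx
      rw [interior_Ici] at hx
      exact ((hHd x).sub (hd x hx)).differentiableAt.differentiableWithinAt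
    · intro x hx
      rw [interior_Ici] at hx
      rw [show deriv (fun x => H x - g x) x = _ from ((hHd x).sub (hd x hx)).deriv]
      linarith [hH'le x hx, neg_abs_le (g' x), hb x hx]
  have hanti2 : AntitoneOn (fun x => H x + g x) (Set.Ici 0) := by
    refine antitoneOn_of_deriv_nonpos (convex_Ici 0) (hHc.continuousOn.add hc) ?_ ?_
    · intro x hx
      rw [interior_Ici] at hx
      exact ((hHd x).add (hd x hx)).differentiableAt.differentiableWithinAt
    · intro x hx
      rw [interior_Ici] at hx
      rw [show deriv (fun x => H x + g x) x = _ from ((hHd x).add (hd x hx)).deriv]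
      linarith [hH'le x hx, le_abs_self (g' x), hb x hx]
  refine ⟨K * (2 / k) * N ^ r, fun x hx => ?_⟩
  have l1 : 0 ≤ H x - g x := by
    have ht : Tendsto (fun x => H x - g x) atTop (𝓝 0) := by simpa using hH0.sub h0
    refine le_of_tendsto ht ?_
    filter_upwards [eventually_ge_atTop x] with z hz
    exact hanti hx (hx.trans hz) hz
  have l2 : 0 ≤ H x + g x := by
    have ht : Tendsto (fun x => H x + g x) atTop (𝓝 0) := by simpa using hH0.add h0
    refine le_of_tendsto ht ?_
    filter_upwards [eventually_ge_atTop x] with z hz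
    exact hanti2 hx (hx.trans hz) hz
  have l3 : |g x| ≤ H x := abs_le.mpr ⟨by linarith, by linarith⟩
  exact l3.trans (hHle x hx)

theorem ExpBdd.of_deriv {k : ℝ} (hk : 0 < k) {g g' : ℝ → ℝ}
    (hd : ∀ x, HasDerivAt g (g' x) x) (hb : ExpBdd k g')
    (h0 : Tendsto g atTop (𝓝 0)) (h0' : Tendsto g atBot (𝓝 0)) : ExpBdd k g := by
  obtain ⟨K, r, hK, hb⟩ := hb.exists_pos
  have hgc : Continuous g := continuous_iff_continuousAt.2 fun x => (hd x).continuousAt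
  obtain ⟨K1, h1⟩ := exp_tail_bound hk hK (fun x _ => hd x) hgc.continuousOn
    (fun x hx => by simpa [abs_of_pos hx] using hb x) h0
  obtain ⟨K2, h2⟩ := exp_tail_bound (g := fun x => g (-x)) (g' := fun x => -g' (-x)) hk hK
    (fun x _ => by
      have := (hd (-x)).comp x (hasDerivAt_neg x)
      simpa [Function.comp_def] using this)
    (hgc.comp continuous_neg).continuousOn
    (fun x hx => by simpa [abs_of_pos hx] using hb (-x)) (h0'.comp tendsto_neg_atTop_atBot)
  refine ⟨max K1 K2, r, fun x => ?_⟩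
  rcases le_total 0 x with hx | hx
  · rw [abs_of_nonneg hx]
    refine (h1 x hx).trans ?_
    have : 0 ≤ 1 + x := by linarith
    gcongr
    exact le_max_left _ _
  · rw [abs_of_nonpos hx]
    have := h2 (-x) (by linarith)
    rw [neg_neg] at this
    refine this.trans ?_
    have : 0 ≤ 1 + -x := by linarith
    gcongr
    exact le_max_right _ _

/-- `n` times continuously differentiable functions whose derivatives up to order `n` are bounded by
polynomials times `exp (-k|x|)`. -/
def Cls (k : ℝ) : ℕ → (ℝ → ℝ) → Prop
  | 0, g => Continuous g ∧ ExpBdd k g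
  | n + 1, g => Differentiable ℝ g ∧ ExpBdd k g ∧ Cls k n (deriv g)

namespace Cls

variable {k l : ℝ} {n : ℕ} {g h : ℝ → ℝ}

theorem expBdd (hg : Cls k n g) : ExpBdd k g := by
  cases n with
  | zero => exact hg.2
  | succ n => exact hg.2.1

theorem continuous (hg : Cls k n g) : Continuous g := by
  cases n with
  | zero => exact hg.1
  | succ n => exact hg.1.continuous

theorem deriv' (hg : Cls k (n + 1) g) : Cls k n (deriv g) := hg.2.2

theorem hasDerivAt (hg : Cls k (n + 1) g) (x : ℝ) : HasDerivAt g (deriv g x) x :=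
  (hg.1 x).hasDerivAt

theorem of_hasDerivAt {g' : ℝ → ℝ} (hd : ∀ x, HasDerivAt g (g' x) x) (hb : ExpBdd k g)
    (hg' : Cls k n g') : Cls k (n + 1) g := by
  refine ⟨fun x => (hd x).differentiableAt, hb, ?_⟩
  rwa [show deriv g = g' from funext fun x => (hd x).deriv]

theorem of_succ (hg : Cls k (n + 1) g) : Cls k n g := by
  induction n generalizing g with
  | zero => exact ⟨hg.1.continuous, hg.2.1⟩
  | succ n ih => exact ⟨hg.1, hg.2.1, ih hg.2.2⟩

theorem of_le {m : ℕ} (hg : Cls k n g) (hm : m ≤ n) : Cls k m g := by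
  induction n with
  | zero => rwa [Nat.le_zero.mp hm]
  | succ n ih =>
    rcases Nat.lt_or_ge m (n + 1) with h | h
    · exact ih hg.of_succ (by omega)
    · rwa [le_antisymm hm h]

theorem mono (hg : Cls k n g) (hl : l ≤ k) : Cls l n g := by
  induction n generalizing g with
  | zero => exact ⟨hg.1, hg.2.mono hl⟩
  | succ n ih => exact ⟨hg.1, hg.2.1.mono hl, ih hg.2.2⟩

theorem const (c : ℝ) : Cls 0 n (fun _ => c) := by
  induction n generalizing c with
  | zero => exact ⟨continuous_const, .const c⟩
  | succ n ih => exact of_hasDerivAt (fun x => hasDerivAt_const x c) (.const c) (ih 0)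

theorem add (hg : Cls k n g) (hh : Cls k n h) : Cls k n (fun x => g x + h x) := by
  induction n generalizing g h with
  | zero => exact ⟨hg.1.add hh.1, hg.2.add hh.2⟩
  | succ n ih =>
    exact of_hasDerivAt (fun x => (hg.hasDerivAt x).add (hh.hasDerivAt x))
      (hg.expBdd.add hh.expBdd) (ih hg.deriv' hh.deriv')

theorem mul (hg : Cls k n g) (hh : Cls l n h) : Cls (k + l) n (fun x => g x * h x) := by
  induction n generalizing g h with
  | zero => exact ⟨hg.1.mul hh.1, hg.2.mul hh.2⟩
  | succ n ih =>
    exact of_hasDerivAt (fun x => (hg.hasDerivAt x).mul (hh.hasDerivAt x))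
      (hg.expBdd.mul hh.expBdd) ((ih hg.deriv' hh.of_succ).add (ih hg.of_succ hh.deriv'))

theorem const_mul (c : ℝ) (hg : Cls k n g) : Cls k n (fun x => c * g x) := by
  simpa using (const (n := n) c).mul hg

theorem neg (hg : Cls k n g) : Cls k n (fun x => -g x) := by
  simpa using hg.const_mul (-1)

theorem sub (hg : Cls k n g) (hh : Cls k n h) : Cls k n (fun x => g x - h x) := by
  simpa [sub_eq_add_neg] using hg.add hh.neg

theorem mul' {m : ℝ} (hg : Cls k n g) (hh : Cls l n h) (hm : m ≤ k + l) :
    Cls m n (fun x => g x * h x) := (hg.mul hh).mono hm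

theorem congr (hg : Cls k n g) (hgh : ∀ x, h x = g x) : Cls k n h := by
  rwa [show h = g from funext hgh]

theorem contDiff (hg : Cls k n g) : ContDiff ℝ n g := by
  induction n generalizing g with
  | zero => exact contDiff_zero.2 hg.1
  | succ n ih =>
    rw [Nat.cast_add, Nat.cast_one, contDiff_succ_iff_deriv]
    exact ⟨hg.1, by simp, ih hg.2.2⟩

theorem iteratedDeriv_bdd (hg : Cls k n g) {j : ℕ} (hj : j ≤ n) :
    ExpBdd k (iteratedDeriv j g) := by
  induction n generalizing g j with
  | zero => obtain rfl := Nat.le_zero.mp hj; simpa using hg.2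
  | succ n ih =>
    cases j with
    | zero => simpa using hg.2.1
    | succ j => rw [iteratedDeriv_succ']; exact ih hg.2.2 (by omega)

theorem of_contDiff (hg : ContDiff ℝ n g) (hb : ∀ j ≤ n, ExpBdd k (iteratedDeriv j g)) :
    Cls k n g := by
  induction n generalizing g with
  | zero => exact ⟨hg.continuous, by simpa using hb 0 le_rfl⟩
  | succ n ih =>
    rw [Nat.cast_add, Nat.cast_one, contDiff_succ_iff_deriv] at hg
    refine ⟨hg.1, by simpa using hb 0 (by omega), ih hg.2.2 fun j hj => ?_⟩
    rw [← iteratedDeriv_succ']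
    exact hb (j + 1) (by omega)

theorem integrable (hg : Cls k n g) (hk : 0 < k) : Integrable g :=
  hg.expBdd.integrable hk hg.continuous

theorem tendsto_zero (hg : Cls k n g) (hk : 0 < k) : Tendsto g atTop (𝓝 0) :=
  hg.expBdd.tendsto_zero hk

end Cls

/-- The recursive form in terms of `deriv` is the one that is stable under products and compositions
by induction; `f` only decides which orders are required. -/
theorem classY_iff {f g : ℝ → ℝ} :
    ClassY f g ↔ ∀ n : ℕ, ContDiff ℝ n f → Cls 1 n g := by
  constructor
  · intro h n hn
    obtain ⟨h1, h2⟩ := h n hn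
    refine Cls.of_contDiff h1 fun j hj => ?_
    obtain ⟨K, r, hb⟩ := h2 j hj
    exact ⟨K, r, fun x => by simpa using hb x⟩
  · intro h n hn
    refine ⟨(h n hn).contDiff, fun j hj => ?_⟩
    obtain ⟨K, r, hb⟩ := (h n hn).iteratedDeriv_bdd hj
    exact ⟨K, r, fun x => by simpa using hb x⟩


/-! ### Soliton profiles and the linearized operator -/

/-- The antiderivative of `f` vanishing at the origin. -/
noncomputable def prim (f : ℝ → ℝ) (s : ℝ) : ℝ := ∫ u in (0:ℝ)..s, f u

theorem hasDerivAt_prim {f : ℝ → ℝ} (hf : Continuous f) (s : ℝ) : HasDerivAt (prim f) (f s) s :=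
  intervalIntegral.integral_hasDerivAt_right (hf.intervalIntegrable _ _)
    (hf.stronglyMeasurableAtFilter _ _) hf.continuousAt

theorem prim_zero (f : ℝ → ℝ) : prim f 0 = 0 := intervalIntegral.integral_same

/-- `Q` is a soliton profile with derivative `Q1`, with its qualitative properties. -/
structure Profile (f Q Q1 : ℝ → ℝ) : Prop where
  f3 : ContDiff ℝ 3 f
  f0 : f 0 = 0
  f1 : deriv f 0 = 0
  f2 : deriv (deriv f) 0 = 2
  d1 : ∀ x, HasDerivAt Q (Q1 x) x
  d2 : ∀ x, HasDerivAt Q1 (Q x - f (Q x)) x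
  even : ∀ x, Q (-x) = Q x
  pos : ∀ x, 0 < Q x
  neg : ∀ x, 0 < x → Q1 x < 0
  curv : Q 0 < f (Q 0)
  lower : ∃ c, 0 < c ∧ ∀ x, c * Real.exp (-|x|) ≤ Q x
  upper : ∃ C, ∀ x, Q x ≤ C * Real.exp (-|x|)
  upper1 : ∃ C, ∀ x, |Q1 x| ≤ C * Real.exp (-|x|)
  lower1 : ∃ c, 0 < c ∧ ∀ x, 1 ≤ x → Q1 x ≤ -(c * Real.exp (-x))

/-- The values of `Q` stay in a compact interval, so `ψ(Q)` is bounded; all the decay of its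
derivatives comes from the factor `Q'` in the chain rule. -/
theorem Cls.comp {ψ Q : ℝ → ℝ} {n : ℕ} (hQ : Cls 1 n Q) (hψ : ContDiff ℝ n ψ) :
    Cls 0 n (fun x => ψ (Q x)) := by
  have hb : ∀ ψ : ℝ → ℝ, Continuous ψ → ExpBdd 0 (fun x => ψ (Q x)) := by
    intro ψ hψ
    obtain ⟨K, r, hK, h⟩ := hQ.expBdd.exists_pos
    obtain ⟨C, hC, hC'⟩ := poly_exp_bound one_pos r
    have hQb : ∀ x, Q x ∈ Set.Icc (-(K * C)) (K * C) := by
      intro x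
      rw [Set.mem_Icc, ← abs_le]
      refine (h x).trans ?_
      rw [mul_assoc]
      exact mul_le_mul_of_nonneg_left (hC' _ (abs_nonneg x)) hK.le
    obtain ⟨B, hB⟩ := isCompact_Icc.exists_bound_of_continuousOn (s := Set.Icc (-(K * C)) (K * C))
      hψ.continuousOn
    exact ⟨B, 0, fun x => by simpa using hB _ (hQb x)⟩
  induction n generalizing ψ with
  | zero => exact ⟨hψ.continuous.comp hQ.continuous, hb ψ hψ.continuous⟩
  | succ n ih =>
    have hψ' := hψ
    rw [Nat.cast_add, Nat.cast_one, contDiff_succ_iff_deriv] at hψ'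
    refine Cls.of_hasDerivAt (g' := fun x => deriv ψ (Q x) * deriv Q x)
      (fun x => (hψ'.1 (Q x)).hasDerivAt.comp x (hQ.hasDerivAt x)) (hb ψ hψ.continuous) ?_
    exact (ih hQ.of_succ hψ'.2.2 ).mul' hQ.deriv' (by norm_num)

theorem Cls.tendsto_zero_bot {k : ℝ} {n : ℕ} {g : ℝ → ℝ} (hg : Cls k n g) (hk : 0 < k) :
    Tendsto g atBot (𝓝 0) := by
  have : ExpBdd k (fun x => g (-x)) := by
    obtain ⟨K, r, h⟩ := hg.expBdd
    exact ⟨K, r, fun x => by simpa using h (-x)⟩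
  have := (this.tendsto_zero hk).comp tendsto_neg_atBot_atTop
  simpa [Function.comp_def] using this

/-- Composition with a function vanishing at the origin, whose derivative gains the weight `l`. -/
theorem Cls.comp_zero {ψ Q : ℝ → ℝ} {n : ℕ} {k l : ℝ} (hk : 0 < k) (hkl : k ≤ l + 1)
    (hQ : Cls 1 (n + 1) Q) (hψ : Differentiable ℝ ψ) (hψ' : Cls l n (fun x => deriv ψ (Q x)))
    (h0 : ψ 0 = 0) : Cls k (n + 1) (fun x => ψ (Q x)) := by
  have hd : ∀ x, HasDerivAt (fun x => ψ (Q x)) (deriv ψ (Q x) * deriv Q x) x :=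
    fun x => (hψ (Q x)).hasDerivAt.comp x (hQ.hasDerivAt x)
  have hg' : Cls k n (fun x => deriv ψ (Q x) * deriv Q x) := hψ'.mul' hQ.deriv' hkl
  have hc : Tendsto ψ (𝓝 0) (𝓝 0) := by simpa [h0] using hψ.continuous.tendsto 0
  exact Cls.of_hasDerivAt hd (ExpBdd.of_deriv hk hd hg'.expBdd
    (hc.comp (hQ.tendsto_zero one_pos)) (hc.comp (hQ.tendsto_zero_bot one_pos))) hg'

/-! ### Decay, energy identity and resonance function of a soliton -/

namespace Profile

variable {f Q Q1 : ℝ → ℝ} {N : ℕ}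

theorem diff_f (h : Profile f Q Q1) : Differentiable ℝ f := h.f3.differentiable (by norm_num)

theorem contDiff_f1 (h : Profile f Q Q1) : ContDiff ℝ 2 (deriv f) := by
  have := h.f3
  rw [show (3 : WithTop ℕ∞) = 2 + 1 by norm_num, contDiff_succ_iff_deriv] at this
  exact this.2.2

theorem contDiff_f2 (h : Profile f Q Q1) : ContDiff ℝ 1 (deriv (deriv f)) := by
  have := h.contDiff_f1
  rw [show (2 : WithTop ℕ∞) = 1 + 1 by norm_num, contDiff_succ_iff_deriv] at this
  exact this.2.2

theorem hasDerivAt_f1 (h : Profile f Q Q1) (s : ℝ) :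
    HasDerivAt (deriv f) (deriv (deriv f) s) s :=
  (h.contDiff_f1.differentiable (by norm_num) s).hasDerivAt

theorem odd1 (h : Profile f Q Q1) (x : ℝ) : Q1 (-x) = -Q1 x := by
  have h1 : HasDerivAt (fun y => Q (-y)) (-Q1 (-x)) x := by
    simpa [Function.comp_def] using (h.d1 (-x)).comp x (hasDerivAt_neg x)
  have h2 := h.d1 x
  rw [show (fun y => Q (-y)) = Q from funext h.even] at h1
  linarith [h1.unique h2]

theorem Q1_zero (h : Profile f Q Q1) : Q1 0 = 0 := by
  have := h.odd1 0
  rw [neg_zero] at this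
  linarith

theorem Q1_ne (h : Profile f Q Q1) {x : ℝ} (hx : x ≠ 0) : Q1 x ≠ 0 := by
  rcases lt_or_gt_of_ne hx with hx | hx
  · have := h.neg (-x) (by linarith)
    rw [h.odd1] at this
    exact fun h0 => by rw [h0] at this; simp at this
  · exact (h.neg x hx).ne

theorem expBdd_Q (h : Profile f Q Q1) : ExpBdd 1 Q := by
  obtain ⟨C, hC⟩ := h.upper
  exact .of_bound (C := C) fun x => by rw [abs_of_pos (h.pos x)]; simpa using hC x

theorem expBdd_Q1 (h : Profile f Q Q1) : ExpBdd 1 Q1 := by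
  obtain ⟨C, hC⟩ := h.upper1
  exact .of_bound (C := C) fun x => by simpa using hC x

theorem cls_Q_aux (h : Profile f Q Q1) : Cls 1 1 Q :=
  .of_hasDerivAt h.d1 h.expBdd_Q
    ⟨continuous_iff_continuousAt.2 fun x => (h.d2 x).continuousAt, h.expBdd_Q1⟩

/-- Elliptic bootstrap: `Q'' = Q - f(Q)` gains two orders over `f(Q)`, and `f(Q)` is as regular as
`Q` up to the smoothness of `f`. -/
theorem cls_Q (h : Profile f Q Q1) (hf : ContDiff ℝ N f) : Cls 1 (N + 2) Q := by
  have step : ∀ n : ℕ, Cls 1 n (fun x => f (Q x)) → Cls 1 n Q → Cls 1 (n + 2) Q := by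
    intro n h1 h2
    exact .of_hasDerivAt h.d1 h.expBdd_Q (.of_hasDerivAt h.d2 h.expBdd_Q1 (h2.sub h1))
  have base : Cls 1 1 (fun x => f (Q x)) :=
    Cls.comp_zero one_pos (by norm_num : (1:ℝ) ≤ 0 + 1) h.cls_Q_aux h.diff_f
      (h.cls_Q_aux.of_succ.comp (by simpa using h.contDiff_f1.continuous)) h.f0
  induction N with
  | zero => exact step 0 base.of_succ h.cls_Q_aux.of_succ
  | succ n ih =>
    have h1 := ih (hf.of_le (by exact_mod_cast Nat.le_succ n))
    refine step (n + 1) ?_ h1.of_succ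
    have hf' := hf
    rw [Nat.cast_add, Nat.cast_one, contDiff_succ_iff_deriv] at hf'
    exact Cls.comp_zero one_pos (by norm_num : (1:ℝ) ≤ 0 + 1) h1.of_succ h.diff_f
      (h1.of_succ.of_succ.comp hf'.2.2) h.f0

theorem deriv_Q (h : Profile f Q Q1) : deriv Q = Q1 := funext fun x => (h.d1 x).deriv

theorem cls_Q1 (h : Profile f Q Q1) (hf : ContDiff ℝ N f) : Cls 1 (N + 1) Q1 := by
  have := (h.cls_Q hf).deriv'
  rwa [h.deriv_Q] at this

theorem contDiff_nat (h : Profile f Q Q1) : ContDiff ℝ (3 : ℕ) f := by exact_mod_cast h.f3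

/-- `f''(Q) - 2`. -/
theorem cls_f2 (h : Profile f Q Q1) {n : ℕ} (hf : ContDiff ℝ (n + 3 : ℕ) f) :
    Cls 1 (n + 1) (fun x => deriv (deriv f) (Q x) - 2) := by
  have hQ := h.cls_Q hf
  have e : ((n + 3 : ℕ) : WithTop ℕ∞) = ((n + 2 : ℕ) : WithTop ℕ∞) + 1 := by norm_cast
  have hf0 := hf
  rw [e, contDiff_succ_iff_deriv] at hf0
  have e : ((n + 2 : ℕ) : WithTop ℕ∞) = ((n + 1 : ℕ) : WithTop ℕ∞) + 1 := by norm_cast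
  have hf1 := hf0.2.2
  rw [e, contDiff_succ_iff_deriv] at hf1
  have e : ((n + 1 : ℕ) : WithTop ℕ∞) = (n : WithTop ℕ∞) + 1 := by norm_cast
  have hf2 := hf1.2.2
  rw [e, contDiff_succ_iff_deriv] at hf2
  refine Cls.comp_zero (ψ := fun s => deriv (deriv f) s - 2) one_pos (by norm_num : (1:ℝ) ≤ 0 + 1)
    (hQ.of_le (by omega)) (hf2.1.sub_const 2) ?_ (by simp [h.f2])
  refine ((hQ.of_le (by omega) : Cls 1 n Q).comp hf2.2.2).congr fun x => ?_
  rw [deriv_sub_const]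

theorem cls_f2' (h : Profile f Q Q1) {n : ℕ} (hf : ContDiff ℝ (n + 3 : ℕ) f) :
    Cls 0 (n + 1) (fun x => deriv (deriv f) (Q x)) :=
  (((h.cls_f2 hf).mono zero_le_one).add (.const 2)).congr fun x => by ring

theorem cls_f1 (h : Profile f Q Q1) {n : ℕ} (hf : ContDiff ℝ (n + 3 : ℕ) f) :
    Cls 1 (n + 2) (fun x => deriv f (Q x)) :=
  Cls.comp_zero one_pos (by norm_num : (1:ℝ) ≤ 0 + 1) ((h.cls_Q hf).of_le (by omega))
    (h.contDiff_f1.differentiable (by norm_num)) (h.cls_f2' hf) h.f1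

/-- Decay is obtained by integrating from infinity: each passage from `ψ'(Q)` to `ψ(Q)` with `ψ(0) =
0` gains a factor of the size of `Q'`. Thus `f'(Q)`, `f(Q)` and `F(Q)` have weights 1, 2 and 3. -/
theorem cls_f (h : Profile f Q Q1) {n : ℕ} (hf : ContDiff ℝ (n + 3 : ℕ) f) :
    Cls 2 (n + 3) (fun x => f (Q x)) :=
  Cls.comp_zero two_pos (by norm_num : (2:ℝ) ≤ 1 + 1) ((h.cls_Q hf).of_le (by omega))
    h.diff_f (h.cls_f1 hf) h.f0

theorem cls_F (h : Profile f Q Q1) {n : ℕ} (hf : ContDiff ℝ (n + 3 : ℕ) f) :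
    Cls 3 (n + 4) (fun x => prim f (Q x)) := by
  have hd := fun s => hasDerivAt_prim h.diff_f.continuous s
  refine Cls.comp_zero three_pos (by norm_num : (3:ℝ) ≤ 2 + 1) ((h.cls_Q hf).of_le (by omega))
    (fun s => (hd s).differentiableAt) ?_ (prim_zero f)
  exact (h.cls_f hf).congr fun x => (hd _).deriv

theorem energy (h : Profile f Q Q1) (x : ℝ) : Q1 x ^ 2 = Q x ^ 2 - 2 * prim f (Q x) := by
  set e : ℝ → ℝ := fun x => Q1 x ^ 2 - Q x ^ 2 + 2 * prim f (Q x) with he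
  have hd : ∀ x, HasDerivAt e 0 x := by
    intro x
    have := (((h.d2 x).fun_pow 2).sub ((h.d1 x).fun_pow 2)).add
      (((hasDerivAt_prim h.diff_f.continuous (Q x)).comp x (h.d1 x)).const_mul 2)
    refine this.congr_deriv ?_
    simp only [Nat.cast_ofNat]
    ring
  have hcon : ∀ x y, e x = e y := is_const_of_deriv_eq_zero (fun x => (hd x).differentiableAt)
    (fun x => (hd x).deriv)
  have hlim : Tendsto e atTop (𝓝 (0 ^ 2 - 0 ^ 2 + 2 * 0)) :=
    ((((h.cls_Q1 h.contDiff_nat).tendsto_zero one_pos).pow 2).sub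
      (((h.cls_Q h.contDiff_nat).tendsto_zero one_pos).pow 2)).add
      (((h.cls_F (n := 0) h.contDiff_nat).tendsto_zero three_pos).const_mul 2)
  have h2 : Tendsto e atTop (𝓝 (e x)) :=
    tendsto_const_nhds.congr (fun y => hcon x y)
  have := tendsto_nhds_unique h2 hlim
  simp only [he] at this
  linarith

theorem cls_inv (h : Profile f Q Q1) (hf : ContDiff ℝ N f) : Cls (-1) (N + 2) (fun x => (Q x)⁻¹) := by
  have hb : ExpBdd (-1) (fun x => (Q x)⁻¹) := by
    obtain ⟨c, hc, h1⟩ := h.lower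
    refine .of_bound (C := c⁻¹) fun x => ?_
    rw [abs_of_pos (inv_pos.2 (h.pos x)), show -(-1 * |x|) = -(-|x|) by ring, Real.exp_neg,
      ← mul_inv]
    exact inv_anti₀ (by positivity) (h1 x)
  have key : ∀ n ≤ N + 2, Cls (-1) n (fun x => (Q x)⁻¹) := by
    intro n
    induction n with
    | zero =>
      exact fun _ => ⟨(h.cls_Q hf).continuous.inv₀ fun x => (h.pos x).ne', hb⟩
    | succ n ih =>
      intro hn
      have i := ih (by omega)
      refine .of_hasDerivAt (g' := fun x => -((Q x)⁻¹ * ((Q x)⁻¹ * Q1 x))) (fun x => ?_) hb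
        ((i.mul (i.mul ((h.cls_Q1 hf).of_le (by omega)))).neg.mono (by norm_num))
      refine ((h.d1 x).inv (h.pos x).ne').congr_deriv ?_
      field_simp
  exact key _ le_rfl

theorem resonance_eq (h : Profile f Q Q1) (x : ℝ) : resonance Q x = -(Q1 x * (Q x)⁻¹) := by
  rw [resonance, h.deriv_Q]; ring

theorem cls_res (h : Profile f Q Q1) (hf : ContDiff ℝ N f) : Cls 0 (N + 1) (resonance Q) :=
  (((h.cls_Q1 hf).mul' ((h.cls_inv hf).of_le (by omega)) (by norm_num) :
    Cls 0 (N + 1) _).neg).congr h.resonance_eq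

/-- In `φ' = (Q'² - QQ'')/Q²` the energy identity cancels the leading constants; what is left is of
the size of `Q`, which is why `φ'` decays. -/
theorem hasDerivAt_res (h : Profile f Q Q1) (x : ℝ) :
    HasDerivAt (resonance Q) (f (Q x) * (Q x)⁻¹ - 2 * (prim f (Q x) * ((Q x)⁻¹ * (Q x)⁻¹))) x := by
  rw [show resonance Q = fun x => -(Q1 x * (Q x)⁻¹) from funext h.resonance_eq]
  have hQ := (h.pos x).ne'
  refine ((h.d2 x).mul ((h.d1 x).inv hQ)).neg.congr_deriv ?_
  have := h.energy x
  simp only [Pi.inv_apply]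
  field_simp
  linear_combination this

theorem cls_res' (h : Profile f Q Q1) {n : ℕ} (hf : ContDiff ℝ (n + 3 : ℕ) f) :
    Cls 1 (n + 3) (deriv (resonance Q)) := by
  have hi : Cls (-1) (n + 3) (fun x => (Q x)⁻¹) := (h.cls_inv hf).of_le (by omega)
  have h1 : Cls 1 (n + 3) (fun x => f (Q x) * (Q x)⁻¹) := (h.cls_f hf).mul' hi (by norm_num)
  have h2 : Cls 1 (n + 3) (fun x => prim f (Q x) * ((Q x)⁻¹ * (Q x)⁻¹)) :=
    (h.cls_F hf).of_succ.mul' (hi.mul hi) (by norm_num)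
  exact (h1.sub (h2.const_mul 2)).congr fun x => (h.hasDerivAt_res x).deriv

theorem res_pos (h : Profile f Q Q1) {x : ℝ} (hx : 0 < x) : 0 < resonance Q x := by
  rw [h.resonance_eq, ← neg_mul]
  exact mul_pos (by linarith [h.neg x hx]) (inv_pos.2 (h.pos x))

theorem res_odd (h : Profile f Q Q1) (x : ℝ) : resonance Q (-x) = -resonance Q x := by
  rw [h.resonance_eq, h.resonance_eq, h.even, h.odd1]; ring

theorem res_sq (h : Profile f Q Q1) (x : ℝ) :
    resonance Q x ^ 2 = 1 - 2 * (prim f (Q x) * ((Q x)⁻¹ * (Q x)⁻¹)) := by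
  rw [h.resonance_eq]
  have hQ := (h.pos x).ne'
  field_simp
  linear_combination h.energy x

/-- The energy identity gives `φ² = 1 - 2F(Q)/Q²`, which tends to 1, and `φ` is positive on the
right half line. -/
theorem res_tendsto (h : Profile f Q Q1) : Tendsto (resonance Q) atTop (𝓝 1) := by
  have hi := h.cls_inv h.contDiff_nat
  have h2 : Cls 1 0 (fun x => prim f (Q x) * ((Q x)⁻¹ * (Q x)⁻¹)) :=
    ((h.cls_F (n := 0) h.contDiff_nat).of_le (by omega)).mul'
      ((hi.of_le (by omega)).mul (hi.of_le (by omega))) (by norm_num)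
  have h3 : Tendsto (fun x => √(1 - 2 * (prim f (Q x) * ((Q x)⁻¹ * (Q x)⁻¹)))) atTop
      (𝓝 (√(1 - 2 * 0))) :=
    (Real.continuous_sqrt.tendsto _).comp (tendsto_const_nhds.sub ((h2.tendsto_zero one_pos).const_mul 2))
  rw [mul_zero, sub_zero, Real.sqrt_one] at h3
  refine h3.congr' ?_
  filter_upwards [eventually_gt_atTop 0] with x hx
  rw [← h.res_sq, Real.sqrt_sq (h.res_pos hx).le]

end Profile

namespace Profile

variable {f Q Q1 : ℝ → ℝ} {N : ℕ}

/-! ### Solving `ℒ w = n` -/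

theorem hasDerivAt_d2 (h : Profile f Q Q1) (x : ℝ) :
    HasDerivAt (fun x => Q x - f (Q x)) ((1 - deriv f (Q x)) * Q1 x) x := by
  refine ((h.d1 x).sub (((h.diff_f (Q x)).hasDerivAt).comp x (h.d1 x))).congr_deriv ?_
  ring

theorem continuous_Q (h : Profile f Q Q1) : Continuous Q := h.cls_Q_aux.continuous

theorem continuous_Q1 (h : Profile f Q Q1) : Continuous Q1 :=
  continuous_iff_continuousAt.2 fun x => (h.d2 x).continuousAt

theorem continuous_Q2 (h : Profile f Q Q1) : Continuous fun x => Q x - f (Q x) :=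
  h.continuous_Q.sub (h.diff_f.continuous.comp h.continuous_Q)

theorem abs_Q1_lower (h : Profile f Q Q1) :
    ∃ c, 0 < c ∧ ∀ x, 1 ≤ |x| → c * Real.exp (-|x|) ≤ |Q1 x| := by
  obtain ⟨c, hc, h1⟩ := h.lower1
  refine ⟨c, hc, fun x hx => ?_⟩
  have h2 := h1 |x| hx
  have h3 : abs (Q1 (abs x)) = abs (Q1 x) := by
    rcases abs_cases x with ⟨h4, -⟩ | ⟨h4, -⟩
    · rw [h4]
    · rw [h4, h.odd1, abs_neg]
  rw [← h3]
  linarith [neg_abs_le (Q1 (abs x))]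

/-- Reduction of order with the kernel element `Q'`: for `w = Q'W` the equation `Lw = n` reads `(Q'²
W')' = -Q'n`, that is `W' = -P/Q'²`. As `P` has weight 2 and `|Q'|` is bounded below by a multiple
of `exp(-|x|)` for `|x| ≥ 1`, `W'` and hence `W` grow at most polynomially. The simple zero of `Q'`
at the origin is compensated by `P(0) = 0`. -/
theorem solve_aux (h : Profile f Q Q1) {n P : ℝ → ℝ} (hn : Continuous n)
    (hP : ∀ x, HasDerivAt P (Q1 x * n x) x) (hP0 : P 0 = 0) (hPb : ExpBdd 2 P) :
    ∃ w w' : ℝ → ℝ, (∀ x, HasDerivAt w (w' x) x) ∧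
      (∀ x, HasDerivAt w' ((1 - deriv f (Q x)) * w x - n x) x) ∧ ExpBdd 1 w ∧ ExpBdd 1 w' := by
  have hQ20 : Q 0 - f (Q 0) < 0 := by linarith [h.curv]
  -- The limit of `-P/Q'²` at the origin, by l'Hôpital: the quotient of derivatives is `Q'n /
  -- (2Q'Q'')`.
  set c0 : ℝ := -(n 0 / (2 * (Q 0 - f (Q 0)))) with hc0
  set om : ℝ → ℝ := fun x => if x = 0 then c0 else -(P x / Q1 x ^ 2) with hom
  have hPc : Continuous P := continuous_iff_continuousAt.2 fun x => (hP x).continuousAt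
  have hom_ne : ∀ x, x ≠ 0 → om x = -(P x / Q1 x ^ 2) := fun x hx => if_neg hx
  have hom0 : om 0 = c0 := if_pos rfl
  have hev : ∀ᶠ x in 𝓝[≠] (0:ℝ), x ≠ 0 := eventually_mem_nhdsWithin
  have hlim : Tendsto (fun x => P x / Q1 x ^ 2) (𝓝[≠] 0) (𝓝 (n 0 / (2 * (Q 0 - f (Q 0))))) := by
    have hQ2c := h.continuous_Q2.tendsto 0
    have hQ2ne : ∀ᶠ x in 𝓝[≠] (0:ℝ), Q x - f (Q x) < 0 :=
      (hQ2c.eventually_lt_const hQ20).filter_mono nhdsWithin_le_nhds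
    refine HasDerivAt.lhopital_zero_nhdsNE (f' := fun x => Q1 x * n x)
      (g' := fun x => 2 * Q1 x * (Q x - f (Q x))) (Eventually.of_forall hP)
      (Eventually.of_forall fun x => ?_) ?_ ?_ ?_ ?_
    · refine ((h.d2 x).fun_pow 2).congr_deriv ?_
      simp
    · filter_upwards [hev, hQ2ne] with x hx hx2
      exact mul_ne_zero (mul_ne_zero two_ne_zero (h.Q1_ne hx)) hx2.ne
    · simpa [hP0] using (hPc.tendsto 0).mono_left nhdsWithin_le_nhds
    · have := (((h.continuous_Q1.tendsto 0).pow 2)).mono_left (nhdsWithin_le_nhds (s := {0}ᶜ))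
      simpa [h.Q1_zero] using this
    · have : Tendsto (fun x => n x / (2 * (Q x - f (Q x)))) (𝓝[≠] 0)
          (𝓝 (n 0 / (2 * (Q 0 - f (Q 0))))) :=
        ((hn.tendsto 0).div (hQ2c.const_mul 2) (by linarith)).mono_left nhdsWithin_le_nhds
      refine this.congr' ?_
      filter_upwards [hev, hQ2ne] with x hx hx2
      have := h.Q1_ne hx
      field_simp
  have homc : Continuous om := by
    rw [continuous_iff_continuousAt]
    intro x
    by_cases hx : x = 0
    · subst hx
      rw [continuousAt_iff_punctured_nhds, hom0]
      refine hlim.neg.congr' ?_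
      filter_upwards [hev] with y hy
      exact (hom_ne y hy).symm
    · have : ContinuousAt (fun x => -(P x / Q1 x ^ 2)) x :=
        ((hPc.continuousAt).div (h.continuous_Q1.continuousAt.pow 2)
          (pow_ne_zero 2 (h.Q1_ne hx))).neg
      refine this.congr ?_
      filter_upwards [isOpen_ne.mem_nhds hx] with y hy
      exact (hom_ne y hy).symm
  have homb : ExpBdd 0 om := by
    obtain ⟨K, r, hK, hb⟩ := hPb.exists_pos
    obtain ⟨c, hc, hl⟩ := h.abs_Q1_lower
    obtain ⟨B, hB⟩ := isCompact_Icc.exists_bound_of_continuousOn (s := Set.Icc (-1 : ℝ) 1)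
      homc.continuousOn
    have hB0 : 0 ≤ B := (norm_nonneg _).trans (hB 0 (by simp))
    refine ⟨B + K / c ^ 2, r, fun x => ?_⟩
    have h1 : (1:ℝ) ≤ (1 + |x|) ^ r := one_le_pow₀ (by linarith [abs_nonneg x])
    simp only [zero_mul, neg_zero, Real.exp_zero, mul_one]
    rcases le_total |x| 1 with hx | hx
    · have := hB x (abs_le.1 hx)
      rw [Real.norm_eq_abs] at this
      have h3 : 0 ≤ K / c ^ 2 := by positivity
      nlinarith
    · have hx0 : x ≠ 0 := by rintro rfl; simp at hx; linarith
      rw [hom_ne x hx0, abs_neg, abs_div, abs_pow]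
      have hQ1 := hl x hx
      have he : 0 < c * Real.exp (-|x|) := by positivity
      have : |P x| / |Q1 x| ^ 2 ≤ K * (1 + |x|) ^ r * Real.exp (-(2 * |x|)) /
          (c * Real.exp (-|x|)) ^ 2 := by
        gcongr
        exact hb x
      refine this.trans ?_
      have e2 : Real.exp (-(2 * |x|)) = Real.exp (-|x|) ^ 2 := by
        rw [← Real.exp_nat_mul]; congr 1; push_cast; ring
      rw [e2]
      have : K * (1 + |x|) ^ r * Real.exp (-|x|) ^ 2 / (c * Real.exp (-|x|)) ^ 2 =
          K / c ^ 2 * (1 + |x|) ^ r := by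
        have := Real.exp_pos (-|x|)
        field_simp
      rw [this]
      nlinarith
  set W : ℝ → ℝ := fun x => ∫ u in (0:ℝ)..x, om u with hW
  have hWd : ∀ x, HasDerivAt W (om x) x := fun x => hasDerivAt_prim homc x
  have hWb : ExpBdd 0 W := by
    obtain ⟨K, r, hK, hb⟩ := homb.exists_pos
    refine ⟨K, r + 1, fun x => ?_⟩
    simp only [zero_mul, neg_zero, Real.exp_zero, mul_one] at hb ⊢
    have : ‖∫ u in (0:ℝ)..x, om u‖ ≤ K * (1 + |x|) ^ r * |x - 0| := by
      refine intervalIntegral.norm_integral_le_of_norm_le_const fun u hu => ?_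
      rw [Real.norm_eq_abs]
      have : |u| ≤ |x| := by
        rcases Set.mem_uIoc.1 hu with ⟨h1, h2⟩ | ⟨h1, h2⟩
        · rw [abs_of_pos h1, abs_of_pos (h1.trans_le h2)]; exact h2
        · rw [abs_of_nonpos h2, abs_of_nonpos (h1.le.trans h2)]; linarith
      refine (hb u).trans ?_
      gcongr
    rw [Real.norm_eq_abs, sub_zero] at this
    refine this.trans ?_
    rw [pow_succ, ← mul_assoc]
    gcongr
    linarith
  have hQ2b : ExpBdd 1 fun x => Q x - f (Q x) :=
    ((h.cls_Q h.contDiff_nat).expBdd).add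
      (((h.cls_f (n := 0) h.contDiff_nat).mono (by norm_num : (1:ℝ) ≤ 2)).neg.expBdd)
  refine ⟨fun x => Q1 x * W x, fun x => (Q x - f (Q x)) * W x + Q1 x * om x,
    fun x => (h.d2 x).mul (hWd x), fun x => ?_, by simpa using h.expBdd_Q1.mul hWb, ?_⟩
  · have hA := (h.hasDerivAt_d2 x).mul (hWd x)
    have hB : HasDerivAt (fun x => Q1 x * om x) (-n x - (Q x - f (Q x)) * om x) x := by
      -- At the origin `Q' om` is differentiable because `Q'(0) = 0` and `om` is continuous; its
      -- derivative is `Q''(0) om(0)`, and the value `c0` makes this agree with `-n(0) - Q''(0)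
      -- om(0)`.
      by_cases hx : x = 0
      · subst hx
        have h1 : Tendsto (fun t => (t⁻¹ * Q1 t) * om t) (𝓝[≠] 0)
            (𝓝 ((Q 0 - f (Q 0)) * om 0)) := by
          refine Tendsto.mul ?_ ((homc.tendsto 0).mono_left nhdsWithin_le_nhds)
          have := hasDerivAt_iff_tendsto_slope_zero.1 (h.d2 0)
          simpa [h.Q1_zero] using this
        have e : -n 0 - (Q 0 - f (Q 0)) * om 0 = (Q 0 - f (Q 0)) * om 0 := by
          rw [hom0, hc0]; have := hQ20.ne; field_simp; ring
        rw [e, hasDerivAt_iff_tendsto_slope_zero]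
        refine h1.congr fun t => ?_
        simp [h.Q1_zero, mul_assoc]
      · have hQx := h.Q1_ne hx
        have h1 : HasDerivAt (fun x => -(P x / Q1 x)) (-n x - (Q x - f (Q x)) * om x) x := by
          refine ((hP x).div (h.d2 x) hQx).neg.congr_deriv ?_
          rw [hom_ne x hx]
          field_simp
          ring
        refine h1.congr_of_eventuallyEq ?_
        filter_upwards [isOpen_ne.mem_nhds hx] with y hy
        have := h.Q1_ne hy
        rw [hom_ne y hy]
        field_simp
    refine (hA.add hB).congr_deriv ?_
    ring
  · have h1 := hQ2b.mul hWb
    have h2 := h.expBdd_Q1.mul homb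
    rw [add_zero] at h1 h2
    exact h1.add h2

theorem hasDerivAt_neg_comp {g : ℝ → ℝ} {a : ℝ} {x : ℝ} (hg : HasDerivAt g a (-x)) :
    HasDerivAt (fun x => g (-x)) (-a) x := by
  simpa [Function.comp_def] using hg.comp x (hasDerivAt_neg x)

theorem _root_.GKdV.ExpBdd.comp_neg {k : ℝ} {g : ℝ → ℝ} (hg : ExpBdd k g) :
    ExpBdd k (fun x => g (-x)) := by
  obtain ⟨K, r, h⟩ := hg
  exact ⟨K, r, fun x => by simpa using h (-x)⟩

theorem _root_.GKdV.ExpBdd.const_mul {k : ℝ} {g : ℝ → ℝ} (c : ℝ) (hg : ExpBdd k g) :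
    ExpBdd k (fun x => c * g x) := by
  simpa using (ExpBdd.const c).mul hg

/-- Symmetrization of a solution: `e = 1` gives even solutions, `e = -1` odd ones. -/
theorem solve_parity (h : Profile f Q Q1) {n w w' : ℝ → ℝ} {e : ℝ} (he : e * e = 1)
    (hn : ∀ x, n (-x) = e * n x)
    (hw : ∀ x, HasDerivAt w (w' x) x)
    (hw' : ∀ x, HasDerivAt w' ((1 - deriv f (Q x)) * w x - n x) x) (hb : ExpBdd 1 w)
    (hb' : ExpBdd 1 w') :
    ∃ w w' : ℝ → ℝ, (∀ x, w (-x) = e * w x) ∧ (∀ x, HasDerivAt w (w' x) x) ∧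
      (∀ x, HasDerivAt w' ((1 - deriv f (Q x)) * w x - n x) x) ∧ ExpBdd 1 w ∧ ExpBdd 1 w' := by
  refine ⟨fun x => 1 / 2 * (w x + e * w (-x)), fun x => 1 / 2 * (w' x + (-e) * w' (-x)),
    fun x => ?_, fun x => ?_, fun x => ?_, (hb.add (hb.comp_neg.const_mul e)).const_mul _,
    (hb'.add (hb'.comp_neg.const_mul (-e))).const_mul _⟩
  · simp only [neg_neg]; linear_combination (-1 / 2) * w (-x) * he
  · refine (((hw x).add ((hasDerivAt_neg_comp (hw (-x))).const_mul e)).const_mul _).congr_deriv ?_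
    ring
  · refine (((hw' x).add ((hasDerivAt_neg_comp (hw' (-x))).const_mul (-e))).const_mul _).congr_deriv ?_
    rw [h.even, hn]
    linear_combination (-1 / 2) * n x * he

theorem exp_primitive (h : Profile f Q Q1) {g : ℝ → ℝ} (hn : Continuous g) (hnb : ExpBdd 1 g) :
    ∃ P : ℝ → ℝ, (∀ x, HasDerivAt P (Q1 x * g x) x) ∧ Tendsto P atTop (𝓝 0) := by
  have hc : Continuous fun x => Q1 x * g x := h.continuous_Q1.mul hn
  have hi : Integrable fun x => Q1 x * g x :=
    ExpBdd.integrable ((h.expBdd_Q1.mul hnb)) (by norm_num) hc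
  refine ⟨fun x => prim (fun x => Q1 x * g x) x - ∫ x in Set.Ioi (0:ℝ), Q1 x * g x,
    fun x => (hasDerivAt_prim hc x).sub_const _, ?_⟩
  have := (intervalIntegral_tendsto_integral_Ioi 0 hi.integrableOn tendsto_id).sub_const
    (∫ x in Set.Ioi (0:ℝ), Q1 x * g x)
  rwa [sub_self] at this

theorem even_of_odd_deriv {P p : ℝ → ℝ} (hP : ∀ x, HasDerivAt P (p x) x)
    (hp : ∀ x, p (-x) = -p x) (x : ℝ) : P (-x) = P x := by
  have hd : ∀ x, HasDerivAt (fun x => P (-x) - P x) 0 x := fun x => by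
    refine ((hasDerivAt_neg_comp (hP (-x))).sub (hP x)).congr_deriv ?_
    rw [hp]; ring
  have := is_const_of_deriv_eq_zero (fun x => (hd x).differentiableAt) (fun x => (hd x).deriv) x 0
  simp only [neg_zero, sub_self] at this
  linarith

theorem odd_of_even_deriv {P p : ℝ → ℝ} (hP : ∀ x, HasDerivAt P (p x) x) (h0 : P 0 = 0)
    (hp : ∀ x, p (-x) = p x) (x : ℝ) : P (-x) = -P x := by
  have hd : ∀ x, HasDerivAt (fun x => P (-x) + P x) 0 x := fun x => by
    refine ((hasDerivAt_neg_comp (hP (-x))).add (hP x)).congr_deriv ?_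
    rw [hp]; ring
  have := is_const_of_deriv_eq_zero (fun x => (hd x).differentiableAt) (fun x => (hd x).deriv) x 0
  simp only [neg_zero, h0, add_zero] at this
  linarith

theorem tendsto_bot_of_even {P : ℝ → ℝ} {e : ℝ} (hP : ∀ x, P (-x) = e * P x)
    (h : Tendsto P atTop (𝓝 0)) : Tendsto P atBot (𝓝 0) := by
  have := (h.comp tendsto_neg_atBot_atTop).const_mul (e * 1)
  rw [mul_zero] at this
  have h2 : ∀ x, P x = e * 1 * (P ∘ Neg.neg) x := fun x => by
    have := hP (-x)
    rw [neg_neg] at this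
    simp [this]
  exact this.congr fun x => (h2 x).symm

/-- For even `n` the primitive of `Q'n` that vanishes at infinity need not vanish at the origin, as
reduction of order requires. This is repaired by subtracting from `n` a multiple of `LQ = f(Q) -
f'(Q)Q`: the corresponding primitive is `J = 2F(Q) - Qf(Q)`, and `J(0) = Q(0)Q''(0)` is nonzero by
the energy identity. The same multiple of `Q` is added back to the solution. -/
theorem solve_even (h : Profile f Q Q1) {n : ℝ → ℝ} (hn : Continuous n) (hnb : ExpBdd 1 n)
    (hne : ∀ x, n (-x) = n x) :
    ∃ w w' : ℝ → ℝ, (∀ x, w (-x) = w x) ∧ (∀ x, HasDerivAt w (w' x) x) ∧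
      (∀ x, HasDerivAt w' ((1 - deriv f (Q x)) * w x - n x) x) ∧ ExpBdd 1 w ∧ ExpBdd 1 w' := by
  obtain ⟨H, hH, hH0⟩ := h.exp_primitive hn hnb
  set J : ℝ → ℝ := fun x => 2 * prim f (Q x) - Q x * f (Q x) with hJ
  have hJd : ∀ x, HasDerivAt J (Q1 x * (f (Q x) - deriv f (Q x) * Q x)) x := fun x => by
    have hfd := ((h.diff_f (Q x)).hasDerivAt).comp x (h.d1 x)
    refine ((((hasDerivAt_prim h.diff_f.continuous (Q x)).comp x (h.d1 x)).const_mul 2).sub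
      ((h.d1 x).mul hfd)).congr_deriv ?_
    simp only [Function.comp_apply]
    ring
  have c3 := h.contDiff_nat
  have hfQ : Cls 1 1 fun x => f (Q x) := ((h.cls_f (n := 0) c3).mono (by norm_num)).of_le (by omega)
  have hQQ : Cls 1 1 Q := (h.cls_Q c3).of_le (by omega)
  have hJc : Cls 1 1 J :=
    ((((h.cls_F (n := 0) c3).mono (by norm_num : (1:ℝ) ≤ 3)).of_le (by omega)).const_mul 2).sub
      (hQQ.mul' hfQ (by norm_num))
  have hJ00 : J 0 ≠ 0 := by
    have := h.energy 0
    rw [h.Q1_zero] at this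
    have e : J 0 = Q 0 * (Q 0 - f (Q 0)) := by simp only [hJ]; linear_combination this
    rw [e]
    exact mul_ne_zero (h.pos 0).ne' (by linarith [h.curv])
  set la : ℝ := H 0 / J 0 with hla
  set n' : ℝ → ℝ := fun x => n x - la * (f (Q x) - deriv f (Q x) * Q x) with hn'
  have hm : Cls 1 0 fun x => f (Q x) - deriv f (Q x) * Q x :=
    hfQ.of_succ.sub
    (((h.cls_f1 (n := 0) c3).of_le (by omega)).mul' hQQ.of_succ (by norm_num))
  have hn'c : Cls 1 0 n' := Cls.sub ⟨hn, hnb⟩ (hm.const_mul la)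
  have hP : ∀ x, HasDerivAt (fun x => H x - la * J x) (Q1 x * n' x) x := fun x => by
    refine ((hH x).sub ((hJd x).const_mul la)).congr_deriv ?_
    simp only [hn']; ring
  have hn'e : ∀ x, n' (-x) = n' x := fun x => by simp only [hn']; rw [h.even, hne]
  have hlim : Tendsto (fun x => H x - la * J x) atTop (𝓝 0) := by
    simpa using hH0.sub ((hJc.tendsto_zero one_pos).const_mul la)
  have hev := even_of_odd_deriv hP (fun x => by rw [h.odd1, hn'e]; ring)
  have hlim' : Tendsto (fun x => H x - la * J x) atBot (𝓝 0) :=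
    tendsto_bot_of_even (e := 1) (fun x => by simpa using hev x) hlim
  have hb2 : ExpBdd 2 fun x => Q1 x * n' x := by
    have := h.expBdd_Q1.mul hn'c.expBdd
    norm_num at this; exact this
  obtain ⟨w, w', h1, h2, h3, h4⟩ := h.solve_aux hn'c.continuous hP
    (by rw [hla]; field_simp; ring) (ExpBdd.of_deriv two_pos hP hb2 hlim hlim')
  have hQ1c : Cls 1 0 Q1 := (h.cls_Q1 c3).of_le (by omega)
  obtain ⟨v, v', g1, g2, g3, g4, g5⟩ := h.solve_parity (e := 1) (n := n) (by norm_num)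
    (fun x => by rw [hne]; ring) (w := fun x => w x + la * Q x) (w' := fun x => w' x + la * Q1 x)
    (fun x => (h1 x).add ((h.d1 x).const_mul la))
    (fun x => by
      refine ((h2 x).add ((h.d2 x).const_mul la)).congr_deriv ?_
      simp only [hn']; ring)
    (h3.add (hQQ.expBdd.const_mul la)) (h4.add (hQ1c.expBdd.const_mul la))
  exact ⟨v, v', fun x => by simpa using g1 x, g2, g3, g4, g5⟩

/-- For odd `n` the orthogonality to `Q'` is a genuine condition; it is expressed by a primitive of
`Q'n` that vanishes both at the origin and at infinity. -/
theorem solve_odd (h : Profile f Q Q1) {n P : ℝ → ℝ} (hn : Continuous n) (hnb : ExpBdd 1 n)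
    (hno : ∀ x, n (-x) = -n x) (hP : ∀ x, HasDerivAt P (Q1 x * n x) x) (hP0 : P 0 = 0)
    (hlim : Tendsto P atTop (𝓝 0)) :
    ∃ w w' : ℝ → ℝ, (∀ x, w (-x) = -w x) ∧ (∀ x, HasDerivAt w (w' x) x) ∧
      (∀ x, HasDerivAt w' ((1 - deriv f (Q x)) * w x - n x) x) ∧ ExpBdd 1 w ∧ ExpBdd 1 w' := by
  have hodd := odd_of_even_deriv hP hP0 (fun x => by rw [h.odd1, hno]; ring)
  have hb2 : ExpBdd 2 fun x => Q1 x * n x := by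
    have := h.expBdd_Q1.mul hnb
    norm_num at this; exact this
  obtain ⟨w, w', h1, h2, h3, h4⟩ := h.solve_aux hn hP hP0 (ExpBdd.of_deriv two_pos hP hb2 hlim
    (tendsto_bot_of_even (e := -1) (fun x => by simpa using hodd x) hlim))
  obtain ⟨v, v', g1, g2, g3, g4, g5⟩ := h.solve_parity (e := -1) (n := n) (by norm_num)
    (fun x => by rw [hno]; ring) h1 h2 h3 h4
  exact ⟨v, v', fun x => by simpa using g1 x, g2, g3, g4, g5⟩

/-- Regularity of solutions. -/
theorem bootstrap (h : Profile f Q Q1) {n : ℕ} (hf : ContDiff ℝ (n + 3 : ℕ) f) {g w w' : ℝ → ℝ}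
    {m : ℕ} (hm : m ≤ n + 2) (hg : Cls 1 m g) (hw : ∀ x, HasDerivAt w (w' x) x)
    (hw' : ∀ x, HasDerivAt w' ((1 - deriv f (Q x)) * w x - g x) x) (hb : ExpBdd 1 w)
    (hb' : ExpBdd 1 w') : Cls 1 (m + 2) w := by
  have hf1 : ∀ j ≤ n + 2, Cls 0 j fun x => 1 - deriv f (Q x) := fun j hj =>
    (Cls.const 1).sub (((h.cls_f1 hf).of_le hj).mono zero_le_one)
  have hcw : Continuous w := continuous_iff_continuousAt.2 fun x => (hw x).continuousAt
  have key : ∀ j ≤ m, Cls 1 j w → Cls 1 (j + 2) w := fun j hj hc =>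
    .of_hasDerivAt hw hb (.of_hasDerivAt hw' hb'
      (((hf1 j (hj.trans hm)).mul' hc (by norm_num)).sub (hg.of_le hj)))
  have : ∀ j ≤ m, Cls 1 (j + 2) w := by
    intro j
    induction j with
    | zero => exact fun _ => key 0 (by omega) ⟨hcw, hb⟩
    | succ j ih => exact fun hj => key (j + 1) hj (ih (by omega)).of_succ
  exact this m le_rfl

end Profile

/-! ### The first linear system -/

/-- Integrated form of the system `(Ω_{1,0})`; here `M = ∫₀ˣ (A + a Q)` and `V = ∫ₓ^∞ (B - M)`. -/
structure FirstSol (f Q Q1 A B M V : ℝ → ℝ) (a b : ℝ) : Prop where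
  evenA : ∀ x, A (-x) = A x
  oddB : ∀ x, B (-x) = -B x
  clsA : Cls 1 3 A
  clsB : Cls 1 3 (fun x => B x - b * resonance Q x)
  eqA : ∀ x, deriv (deriv A) x = A x - deriv f (Q x) * A x
    - (deriv f (Q x) - a * (3 * Q x - 2 * f (Q x)))
  eqB : ∀ x, deriv (deriv B) x = B x - deriv f (Q x) * B x - (M x + 2 * deriv A x - a * Q1 x)
  hM : ∀ x, HasDerivAt M (A x + a * Q x) x
  M0 : M 0 = 0
  hV : ∀ x, HasDerivAt V (M x - B x) x
  V_lim : Tendsto V atTop (𝓝 0)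

theorem odd_deriv_of_even {g g' : ℝ → ℝ} (hg : ∀ x, HasDerivAt g (g' x) x)
    (he : ∀ x, g (-x) = g x) (x : ℝ) : g' (-x) = -g' x := by
  have h1 := Profile.hasDerivAt_neg_comp (hg (-x))
  rw [show (fun x => g (-x)) = g from funext he] at h1
  linarith [h1.unique (hg x)]

theorem even_deriv_of_odd {g g' : ℝ → ℝ} (hg : ∀ x, HasDerivAt g (g' x) x)
    (ho : ∀ x, g (-x) = -g x) (x : ℝ) : g' (-x) = g' x := by
  have h1 := Profile.hasDerivAt_neg_comp (hg (-x))
  rw [show (fun x => g (-x)) = fun x => -g x from funext ho] at h1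
  linarith [h1.unique (hg x).neg]

theorem eq_of_hasDerivAt_eq {g h g' : ℝ → ℝ} (hg : ∀ x, HasDerivAt g (g' x) x)
    (hh : ∀ x, HasDerivAt h (g' x) x) {x₀ : ℝ} (h0 : g x₀ = h x₀) (x : ℝ) : g x = h x := by
  have hd : ∀ x, HasDerivAt (fun x => g x - h x) 0 x := fun x => by
    exact ((hg x).sub (hh x)).congr_deriv (sub_self _)
  have := is_const_of_deriv_eq_zero (fun x => (hd x).differentiableAt) (fun x => (hd x).deriv) x x₀
  simp only [h0, sub_self] at this
  linarith

theorem eq_of_hasDerivAt_eq_of_tendsto {g h g' : ℝ → ℝ} (hg : ∀ x, HasDerivAt g (g' x) x)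
    (hh : ∀ x, HasDerivAt h (g' x) x) {c : ℝ} (h1 : Tendsto g atTop (𝓝 c))
    (h2 : Tendsto h atTop (𝓝 c)) (x : ℝ) : g x = h x := by
  have hd : ∀ x, HasDerivAt (fun x => g x - h x) 0 x := fun x => by
    exact ((hg x).sub (hh x)).congr_deriv (sub_self _)
  have hc := is_const_of_deriv_eq_zero (fun x => (hd x).differentiableAt) (fun x => (hd x).deriv)
  have hl : Tendsto (fun x => g x - h x) atTop (𝓝 0) := by simpa using h1.sub h2
  have := tendsto_nhds_unique (tendsto_const_nhds.congr fun y => hc x y) hl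
  linarith

theorem odd_zero {g : ℝ → ℝ} (ho : ∀ x, g (-x) = -g x) : g 0 = 0 := by
  have := ho 0
  rw [neg_zero] at this
  linarith

theorem _root_.GKdV.Cls.hasDerivAt_of {k : ℝ} {n : ℕ} {g : ℝ → ℝ} (hg : Cls k n g) (hn : n ≠ 0)
    (x : ℝ) : HasDerivAt g (deriv g x) x := by
  obtain ⟨m, rfl⟩ := Nat.exists_eq_succ_of_ne_zero hn
  exact hg.hasDerivAt x

namespace Profile

variable {f Q Q1 : ℝ → ℝ}

theorem hasDerivAt_fQ (h : Profile f Q Q1) (x : ℝ) :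
    HasDerivAt (fun x => f (Q x)) (deriv f (Q x) * Q1 x) x :=
  ((h.diff_f (Q x)).hasDerivAt).comp x (h.d1 x)

theorem hasDerivAt_f1Q (h : Profile f Q Q1) (x : ℝ) :
    HasDerivAt (fun x => deriv f (Q x)) (deriv (deriv f) (Q x) * Q1 x) x :=
  (h.hasDerivAt_f1 (Q x)).comp x (h.d1 x)

theorem hasDerivAt_f2Q (h : Profile f Q Q1) (x : ℝ) :
    HasDerivAt (fun x => deriv (deriv f) (Q x)) (deriv (deriv (deriv f)) (Q x) * Q1 x) x :=
  ((h.contDiff_f2.differentiable (by norm_num) (Q x)).hasDerivAt).comp x (h.d1 x)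

theorem deriv2_Q (h : Profile f Q Q1) : deriv (deriv Q) = fun x => Q x - f (Q x) := by
  rw [h.deriv_Q]; exact funext fun x => (h.d2 x).deriv

theorem cls_B (h : Profile f Q Q1) {n : ℕ} (hf : ContDiff ℝ n f) {B : ℝ → ℝ} {b : ℝ}
    (hB : Cls 1 n (fun x => B x - b * resonance Q x)) : Cls 0 n B :=
  ((hB.mono zero_le_one).add ((h.cls_res hf).of_succ.const_mul b)).congr fun x => by ring

theorem res_zero (h : Profile f Q Q1) : resonance Q 0 = 0 := odd_zero h.res_odd

/-- `ℒ φ - φ`. -/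
theorem cls_linOp_res (h : Profile f Q Q1) {n : ℕ} (hf : ContDiff ℝ (n + 3 : ℕ) f) :
    Cls 1 (n + 2) (fun x => -deriv (deriv (resonance Q)) x - deriv f (Q x) * resonance Q x) :=
  (h.cls_res' hf).deriv'.neg.sub
    ((h.cls_f1 hf).mul' ((h.cls_res hf).of_le (by omega)) (by norm_num))

theorem cls_3Q (h : Profile f Q Q1) {n : ℕ} (hf : ContDiff ℝ (n + 3 : ℕ) f) :
    Cls 1 (n + 3) (fun x => 3 * Q x - 2 * f (Q x)) :=
  (((h.cls_Q hf).of_le (by omega)).const_mul 3).sub (((h.cls_f hf).mono (by norm_num)).const_mul 2)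

end Profile

variable {f Q Q1 A B M V : ℝ → ℝ} {a b : ℝ}

/-- The first equation is an equality of derivatives of functions vanishing at infinity. Inserting
it into the second one gives `(LB)' = (M + 2A' - aQ')'`, and both sides before differentiation are
odd, hence agree at the origin. -/
theorem FirstSol.of_isOmegaSolution (h : Profile f Q Q1)
    (hs : IsOmegaSolution f Q (F10 f Q) (G10 f Q) A B 0 a b) :
    ∃ M V, FirstSol f Q Q1 A B M V a b := by
  have c3 := h.contDiff_nat
  have hA : Cls 1 3 A := by simpa using classY_iff.1 hs.classY_A 3 c3
  have hBw : Cls 1 3 (fun x => B x - b * resonance Q x) := classY_iff.1 hs.classY_B 3 c3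
  have hB : Cls 0 3 B := h.cls_B c3 hBw
  have hres := h.cls_res c3
  have h3Q := h.cls_3Q (n := 0) c3
  have hf1 := h.cls_f1 (n := 0) c3
  -- the equation for `A`
  have hlinA : Cls 1 1 (linOp f Q A) :=
    ((hA.deriv'.deriv'.neg.add (hA.of_le (by omega))).sub
      ((hf1.of_le (by omega)).mul' (hA.of_le (by omega)) (by norm_num)))
  have eqA : ∀ x, linOp f Q A x + a * (3 * Q x - 2 * f (Q x)) = deriv f (Q x) := by
    refine eq_of_hasDerivAt_eq_of_tendsto (fun x => ((hlinA.hasDerivAt x).add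
      ((h3Q.hasDerivAt x).const_mul a)).congr_deriv (hs.eqA x))
      (fun x => (hf1.hasDerivAt x)) (c := 0) ?_ (hf1.tendsto_zero one_pos)
    simpa using (hlinA.tendsto_zero one_pos).add ((h3Q.tendsto_zero one_pos).const_mul a)
  have hA2 : ∀ x, deriv (deriv A) x = A x - deriv f (Q x) * A x
      - (deriv f (Q x) - a * (3 * Q x - 2 * f (Q x))) := fun x => by
    have := eqA x
    rw [linOp] at this
    linarith
  -- the equation for `B`
  have hAQc : Continuous fun x => A x + a * Q x := hA.continuous.add (h.continuous_Q.const_mul a)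
  set M : ℝ → ℝ := prim fun x => A x + a * Q x with hMdef
  have hM : ∀ x, HasDerivAt M (A x + a * Q x) x := fun x => hasDerivAt_prim hAQc x
  have hB1 : ∀ x, HasDerivAt B (deriv B x) x := fun x => hB.hasDerivAt_of (by simp) x
  have hB2 : ∀ x, HasDerivAt (deriv B) (deriv (deriv B) x) x :=
    fun x => hB.deriv'.hasDerivAt_of (by simp) x
  have hB2odd := odd_deriv_of_even hB2 (even_deriv_of_odd hB1 hs.odd)
  have hlinB : Cls 0 1 (linOp f Q B) :=
    ((hB.deriv'.deriv'.neg.add (hB.of_le (by omega))).sub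
      ((hf1.of_le (by omega)).mul' (hB.of_le (by omega)) (by norm_num)))
  have hM0 : M 0 = 0 := prim_zero _
  have hA1odd := odd_deriv_of_even (fun x => hA.hasDerivAt_of (by simp) x) hs.even
  have eqB : ∀ x, linOp f Q B x = M x + 2 * deriv A x - a * Q1 x := by
    refine eq_of_hasDerivAt_eq (x₀ := 0) (fun x => hlinB.hasDerivAt x) (fun x => ?_) ?_
    · refine (((hM x).add ((hA.deriv'.hasDerivAt_of (by simp) x).const_mul 2)).sub
        ((h.d2 x).const_mul a)).congr_deriv ?_
      have := hs.eqB x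
      rw [G10, h.deriv2_Q] at this
      linear_combination -hA2 x - this
    · rw [linOp, odd_zero hB2odd, odd_zero hs.odd, hM0, odd_zero hA1odd, h.Q1_zero]
      ring
  -- The equation for `B` itself shows that `M - B` decays: it expresses it through terms that all
  -- have weight 1.
  have hBM : Cls 1 1 fun x => M x - B x := by
    have e : ∀ x, M x - B x = -deriv (deriv fun x => B x - b * resonance Q x) x
        - b * deriv (deriv (resonance Q)) x - deriv f (Q x) * B x - 2 * deriv A x + a * Q1 x := by
      intro x
      have e1 : deriv (fun x => B x - b * resonance Q x) =
          fun x => deriv B x - b * deriv (resonance Q) x := funext fun x =>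
        ((hB1 x).sub ((hres.hasDerivAt x).const_mul b)).deriv
      rw [e1, show deriv (fun x => deriv B x - b * deriv (resonance Q) x) x = _ from
        ((hB2 x).sub ((hres.deriv'.hasDerivAt_of (by simp) x).const_mul b)).deriv]
      have := eqB x
      rw [linOp] at this
      linear_combination -this
    refine Cls.congr ?_ e
    exact ((((hBw.deriv'.deriv'.neg.sub (((h.cls_res' (n := 0) c3).deriv'.of_le
      (by omega)).const_mul b)).sub ((hf1.of_le (by omega)).mul' (hB.of_le (by omega))
      (by norm_num))).sub ((hA.deriv'.of_le (by omega)).const_mul 2)).add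
      (((h.cls_Q1 c3).of_le (by omega)).const_mul a))
  have hiBM : Integrable fun x => M x - B x := hBM.integrable one_pos
  refine ⟨M, fun x => prim (fun x => M x - B x) x - ∫ x in Set.Ioi (0:ℝ), (M x - B x),
    hs.even, hs.odd, hA, hBw, hA2, fun x => ?_, hM, hM0,
    fun x => (hasDerivAt_prim hBM.continuous x).sub_const _, ?_⟩
  · have := eqB x
    rw [linOp] at this
    linarith
  · have := (intervalIntegral_tendsto_integral_Ioi 0 hiBM.integrableOn tendsto_id).sub_const
      (∫ x in Set.Ioi (0:ℝ), (M x - B x))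
    rwa [sub_self] at this

namespace FirstSol

theorem cls_B (hs : FirstSol f Q Q1 A B M V a b) (h : Profile f Q Q1) : Cls 0 3 B :=
  h.cls_B h.contDiff_nat hs.clsB

theorem cls_BM (hs : FirstSol f Q Q1 A B M V a b) (h : Profile f Q Q1) :
    Cls 1 1 fun x => M x - B x := by
  have c3 := h.contDiff_nat
  have hB := hs.cls_B h
  have hres := h.cls_res c3
  have e : ∀ x, M x - B x = -deriv (deriv fun x => B x - b * resonance Q x) x
      - b * deriv (deriv (resonance Q)) x - deriv f (Q x) * B x - 2 * deriv A x + a * Q1 x := by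
    intro x
    have e1 : deriv (fun x => B x - b * resonance Q x) =
        fun x => deriv B x - b * deriv (resonance Q) x := funext fun x =>
      ((hB.hasDerivAt_of (by simp) x).sub ((hres.hasDerivAt x).const_mul b)).deriv
    rw [e1, show deriv (fun x => deriv B x - b * deriv (resonance Q) x) x = _ from
      ((hB.deriv'.hasDerivAt_of (by simp) x).sub
        ((hres.deriv'.hasDerivAt_of (by simp) x).const_mul b)).deriv]
    linear_combination hs.eqB x
  refine Cls.congr ?_ e
  exact ((((hs.clsB.deriv'.deriv'.neg.sub (((h.cls_res' (n := 0) c3).deriv'.of_le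
    (by omega)).const_mul b)).sub (((h.cls_f1 (n := 0) c3).of_le (by omega)).mul'
    (hB.of_le (by omega)) (by norm_num))).sub ((hs.clsA.deriv'.of_le (by omega)).const_mul 2)).add
    (((h.cls_Q1 c3).of_le (by omega)).const_mul a))

theorem M_odd (hs : FirstSol f Q Q1 A B M V a b) (h : Profile f Q Q1) (x : ℝ) : M (-x) = -M x :=
  Profile.odd_of_even_deriv hs.hM hs.M0 (fun x => by rw [hs.evenA, h.even]) x

theorem V_even (hs : FirstSol f Q Q1 A B M V a b) (h : Profile f Q Q1) (x : ℝ) : V (-x) = V x :=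
  Profile.even_of_odd_deriv hs.hV (fun x => by rw [hs.M_odd h, hs.oddB]; ring) x

theorem expBdd_V (hs : FirstSol f Q Q1 A B M V a b) (h : Profile f Q Q1) : ExpBdd 1 V :=
  ExpBdd.of_deriv one_pos hs.hV (hs.cls_BM h).expBdd hs.V_lim
    (Profile.tendsto_bot_of_even (e := 1) (fun x => by simpa using hs.V_even h x) hs.V_lim)

theorem tendsto_B (hs : FirstSol f Q Q1 A B M V a b) (h : Profile f Q Q1) :
    Tendsto B atTop (𝓝 b) := by
  have := (hs.clsB.tendsto_zero one_pos).add (h.res_tendsto.const_mul b)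
  simpa using this

theorem tendsto_M (hs : FirstSol f Q Q1 A B M V a b) (h : Profile f Q Q1) :
    Tendsto M atTop (𝓝 b) := by
  have := ((hs.cls_BM h).tendsto_zero one_pos).add (hs.tendsto_B h)
  simpa using this

/-- Regularity of the first order solutions. -/
theorem cls_A' (hs : FirstSol f Q Q1 A B M V a b) (h : Profile f Q Q1) {n : ℕ}
    (hf : ContDiff ℝ (n + 3 : ℕ) f) : Cls 1 (n + 4) A := by
  have hA := hs.clsA
  refine h.bootstrap hf (m := n + 2) le_rfl (g := fun x => deriv f (Q x) -
    a * (3 * Q x - 2 * f (Q x))) ((h.cls_f1 hf).sub ((h.cls_3Q hf).of_succ.const_mul a))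
    (fun x => hA.hasDerivAt_of (by simp) x)
    (fun x => (hA.deriv'.hasDerivAt_of (by simp) x).congr_deriv ?_) hA.expBdd hA.deriv'.expBdd
  rw [hs.eqA]; ring

theorem cls_M' (hs : FirstSol f Q Q1 A B M V a b) (h : Profile f Q Q1) {n : ℕ}
    (hf : ContDiff ℝ (n + 3 : ℕ) f) : Cls 1 (n + 3) fun x => M x - b * resonance Q x := by
  have hd : ∀ x, HasDerivAt (fun x => M x - b * resonance Q x)
      (A x + a * Q x - b * deriv (resonance Q) x) x :=
    fun x => (hs.hM x).sub (((h.cls_res hf).hasDerivAt x).const_mul b)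
  have hc : Cls 1 (n + 2) fun x => A x + a * Q x - b * deriv (resonance Q) x :=
    (((hs.cls_A' h hf).of_le (by omega)).add (((h.cls_Q hf).of_le (by omega)).const_mul a)).sub
      ((h.cls_res' hf).of_succ.const_mul b)
  have hlim : Tendsto (fun x => M x - b * resonance Q x) atTop (𝓝 0) := by
    simpa using (hs.tendsto_M h).sub (h.res_tendsto.const_mul b)
  exact .of_hasDerivAt hd (ExpBdd.of_deriv one_pos hd hc.expBdd hlim
    (Profile.tendsto_bot_of_even (e := -1)
      (fun x => by rw [hs.M_odd h, h.res_odd]; ring) hlim)) hc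

theorem cls_B' (hs : FirstSol f Q Q1 A B M V a b) (h : Profile f Q Q1) {n : ℕ}
    (hf : ContDiff ℝ (n + 3 : ℕ) f) : Cls 1 (n + 4) fun x => B x - b * resonance Q x := by
  have hB := hs.clsB
  have hA := hs.cls_A' h hf
  have hres := h.cls_res hf
  refine h.bootstrap hf (m := n + 2) le_rfl (g := fun x => (M x - b * resonance Q x) +
    2 * deriv A x - a * Q1 x - b * (-deriv (deriv (resonance Q)) x - deriv f (Q x) * resonance Q x))
    ((((hs.cls_M' h hf).of_succ.add (hA.deriv'.of_succ.const_mul 2)).sub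
      (((h.cls_Q1 hf).of_le (by omega)).const_mul a)).sub ((h.cls_linOp_res hf).const_mul b))
    (fun x => hB.hasDerivAt_of (by simp) x)
    (fun x => (hB.deriv'.hasDerivAt_of (by simp) x).congr_deriv ?_) hB.expBdd hB.deriv'.expBdd
  have hB0 := hs.cls_B h
  have e1 : deriv (fun x => B x - b * resonance Q x) =
      fun x => deriv B x - b * deriv (resonance Q) x := funext fun x =>
    ((hB0.hasDerivAt_of (by simp) x).sub ((hres.hasDerivAt x).const_mul b)).deriv
  rw [e1, show deriv (fun x => deriv B x - b * deriv (resonance Q) x) x = _ from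
    ((hB0.deriv'.hasDerivAt_of (by simp) x).sub
      ((hres.deriv'.hasDerivAt_of (by simp) x).const_mul b)).deriv]
  linear_combination hs.eqB x

theorem isOmegaSolution (hs : FirstSol f Q Q1 A B M V a b) (h : Profile f Q Q1) :
    IsOmegaSolution f Q (F10 f Q) (G10 f Q) A B 0 a b := by
  have c3 := h.contDiff_nat
  have hA := hs.clsA
  have hB := hs.cls_B h
  refine ⟨hs.evenA, hs.oddB, classY_iff.2 fun n hn => ?_, classY_iff.2 fun n hn => ?_,
    fun x => ?_, fun x => ?_⟩
  · simp only [sub_zero]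
    -- The class requires the order `n` of smoothness of `f`. Up to order 3 this is part of
    -- `FirstSol`; above, `f` is smooth enough for the bootstrap.
    rcases le_total n 3 with h3 | h3
    · exact hA.of_le h3
    · obtain ⟨k, rfl⟩ := Nat.exists_eq_add_of_le' h3
      exact (hs.cls_A' h hn).of_succ
  · rcases le_total n 3 with h3 | h3
    · exact hs.clsB.of_le h3
    · obtain ⟨k, rfl⟩ := Nat.exists_eq_add_of_le' h3
      exact (hs.cls_B' h hn).of_succ
  · have e : linOp f Q A = fun x => deriv f (Q x) - a * (3 * Q x - 2 * f (Q x)) := funext fun x => by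
      rw [linOp, hs.eqA]; ring
    have h3Q := (h.cls_3Q (n := 0) c3).hasDerivAt x
    rw [e, show deriv (fun x => deriv f (Q x) - a * (3 * Q x - 2 * f (Q x))) x = _ from
      ((h.hasDerivAt_f1Q x).sub (h3Q.const_mul a)).deriv, F10, (h.hasDerivAt_f1Q x).deriv]
    ring
  · have e : linOp f Q B = fun x => M x + 2 * deriv A x - a * Q1 x := funext fun x => by
      rw [linOp, hs.eqB]; ring
    rw [e, show deriv (fun x => M x + 2 * deriv A x - a * Q1 x) x = _ from
      (((hs.hM x).add ((hA.deriv'.hasDerivAt_of (by simp) x).const_mul 2)).sub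
        ((h.d2 x).const_mul a)).deriv, h.deriv2_Q, G10]
    linear_combination -hs.eqA x

end FirstSol


/-- The nondegeneracy of the soliton, `∂_c ∫ Q_c² ≠ 0` at `c = 1`, in terms of the even solution of
`ℒ u = -(3 Q - 2 f(Q))`. -/
def Nondeg (f Q : ℝ → ℝ) : Prop :=
  ∀ u u' : ℝ → ℝ, (∀ x, u (-x) = u x) → (∀ x, HasDerivAt u (u' x) x) →
    (∀ x, HasDerivAt u' ((1 - deriv f (Q x)) * u x + (3 * Q x - 2 * f (Q x))) x) →
    ExpBdd 1 u → ExpBdd 1 u' →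
    ∫ x in Set.Ioi (0:ℝ), (u x * (3 * Q x - 2 * f (Q x)) + Q x * f (Q x)) ≠ 0

/-! ### Solvability of the first system -/

theorem integral_Ioi_eq_neg {g g' : ℝ → ℝ} (hg : ∀ x, HasDerivAt g (g' x) x)
    (hi : IntegrableOn g' (Set.Ioi 0)) {c : ℝ} (hl : Tendsto g atTop (𝓝 c)) :
    ∫ x in Set.Ioi (0:ℝ), g' x = c - g 0 :=
  integral_Ioi_of_hasDerivAt_of_tendsto (hg 0).continuousAt.continuousWithinAt
    (fun x _ => hg x) hi hl

namespace Profile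

variable {f Q Q1 : ℝ → ℝ}

/-- Solving `(ℒ B)' = k` by an odd function with limits at infinity. -/
theorem solve_res (h : Profile f Q Q1) {K k : ℝ → ℝ} (hK : ∀ x, HasDerivAt K (k x) x)
    (hKo : ∀ x, K (-x) = -K x) (hk : Cls 1 0 k) (horth : ∫ x in Set.Ioi (0:ℝ), Q x * k x = 0) :
    ∃ (b : ℝ) (w w' : ℝ → ℝ), (∀ x, w (-x) = -w x) ∧ (∀ x, HasDerivAt w (w' x) x) ∧
      (∀ x, HasDerivAt w' ((1 - deriv f (Q x)) * w x - (K x - b * (-deriv (deriv (resonance Q)) x +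
        resonance Q x - deriv f (Q x) * resonance Q x))) x) ∧ ExpBdd 1 w ∧ ExpBdd 1 w' ∧
      Cls 1 1 (fun x => K x - b * (-deriv (deriv (resonance Q)) x +
        resonance Q x - deriv f (Q x) * resonance Q x)) ∧ Tendsto K atTop (𝓝 b) := by
  have c3 := h.contDiff_nat
  have hK0 : K 0 = 0 := odd_zero hKo
  set b := ∫ x in Set.Ioi (0:ℝ), k x with hb
  have hlimK : Tendsto K atTop (𝓝 b) := by
    have := intervalIntegral_tendsto_integral_Ioi 0 (hk.integrable one_pos).integrableOn tendsto_id
    refine this.congr fun x => ?_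
    rw [id, intervalIntegral.integral_eq_sub_of_hasDerivAt (fun x _ => hK x)
      (hk.continuous.intervalIntegrable _ _), hK0, sub_zero]
  have hres := h.cls_res c3
  have hL := h.cls_linOp_res (n := 0) c3
  set r := resonance Q with hr
  have hr1 : ∀ x, HasDerivAt r (deriv r x) x := fun x => hres.hasDerivAt_of (by simp) x
  have hr2 : ∀ x, HasDerivAt (deriv r) (deriv (deriv r) x) x :=
    fun x => hres.deriv'.hasDerivAt_of (by simp) x
  have hr0 : r 0 = 0 := h.res_zero
  have hrodd := h.res_odd
  have hr1c : Cls 1 0 (deriv r) := (h.cls_res' (n := 0) c3).of_le (by omega)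
  have hQc : Cls 1 1 Q := (h.cls_Q c3).of_le (by omega)
  -- the source
  set n : ℝ → ℝ := fun x => K x - b * (-deriv (deriv r) x + r x - deriv f (Q x) * r x) with hn
  have hnc : Cls 1 1 n := by
    have hd : ∀ x, HasDerivAt (fun x => K x - b * r x) (k x - b * deriv r x) x :=
      fun x => (hK x).sub ((hr1 x).const_mul b)
    have hc : Cls 1 0 fun x => k x - b * deriv r x := hk.sub (hr1c.const_mul b)
    have hlim : Tendsto (fun x => K x - b * r x) atTop (𝓝 0) := by
      simpa using hlimK.sub (h.res_tendsto.const_mul b)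
    have h1 : Cls 1 1 fun x => K x - b * r x :=
      .of_hasDerivAt hd (ExpBdd.of_deriv one_pos hd hc.expBdd hlim
        (tendsto_bot_of_even (e := -1) (fun x => by rw [hKo, show r (-x) = -r x from hrodd x]; ring) hlim)) hc
    refine (h1.sub ((hL.of_le (by omega)).const_mul b)).congr fun x => ?_
    simp only [hn]; ring
  have hno : ∀ x, n (-x) = -n x := fun x => by
    have h2 := odd_deriv_of_even hr2 (even_deriv_of_odd hr1 hrodd) x
    simp only [hn]
    rw [h2, hKo, show r (-x) = -r x from hrodd x, h.even]; ring
  have hQk : Cls 1 0 fun x => Q x * k x := hQc.of_succ.mul' hk (by norm_num)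
  -- A primitive of `Q'n`: the first two terms integrate `Q'K` by parts, and since `LQ' = 0` the
  -- pairing of `Q'` with `Lφ` is a Wronskian. The hypothesis `∫ Qk = 0` makes it vanish at
  -- infinity.
  set P : ℝ → ℝ := fun x => Q x * K x - prim (fun x => Q x * k x) x
    - b * ((Q x - f (Q x)) * r x - Q1 x * deriv r x) with hP
  have hPd : ∀ x, HasDerivAt P (Q1 x * n x) x := fun x => by
    refine ((((h.d1 x).mul (hK x)).sub (hasDerivAt_prim hQk.continuous x)).sub
      ((((h.hasDerivAt_d2 x).mul (hr1 x)).sub ((h.d2 x).mul (hr2 x))).const_mul b)).congr_deriv ?_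
    simp only [hn]; ring
  have hP0 : P 0 = 0 := by simp only [hP]; rw [hK0, prim_zero, hr0, h.Q1_zero]; ring
  have hPl : Tendsto P atTop (𝓝 0) := by
    have t1 := (hQc.tendsto_zero one_pos).mul hlimK
    have t2 := intervalIntegral_tendsto_integral_Ioi 0 (hQk.integrable one_pos).integrableOn
      tendsto_id
    rw [horth] at t2
    have t3 : Tendsto (fun x => Q x - f (Q x)) atTop (𝓝 (0 - 0)) :=
      (hQc.tendsto_zero one_pos).sub ((h.cls_f (n := 0) c3).tendsto_zero two_pos)
    have t4 := (h.cls_Q1 c3).tendsto_zero one_pos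
    have := (t1.sub t2).sub (((t3.mul h.res_tendsto).sub (t4.mul
      (hr1c.tendsto_zero one_pos))).const_mul b)
    simp only [zero_mul, sub_zero, mul_zero] at this
    exact this
  obtain ⟨w, w', h1, h2, h3, h4, h5⟩ :=
    h.solve_odd hnc.continuous hnc.expBdd hno hPd hP0 hPl
  exact ⟨b, w, w', h1, h2, h3, h4, h5, hnc, hlimK⟩

/-- The even solution of `ℒ u = -(3 Q - 2 f(Q))`. -/
theorem exists_hom (h : Profile f Q Q1) (hD : Nondeg f Q) :
    ∃ u u' : ℝ → ℝ, (∀ x, u (-x) = u x) ∧ (∀ x, HasDerivAt u (u' x) x) ∧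
      (∀ x, HasDerivAt u' ((1 - deriv f (Q x)) * u x + (3 * Q x - 2 * f (Q x))) x) ∧
      ExpBdd 1 u ∧ ExpBdd 1 u' ∧ ∫ x in Set.Ioi (0:ℝ), Q x * (u x + 2 * ((1 - deriv f (Q x)) * u x
        + (3 * Q x - 2 * f (Q x))) + f (Q x)) ≠ 0 := by
  have c3 := h.contDiff_nat
  have h3 := h.cls_3Q (n := 0) c3
  obtain ⟨u, u', h1, h2, h3', h4, h5⟩ := h.solve_even (n := fun x => -(3 * Q x - 2 * f (Q x)))
    h3.neg.continuous h3.neg.expBdd (fun x => by rw [h.even])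
  have h3'' : ∀ x, HasDerivAt u' ((1 - deriv f (Q x)) * u x + (3 * Q x - 2 * f (Q x))) x :=
    fun x => (h3' x).congr_deriv (by ring)
  refine ⟨u, u', h1, h2, h3'', h4, h5, ?_⟩
  have hne := hD u u' h1 h2 h3'' h4 h5
  have huc : Cls 1 2 u := h.bootstrap (n := 0) c3 (m := 0) (by omega) (h3.neg.of_le (by omega))
    h2 h3' h4 h5
  have hQc : Cls 1 0 Q := (h.cls_Q c3).of_le (by omega)
  have hfc : Cls 1 0 fun x => f (Q x) :=
    ((h.cls_f (n := 0) c3).mono (by norm_num)).of_le (by omega)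
  have hf1 : Cls 0 0 fun x => 1 - deriv f (Q x) :=
    (Cls.const 1).sub (((h.cls_f1 (n := 0) c3).mono zero_le_one).of_le (by omega))
  -- Green's formula: the two integrands differ by `2(Qu'' - Q''u)`, the derivative of a function
  -- that vanishes at the origin and at infinity. Hence the coefficient of `a` in the solvability
  -- condition is the integral of `Nondeg`.
  have hd : ∀ x, HasDerivAt (fun x => 2 * (Q x * u' x - Q1 x * u x))
      (Q x * (u x + 2 * ((1 - deriv f (Q x)) * u x + (3 * Q x - 2 * f (Q x))) + f (Q x))
        - (u x * (3 * Q x - 2 * f (Q x)) + Q x * f (Q x))) x := fun x => by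
    refine ((((h.d1 x).mul (h3'' x)).sub ((h.d2 x).mul (h2 x))).const_mul 2).congr_deriv ?_
    ring
  have hu0 := huc.of_le (Nat.zero_le _)
  have i1 : Cls 1 0 fun x => Q x * (u x + 2 * ((1 - deriv f (Q x)) * u x +
      (3 * Q x - 2 * f (Q x))) + f (Q x)) :=
    hQc.mul' (((hu0).add (((hf1.mul' hu0 (by norm_num)).add
      (h3.of_le (by omega))).const_mul 2)).add hfc) (by norm_num)
  have i2 : Cls 1 0 fun x => u x * (3 * Q x - 2 * f (Q x)) + Q x * f (Q x) :=
    (hu0.mul' (h3.of_le (by omega)) (by norm_num)).add (hQc.mul' hfc (by norm_num))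
  have hlim : Tendsto (fun x => 2 * (Q x * u' x - Q1 x * u x)) atTop (𝓝 0) := by
    have := ((((hQc.tendsto_zero one_pos).mul (h5.tendsto_zero one_pos)).sub
      (((h.cls_Q1 c3).tendsto_zero one_pos).mul (h4.tendsto_zero one_pos))).const_mul 2)
    simpa using this
  have key := integral_Ioi_eq_neg hd ((i1.integrable one_pos).sub (i2.integrable one_pos)).integrableOn
    hlim
  have hu'0 : u' 0 = 0 := odd_zero (odd_deriv_of_even h2 h1)
  rw [integral_sub (i1.integrable one_pos).integrableOn (i2.integrable one_pos).integrableOn,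
    hu'0, h.Q1_zero] at key
  intro h0
  rw [h0] at key
  apply hne
  linarith

end Profile

variable {f Q Q1 : ℝ → ℝ}

theorem exists_firstSol (h : Profile f Q Q1) (hD : Nondeg f Q) :
    ∃ (A B M V : ℝ → ℝ) (a b : ℝ), FirstSol f Q Q1 A B M V a b ∧ ∫ x, deriv Q x * B x = 0 := by
  have c3 := h.contDiff_nat
  have h3 := h.cls_3Q (n := 0) c3
  have hf1 := h.cls_f1 (n := 0) c3
  obtain ⟨u, u', u1, u2, u3, u4, u5, u6⟩ := h.exists_hom hD
  obtain ⟨v, v', v1, v2, v3, v4, v5⟩ := h.solve_even (n := fun x => deriv f (Q x))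
    hf1.continuous hf1.expBdd (fun x => by rw [h.even])
  have hQc : Cls 1 0 Q := (h.cls_Q c3).of_le (by omega)
  have hfc : Cls 1 0 fun x => f (Q x) :=
    ((h.cls_f (n := 0) c3).mono (by norm_num)).of_le (by omega)
  have hf1c : Cls 0 0 fun x => 1 - deriv f (Q x) :=
    (Cls.const 1).sub ((hf1.mono zero_le_one).of_le (by omega))
  have huc : Cls 1 0 u := ⟨continuous_iff_continuousAt.2 fun x => (u2 x).continuousAt, u4⟩
  have hvc : Cls 1 0 v := ⟨continuous_iff_continuousAt.2 fun x => (v2 x).continuousAt, v4⟩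
  set D := ∫ x in Set.Ioi (0:ℝ), Q x * (u x + 2 * ((1 - deriv f (Q x)) * u x
        + (3 * Q x - 2 * f (Q x))) + f (Q x)) with hDdef
  have iD : Cls 1 0 fun x => Q x * (u x + 2 * ((1 - deriv f (Q x)) * u x
        + (3 * Q x - 2 * f (Q x))) + f (Q x)) :=
    hQc.mul' (((huc).add (((hf1c.mul' huc (by norm_num)).add
      (h3.of_le (by omega))).const_mul 2)).add hfc) (by norm_num)
  have iE : Cls 1 0 fun x => Q x * (v x + 2 * ((1 - deriv f (Q x)) * v x - deriv f (Q x))) :=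
    hQc.mul' (hvc.add (((hf1c.mul' hvc (by norm_num)).sub
      (hf1.of_le (by omega))).const_mul 2)) (by norm_num)
  set E := ∫ x in Set.Ioi (0:ℝ), Q x * (v x + 2 * ((1 - deriv f (Q x)) * v x - deriv f (Q x)))
    with hE
  -- With `A = v + au`, the solvability condition `∫ Qk = 0` of the equation for `B` is the affine
  -- equation `E + aD = 0`.
  set a : ℝ := -(E / D) with ha
  set A : ℝ → ℝ := fun x => v x + a * u x with hA
  set A' : ℝ → ℝ := fun x => v' x + a * u' x with hA'
  have hA1 : ∀ x, HasDerivAt A (A' x) x := fun x => (v2 x).add ((u2 x).const_mul a)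
  have hA2 : ∀ x, HasDerivAt A' ((1 - deriv f (Q x)) * A x -
      (deriv f (Q x) - a * (3 * Q x - 2 * f (Q x)))) x := fun x => by
    refine ((v3 x).add ((u3 x).const_mul a)).congr_deriv ?_
    simp only [hA]; ring
  have hAe : ∀ x, A (-x) = A x := fun x => by simp only [hA]; rw [v1, u1]
  have hAb : ExpBdd 1 A := v4.add (u4.const_mul a)
  have hA'b : ExpBdd 1 A' := v5.add (u5.const_mul a)
  have hAc : Cls 1 3 A := h.bootstrap (n := 0) c3 (m := 1) (by omega)
    (((hf1.of_le (by omega)).sub ((h3.of_le (by omega)).const_mul a))) hA1 hA2 hAb hA'b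
  have hdA : deriv A = A' := funext fun x => (hA1 x).deriv
  have hdA' : ∀ x, deriv A' x = _ := fun x => (hA2 x).deriv
  have hAQ : Cls 1 0 fun x => A x + a * Q x := (hAc.of_le (by omega)).add (hQc.const_mul a)
  set M := prim fun x => A x + a * Q x with hM
  have hMd : ∀ x, HasDerivAt M (A x + a * Q x) x := fun x => hasDerivAt_prim hAQ.continuous x
  have hM0 : M 0 = 0 := prim_zero _
  set K : ℝ → ℝ := fun x => M x + 2 * A' x - a * Q1 x with hK
  set k : ℝ → ℝ := fun x => A x + 2 * ((1 - deriv f (Q x)) * A x -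
      (deriv f (Q x) - a * (3 * Q x - 2 * f (Q x)))) + a * f (Q x) with hk
  have hKd : ∀ x, HasDerivAt K (k x) x := fun x => by
    refine (((hMd x).add ((hA2 x).const_mul 2)).sub ((h.d2 x).const_mul a)).congr_deriv ?_
    simp only [hk]; ring
  have hA'o := odd_deriv_of_even hA1 hAe
  have hMo := Profile.odd_of_even_deriv hMd hM0 (fun x => by rw [hAe, h.even])
  have hA0 : Cls 1 0 A := hAc.of_le (by omega)
  have hkc : Cls 1 0 k := (hA0.add (((hf1c.mul' hA0 (by norm_num)).sub
    ((hf1.of_le (by omega)).sub ((h3.of_le (by omega)).const_mul a))).const_mul 2)).add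
      (hfc.const_mul a)
  have horth : ∫ x in Set.Ioi (0:ℝ), Q x * k x = 0 := by
    have e : ∀ x, Q x * k x = Q x * (v x + 2 * ((1 - deriv f (Q x)) * v x - deriv f (Q x))) +
        a * (Q x * (u x + 2 * ((1 - deriv f (Q x)) * u x
        + (3 * Q x - 2 * f (Q x))) + f (Q x))) := fun x => by simp only [hk, hA]; ring
    simp_rw [e]
    rw [integral_add (iE.integrable one_pos).integrableOn
      ((iD.integrable one_pos).const_mul a).integrableOn, integral_const_mul, ← hE, ← hDdef, ha]
    field_simp
    ring
  obtain ⟨b, w, w', w1, w2, w3, w4, w5, w6, -⟩ := h.solve_res hKd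
    (fun x => by simp only [hK]; rw [hMo, hA'o, h.odd1]; ring) hkc horth
  have hres := h.cls_res c3
  set r := resonance Q with hr
  have hr1 : ∀ x, HasDerivAt r (deriv r x) x := fun x => hres.hasDerivAt_of (by simp) x
  have hr2 : ∀ x, HasDerivAt (deriv r) (deriv (deriv r) x) x :=
    fun x => hres.deriv'.hasDerivAt_of (by simp) x
  -- normalization
  have hQ1c : Cls 1 4 Q1 := h.cls_Q1 c3
  have hwc0 : Cls 1 0 w := ⟨continuous_iff_continuousAt.2 fun x => (w2 x).continuousAt, w4⟩
  have hBc0 : Cls 0 0 fun x => w x + b * r x :=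
    (hwc0.mono zero_le_one).add ((hres.of_le (by omega)).const_mul b)
  have i1 : Integrable fun x => Q1 x * (w x + b * r x) :=
    (((hQ1c.of_le (by omega) : Cls 1 0 Q1).mul' hBc0 (by norm_num) :
      Cls 1 0 fun x => Q1 x * (w x + b * r x))).integrable one_pos
  have i2 : Integrable fun x => Q1 x * Q1 x :=
    (((hQ1c.of_le (by omega) : Cls 1 0 Q1).mul' (hQ1c.of_le (by omega) : Cls 1 0 Q1) (by norm_num) :
      Cls 1 0 fun x => Q1 x * Q1 x)).integrable one_pos
  have hpos : 0 < ∫ x, Q1 x * Q1 x :=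
    integral_pos_of_integrable_nonneg_nonzero (x := 1) (h.continuous_Q1.mul h.continuous_Q1) i2
      (fun x => mul_self_nonneg _) (mul_self_ne_zero.2 (h.Q1_ne one_ne_zero))
  -- The odd kernel element `Q'` is available to normalize `∫ Q'B = 0`.
  set c : ℝ := -((∫ x, Q1 x * (w x + b * r x)) / ∫ x, Q1 x * Q1 x) with hc
  set B : ℝ → ℝ := fun x => w x + b * r x + c * Q1 x with hB
  have hB1 : ∀ x, HasDerivAt B (w' x + b * deriv r x + c * (Q x - f (Q x))) x := fun x =>
    ((w2 x).add ((hr1 x).const_mul b)).add ((h.d2 x).const_mul c)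
  have hB2 : ∀ x, HasDerivAt (fun x => w' x + b * deriv r x + c * (Q x - f (Q x)))
      (B x - deriv f (Q x) * B x - K x) x := fun x => by
    refine (((w3 x).add ((hr2 x).const_mul b)).add ((h.hasDerivAt_d2 x).const_mul c)).congr_deriv ?_
    simp only [hB]; ring
  have hnorm : ∫ x, Q1 x * B x = 0 := by
    have e : ∀ x, Q1 x * B x = Q1 x * (w x + b * r x) + c * (Q1 x * Q1 x) := fun x => by
      simp only [hB]; ring
    simp_rw [e]
    rw [integral_add i1 (i2.const_mul c), integral_const_mul, hc,
      neg_mul, div_mul_cancel₀ _ hpos.ne', add_neg_cancel]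
  have hwc : Cls 1 3 w := h.bootstrap (n := 0) c3 (m := 1) (by omega) w6 w2 w3 w4 w5
  have hBw : Cls 1 3 fun x => B x - b * r x :=
    (hwc.add ((hQ1c.of_le (by omega)).const_mul c)).congr fun x => by simp only [hB]; ring
  have hL := h.cls_linOp_res (n := 0) c3
  have hA'c : Cls 1 2 A' := by rw [← hdA]; exact hAc.deriv'
  have hMB : Cls 1 0 fun x => M x - B x := by
    have : Cls 1 0 fun x => (K x - b * (-deriv (deriv r) x + r x - deriv f (Q x) * r x))
        - 2 * A' x + a * Q1 x + b * (-deriv (deriv r) x - deriv f (Q x) * r x)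
        - (B x - b * r x) :=
      (((((w6.of_le (by omega)).sub ((hA'c.of_le (by omega)).const_mul 2)).add
        ((hQ1c.of_le (by omega)).const_mul a)).add ((hL.of_le (by omega)).const_mul b)).sub
        (hBw.of_le (by omega)))
    refine this.congr fun x => ?_
    simp only [hK]; ring
  refine ⟨A, B, M, fun x => prim (fun x => M x - B x) x - ∫ x in Set.Ioi (0:ℝ), (M x - B x), a, b,
    ⟨hAe, fun x => ?_, hAc, hBw, fun x => ?_, fun x => ?_, hMd, hM0,
      fun x => (hasDerivAt_prim hMB.continuous x).sub_const _, ?_⟩, by rw [h.deriv_Q]; exact hnorm⟩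
  · simp only [hB]
    rw [w1, show r (-x) = -r x from h.res_odd x, h.odd1]; ring
  · rw [hdA, hdA']; ring
  · rw [show deriv B = _ from funext fun x => (hB1 x).deriv, (hB2 x).deriv, hdA]
  · have := (intervalIntegral_tendsto_integral_Ioi 0
      (hMB.integrable one_pos).integrableOn tendsto_id).sub_const
      (∫ x in Set.Ioi (0:ℝ), (M x - B x))
    rwa [sub_self] at this


/-! ### The second linear system -/

/-- The antiderivative of `F_{2,0}` vanishing at infinity. -/
noncomputable def Phi (f Q A B V : ℝ → ℝ) (a : ℝ) (x : ℝ) : ℝ :=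
  1 / 2 * deriv (deriv f) (Q x) * (1 + A x) ^ 2 - 1 - A x - 2 * deriv B x + V x
    - a * (2 * deriv (deriv A) x + A x) - a ^ 2 * f (Q x)

/-- `G_{2,0} - Φ`. -/
noncomputable def GPhi (f Q Q1 A B V : ℝ → ℝ) (a : ℝ) (x : ℝ) : ℝ :=
  -deriv B x - V x + 3 / 2 * a * (A x - deriv (deriv A) x) + 3 / 2 * a ^ 2 * Q x
    - a * deriv (deriv (deriv B)) x - 1 / 2 * a * deriv B x
    + 1 / 2 * (deriv (deriv (deriv f)) (Q x) * Q1 x * ((1 + A x) * B x)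
      + deriv (deriv f) (Q x) * (deriv A x * B x + (1 + A x) * deriv B x))

/-- Integrated form of the system `(Ω_{2,0})`. -/
structure SecondSol (f Q Q1 A B V A₂ B₂ : ℝ → ℝ) (a γ a₂ b₂ : ℝ) : Prop where
  evenA : ∀ x, A₂ (-x) = A₂ x
  oddB : ∀ x, B₂ (-x) = -B₂ x
  clsA : Cls 1 3 (fun x => A₂ x - γ)
  clsB : Cls 1 3 (fun x => B₂ x - b₂ * resonance Q x)
  eqA : ∀ x, deriv (deriv A₂) x = A₂ x - deriv f (Q x) * A₂ x
    - (γ + Phi f Q A B V a x - a₂ * (3 * Q x - 2 * f (Q x)))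
  eqB : ∀ x, HasDerivAt (linOp f Q B₂) (GPhi f Q Q1 A B V a x + 2 * deriv (deriv A₂) x
    + (A₂ x - γ) + a₂ * f (Q x)) x

variable {f Q Q1 A B M V A₂ B₂ : ℝ → ℝ} {a b γ a₂ b₂ : ℝ}

namespace FirstSol

theorem dA (hs : FirstSol f Q Q1 A B M V a b) (x : ℝ) : HasDerivAt A (deriv A x) x :=
  hs.clsA.hasDerivAt_of (by simp) x

theorem dA1 (hs : FirstSol f Q Q1 A B M V a b) (x : ℝ) :
    HasDerivAt (deriv A) (deriv (deriv A) x) x :=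
  hs.clsA.deriv'.hasDerivAt_of (by simp) x

theorem dA2 (hs : FirstSol f Q Q1 A B M V a b) (x : ℝ) :
    HasDerivAt (deriv (deriv A)) (deriv (deriv (deriv A)) x) x :=
  hs.clsA.deriv'.deriv'.hasDerivAt_of (by simp) x

theorem dB (hs : FirstSol f Q Q1 A B M V a b) (h : Profile f Q Q1) (x : ℝ) :
    HasDerivAt B (deriv B x) x := (hs.cls_B h).hasDerivAt_of (by simp) x

theorem dB1 (hs : FirstSol f Q Q1 A B M V a b) (h : Profile f Q Q1) (x : ℝ) :
    HasDerivAt (deriv B) (deriv (deriv B) x) x :=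
  (hs.cls_B h).deriv'.hasDerivAt_of (by simp) x

theorem dB2 (hs : FirstSol f Q Q1 A B M V a b) (h : Profile f Q Q1) (x : ℝ) :
    HasDerivAt (deriv (deriv B)) (deriv (deriv (deriv B)) x) x :=
  (hs.cls_B h).deriv'.deriv'.hasDerivAt_of (by simp) x

theorem eqA3 (hs : FirstSol f Q Q1 A B M V a b) (h : Profile f Q Q1) (x : ℝ) :
    deriv (deriv (deriv A)) x = deriv A x - (deriv (deriv f) (Q x) * Q1 x * A x
      + deriv f (Q x) * deriv A x) - (deriv (deriv f) (Q x) * Q1 x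
      - a * (3 * Q1 x - 2 * (deriv f (Q x) * Q1 x))) := by
  have : deriv (deriv A) = fun x => A x - deriv f (Q x) * A x
    - (deriv f (Q x) - a * (3 * Q x - 2 * f (Q x))) := funext hs.eqA
  refine (hs.dA2 x).unique ?_
  rw [this]
  exact ((hs.dA x).sub ((h.hasDerivAt_f1Q x).mul (hs.dA x))).sub ((h.hasDerivAt_f1Q x).sub
    ((((h.d1 x).const_mul 3).sub ((h.hasDerivAt_fQ x).const_mul 2)).const_mul a))

theorem eqB3 (hs : FirstSol f Q Q1 A B M V a b) (h : Profile f Q Q1) (x : ℝ) :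
    deriv (deriv (deriv B)) x = deriv B x - (deriv (deriv f) (Q x) * Q1 x * B x
      + deriv f (Q x) * deriv B x) - (A x + a * Q x + 2 * deriv (deriv A) x
      - a * (Q x - f (Q x))) := by
  have : deriv (deriv B) = fun x => B x - deriv f (Q x) * B x
    - (M x + 2 * deriv A x - a * Q1 x) := funext hs.eqB
  refine (hs.dB2 h x).unique ?_
  rw [this]
  exact ((hs.dB h x).sub ((h.hasDerivAt_f1Q x).mul (hs.dB h x))).sub
    (((hs.hM x).add ((hs.dA1 x).const_mul 2)).sub ((h.d2 x).const_mul a))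

/-- The only part of the source that is not visibly a derivative is `-f'(Q)B`. The equation for `B`
turns `f'(Q)B` into `B - B'' - M - 2A' + aQ'`, where `M - B = V'`. The remaining third derivative of
`A` is removed with `eqA3`. -/
theorem hasDerivAt_Phi (hs : FirstSol f Q Q1 A B M V a b) (h : Profile f Q Q1) (x : ℝ) :
    HasDerivAt (Phi f Q A B V a) (F20 f Q A B a x) x := by
  have e1 : deriv (fun y => deriv (deriv f) (Q y) * (2 * A y + A y ^ 2)) x = _ :=
    ((h.hasDerivAt_f2Q x).mul (((hs.dA x).const_mul 2).add ((hs.dA x).fun_pow 2))).deriv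
  have e2 : deriv (fun y => 3 * deriv (deriv A) y - Q y + deriv f (Q y) * (1 + A y)) x = _ :=
    ((((hs.dA2 x).const_mul 3).sub (h.d1 x)).add
      ((h.hasDerivAt_f1Q x).mul ((hs.dA x).const_add 1))).deriv
  have e3 : deriv (deriv (deriv Q)) x = (1 - deriv f (Q x)) * Q1 x := by
    rw [h.deriv2_Q]; exact (h.hasDerivAt_d2 x).deriv
  have e4 : deriv (fun y => deriv (deriv f) (Q y) - 2) x = _ :=
    ((h.hasDerivAt_f2Q x).sub_const 2).deriv
  refine ((((((((h.hasDerivAt_f2Q x).const_mul (1 / 2)).mul (((hs.dA x).const_add 1).fun_pow 2)).sub_const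
    1).sub (hs.dA x)).sub ((hs.dB1 h x).const_mul 2)).add (hs.hV x)).sub ((((hs.dA2 x).const_mul
      2).add (hs.dA x)).const_mul a)).sub ((h.hasDerivAt_fQ x).const_mul (a ^ 2)) |>.congr_deriv ?_
  rw [F20, e1, e2, e3, e4]
  simp only [Nat.cast_ofNat, Nat.add_one_sub_one, pow_one, Pi.add_apply]
  linear_combination hs.eqB x + a * hs.eqA3 h x

theorem G20_eq (hs : FirstSol f Q Q1 A B M V a b) (h : Profile f Q Q1) (x : ℝ) :
    G20 f Q A B a x = GPhi f Q Q1 A B V a x + Phi f Q A B V a x := by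
  have e1 : deriv (fun y => 9 * deriv A y + 3 * deriv (deriv B) y + deriv f (Q y) * B y) x = _ :=
    ((((hs.dA1 x).const_mul 9).add ((hs.dB2 h x).const_mul 3)).add
      ((h.hasDerivAt_f1Q x).mul (hs.dB h x))).deriv
  have e2 : deriv (fun y => deriv (deriv f) (Q y) * (B y + A y * B y)) x = _ :=
    ((h.hasDerivAt_f2Q x).mul ((hs.dB h x).add ((hs.dA x).mul (hs.dB h x)))).deriv
  rw [G20, e1, e2, h.deriv2_Q, GPhi, Phi]
  simp only [Pi.add_apply, Pi.mul_apply]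
  linear_combination (-a / 2) * hs.eqB3 h x

theorem cls_T (hs : FirstSol f Q Q1 A B M V a b) (h : Profile f Q Q1) {n : ℕ}
    (hf : ContDiff ℝ (n + 3 : ℕ) f) : Cls 0 (n + 4) fun x => 1 + A x :=
  (Cls.const 1).add ((hs.cls_A' h hf).mono zero_le_one)

theorem cls_V (hs : FirstSol f Q Q1 A B M V a b) (h : Profile f Q Q1) {n : ℕ}
    (hf : ContDiff ℝ (n + 3 : ℕ) f) : Cls 1 (n + 4) V :=
  .of_hasDerivAt hs.hV (hs.expBdd_V h) (((hs.cls_M' h hf).sub ((hs.cls_B' h hf).of_succ)).congr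
    fun x => by ring)

theorem cls_dB (hs : FirstSol f Q Q1 A B M V a b) (h : Profile f Q Q1) {n : ℕ}
    (hf : ContDiff ℝ (n + 3 : ℕ) f) : Cls 1 (n + 3) (deriv B) := by
  have h1 := (hs.cls_B' h hf).deriv'
  have h2 := (h.cls_res' hf).const_mul b
  refine (h1.add h2).congr fun x => ?_
  rw [show deriv (fun x => B x - b * resonance Q x) x = _ from
    ((hs.dB h x).sub (((h.cls_res hf).hasDerivAt x).const_mul b)).deriv]
  ring

theorem cls_Phi (hs : FirstSol f Q Q1 A B M V a b) (h : Profile f Q Q1) {n : ℕ}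
    (hf : ContDiff ℝ (n + 3 : ℕ) f) : Cls 1 (n + 1) (Phi f Q A B V a) := by
  have hT := (hs.cls_T h hf).of_le (show n + 1 ≤ n + 4 by omega)
  have hA := hs.cls_A' h hf
  have hA' := hA.of_le (show n + 1 ≤ n + 4 by omega)
  have h1 : Cls 1 (n + 1) fun x => (deriv (deriv f) (Q x) - 2) * ((1 + A x) * (1 + A x)) :=
    (h.cls_f2 hf).mul' (hT.mul hT) (by norm_num)
  have h2 : Cls 1 (n + 1) fun x => A x * A x := hA'.mul' hA' (by norm_num)
  have h3 := ((h.cls_f hf).mono (by norm_num : (1:ℝ) ≤ 2)).of_le (show n + 1 ≤ n + 3 by omega)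
  refine (((((((h1.const_mul (1 / 2)).add h2).add hA').sub (((hs.cls_dB h hf).of_le
    (by omega)).const_mul 2)).add ((hs.cls_V h hf).of_le (by omega))).sub
    (((((hA.deriv'.deriv'.of_le (by omega)).const_mul 2)).add hA').const_mul a)).sub
    (h3.const_mul (a ^ 2))).congr fun x => ?_
  rw [Phi]; ring

theorem cls_GPhi (hs : FirstSol f Q Q1 A B M V a b) (h : Profile f Q Q1) {n : ℕ}
    (hf : ContDiff ℝ (n + 3 : ℕ) f) : Cls 1 n (GPhi f Q Q1 A B V a) := by
  have hT := (hs.cls_T h hf).of_le (show n ≤ n + 4 by omega)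
  have hA := hs.cls_A' h hf
  have hA' := hA.of_le (show n ≤ n + 4 by omega)
  have hB1 := hs.cls_dB h hf
  have hB1' := hB1.of_le (show n ≤ n + 3 by omega)
  have hf2 : Cls 0 n fun x => deriv (deriv f) (Q x) := (h.cls_f2' hf).of_succ
  have hf3 : Cls 1 n fun x => deriv (deriv (deriv f)) (Q x) * Q1 x :=
    (h.cls_f2' hf).deriv'.mono le_rfl |> fun _ => by
      have := (h.cls_f2 hf).deriv'
      refine this.congr fun x => ?_
      rw [((h.hasDerivAt_f2Q x).sub_const 2).deriv]
  have hB : Cls 0 n B := h.cls_B (hf.of_le (by exact_mod_cast (by omega : n ≤ n + 3)))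
    ((hs.cls_B' h hf).of_le (by omega))
  have hQ := (h.cls_Q hf).of_le (show n ≤ n + 3 + 2 by omega)
  have k1 : Cls 1 n fun x => deriv (deriv (deriv f)) (Q x) * Q1 x * ((1 + A x) * B x) :=
    hf3.mul' (hT.mul hB) (by norm_num)
  have k2 : Cls 1 n fun x => deriv A x * B x :=
    (hA.deriv'.of_le (by omega) : Cls 1 n _).mul' hB (by norm_num)
  have k3 : Cls 1 n fun x => (1 + A x) * deriv B x := hT.mul' hB1' (by norm_num)
  have k4 : Cls 1 n fun x => deriv (deriv f) (Q x) * (deriv A x * B x + (1 + A x) * deriv B x) :=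
    hf2.mul' (k2.add k3) (by norm_num)
  exact ((((((hB1'.neg.sub ((hs.cls_V h hf).of_le (by omega))).add ((hA'.sub
    (hA.deriv'.deriv'.of_le (by omega))).const_mul (3 / 2 * a))).add (hQ.const_mul
    (3 / 2 * a ^ 2))).sub ((hB1.deriv'.deriv'.of_le (by omega)).const_mul a)).sub
    (hB1'.const_mul (1 / 2 * a))).add ((k1.add k4).const_mul (1 / 2)))

theorem A1_odd (hs : FirstSol f Q Q1 A B M V a b) (x : ℝ) : deriv A (-x) = -deriv A x :=
  odd_deriv_of_even hs.dA hs.evenA x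

theorem Phi_even (hs : FirstSol f Q Q1 A B M V a b) (h : Profile f Q Q1) (x : ℝ) :
    Phi f Q A B V a (-x) = Phi f Q A B V a x := by
  simp only [Phi]
  rw [h.even, hs.evenA, hs.V_even h, even_deriv_of_odd (hs.dB h) hs.oddB,
    even_deriv_of_odd hs.dA1 hs.A1_odd]

theorem GPhi_even (hs : FirstSol f Q Q1 A B M V a b) (h : Profile f Q Q1) (x : ℝ) :
    GPhi f Q Q1 A B V a (-x) = GPhi f Q Q1 A B V a x := by
  have hB1 := even_deriv_of_odd (hs.dB h) hs.oddB
  have hB2 := odd_deriv_of_even (hs.dB1 h) hB1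
  simp only [GPhi]
  rw [h.even, hs.evenA, hs.V_even h, hB1, even_deriv_of_odd hs.dA1 hs.A1_odd,
    even_deriv_of_odd (hs.dB2 h) hB2, h.odd1, hs.oddB, hs.A1_odd]
  ring

end FirstSol

theorem SecondSol.of_isOmegaSolution (h : Profile f Q Q1) (hs : FirstSol f Q Q1 A B M V a b)
    (ho : IsOmegaSolution f Q (F20 f Q A B a) (G20 f Q A B a) A₂ B₂ γ a₂ b₂) :
    SecondSol f Q Q1 A B V A₂ B₂ a γ a₂ b₂ := by
  have c3 := h.contDiff_nat
  have hA : Cls 1 3 fun x => A₂ x - γ := classY_iff.1 ho.classY_A 3 c3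
  have hBw : Cls 1 3 fun x => B₂ x - b₂ * resonance Q x := classY_iff.1 ho.classY_B 3 c3
  have hB : Cls 0 3 B₂ := h.cls_B c3 hBw
  have h3Q := h.cls_3Q (n := 0) c3
  have hf1 := h.cls_f1 (n := 0) c3
  have hA0 : Cls 0 3 A₂ := ((hA.mono zero_le_one).add (.const γ)).congr fun x => by ring
  have e1 : deriv (fun x => A₂ x - γ) = deriv A₂ := funext fun x => deriv_sub_const γ
  have hA1 : Cls 1 2 (deriv A₂) := by rw [← e1]; exact hA.deriv'
  have hlin : Cls 0 1 (linOp f Q A₂) :=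
    (((hA1.deriv'.mono zero_le_one).neg.add (hA0.of_le (by omega))).sub
      ((hf1.of_le (by omega)).mul' (hA0.of_le (by omega)) (by norm_num)))
  have hd : ∀ x, HasDerivAt (linOp f Q A₂) (deriv (linOp f Q A₂) x) x := fun x => hlin.hasDerivAt x
  have hlinlim : Tendsto (linOp f Q A₂) atTop (𝓝 γ) := by
    have t1 := hA1.deriv'.tendsto_zero one_pos
    have t2 := (hA.tendsto_zero one_pos).add_const γ
    have t3 := ((hf1.of_le (by omega : 0 ≤ 0 + 2)).mul' (hA0.of_le (Nat.zero_le _))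
      (by norm_num) : Cls 1 0 fun x => deriv f (Q x) * A₂ x).tendsto_zero one_pos
    have := (t1.neg.add t2).sub t3
    simp only [neg_zero, zero_add, sub_zero, sub_add_cancel] at this
    exact this
  have eqA : ∀ x, linOp f Q A₂ x = γ + Phi f Q A B V a x - a₂ * (3 * Q x - 2 * f (Q x)) := by
    refine eq_of_hasDerivAt_eq_of_tendsto hd (fun x => ?_) hlinlim (c := γ) ?_
    · refine (((hs.hasDerivAt_Phi h x).const_add γ).sub
        ((h3Q.hasDerivAt x).const_mul a₂)).congr_deriv ?_
      linear_combination -ho.eqA x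
    · have := (((hs.cls_Phi (n := 0) h c3).tendsto_zero one_pos).const_add γ).sub
        ((h3Q.tendsto_zero one_pos).const_mul a₂)
      simpa using this
  have hA2 : ∀ x, deriv (deriv A₂) x = A₂ x - deriv f (Q x) * A₂ x
      - (γ + Phi f Q A B V a x - a₂ * (3 * Q x - 2 * f (Q x))) := fun x => by
    have := eqA x
    rw [linOp] at this
    linarith
  have hlinB : Cls 0 1 (linOp f Q B₂) :=
    ((hB.deriv'.deriv'.neg.add (hB.of_le (by omega))).sub
      ((hf1.of_le (by omega)).mul' (hB.of_le (by omega)) (by norm_num)))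
  refine ⟨ho.even, ho.odd, hA, hBw, hA2, fun x => (hlinB.hasDerivAt x).congr_deriv ?_⟩
  have := ho.eqB x
  rw [hs.G20_eq h, h.deriv2_Q] at this
  linear_combination this + hA2 x

theorem SecondSol.isOmegaSolution (h : Profile f Q Q1) (hs : FirstSol f Q Q1 A B M V a b)
    (ho : SecondSol f Q Q1 A B V A₂ B₂ a γ a₂ b₂) :
    IsOmegaSolution f Q (F20 f Q A B a) (G20 f Q A B a) A₂ B₂ γ a₂ b₂ := by
  have c3 := h.contDiff_nat
  have hA := ho.clsA
  have hB := ho.clsB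
  have hB0 : Cls 0 3 B₂ := h.cls_B c3 hB
  have e1 : deriv (fun x => A₂ x - γ) = deriv A₂ := funext fun x => deriv_sub_const γ
  have hA1 : Cls 1 2 (deriv A₂) := by rw [← e1]; exact hA.deriv'
  have hA' : ∀ {k : ℕ}, ContDiff ℝ (k + 3 : ℕ) f → Cls 1 (k + 3) fun x => A₂ x - γ := by
    intro k hk
    refine h.bootstrap hk (m := k + 1) (by omega) (g := fun x => Phi f Q A B V a x
      + γ * deriv f (Q x) - a₂ * (3 * Q x - 2 * f (Q x)))
      (((hs.cls_Phi h hk).add (((h.cls_f1 hk).of_le (by omega)).const_mul γ)).sub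
        (((h.cls_3Q hk).of_le (by omega)).const_mul a₂))
      (fun x => hA.hasDerivAt_of (by simp) x)
      (fun x => (hA.deriv'.hasDerivAt_of (by simp) x).congr_deriv ?_) hA.expBdd hA.deriv'.expBdd
    rw [e1, ho.eqA]; ring
  refine ⟨ho.evenA, ho.oddB, classY_iff.2 fun n hn => ?_, classY_iff.2 fun n hn => ?_,
    fun x => ?_, fun x => ?_⟩
  · rcases le_total n 3 with h3 | h3
    · exact hA.of_le h3
    · obtain ⟨k, rfl⟩ := Nat.exists_eq_add_of_le' h3
      exact hA' hn
  · rcases le_total n 3 with h3 | h3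
    · exact hB.of_le h3
    · obtain ⟨k, rfl⟩ := Nat.exists_eq_add_of_le' h3
      have hres := h.cls_res hn
      set r := resonance Q with hr
      have hr1 : ∀ x, HasDerivAt r (deriv r x) x := fun x => hres.hasDerivAt_of (by simp) x
      have hr2 : ∀ x, HasDerivAt (deriv r) (deriv (deriv r) x) x :=
        fun x => hres.deriv'.hasDerivAt_of (by simp) x
      have hL := h.cls_linOp_res hn
      set g : ℝ → ℝ := fun x => linOp f Q B₂ x - b₂ * (-deriv (deriv r) x + r x
        - deriv f (Q x) * r x) with hg
      have e2 : deriv (fun x => B₂ x - b₂ * r x) = fun x => deriv B₂ x - b₂ * deriv r x :=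
        funext fun x => ((hB0.hasDerivAt_of (by simp) x).sub ((hr1 x).const_mul b₂)).deriv
      have e3 : ∀ x, deriv (deriv (fun x => B₂ x - b₂ * r x)) x =
          deriv (deriv B₂) x - b₂ * deriv (deriv r) x := fun x => by
        rw [e2]
        exact ((hB0.deriv'.hasDerivAt_of (by simp) x).sub ((hr2 x).const_mul b₂)).deriv
      have hgb : ExpBdd 1 g := by
        have : Cls 1 0 fun x => -deriv (deriv (fun x => B₂ x - b₂ * r x)) x
            + (B₂ x - b₂ * r x) - deriv f (Q x) * (B₂ x - b₂ * r x) :=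
          (((hB.deriv'.deriv'.neg.of_le (by omega)).add (hB.of_le (by omega))).sub
          (((h.cls_f1 hn).of_le (by omega)).mul' (hB.of_le (by omega)) (by norm_num)))
        refine (this.congr fun x => ?_).expBdd
        rw [e3]; simp only [hg, linOp]; ring
      have hgc : Cls 1 (k + 1) g := by
        refine .of_hasDerivAt (fun x => ((ho.eqB x).sub ((((hL.hasDerivAt x).add
          (hr1 x)).const_mul b₂))).congr_of_eventuallyEq (.of_forall fun y => ?_)) hgb ?_
        · simp only [hg, Pi.add_apply, Pi.sub_apply]; ring
        · have hA2 : Cls 1 (k + 1) (deriv (deriv A₂)) := by rw [← e1]; exact (hA' hn).deriv'.deriv'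
          exact (((((hs.cls_GPhi h hn).add (hA2.of_succ.const_mul 2)).add
            ((hA' hn).of_le (by omega))).add ((((h.cls_f hn).mono (by norm_num)).of_le
              (by omega)).const_mul a₂)).sub (((hL.deriv'.of_le (by omega)).add
              ((h.cls_res' hn).of_le (by omega))).const_mul b₂))
      refine h.bootstrap hn (m := k + 1) (by omega) hgc
        (fun x => hB.hasDerivAt_of (by simp) x)
        (fun x => (hB.deriv'.hasDerivAt_of (by simp) x).congr_deriv ?_) hB.expBdd hB.deriv'.expBdd
      rw [e3]; simp only [hg, linOp]; ring
  · have e : linOp f Q A₂ = fun x => γ + Phi f Q A B V a x - a₂ * (3 * Q x - 2 * f (Q x)) :=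
      funext fun x => by rw [linOp, ho.eqA]; ring
    have h3Q := (h.cls_3Q (n := 0) c3).hasDerivAt x
    rw [e, show deriv (fun x => γ + Phi f Q A B V a x - a₂ * (3 * Q x - 2 * f (Q x))) x = _ from
      (((hs.hasDerivAt_Phi h x).const_add γ).sub (h3Q.const_mul a₂)).deriv]
    ring
  · rw [(ho.eqB x).deriv, hs.G20_eq h, h.deriv2_Q]
    linear_combination -ho.eqA x


variable {f Q Q1 A B M V : ℝ → ℝ} {a b : ℝ}

/-- The same scheme with `A₂ = γ + w₁`: the constant contributes `Lγ = γ - γf'(Q)`, which moves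
`γf'(Q)` to the source. The coefficient `a₂` multiplies the same solvability integral `D` as in the
first system, so nondegeneracy again suffices, whatever `γ` is. -/
theorem exists_secondSol (h : Profile f Q Q1) (hD : Nondeg f Q)
    (hs : FirstSol f Q Q1 A B M V a b) (γ : ℝ) :
    ∃ (A₂ B₂ : ℝ → ℝ) (a₂ b₂ : ℝ), SecondSol f Q Q1 A B V A₂ B₂ a γ a₂ b₂ := by
  have c3 := h.contDiff_nat
  have h3 := h.cls_3Q (n := 0) c3
  have hf1 := h.cls_f1 (n := 0) c3
  have hΦ := hs.cls_Phi (n := 0) h c3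
  have hG := hs.cls_GPhi (n := 0) h c3
  have hΦe := hs.Phi_even h
  have hGe := hs.GPhi_even h
  set Φ := Phi f Q A B V a
  set G := GPhi f Q Q1 A B V a
  have hn : Cls 1 1 fun x => Φ x + γ * deriv f (Q x) :=
    hΦ.add ((hf1.of_le (by omega)).const_mul γ)
  obtain ⟨u, u', u1, u2, u3, u4, u5, u6⟩ := h.exists_hom hD
  obtain ⟨v, v', v1, v2, v3, v4, v5⟩ := h.solve_even (n := fun x => Φ x + γ * deriv f (Q x))
    hn.continuous hn.expBdd (fun x => by rw [h.even, hΦe])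
  have hQc : Cls 1 0 Q := (h.cls_Q c3).of_le (by omega)
  have hfc : Cls 1 0 fun x => f (Q x) :=
    ((h.cls_f (n := 0) c3).mono (by norm_num)).of_le (by omega)
  have hf1c : Cls 0 0 fun x => 1 - deriv f (Q x) :=
    (Cls.const 1).sub ((hf1.mono zero_le_one).of_le (by omega))
  have huc : Cls 1 0 u := ⟨continuous_iff_continuousAt.2 fun x => (u2 x).continuousAt, u4⟩
  have hvc : Cls 1 0 v := ⟨continuous_iff_continuousAt.2 fun x => (v2 x).continuousAt, v4⟩
  set D := ∫ x in Set.Ioi (0:ℝ), Q x * (u x + 2 * ((1 - deriv f (Q x)) * u x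
        + (3 * Q x - 2 * f (Q x))) + f (Q x)) with hDdef
  have iu : Cls 1 0 fun x => u x + 2 * ((1 - deriv f (Q x)) * u x
        + (3 * Q x - 2 * f (Q x))) + f (Q x) :=
    (((huc).add (((hf1c.mul' huc (by norm_num)).add
      (h3.of_le (by omega))).const_mul 2)).add hfc)
  have iD : Cls 1 0 fun x => Q x * (u x + 2 * ((1 - deriv f (Q x)) * u x
        + (3 * Q x - 2 * f (Q x))) + f (Q x)) := hQc.mul' iu (by norm_num)
  have iv : Cls 1 0 fun x => G x + (v x + 2 * ((1 - deriv f (Q x)) * v x -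
      (Φ x + γ * deriv f (Q x)))) :=
    hG.add (hvc.add (((hf1c.mul' hvc (by norm_num)).sub (hn.of_le (by omega))).const_mul 2))
  have iE : Cls 1 0 fun x => Q x * (G x + (v x + 2 * ((1 - deriv f (Q x)) * v x -
      (Φ x + γ * deriv f (Q x))))) := hQc.mul' iv (by norm_num)
  set E := ∫ x in Set.Ioi (0:ℝ), Q x * (G x + (v x + 2 * ((1 - deriv f (Q x)) * v x -
      (Φ x + γ * deriv f (Q x))))) with hE
  set a₂ : ℝ := -(E / D) with ha
  set w₁ : ℝ → ℝ := fun x => v x + a₂ * u x with hw₁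
  set w₁' : ℝ → ℝ := fun x => v' x + a₂ * u' x with hw₁'
  have hA1 : ∀ x, HasDerivAt w₁ (w₁' x) x := fun x => (v2 x).add ((u2 x).const_mul a₂)
  have hA2 : ∀ x, HasDerivAt w₁' ((1 - deriv f (Q x)) * w₁ x -
      (Φ x + γ * deriv f (Q x) - a₂ * (3 * Q x - 2 * f (Q x)))) x := fun x => by
    refine ((v3 x).add ((u3 x).const_mul a₂)).congr_deriv ?_
    simp only [hw₁]; ring
  have hwe : ∀ x, w₁ (-x) = w₁ x := fun x => by simp only [hw₁]; rw [v1, u1]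
  have hwb : ExpBdd 1 w₁ := v4.add (u4.const_mul a₂)
  have hwb' : ExpBdd 1 w₁' := v5.add (u5.const_mul a₂)
  have hwc : Cls 1 3 w₁ := h.bootstrap (n := 0) c3 (m := 1) (by omega)
    (hn.sub ((h3.of_le (by omega)).const_mul a₂)) hA1 hA2 hwb hwb'
  set k : ℝ → ℝ := fun x => (G x + (v x + 2 * ((1 - deriv f (Q x)) * v x -
      (Φ x + γ * deriv f (Q x))))) + a₂ * (u x + 2 * ((1 - deriv f (Q x)) * u x
        + (3 * Q x - 2 * f (Q x))) + f (Q x)) with hk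
  have hkc : Cls 1 0 k := iv.add (iu.const_mul a₂)
  have hKd : ∀ x, HasDerivAt (prim k) (k x) x := fun x => hasDerivAt_prim hkc.continuous x
  have hKo := Profile.odd_of_even_deriv hKd (prim_zero _) (fun x => by
    simp only [hk]; rw [h.even, hGe, hΦe, u1, v1])
  have horth : ∫ x in Set.Ioi (0:ℝ), Q x * k x = 0 := by
    simp only [hk, mul_add (Q _) _ (a₂ * _), mul_left_comm (Q _) a₂]
    rw [integral_add (iE.integrable one_pos).integrableOn
      ((iD.integrable one_pos).const_mul a₂).integrableOn, integral_const_mul, ← hE, ← hDdef, ha]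
    field_simp
    ring
  obtain ⟨b, w, w', w1, w2, w3, w4, w5, w6, -⟩ := h.solve_res hKd hKo hkc horth
  have hres := h.cls_res c3
  set r := resonance Q with hr
  have hr1 : ∀ x, HasDerivAt r (deriv r x) x := fun x => hres.hasDerivAt_of (by simp) x
  have hr2 : ∀ x, HasDerivAt (deriv r) (deriv (deriv r) x) x :=
    fun x => hres.deriv'.hasDerivAt_of (by simp) x
  have hwc2 : Cls 1 3 w := h.bootstrap (n := 0) c3 (m := 1) (by omega) w6 w2 w3 w4 w5
  have hB1 : ∀ x, HasDerivAt (fun x => w x + b * r x) (w' x + b * deriv r x) x := fun x =>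
    (w2 x).add ((hr1 x).const_mul b)
  have hB2 : ∀ x, HasDerivAt (fun x => w' x + b * deriv r x)
      ((1 - deriv f (Q x)) * (w x + b * r x) - prim k x) x := fun x => by
    refine ((w3 x).add ((hr2 x).const_mul b)).congr_deriv ?_
    ring
  have eA1 : deriv (fun x => γ + w₁ x) = w₁' := funext fun x => ((hA1 x).const_add γ).deriv
  have eA2 : ∀ x, deriv w₁' x = _ := fun x => (hA2 x).deriv
  refine ⟨fun x => γ + w₁ x, fun x => w x + b * r x, a₂, b, fun x => by rw [hwe], fun x => ?_,
    hwc.congr fun x => by ring, hwc2.congr fun x => by ring, fun x => ?_, fun x => ?_⟩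
  · rw [w1, show r (-x) = -r x from h.res_odd x]; ring
  · rw [eA1, eA2]; ring
  · have : linOp f Q (fun x => w x + b * r x) = prim k := funext fun x => by
      rw [linOp, show deriv (fun x => w x + b * r x) = _ from funext fun x => (hB1 x).deriv,
        (hB2 x).deriv]; ring
    rw [this]
    refine (hKd x).congr_deriv ?_
    rw [eA1, eA2]
    simp only [hk, hw₁]; ring


/-! ### The defect as an integral in the first solution -/

/-- The antiderivative of `-(A (3 Q - 2 f(Q)) + a Q f(Q))` vanishing at the origin. -/
noncomputable def Sfun (f Q Q1 A B M : ℝ → ℝ) (a : ℝ) (x : ℝ) : ℝ :=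
  -(Q1 x * deriv B x - (Q x - f (Q x)) * B x + M x * Q x + 2 * A x * Q1 x - a * Q x * Q1 x)

/-- Boundary terms that depend on the first solution only. -/
noncomputable def Zfun (f Q Q1 A B M V : ℝ → ℝ) (a : ℝ) (x : ℝ) : ℝ :=
  -B x + a * (B x * Q x) + M x * V x - 3 / 2 * a * deriv A x + 3 / 2 * a * M x
    - a * deriv (deriv B) x + a ^ 2 * (Q x * deriv (deriv B) x - Q1 x * deriv B x
      + (Q x - f (Q x)) * B x) - 1 / 2 * a * B x + 1 / 2 * a ^ 2 * (Q x * B x)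
    + 1 / 2 * ((1 - a * Q x) * (deriv (deriv f) (Q x) * ((1 + A x) * B x)))
    - 2 * (B x * (1 + A x)) - 2 * a * deriv A x - 2 * a * (A x * deriv A x) + a ^ 2 * Q1 x
    - a * M x + 2 * M x - 1 / 2 * a * (B x * deriv (deriv A) x - deriv B x * deriv A x)
    + 1 / 2 * a * (A x * M x) - 1 / 2 * a ^ 2 * (A x * Q1 x)
    + 3 / 2 * a ^ 2 * (Q x * deriv A x - Q1 x * A x)

/-- The antiderivative of the density of the defect. -/
noncomputable def Xifun (f Q Q1 A B M V A₂ B₂ : ℝ → ℝ) (a γ a₂ : ℝ) (x : ℝ) : ℝ :=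
  (1 - a * Q x) * linOp f Q B₂ x + a * ((Q x - f (Q x)) * B₂ x - Q1 x * deriv B₂ x)
    + ((A₂ x - γ) * deriv A x - (1 + A x) * deriv A₂ x) - 2 * deriv A₂ x
    + 2 * a * (Q x * deriv A₂ x - Q1 x * (A₂ x - γ)) + 3 * a₂ * Q1 x
    - a₂ * Sfun f Q Q1 A B M a x - γ * (M x - deriv A x + 2 * a * Q1 x)
    - Zfun f Q Q1 A B M V a x

/-- The polynomial part of the density of the defect. -/
noncomputable def brPoly (f Q A : ℝ → ℝ) (a : ℝ) (x : ℝ) : ℝ :=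
  1 / 2 * deriv (deriv f) (Q x) * (1 + A x) ^ 3 - 1 - 4 * A x - A x ^ 2 - 2 * a * Q x
    + 3 * a * deriv A x ^ 2 - 3 / 2 * a * A x ^ 2 - 3 * a ^ 2 * A x * f (Q x)
    - 3 / 2 * a ^ 3 * Q x ^ 2

variable {f Q Q1 A B M V A₂ B₂ : ℝ → ℝ} {a b γ a₂ b₂ : ℝ}

namespace FirstSol

/-- The Wronskian of `Q'` and `B`. As `LQ' = 0`, its derivative is `-Q' LB`: it sees only the
right-hand side of the equation for `B`, not the multiple of `Q'` contained in `B`. -/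
theorem hasDerivAt_P (hs : FirstSol f Q Q1 A B M V a b) (h : Profile f Q Q1) (x : ℝ) :
    HasDerivAt (fun x => Q1 x * deriv B x - (Q x - f (Q x)) * B x)
      (-(M x + 2 * deriv A x - a * Q1 x) * Q1 x) x := by
  refine (((h.d2 x).mul (hs.dB1 h x)).sub ((h.hasDerivAt_d2 x).mul (hs.dB h x))).congr_deriv ?_
  linear_combination Q1 x * hs.eqB x

/-- The solvability condition of the first system in integrated form: as `Sfun` vanishes at the
origin and at infinity, `∫₀^∞ (A(3Q - 2f(Q)) + aQf(Q)) = 0`. This is what determines `a`, and it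
removes `a₂` from the formula for the defect. -/
theorem hasDerivAt_S (hs : FirstSol f Q Q1 A B M V a b) (h : Profile f Q Q1) (x : ℝ) :
    HasDerivAt (Sfun f Q Q1 A B M a) (-(A x * (3 * Q x - 2 * f (Q x)) + a * Q x * f (Q x))) x := by
  refine ((((hs.hasDerivAt_P h x).add ((hs.hM x).mul (h.d1 x))).add
    (((hs.dA x).const_mul 2).mul (h.d2 x))).sub
    (((h.d1 x).const_mul a).mul (h.d2 x))).neg.congr_deriv ?_
  ring

theorem hasDerivAt_Z (hs : FirstSol f Q Q1 A B M V a b) (h : Profile f Q Q1) (x : ℝ) :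
    HasDerivAt (Zfun f Q Q1 A B M V a) (-deriv B x + a * (deriv B x * Q x + B x * Q1 x)
    + ((A x + a * Q x) * V x + M x * (M x - B x)) - 3 / 2 * a * deriv (deriv A) x
    + 3 / 2 * a * (A x + a * Q x)
    - a * deriv (deriv (deriv B)) x + a ^ 2 * (Q x * deriv (deriv (deriv B)) x
      + (1 - deriv f (Q x)) * Q1 x * B x) - 1 / 2 * a * deriv B x
    + 1 / 2 * a ^ 2 * (Q1 x * B x + Q x * deriv B x)
    + 1 / 2 * (-(a * Q1 x) * (deriv (deriv f) (Q x) * ((1 + A x) * B x)) +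
      (1 - a * Q x) * (deriv (deriv (deriv f)) (Q x) * Q1 x * ((1 + A x) * B x)
        + deriv (deriv f) (Q x) * (deriv A x * B x + (1 + A x) * deriv B x)))
    - 2 * (deriv B x * (1 + A x) + B x * deriv A x) - 2 * a * deriv (deriv A) x
    - 2 * a * (deriv A x * deriv A x + A x * deriv (deriv A) x) + a ^ 2 * (Q x - f (Q x))
    - a * (A x + a * Q x) + 2 * (A x + a * Q x)
    - 1 / 2 * a * (B x * deriv (deriv (deriv A)) x - deriv (deriv B) x * deriv A x)
    + 1 / 2 * a * (deriv A x * M x + A x * (A x + a * Q x))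
    - 1 / 2 * a ^ 2 * (deriv A x * Q1 x + A x * (Q x - f (Q x)))
    + 3 / 2 * a ^ 2 * (Q x * deriv (deriv A) x - (Q x - f (Q x)) * A x)) x := by
  have q0 := h.d1 x
  have q1 := h.d2 x
  have q2 := h.hasDerivAt_d2 x
  have A0 := hs.dA x
  have A1 := hs.dA1 x
  have A2 := hs.dA2 x
  have T0 := A0.const_add 1
  have B0 := hs.dB h x
  have B1 := hs.dB1 h x
  have B2 := hs.dB2 h x
  have M0 := hs.hM x
  have V0 := hs.hV x
  have f2 := h.hasDerivAt_f2Q x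
  have z := ((((((((((((((((((((B0.neg).add ((B0.mul q0).const_mul a)).add (M0.mul V0)).sub
    (A1.const_mul (3 / 2 * a))).add (M0.const_mul (3 / 2 * a))).sub (B2.const_mul a)).add
    ((((q0.mul B2).sub (q1.mul B1)).add (q2.mul B0)).const_mul (a ^ 2))).sub
    (B0.const_mul (1 / 2 * a))).add ((q0.mul B0).const_mul (1 / 2 * a ^ 2))).add
    ((((q0.const_mul a).const_sub 1).mul (f2.mul (T0.mul B0))).const_mul (1 / 2))).sub
    ((B0.mul T0).const_mul 2)).sub (A1.const_mul (2 * a))).sub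
    ((A0.mul A1).const_mul (2 * a))).add (q1.const_mul (a ^ 2))).sub (M0.const_mul a)).add
    (M0.const_mul 2)).sub (((B0.mul A2).sub (B1.mul A1)).const_mul (1 / 2 * a))).add
    ((A0.mul M0).const_mul (1 / 2 * a))).sub ((A0.mul q1).const_mul (1 / 2 * a ^ 2))).add
    (((q0.mul A1).sub (q1.mul A0)).const_mul (3 / 2 * a ^ 2)))
  refine z.congr_deriv ?_
  simp only [Pi.mul_apply]
  ring

theorem P_zero (hs : FirstSol f Q Q1 A B M V a b) (h : Profile f Q Q1) :
    Q1 0 * deriv B 0 - (Q 0 - f (Q 0)) * B 0 = 0 := by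
  rw [h.Q1_zero, odd_zero hs.oddB]; ring

theorem S_zero (hs : FirstSol f Q Q1 A B M V a b) (h : Profile f Q Q1) :
    Sfun f Q Q1 A B M a 0 = 0 := by
  rw [Sfun, h.Q1_zero, odd_zero hs.oddB, hs.M0]; ring

theorem tendsto_A (hs : FirstSol f Q Q1 A B M V a b) : Tendsto A atTop (𝓝 0) :=
  hs.clsA.tendsto_zero one_pos

theorem tendsto_A1 (hs : FirstSol f Q Q1 A B M V a b) : Tendsto (deriv A) atTop (𝓝 0) :=
  hs.clsA.deriv'.tendsto_zero one_pos

theorem tendsto_A2 (hs : FirstSol f Q Q1 A B M V a b) :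
    Tendsto (deriv (deriv A)) atTop (𝓝 0) :=
  hs.clsA.deriv'.deriv'.tendsto_zero one_pos

theorem tendsto_B1 (hs : FirstSol f Q Q1 A B M V a b) (h : Profile f Q Q1) :
    Tendsto (deriv B) atTop (𝓝 0) := (hs.cls_dB (n := 0) h h.contDiff_nat).tendsto_zero one_pos

theorem tendsto_B2 (hs : FirstSol f Q Q1 A B M V a b) (h : Profile f Q Q1) :
    Tendsto (deriv (deriv B)) atTop (𝓝 0) :=
  (hs.cls_dB (n := 0) h h.contDiff_nat).deriv'.tendsto_zero one_pos

end FirstSol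

theorem Profile.tendsto_Q (h : Profile f Q Q1) : Tendsto Q atTop (𝓝 0) :=
  (h.cls_Q h.contDiff_nat).tendsto_zero one_pos

theorem Profile.tendsto_Q1 (h : Profile f Q Q1) : Tendsto Q1 atTop (𝓝 0) :=
  (h.cls_Q1 h.contDiff_nat).tendsto_zero one_pos

theorem Profile.tendsto_fQ (h : Profile f Q Q1) : Tendsto (fun x => f (Q x)) atTop (𝓝 0) :=
  (h.cls_f (n := 0) h.contDiff_nat).tendsto_zero two_pos

theorem Profile.tendsto_f1Q (h : Profile f Q Q1) : Tendsto (fun x => deriv f (Q x)) atTop (𝓝 0) :=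
  (h.cls_f1 (n := 0) h.contDiff_nat).tendsto_zero one_pos

theorem Profile.tendsto_f2Q (h : Profile f Q Q1) :
    Tendsto (fun x => deriv (deriv f) (Q x)) atTop (𝓝 2) := by
  simpa using ((h.cls_f2 (n := 0) h.contDiff_nat).tendsto_zero one_pos).add_const 2

namespace FirstSol

theorem tendsto_S (hs : FirstSol f Q Q1 A B M V a b) (h : Profile f Q Q1) :
    Tendsto (Sfun f Q Q1 A B M a) atTop (𝓝 0) := by
  have := (((((h.tendsto_Q1.mul (hs.tendsto_B1 h)).sub ((h.tendsto_Q.sub h.tendsto_fQ).mul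
    (hs.tendsto_B h))).add ((hs.tendsto_M h).mul h.tendsto_Q)).add
    ((hs.tendsto_A.const_mul 2).mul h.tendsto_Q1)).sub
    ((h.tendsto_Q.const_mul a).mul h.tendsto_Q1)).neg
  simp only [mul_zero, zero_mul, sub_zero, add_zero, neg_zero] at this
  exact this

theorem Z_zero (hs : FirstSol f Q Q1 A B M V a b) (h : Profile f Q Q1) :
    Zfun f Q Q1 A B M V a 0 = 0 := by
  have hA1 := odd_zero hs.A1_odd
  have hB2 := odd_zero (odd_deriv_of_even (hs.dB1 h) (even_deriv_of_odd (hs.dB h) hs.oddB))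
  rw [Zfun, h.Q1_zero, odd_zero hs.oddB, hs.M0, hA1, hB2]; ring

theorem tendsto_Z (hs : FirstSol f Q Q1 A B M V a b) (h : Profile f Q Q1) :
    Tendsto (Zfun f Q Q1 A B M V a) atTop (𝓝 0) := by
  have q0 := h.tendsto_Q
  have q1 := h.tendsto_Q1
  have q2 := q0.sub h.tendsto_fQ
  have A0 := hs.tendsto_A
  have A1 := hs.tendsto_A1
  have A2 := hs.tendsto_A2
  have T0 := A0.const_add 1
  have B0 := hs.tendsto_B h
  have B1 := hs.tendsto_B1 h
  have B2 := hs.tendsto_B2 h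
  have M0 := hs.tendsto_M h
  have V0 := hs.V_lim
  have f2 := h.tendsto_f2Q
  have z := ((((((((((((((((((((B0.neg).add ((B0.mul q0).const_mul a)).add (M0.mul V0)).sub
    (A1.const_mul (3 / 2 * a))).add (M0.const_mul (3 / 2 * a))).sub (B2.const_mul a)).add
    ((((q0.mul B2).sub (q1.mul B1)).add (q2.mul B0)).const_mul (a ^ 2))).sub
    (B0.const_mul (1 / 2 * a))).add ((q0.mul B0).const_mul (1 / 2 * a ^ 2))).add
    ((((q0.const_mul a).const_sub 1).mul (f2.mul (T0.mul B0))).const_mul (1 / 2))).sub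
    ((B0.mul T0).const_mul 2)).sub (A1.const_mul (2 * a))).sub
    ((A0.mul A1).const_mul (2 * a))).add (q1.const_mul (a ^ 2))).sub (M0.const_mul a)).add
    (M0.const_mul 2)).sub (((B0.mul A2).sub (B1.mul A1)).const_mul (1 / 2 * a))).add
    ((A0.mul M0).const_mul (1 / 2 * a))).sub ((A0.mul q1).const_mul (1 / 2 * a ^ 2))).add
    (((q0.mul A1).sub (q1.mul A0)).const_mul (3 / 2 * a ^ 2)))
  exact Eq.subst (motive := fun c => Tendsto (Zfun f Q Q1 A B M V a) atTop (𝓝 c)) (by ring) z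

end FirstSol

namespace SecondSol

theorem cls_B₂ (ho : SecondSol f Q Q1 A B V A₂ B₂ a γ a₂ b₂) (h : Profile f Q Q1) :
    Cls 0 3 B₂ := h.cls_B h.contDiff_nat ho.clsB

theorem dA (ho : SecondSol f Q Q1 A B V A₂ B₂ a γ a₂ b₂) (x : ℝ) :
    HasDerivAt A₂ (deriv A₂ x) x := by
  have := (ho.clsA.hasDerivAt_of (by simp) x).add_const γ
  simp only [sub_add_cancel, deriv_sub_const] at this
  exact this

theorem cls_dA (ho : SecondSol f Q Q1 A B V A₂ B₂ a γ a₂ b₂) : Cls 1 2 (deriv A₂) := by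
  have := ho.clsA.deriv'
  rwa [show deriv (fun x => A₂ x - γ) = deriv A₂ from funext fun x => deriv_sub_const γ] at this

/-- The equation for `(LB₂)'` is multiplied by `1 - aQ`. Integrating `Q(LB₂)'` by parts gives `Q'
LB₂`, a Wronskian derivative because `LQ' = 0`. The terms `(1 - aQ)(A₂ - γ + 2A₂'')` become, up to
boundary terms, `(A₂ - γ)(1 - a(3Q - 2f(Q))) = (A₂ - γ) L(1 + A)`; Green's formula and the equation
for `A₂` then leave `(1 + A)` times known sources. The terms with `a₂` assemble into `Sfun` and
`Q''`. `Zfun` collects the boundary terms that bring the rest to a form without higher derivatives.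
-/
theorem hasDerivAt_Xi (ho : SecondSol f Q Q1 A B V A₂ B₂ a γ a₂ b₂)
    (hs : FirstSol f Q Q1 A B M V a b) (h : Profile f Q Q1) (x : ℝ) :
    HasDerivAt (Xifun f Q Q1 A B M V A₂ B₂ a γ a₂) (brPoly f Q A a x
      + B x * (M x + 2 * deriv A x - a * Q1 x) - M x ^ 2) x := by
  have q0 := h.d1 x
  have q1 := h.d2 x
  have q2 := h.hasDerivAt_d2 x
  have A0 := hs.dA x
  have A1 := hs.dA1 x
  have w0 := (ho.dA x).sub_const γ
  have w1 := ho.cls_dA.hasDerivAt_of (by simp) x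
  have k2 := ho.eqB x
  have b0 := (ho.cls_B₂ h).hasDerivAt_of (by simp) x
  have b1 := (ho.cls_B₂ h).deriv'.hasDerivAt_of (by simp) x
  have M0 := hs.hM x
  have hx := (((((((((q0.const_mul a).const_sub 1).mul k2).add
    (((q2.mul b0).sub (q1.mul b1)).const_mul a)).add ((w0.mul A1).sub
    ((A0.const_add 1).mul w1))).sub (w1.const_mul 2)).add
    (((q0.mul w1).sub (q1.mul w0)).const_mul (2 * a))).add (q1.const_mul (3 * a₂))).sub
    ((hs.hasDerivAt_S h x).const_mul a₂)).sub
    (((M0.sub A1).add (q1.const_mul (2 * a))).const_mul γ) |>.sub (hs.hasDerivAt_Z h x)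
  refine hx.congr_deriv ?_
  rw [hs.eqA3 h, hs.eqB3 h, ho.eqA, hs.eqB, hs.eqA]
  simp only [GPhi, Phi, brPoly, linOp]
  rw [hs.eqB3 h, hs.eqA]
  ring

theorem Xi_zero (ho : SecondSol f Q Q1 A B V A₂ B₂ a γ a₂ b₂)
    (hs : FirstSol f Q Q1 A B M V a b) (h : Profile f Q Q1) :
    Xifun f Q Q1 A B M V A₂ B₂ a γ a₂ 0 = 0 := by
  have b0 := fun x => (ho.cls_B₂ h).hasDerivAt_of (by simp) x
  have b1 := fun x => (ho.cls_B₂ h).deriv'.hasDerivAt_of (by simp) x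
  have h1 := odd_zero hs.A1_odd
  have h2 := odd_zero (odd_deriv_of_even b1 (even_deriv_of_odd b0 ho.oddB))
  have h3 := odd_zero (odd_deriv_of_even ho.dA ho.evenA)
  rw [Xifun, hs.S_zero h, hs.Z_zero h, linOp, h2, h1, h3, h.Q1_zero, hs.M0, odd_zero ho.oddB]
  ring

theorem tendsto_Xi (ho : SecondSol f Q Q1 A B V A₂ B₂ a γ a₂ b₂)
    (hs : FirstSol f Q Q1 A B M V a b) (h : Profile f Q Q1) :
    Tendsto (Xifun f Q Q1 A B M V A₂ B₂ a γ a₂) atTop (𝓝 (b₂ - γ * b)) := by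
  have c3 := h.contDiff_nat
  have hres := h.cls_res c3
  have hr' := h.cls_res' (n := 0) c3
  have q0 := h.tendsto_Q
  have q1 := h.tendsto_Q1
  have q2 := q0.sub h.tendsto_fQ
  have A0 := hs.tendsto_A
  have A1 := hs.tendsto_A1
  have w0 := ho.clsA.tendsto_zero one_pos
  have w1 := ho.cls_dA.tendsto_zero one_pos
  have b0 : Tendsto B₂ atTop (𝓝 b₂) := by
    have := (ho.clsB.tendsto_zero one_pos).add (h.res_tendsto.const_mul b₂)
    simpa using this
  have hB := ho.cls_B₂ h
  have d1 : ∀ x, deriv (fun x => B₂ x - b₂ * resonance Q x) x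
      = deriv B₂ x - b₂ * deriv (resonance Q) x := fun x =>
    ((hB.hasDerivAt_of (by simp) x).sub ((hres.hasDerivAt_of (by simp) x).const_mul b₂)).deriv
  have hb1 : Cls 1 2 (deriv B₂) := (ho.clsB.deriv'.add ((hr'.of_le (by omega)).const_mul b₂)).congr
    fun x => by rw [d1]; ring
  have b1 := hb1.tendsto_zero one_pos
  have b2 := hb1.deriv'.tendsto_zero one_pos
  have k2 : Tendsto (linOp f Q B₂) atTop (𝓝 b₂) := by
    have := (b2.neg.add b0).sub (h.tendsto_f1Q.mul b0)
    simp only [neg_zero, zero_add, zero_mul, sub_zero] at this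
    exact this
  have M0 := hs.tendsto_M h
  have hx := (((((((((q0.const_mul a).const_sub 1).mul k2).add
    (((q2.mul b0).sub (q1.mul b1)).const_mul a)).add ((w0.mul A1).sub
    ((A0.const_add 1).mul w1))).sub (w1.const_mul 2)).add
    (((q0.mul w1).sub (q1.mul w0)).const_mul (2 * a))).add (q1.const_mul (3 * a₂))).sub
    ((hs.tendsto_S h).const_mul a₂)).sub
    (((M0.sub A1).add (q1.const_mul (2 * a))).const_mul γ) |>.sub (hs.tendsto_Z h)
  exact Eq.subst (motive := fun c => Tendsto (Xifun f Q Q1 A B M V A₂ B₂ a γ a₂) atTop (𝓝 c))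
    (by ring) hx

/-- The antiderivative of the density of the defect, in a form that does not involve `B`. -/
noncomputable def _root_.GKdV.Defun (f Q Q1 A B M V A₂ B₂ : ℝ → ℝ) (a γ a₂ : ℝ) (x : ℝ) : ℝ :=
  Xifun f Q Q1 A B M V A₂ B₂ a γ a₂ x +
    (Q1 x * deriv B x - (Q x - f (Q x)) * B x) * B x / Q1 x

/-- With `P = Q'B' - Q''B` one has `(B/Q')' = P/Q'²` and `P'/Q' = -(M + 2A' - aQ')`. So the
derivative of `PB/Q'` cancels the term linear in `B` and produces `(P/Q')²`. -/
theorem hasDerivAt_Defun (ho : SecondSol f Q Q1 A B V A₂ B₂ a γ a₂ b₂)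
    (hs : FirstSol f Q Q1 A B M V a b) (h : Profile f Q Q1) {x : ℝ} (hx : x ≠ 0) :
    HasDerivAt (Defun f Q Q1 A B M V A₂ B₂ a γ a₂) (brPoly f Q A a x
      + ((Q1 x * deriv B x - (Q x - f (Q x)) * B x) / Q1 x) ^ 2 - M x ^ 2) x := by
  have hQ1 := h.Q1_ne hx
  refine ((ho.hasDerivAt_Xi hs h x).add (((hs.hasDerivAt_P h x).mul (hs.dB h x)).div (h.d2 x)
    hQ1)).congr_deriv ?_
  simp only [Pi.mul_apply]
  field_simp
  ring

/-- The division by `Q'` is harmless at the origin: `B/Q'` tends to `B'(0)/Q''(0)`, while `P` tends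
to zero. -/
theorem tendsto_Defun_zero (ho : SecondSol f Q Q1 A B V A₂ B₂ a γ a₂ b₂)
    (hs : FirstSol f Q Q1 A B M V a b) (h : Profile f Q Q1) :
    Tendsto (Defun f Q Q1 A B M V A₂ B₂ a γ a₂) (𝓝[>] 0) (𝓝 0) := by
  have h1 : Tendsto (Xifun f Q Q1 A B M V A₂ B₂ a γ a₂) (𝓝[>] 0) (𝓝 0) := by
    have := (ho.hasDerivAt_Xi hs h 0).continuousAt.tendsto
    rw [ho.Xi_zero hs h] at this
    exact this.mono_left nhdsWithin_le_nhds
  have hP := hs.hasDerivAt_P h 0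
  have hB0 : Tendsto B (𝓝[>] 0) (𝓝 0) := by
    have := (hs.dB h 0).continuousAt.tendsto
    rw [odd_zero hs.oddB] at this
    exact this.mono_left nhdsWithin_le_nhds
  have hP0 : Tendsto (fun x => Q1 x * deriv B x - (Q x - f (Q x)) * B x) (𝓝[>] 0) (𝓝 0) := by
    have := hP.continuousAt.tendsto
    simp only [hs.P_zero h] at this
    exact this.mono_left nhdsWithin_le_nhds
  have hle : 𝓝[>] (0:ℝ) ≤ 𝓝[≠] 0 := nhdsWithin_mono _ fun x hx => ne_of_gt hx
  have s1 := ((hasDerivAt_iff_tendsto_slope.1 (hs.dB h 0))).mono_left hle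
  have s2 := ((hasDerivAt_iff_tendsto_slope.1 (h.d2 0))).mono_left hle
  have hne : Q 0 - f (Q 0) ≠ 0 := by linarith [h.curv] |> fun (h : Q 0 - f (Q 0) < 0) => h.ne
  have h2 := (hP0.mul (s1.div s2 hne))
  rw [zero_mul] at h2
  have := h1.add h2
  rw [zero_add] at this
  refine this.congr' ?_
  filter_upwards [self_mem_nhdsWithin] with x hx
  have hx0 : x ≠ 0 := ne_of_gt hx
  simp only [Defun, slope_def_field, Pi.div_apply]
  rw [odd_zero hs.oddB, h.Q1_zero]
  have hQ1 := h.Q1_ne hx0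
  field_simp
  simp [mul_comm]

/-- The added term is `BB' - (Q''/Q')B²`, and `Q''/Q'` tends to `-1`; hence the extra `b²`. -/
theorem tendsto_Defun (ho : SecondSol f Q Q1 A B V A₂ B₂ a γ a₂ b₂)
    (hs : FirstSol f Q Q1 A B M V a b) (h : Profile f Q Q1) :
    Tendsto (Defun f Q Q1 A B M V A₂ B₂ a γ a₂) atTop (𝓝 (b₂ - γ * b + b ^ 2)) := by
  refine (ho.tendsto_Xi hs h).add ?_
  have hg : Tendsto (fun x => f (Q x) / Q x) atTop (𝓝 0) := by
    exact ((((h.cls_f (n := 0) h.contDiff_nat).of_le (Nat.zero_le _)).mul' ((h.cls_inv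
      h.contDiff_nat).of_le (Nat.zero_le _)) (by norm_num) : Cls 1 0
      fun x => f (Q x) * (Q x)⁻¹)).tendsto_zero one_pos
  have h1 : Tendsto (fun x => (Q x - f (Q x)) / Q1 x) atTop (𝓝 (-1)) := by
    have := ((hg.const_sub 1).div h.res_tendsto one_ne_zero).neg
    simp only [sub_zero, div_one] at this
    refine this.congr' ?_
    filter_upwards [eventually_gt_atTop 0] with x hx
    have hQ1 := h.Q1_ne hx.ne'
    have hQ := (h.pos x).ne'
    simp only [Pi.div_apply, resonance, h.deriv_Q]
    field_simp
  have B0 := hs.tendsto_B h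
  have := ((hs.tendsto_B1 h).sub (h1.mul B0)).mul B0
  have e : (0 - -1 * b) * b = b ^ 2 := by ring
  rw [e] at this
  refine this.congr' ?_
  filter_upwards [eventually_gt_atTop 0] with x hx
  have hQ1 := h.Q1_ne hx.ne'
  field_simp

end SecondSol


/-! ### Existence of the soliton -/

theorem hasDerivAt_tanh (z : ℝ) : HasDerivAt Real.tanh (1 - Real.tanh z ^ 2) z := by
  have h := (Real.hasDerivAt_sinh z).div (Real.hasDerivAt_cosh z) (Real.cosh_pos z).ne'
  have e : Real.tanh = Real.sinh / Real.cosh := funext fun x => Real.tanh_eq_sinh_div_cosh x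
  rw [e]
  refine h.congr_deriv ?_
  simp only [Pi.div_apply]
  have := (Real.cosh_pos z).ne'
  field_simp

theorem one_sub_tanh_sq (z : ℝ) : 1 - Real.tanh z ^ 2 = 1 / Real.cosh z ^ 2 := by
  rw [Real.tanh_eq_sinh_div_cosh]
  have := (Real.cosh_pos z).ne'
  field_simp
  linarith [Real.cosh_sq z]

theorem tanh_pos {z : ℝ} (hz : 0 < z) : 0 < Real.tanh z := by
  rw [Real.tanh_eq_sinh_div_cosh]
  exact div_pos (Real.sinh_pos_iff.2 hz) (Real.cosh_pos z)

/-- `Z` is the inverse of `z ↦ ∫₀ᶻ r`. Continuity of `r` at the origin is not assumed, so `Z` is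
differentiated away from it only. Since `1 - tanh²` integrates to `tanh`, the last hypothesis keeps
`Z` within a bounded distance of `x/2`, which later fixes the exact exponential rate of the soliton.
-/
theorem exists_param {r : ℝ → ℝ} {c C K : ℝ} (hc : 0 < c) (heven : ∀ z, r (-z) = r z)
    (hcont : ContinuousOn r {0}ᶜ) (h1 : ∀ z, c ≤ r z) (h2 : ∀ z, r z ≤ C)
    (h3 : ∀ z, |r z - 2| ≤ K * (1 - Real.tanh z ^ 2)) :
    ∃ Z : ℝ → ℝ, (∀ x, Z (-x) = -Z x) ∧ Continuous Z ∧ StrictMono Z ∧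
      (∀ x, x ≠ 0 → HasDerivAt Z (r (Z x))⁻¹ x) ∧ ∀ x, |x - 2 * Z x| ≤ K := by
  have hm : AEStronglyMeasurable r volume := by
    have := hcont.aestronglyMeasurable (μ := volume) (measurableSet_singleton (0:ℝ)).compl
    rwa [Measure.restrict_eq_self_of_ae_mem] at this
    rw [ae_iff]; simp
  have hb : ∀ z, ‖r z‖ ≤ C := fun z => by
    rw [Real.norm_eq_abs, abs_of_nonneg (hc.le.trans (h1 z))]; exact h2 z
  have hi : ∀ a b, IntervalIntegrable r volume a b := fun a b => by
    rw [intervalIntegrable_iff]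
    exact Measure.integrableOn_of_bounded (M := C) (by simp)
      hm (ae_of_all _ hb)
  set X : ℝ → ℝ := fun z => ∫ s in (0:ℝ)..z, r s with hX
  have hXc : Continuous X := intervalIntegral.continuous_primitive hi 0
  have hXsub : ∀ a b, X b - X a = ∫ s in a..b, r s := fun a b =>
    intervalIntegral.integral_interval_sub_left (hi _ _) (hi _ _)
  have hXle : ∀ a b, a ≤ b → c * (b - a) ≤ X b - X a := fun a b hab => by
    rw [hXsub]
    have := intervalIntegral.integral_mono_on hab (intervalIntegrable_const (c := c)) (hi a b)
      fun x _ => h1 x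
    simpa [mul_comm] using this
  have hX0 : X 0 = 0 := intervalIntegral.integral_same
  have hmono : StrictMono X := fun a b hab => by
    have := hXle a b hab.le
    have h5 : 0 < c * (b - a) := mul_pos hc (sub_pos.2 hab)
    linarith
  have hXodd : ∀ z, X (-z) = -X z := fun z => by
    have := intervalIntegral.integral_comp_neg (a := 0) (b := z) r
    simp only [heven, neg_zero] at this
    simp only [hX]
    rw [this, ← intervalIntegral.integral_symm]
  have htop : Tendsto X atTop atTop := by
    refine tendsto_atTop_mono' _ ?_ (tendsto_id.const_mul_atTop hc)
    filter_upwards [eventually_ge_atTop 0] with z hz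
    have := hXle 0 z hz
    rw [hX0] at this
    simpa using this
  have hbot : Tendsto X atBot atBot := by
    have := tendsto_neg_atTop_atBot.comp (htop.comp tendsto_neg_atBot_atTop)
    refine this.congr fun z => ?_
    simp only [Function.comp, hXodd, neg_neg]
  have hsurj := hXc.surjective htop hbot
  set e := (hmono.orderIsoOfSurjective X hsurj).toHomeomorph with he
  have heX : ∀ z, e z = X z := fun z => rfl
  set Z : ℝ → ℝ := fun x => e.symm x with hZ
  have hXZ : ∀ x, X (Z x) = x := fun x => by rw [← heX]; exact e.apply_symm_apply x
  have hZc : Continuous Z := e.symm.continuous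
  have hZodd : ∀ x, Z (-x) = -Z x := fun x => hmono.injective (by rw [hXodd, hXZ, hXZ])
  have hZmono : StrictMono Z := fun a b hab => by
    rw [← hmono.lt_iff_lt, hXZ, hXZ]; exact hab
  have hZ0 : Z 0 = 0 := odd_zero hZodd
  refine ⟨Z, hZodd, hZc, hZmono, fun x hx => ?_, fun x => ?_⟩
  · have hne : Z x ≠ 0 := fun h0 => hx (by rw [← hXZ x, h0, hX0])
    have hca : ContinuousAt r (Z x) := hcont.continuousAt (isOpen_compl_singleton.mem_nhds hne)
    have hd : HasDerivAt X (r (Z x)) (Z x) :=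
      intervalIntegral.integral_hasDerivAt_right (hi _ _) (hm.stronglyMeasurableAtFilter) hca
    exact hd.of_local_left_inverse hZc.continuousAt (hc.trans_le (h1 _)).ne' (.of_forall hXZ)
  · have key : ∀ z, 0 ≤ z → |X z - 2 * z| ≤ K := fun z hz => by
      have e1 : X z - 2 * z = ∫ s in (0:ℝ)..z, (r s - 2) := by
        rw [intervalIntegral.integral_sub (hi _ _) intervalIntegrable_const]
        simp [hX, mul_comm]
      have e2 : ∫ s in (0:ℝ)..z, K * (1 - Real.tanh s ^ 2) = K * Real.tanh z := by
        rw [intervalIntegral.integral_const_mul,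
          intervalIntegral.integral_eq_sub_of_hasDerivAt (f := Real.tanh)
            (fun s _ => hasDerivAt_tanh s), Real.tanh_zero, sub_zero]
        refine Continuous.intervalIntegrable ?_ _ _
        have : Continuous Real.tanh :=
          continuous_iff_continuousAt.2 fun s => (hasDerivAt_tanh s).continuousAt
        fun_prop
      have hK : 0 ≤ K := by
        have := (abs_nonneg _).trans (h3 0)
        simpa using this
      rw [e1, ← Real.norm_eq_abs]
      refine (intervalIntegral.norm_integral_le_of_norm_le hz (ae_of_all _ fun s _ => h3 s) ?_).trans ?_
      · refine Continuous.intervalIntegrable ?_ _ _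
        have : Continuous Real.tanh :=
          continuous_iff_continuousAt.2 fun s => (hasDerivAt_tanh s).continuousAt
        fun_prop
      · rw [e2]
        exact mul_le_of_le_one_right hK (Real.tanh_lt_one z).le
    rcases le_total 0 (Z x) with h | h
    · have := key _ h
      rwa [hXZ] at this
    · have := key (-Z x) (by linarith)
      rw [hXodd, hXZ, ← abs_neg] at this
      rwa [show x - 2 * Z x = -(-x - 2 * -Z x) by ring]

/-- Continuous bounded functions on `(0, 1)`. -/
abbrev Bd := BoundedContinuousFunction (Set.Ioo (0:ℝ) 1) ℝ

namespace Bd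

/-- Extension by zero. -/
noncomputable def ext (g : Bd) (t : ℝ) : ℝ := if h : t ∈ Set.Ioo (0:ℝ) 1 then g ⟨t, h⟩ else 0

theorem ext_of_mem (g : Bd) {t : ℝ} (h : t ∈ Set.Ioo (0:ℝ) 1) : ext g t = g ⟨t, h⟩ := dif_pos h

theorem ext_of_notMem (g : Bd) {t : ℝ} (h : t ∉ Set.Ioo (0:ℝ) 1) : ext g t = 0 := dif_neg h

theorem abs_ext_le (g : Bd) (t : ℝ) : |ext g t| ≤ ‖g‖ := by
  by_cases h : t ∈ Set.Ioo (0:ℝ) 1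
  · rw [ext_of_mem g h]; exact g.norm_coe_le_norm _
  · rw [ext_of_notMem g h]; simp

theorem continuousOn_ext (g : Bd) : ContinuousOn (ext g) (Set.Ioo 0 1) := by
  rw [continuousOn_iff_continuous_domRestrict]
  have : (Set.Ioo (0:ℝ) 1).domRestrict (ext g) = g := funext fun t => ext_of_mem g t.2
  rw [this]
  exact g.continuous

theorem continuousAt_ext (g : Bd) {t : ℝ} (h : t ∈ Set.Ioo (0:ℝ) 1) : ContinuousAt (ext g) t :=
  (continuousOn_ext g).continuousAt (isOpen_Ioo.mem_nhds h)

end Bd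

/-- The function `f` is described, on the interval `(0, m]` swept by its soliton `m (1 - t²)`, by
the difference quotients `dg`, `dk`, `ζ`. -/
structure Realizes (f : ℝ → ℝ) (m g₁ : ℝ) (dg dk ζ : Bd) : Prop where
  f3 : ContDiff ℝ 3 f
  f0 : f 0 = 0
  f1 : deriv f 0 = 0
  f2 : deriv (deriv f) 0 = 2
  hm : 0 < m
  curv : 1 < m * g₁
  fm : f m = m ^ 2 * g₁
  Fm : 2 * prim f m = m ^ 2
  hg : ∀ t : Set.Ioo (0:ℝ) 1, f (m * (1 - t ^ 2)) =
    (m * (1 - t ^ 2)) ^ 2 * (g₁ - t ^ 2 * dg t)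
  hk : ∀ t : Set.Ioo (0:ℝ) 1, (m * (1 - t ^ 2)) ^ 2 - 2 * prim f (m * (1 - t ^ 2)) =
    (m * (1 - t ^ 2)) ^ 2 * (t ^ 2 * (1 + (1 - t ^ 2) * dk t))
  hζ : ∀ t : Set.Ioo (0:ℝ) 1, deriv (deriv f) (m * (1 - t ^ 2)) = 2 + (1 - t ^ 2) * ζ t
  hR : ∃ δ : ℝ, 0 < δ ∧ ∀ t : Set.Ioo (0:ℝ) 1, δ ≤ 1 + (1 - (t:ℝ) ^ 2) * dk t

namespace Realizes

variable {f : ℝ → ℝ} {m g₁ : ℝ} {dg dk ζ : Bd}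

theorem exists_profile (hr : Realizes f m g₁ dg dk ζ) :
    ∃ Q Q1 : ℝ → ℝ, Profile f Q Q1 ∧ Q 0 = m := by
  obtain ⟨δ₀, hδ₀, hR₀⟩ := hr.hR
  have hm := hr.hm
  set R : ℝ → ℝ := fun t => 1 + (1 - t ^ 2) * Bd.ext dk t with hRdef
  -- The extension of `dk` by zero gives `R = 1` outside `(0, 1)`; the minimum with 1 makes the
  -- lower bound global.
  set δ := min δ₀ 1 with hδdef
  have hδ : 0 < δ := lt_min hδ₀ one_pos
  have hRδ : ∀ t, δ ≤ R t := fun t => by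
    by_cases h : t ∈ Set.Ioo (0:ℝ) 1
    · simp only [hRdef]; rw [Bd.ext_of_mem dk h]; exact (min_le_left _ _).trans (hR₀ ⟨t, h⟩)
    · simp only [hRdef]; rw [Bd.ext_of_notMem dk h]; simp [hδdef]
  have hRK : ∀ t, |t| ≤ 1 → |R t - 1| ≤ ‖dk‖ * (1 - t ^ 2) := fun t ht => by
    have h1 : 0 ≤ 1 - t ^ 2 := by
      have := (sq_le_one_iff_abs_le_one t).2 ht
      linarith
    simp only [hRdef, add_sub_cancel_left, abs_mul, abs_of_nonneg h1]
    rw [mul_comm]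
    exact mul_le_mul_of_nonneg_right (Bd.abs_ext_le dk t) h1
  set sg : ℝ → ℝ := fun t => √(R t) with hsg
  have hsd : 0 < √δ := Real.sqrt_pos.2 hδ
  have hsgδ : ∀ t, √δ ≤ sg t := fun t => Real.sqrt_le_sqrt (hRδ t)
  have hsg0 : ∀ t, 0 < sg t := fun t => hsd.trans_le (hsgδ t)
  have hsg2 : ∀ t, sg t ^ 2 = R t := fun t => Real.sq_sqrt (hδ.le.trans (hRδ t))
  have habs : ∀ z, abs (abs (Real.tanh z)) ≤ 1 := fun z => by
    rw [abs_abs]; exact (Real.abs_tanh_lt_one z).le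
  have hmem : ∀ z, z ≠ 0 → |Real.tanh z| ∈ Set.Ioo (0:ℝ) 1 := fun z hz => by
    refine ⟨abs_pos.2 ?_, Real.abs_tanh_lt_one z⟩
    rcases lt_or_gt_of_ne hz with h | h
    · have := tanh_pos (neg_pos.2 h)
      rw [Real.tanh_neg] at this
      linarith
    · exact (tanh_pos h).ne'
  -- Separation of variables: for `Q = m(1 - T²)` with `T = tanh Z`, the identity `Q'² = Q²T²R`
  -- becomes `T' = (1 - T²)√R/2`, that is `Z' = √R/2`.
  obtain ⟨Z, Zodd, Zc, Zm, Zd, ZK⟩ := exists_param (r := fun z => 2 / sg |Real.tanh z|)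
    (c := 2 / √(1 + ‖dk‖)) (C := 2 / √δ) (K := 2 * ‖dk‖ / √δ) (by positivity)
    (fun z => by simp only [Real.tanh_neg, abs_neg]) (by
      refine continuousOn_const.div ?_ fun z _ => (hsg0 _).ne'
      intro z hz
      have h1 := Bd.continuousAt_ext dk (hmem z hz)
      have h2 : ContinuousAt (fun z => |Real.tanh z|) z :=
        (hasDerivAt_tanh z).continuousAt.abs
      have h3 : ContinuousAt R |Real.tanh z| := by
        simp only [hRdef]
        exact continuousAt_const.add ((continuousAt_const.sub (continuousAt_id.pow 2)).mul h1)
      exact (ContinuousAt.comp (f := fun z => |Real.tanh z|) (g := sg)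
        (Real.continuous_sqrt.continuousAt.comp h3) h2).continuousWithinAt)
    (fun z => by
      refine div_le_div_of_nonneg_left zero_le_two (hsg0 _) (Real.sqrt_le_sqrt ?_)
      have h1 := (abs_le.1 (hRK _ (habs z))).2
      have h2 : ‖dk‖ * (1 - |Real.tanh z| ^ 2) ≤ ‖dk‖ :=
        mul_le_of_le_one_right (norm_nonneg _) (by nlinarith [sq_nonneg |Real.tanh z|])
      linarith)
    (fun z => div_le_div_of_nonneg_left zero_le_two hsd (hsgδ _))
    (fun z => by
      set t := |Real.tanh z| with ht
      have h1 := hRK t (habs z)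
      have h2 : 2 / sg t - 2 = -(2 * (R t - 1) / (sg t * (1 + sg t))) := by
        have := (hsg0 t).ne'
        have h3 : 1 + sg t ≠ 0 := by linarith [hsg0 t]
        rw [← hsg2]
        field_simp
        ring
      rw [h2, abs_neg, abs_div, abs_mul, abs_two, abs_of_pos (mul_pos (hsg0 t) (by linarith [hsg0 t])),
        ← sq_abs (Real.tanh z), ← ht, div_mul_eq_mul_div, mul_assoc 2 ‖dk‖]
      refine div_le_div₀ (by have := (abs_nonneg _).trans h1; linarith)
        (mul_le_mul_of_nonneg_left h1 zero_le_two) hsd ((hsgδ t).trans ?_)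
      nlinarith [hsg0 t])
  set K := 2 * ‖dk‖ / √δ with hK
  have hZ0 : Z 0 = 0 := odd_zero Zodd
  have hZne : ∀ x, x ≠ 0 → Z x ≠ 0 := fun x hx h0 => hx (Zm.injective (by rw [h0, hZ0]))
  set T : ℝ → ℝ := fun x => Real.tanh (Z x) with hT
  have hTc : Continuous T := (continuous_iff_continuousAt.2 fun s =>
    (hasDerivAt_tanh s).continuousAt : Continuous Real.tanh).comp Zc
  have hT0 : T 0 = 0 := by simp only [hT, hZ0, Real.tanh_zero]
  have hTodd : ∀ x, T (-x) = -T x := fun x => by simp only [hT, Zodd, Real.tanh_neg]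
  have hTpos : ∀ x, 0 < x → 0 < T x := fun x hx => tanh_pos (by rw [← hZ0]; exact Zm hx)
  have hTmem : ∀ x, x ≠ 0 → |T x| ∈ Set.Ioo (0:ℝ) 1 := fun x hx => hmem _ (hZne x hx)
  have hTd : ∀ x, x ≠ 0 → HasDerivAt T ((1 - T x ^ 2) * (sg |T x| / 2)) x := fun x hx => by
    refine ((hasDerivAt_tanh (Z x)).comp x (Zd x hx)).congr_deriv ?_
    simp only [inv_div, hT]
  have hT1 : ∀ x, 0 < 1 - T x ^ 2 := fun x => sub_pos.2 (Real.tanh_sq_lt_one _)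
  set Q : ℝ → ℝ := fun x => m * (1 - T x ^ 2) with hQ
  set Q1 : ℝ → ℝ := fun x => -(T x * Q x * sg |T x|) with hQ1
  have hQc : Continuous Q := by fun_prop
  have hQpos : ∀ x, 0 < Q x := fun x => mul_pos hm (hT1 x)
  have hQeven : ∀ x, Q (-x) = Q x := fun x => by simp only [hQ, hTodd, neg_sq]
  have hQ1odd : ∀ x, Q1 (-x) = -Q1 x := fun x => by
    simp only [hQ1]; rw [hTodd, hQeven, abs_neg]; ring
  have hQ1neg : ∀ x, 0 < x → Q1 x < 0 := fun x hx =>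
    neg_neg_of_pos (mul_pos (mul_pos (hTpos x hx) (hQpos x)) (hsg0 _))
  have hsgb : ∀ x, sg |T x| ≤ √(1 + ‖dk‖) := fun x => by
    refine Real.sqrt_le_sqrt ?_
    have h1 := (abs_le.1 (hRK _ (habs (Z x)))).2
    have h2 : ‖dk‖ * (1 - |Real.tanh (Z x)| ^ 2) ≤ ‖dk‖ :=
      mul_le_of_le_one_right (norm_nonneg _) (by nlinarith [sq_nonneg |Real.tanh (Z x)|])
    linarith
  have hQ10 : Q1 0 = 0 := by simp only [hQ1, hT0]; ring
  have hQ1c0 : ContinuousAt Q1 0 := by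
    have h1 : Tendsto (fun x => T x * Q x * √(1 + ‖dk‖)) (𝓝 0) (𝓝 0) := by
      have : ContinuousAt (fun x => T x * Q x * √(1 + ‖dk‖)) 0 := by fun_prop
      have := this.tendsto
      rwa [hT0, zero_mul, zero_mul] at this
    rw [ContinuousAt, hQ10]
    refine squeeze_zero_norm (fun x => ?_) (by simpa using h1.norm)
    simp only [hQ1, norm_neg, norm_mul, Real.norm_eq_abs]
    rw [abs_of_pos (hsg0 _), abs_of_nonneg (Real.sqrt_nonneg (1 + ‖dk‖))]
    exact mul_le_mul_of_nonneg_left (hsgb x) (by positivity)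
  have hd1 : ∀ x, x ≠ 0 → HasDerivAt Q (Q1 x) x := fun x hx => by
    refine ((((hTd x hx).fun_pow 2).const_sub 1).const_mul m).congr_deriv ?_
    simp only [hQ1, hQ, Nat.cast_ofNat, Nat.add_one_sub_one, pow_one]
    ring
  -- The data say nothing about `R` at `t = 0`. Differentiability of `Q`, and below of `Q'`, at the
  -- origin follows from the continuity of the function and of the candidate derivative.
  have hdQ := hasDerivAt_of_hasDerivAt_of_ne' hd1 hQc.continuousAt hQ1c0
  have henergy : ∀ x, x ≠ 0 → Q1 x ^ 2 = Q x ^ 2 - 2 * prim f (Q x) := fun x hx => by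
    have h1 := hr.hk ⟨|T x|, hTmem x hx⟩
    simp only [sq_abs] at h1
    rw [show m * (1 - T x ^ 2) = Q x from rfl] at h1
    rw [h1]
    simp only [hQ1]
    rw [neg_sq, mul_pow, hsg2]
    simp only [hRdef]
    rw [Bd.ext_of_mem dk (hTmem x hx), sq_abs]
    ring
  have hfc : Continuous f := hr.f3.continuous
  have hd2pos : ∀ x, 0 < x → HasDerivAt Q1 (Q x - f (Q x)) x := fun x hx => by
    have h1 : HasDerivAt (fun x => Q x ^ 2 - 2 * prim f (Q x))
        (2 * Q x * Q1 x - 2 * (f (Q x) * Q1 x)) x := by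
      refine (((hdQ x).fun_pow 2).sub (((hasDerivAt_prim hfc (Q x)).comp x
        (hdQ x)).const_mul 2)).congr_deriv ?_
      simp
    have hlt := hQ1neg x hx
    have hpos : 0 < Q x ^ 2 - 2 * prim f (Q x) := by
      rw [← henergy x hx.ne']; exact sq_pos_of_neg hlt
    have h2 := (h1.sqrt hpos.ne').neg
    refine (h2.congr_of_eventuallyEq ?_).congr_deriv ?_
    · filter_upwards [eventually_gt_nhds hx] with y hy
      rw [Pi.neg_apply, ← henergy y hy.ne', Real.sqrt_sq_eq_abs, abs_of_neg (hQ1neg y hy), neg_neg]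
    · rw [← henergy x hx.ne', Real.sqrt_sq_eq_abs, abs_of_neg hlt]
      have := hlt.ne
      field_simp
  have hd2 : ∀ x, x ≠ 0 → HasDerivAt Q1 (Q x - f (Q x)) x := fun x hx => by
    rcases lt_or_gt_of_ne hx with h | h
    · have := (Profile.hasDerivAt_neg_comp (hd2pos (-x) (neg_pos.2 h))).neg
      rw [hQeven, neg_neg] at this
      exact this.congr_of_eventuallyEq (.of_forall fun y => by
        change Q1 y = -Q1 (-y); rw [hQ1odd, neg_neg])
    · exact hd2pos x h
  have hdQ1 := hasDerivAt_of_hasDerivAt_of_ne' hd2 hQ1c0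
    (hQc.sub (hfc.comp hQc)).continuousAt
  have hZabs : ∀ x, |(|x| - 2 * |Z x|)| ≤ K := fun x => by
    have := (abs_abs_sub_abs_le_abs_sub x (2 * Z x)).trans (ZK x)
    rwa [abs_mul, abs_two] at this
  have hQcosh : ∀ x, Q x = m / Real.cosh (Z x) ^ 2 := fun x => by
    simp only [hQ, hT, one_sub_tanh_sq]; ring
  have hlower : ∀ x, m * Real.exp (-K) * Real.exp (-|x|) ≤ Q x := fun x => by
    have h1 := (abs_le.1 (hZabs x)).1
    have h2 : Real.cosh (Z x) ≤ Real.exp |Z x| := by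
      rw [← Real.cosh_abs, Real.cosh_eq]
      have : Real.exp (-|Z x|) ≤ Real.exp |Z x| := Real.exp_le_exp.2 (by linarith [abs_nonneg (Z x)])
      linarith
    have h3 : Real.cosh (Z x) ^ 2 ≤ Real.exp (2 * |Z x|) := by
      rw [two_mul, Real.exp_add, ← sq]
      exact pow_le_pow_left₀ (Real.cosh_pos _).le h2 2
    rw [hQcosh, le_div_iff₀ (pow_pos (Real.cosh_pos _) 2), mul_assoc, mul_assoc]
    refine mul_le_of_le_one_right hm.le ?_
    calc _ ≤ Real.exp (-K) * (Real.exp (-|x|) * Real.exp (2 * |Z x|)) := by gcongr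
      _ = Real.exp (-K + (-|x| + 2 * |Z x|)) := by rw [Real.exp_add, Real.exp_add]
      _ ≤ 1 := Real.exp_le_one_iff.2 (by linarith)
  have hupper : ∀ x, Q x ≤ 4 * m * Real.exp K * Real.exp (-|x|) := fun x => by
    have h1 := (abs_le.1 (hZabs x)).2
    have h2 : Real.exp |Z x| / 2 ≤ Real.cosh (Z x) := by
      rw [← Real.cosh_abs, Real.cosh_eq]
      linarith [Real.exp_pos (-|Z x|)]
    have h3 : Real.exp (2 * |Z x|) / 4 ≤ Real.cosh (Z x) ^ 2 := by
      have := pow_le_pow_left₀ (by positivity) h2 2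
      rw [two_mul, Real.exp_add]
      refine le_trans (le_of_eq ?_) this
      ring
    rw [hQcosh, div_le_iff₀ (pow_pos (Real.cosh_pos _) 2)]
    calc m = m * 1 := (mul_one m).symm
      _ ≤ m * Real.exp (K + (-|x| + 2 * |Z x|)) := by
        gcongr; exact Real.one_le_exp (by linarith)
      _ = 4 * m * Real.exp K * Real.exp (-|x|) * (Real.exp (2 * |Z x|) / 4) := by
        rw [Real.exp_add, Real.exp_add]; ring
      _ ≤ _ := by gcongr
  have hQ0 : Q 0 = m := by simp only [hQ, hT0]; ring
  refine ⟨Q, Q1, ⟨hr.f3, hr.f0, hr.f1, hr.f2, hdQ, hdQ1, hQeven, hQpos, hQ1neg, ?_,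
    ⟨_, by positivity, hlower⟩, ⟨_, hupper⟩, ⟨4 * m * Real.exp K * √(1 + ‖dk‖), fun x => ?_⟩,
    ⟨T 1 * √δ * (m * Real.exp (-K)), ?_, fun x hx => ?_⟩⟩, hQ0⟩
  · rw [hQ0, hr.fm]
    nlinarith [mul_pos hm (sub_pos.2 hr.curv)]
  · simp only [hQ1]
    rw [abs_neg, abs_mul, abs_mul, abs_of_pos (hsg0 _), abs_of_pos (hQpos x)]
    have h1 : |T x| ≤ 1 := (Real.abs_tanh_lt_one _).le
    have h2 := mul_le_mul (mul_le_mul h1 (hupper x) (hQpos x).le zero_le_one) (hsgb x) (hsg0 _).le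
      (by positivity)
    linarith
  · have := hTpos 1 one_pos
    positivity
  · have h1 : T 1 ≤ T x := by
      have hmt : Monotone Real.tanh := monotone_of_deriv_nonneg
        (fun z => (hasDerivAt_tanh z).differentiableAt) fun z => by
          rw [(hasDerivAt_tanh z).deriv]; linarith [Real.tanh_sq_lt_one z]
      exact hmt (Zm.monotone hx)
    have h2 := hlower x
    rw [abs_of_pos (by linarith : 0 < x)] at h2
    have hT1 := hTpos 1 one_pos
    simp only [hQ1]
    rw [neg_le_neg_iff]
    calc _ = T 1 * (m * Real.exp (-K) * Real.exp (-x)) * √δ := by ring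
      _ ≤ T x * Q x * sg |T x| := by
        gcongr
        exact mul_nonneg (hT1.le.trans h1) (hQpos x).le
        exact hT1.le.trans h1
        exact hsgδ _

end Realizes


/-! ### Uniqueness of the soliton -/

theorem ode_unique {f q q1 u u1 : ℝ → ℝ} (hf : ContDiff ℝ 1 f) (hq : ∀ x, HasDerivAt q (q1 x) x)
    (hq1 : ∀ x, HasDerivAt q1 (q x - f (q x)) x) (hu : ∀ x, HasDerivAt u (u1 x) x)
    (hu1 : ∀ x, HasDerivAt u1 (u x - f (u x)) x) {x₀ : ℝ} (h0 : q x₀ = u x₀)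
    (h1 : q1 x₀ = u1 x₀) (x : ℝ) : q x = u x := by
  set T := |x₀| + |x| + 1 with hT
  have hx0 : x₀ ∈ Set.Ioo (-T) T := by
    constructor <;> nlinarith [neg_abs_le x₀, le_abs_self x₀, abs_nonneg x]
  have hx : x ∈ Set.Ioo (-T) T := by
    constructor <;> nlinarith [neg_abs_le x, le_abs_self x, abs_nonneg x₀]
  have hd : ∀ {q q1 : ℝ → ℝ}, (∀ x, HasDerivAt q (q1 x) x) →
      (∀ x, HasDerivAt q1 (q x - f (q x)) x) → ∀ x, HasDerivAt (fun x => (q x, q1 x))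
        ((fun p : ℝ × ℝ => (p.2, p.1 - f p.1)) (q x, q1 x)) x := fun h h' x =>
    (h x).prodMk (h' x)
  have hqd := hd hq hq1
  have hud := hd hu hu1
  have hbd : ∀ g : ℝ → ℝ × ℝ, Continuous g → ∃ r, ∀ y ∈ Set.Ioo (-T) T, ‖g y‖ ≤ r := fun g hg => by
    obtain ⟨r, hr⟩ := (isCompact_Icc (a := -T) (b := T)).exists_bound_of_continuousOn hg.continuousOn
    exact ⟨r, fun y hy => hr y (Set.Ioo_subset_Icc_self hy)⟩
  obtain ⟨r1, hr1⟩ := hbd _ (continuous_iff_continuousAt.2 fun x => (hqd x).continuousAt)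
  obtain ⟨r2, hr2⟩ := hbd _ (continuous_iff_continuousAt.2 fun x => (hud x).continuousAt)
  have hv : ContDiff ℝ 1 (fun p : ℝ × ℝ => (p.2, p.1 - f p.1)) :=
    contDiff_snd.prodMk (contDiff_fst.sub (hf.comp contDiff_fst))
  obtain ⟨K, hK⟩ := hv.contDiffOn.exists_lipschitzOnWith (s := Metric.closedBall 0 (max r1 r2))
    one_ne_zero (convex_closedBall _ _) (isCompact_closedBall _ _)
  have := ODE_solution_unique_of_mem_Ioo (v := fun _ => fun p : ℝ × ℝ => (p.2, p.1 - f p.1))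
    (s := fun _ => Metric.closedBall 0 (max r1 r2)) (K := K) (fun _ _ => hK) hx0
    (fun t ht => ⟨hqd t, mem_closedBall_zero_iff.2 ((hr1 t ht).trans (le_max_left _ _))⟩)
    (fun t ht => ⟨hud t, mem_closedBall_zero_iff.2 ((hr2 t ht).trans (le_max_right _ _))⟩)
    (Prod.ext h0 h1) hx
  exact congrArg Prod.fst this

theorem exists_lt_of_integrable {g : ℝ → ℝ} (hg : Integrable g) {ε : ℝ} (hε : 0 < ε) :
    ∃ x, 0 < x ∧ g x < ε := by
  by_contra! h
  have h1 : IntegrableOn (fun _ : ℝ => ε) (Set.Ioi (0:ℝ)) := by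
    refine Integrable.mono' hg.integrableOn aestronglyMeasurable_const ?_
    refine (ae_restrict_iff' measurableSet_Ioi).2 (ae_of_all _ fun x hx => ?_)
    rw [Real.norm_eq_abs, abs_of_pos hε]
    exact h x hx
  rw [integrableOn_const_iff] at h1
  simp [hε.ne'] at h1

namespace Profile

variable {f Q Q1 : ℝ → ℝ}

theorem isSoliton (h : Profile f Q Q1) : IsSoliton f Q := by
  have c3 := h.contDiff_nat
  have hQ := h.cls_Q c3
  have hQ1 := h.cls_Q1 c3
  have sq : ∀ {g : ℝ → ℝ}, Cls 1 0 g → MemLp g 2 volume := fun {g} hg => by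
    rw [memLp_two_iff_integrable_sq hg.continuous.aestronglyMeasurable]
    have := (hg.mul hg).integrable (by norm_num)
    simpa only [← _root_.sq] using this
  refine ⟨hQ.contDiff.of_le (by norm_num), h.pos, h.even, sq (hQ.of_le (by omega)), ?_, fun x => ?_⟩
  · rw [h.deriv_Q]; exact sq (hQ1.of_le (by omega))
  · rw [h.deriv_Q, (h.d2 x).deriv]; ring

theorem lt_zero (h : Profile f Q Q1) {x : ℝ} (hx : 0 < x) : Q x < Q 0 := by
  have := strictAntiOn_of_deriv_neg (convex_Ici (0:ℝ)) h.continuous_Q.continuousOn (fun y hy => by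
    rw [interior_Ici] at hy
    rw [h.deriv_Q]
    exact h.neg y hy)
  exact this (Set.mem_Ici.2 le_rfl) (Set.mem_Ici.2 hx.le) hx

end Profile

/-- Integrability forces zero energy, and `s² - 2F(s)` is positive on `(0, m)`, so `q'(0) = 0` gives
`q(0) ≥ m`. As `q` is small somewhere, it takes the value `m` at some `x₁ ≥ 0`, where zero energy
gives `q' = 0`. Uniqueness for the Cauchy problem makes `q` the translate by `x₁` of the constructed
profile, which is strictly decreasing on the right; `q(0) ≥ m` then forces `x₁ = 0`. -/
theorem Realizes.profile_of_isSoliton {f q : ℝ → ℝ} {m g₁ : ℝ} {dg dk ζ : Bd}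
    (hr : Realizes f m g₁ dg dk ζ) (hq : IsSoliton f q) :
    Profile f q (deriv q) ∧ q 0 = m := by
  obtain ⟨P, P1, hP, hP0⟩ := hr.exists_profile
  have hfc : Continuous f := hr.f3.continuous
  have hd0 : ∀ x, HasDerivAt q (deriv q x) x := fun x =>
    (hq.contDiff.differentiable (by norm_num) x).hasDerivAt
  have hd1 : ∀ x, HasDerivAt (deriv q) (q x - f (q x)) x := fun x => by
    have h1 : ContDiff ℝ 1 (deriv q) := hq.contDiff.deriv'
    refine (h1.differentiable (by norm_num) x).hasDerivAt.congr_deriv ?_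
    linarith [hq.eqn x]
  have hc0 : Continuous q := hq.contDiff.continuous
  have hq10 : deriv q 0 = 0 := odd_zero (odd_deriv_of_even hd0 hq.even)
  set H : ℝ → ℝ → ℝ := fun a b => b ^ 2 - a ^ 2 + 2 * prim f a with hH
  have hconst : ∀ x y, H (q x) (deriv q x) = H (q y) (deriv q y) := by
    have hd : ∀ x, HasDerivAt (fun x => H (q x) (deriv q x)) 0 x := fun x => by
      refine ((((hd1 x).fun_pow 2).sub ((hd0 x).fun_pow 2)).add
        (((hasDerivAt_prim hfc (q x)).comp x (hd0 x)).const_mul 2)).congr_deriv ?_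
      push_cast
      ring
    exact is_const_of_deriv_eq_zero (fun x => (hd x).differentiableAt) fun x => (hd x).deriv
  have hint : Integrable fun x => q x ^ 2 + deriv q x ^ 2 :=
    ((memLp_two_iff_integrable_sq hq.memLp.1).1 hq.memLp).add
      ((memLp_two_iff_integrable_sq hq.memLp_deriv.1).1 hq.memLp_deriv)
  have hE0 : ∀ x, deriv q x ^ 2 = q x ^ 2 - 2 * prim f (q x) := fun x => by
    have hHc : Continuous fun p : ℝ × ℝ => H p.1 p.2 := by
      have : Continuous (prim f) := continuous_iff_continuousAt.2 fun s =>
        (hasDerivAt_prim hfc s).continuousAt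
      simp only [hH]
      fun_prop
    have h1 : |H (q x) (deriv q x)| ≤ 0 := by
      -- The energy is constant and continuous in `(q, q')`, and integrability of `q² + q'²`
      -- provides points where this pair is arbitrarily close to zero.
      refine le_of_forall_pos_lt_add fun η hη => ?_
      obtain ⟨δ, hδ, h2⟩ := Metric.continuousAt_iff.1 (hHc.continuousAt (x := (0, 0))) η hη
      obtain ⟨y, -, hy⟩ := exists_lt_of_integrable hint (pow_pos hδ 2)
      have h3 := h2 (x := (q y, deriv q y)) (by
        rw [Prod.dist_eq, max_lt_iff, Real.dist_eq, Real.dist_eq, sub_zero, sub_zero]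
        exact ⟨abs_lt_of_sq_lt_sq (by nlinarith [sq_nonneg (deriv q y)]) hδ.le,
          abs_lt_of_sq_lt_sq (by nlinarith [sq_nonneg (q y)]) hδ.le⟩)
      simp only [hH, prim_zero, Real.dist_eq] at h3
      rw [hconst x y]
      simpa [hH] using h3
    have := abs_nonpos_iff.1 h1
    simp only [hH] at this
    linarith
  have hm := hr.hm
  have hge : m ≤ q 0 := by
    by_contra! hlt
    have hpos := hq.pos 0
    have h1 : q 0 / m < 1 := (div_lt_one hm).2 hlt
    have h2 : 0 < 1 - q 0 / m := by linarith
    have h3 : √(1 - q 0 / m) ∈ Set.Ioo (0:ℝ) 1 := ⟨Real.sqrt_pos.2 h2, by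
      rw [Real.sqrt_lt' one_pos]
      have : 0 < q 0 / m := div_pos hpos hm
      linarith⟩
    have h4 := hr.hk ⟨_, h3⟩
    obtain ⟨δ, hδ, h5⟩ := hr.hR
    have h6 := h5 ⟨_, h3⟩
    simp only [Real.sq_sqrt h2.le] at h4 h6
    rw [show m * (1 - (1 - q 0 / m)) = q 0 by field_simp; ring, ← hE0, hq10] at h4
    have : 0 < q 0 ^ 2 * ((1 - q 0 / m) * (1 + (1 - (1 - q 0 / m)) * dk ⟨_, h3⟩)) :=
      mul_pos (pow_pos hpos 2) (mul_pos h2 (hδ.trans_le h6))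
    rw [← h4] at this
    norm_num at this
  obtain ⟨X, hX, hXlt⟩ := exists_lt_of_integrable hint (pow_pos hm 2)
  have hqX : q X ≤ m := (abs_le_of_sq_le_sq' (by nlinarith [sq_nonneg (deriv q X)]) hm.le).2
  obtain ⟨x₁, ⟨hx₁, -⟩, hqx₁⟩ := intermediate_value_Icc' hX.le hc0.continuousOn ⟨hqX, hge⟩
  have hq1x₁ : deriv q x₁ = 0 := by
    have := hE0 x₁
    rw [hqx₁, hr.Fm, sub_self] at this
    exact pow_eq_zero_iff two_ne_zero |>.1 this
  have hsh : ∀ x, HasDerivAt (fun x => P (x - x₁)) (P1 (x - x₁)) x := fun x =>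
    ((hP.d1 (x - x₁)).comp_sub_const x x₁)
  have hsh1 : ∀ x, HasDerivAt (fun x => P1 (x - x₁)) (P (x - x₁) - f (P (x - x₁))) x := fun x =>
    ((hP.d2 (x - x₁)).comp_sub_const x x₁)
  have heq : ∀ x, q x = P (x - x₁) := ode_unique (hr.f3.of_le (by norm_num)) hd0 hd1 hsh hsh1
    (x₀ := x₁) (by simp only [sub_self]; rw [hqx₁, hP0])
    (by simp only [sub_self]; rw [hq1x₁, hP.Q1_zero])
  have hx10 : x₁ = 0 := by
    by_contra hne
    have h1 : 0 < x₁ := lt_of_le_of_ne hx₁ (Ne.symm hne)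
    have h2 := hP.lt_zero h1
    have h3 := heq 0
    rw [zero_sub, hP.even] at h3
    linarith
  have hqP : q = P := funext fun x => by rw [heq, hx10, sub_zero]
  rw [hqP, hP.deriv_Q]
  exact ⟨hP, hP0⟩


/-! ### Integral operators on bounded functions on `(0, 1)` -/

namespace Bd

theorem one_sub_sq_pos {t : ℝ} (h : t ∈ Set.Ioo (0:ℝ) 1) : 0 < 1 - t ^ 2 := by
  nlinarith [h.1, h.2]

/-- The coordinate function. -/
noncomputable def tt : Bd := BoundedContinuousFunction.ofNormedAddCommGroup (fun t => (t:ℝ))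
  continuous_subtype_val 1 fun t => by rw [Real.norm_eq_abs, abs_of_pos t.2.1]; exact t.2.2.le

/-- The function `√(1 - t²)`. -/
noncomputable def ss : Bd := BoundedContinuousFunction.ofNormedAddCommGroup
  (fun t => √(1 - (t:ℝ) ^ 2)) (by fun_prop) 1 fun t => by
    rw [Real.norm_eq_abs, abs_of_nonneg (Real.sqrt_nonneg _), Real.sqrt_le_one]
    nlinarith [t.2.1]

@[simp] theorem tt_apply (t : Set.Ioo (0:ℝ) 1) : tt t = t := rfl

@[simp] theorem ss_apply (t : Set.Ioo (0:ℝ) 1) : ss t = √(1 - (t:ℝ) ^ 2) := rfl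

/-- The function `1 - t²`. -/
noncomputable def yy : Bd := 1 - tt * tt

@[simp] theorem yy_apply (t : Set.Ioo (0:ℝ) 1) : yy t = 1 - (t:ℝ) ^ 2 := by
  simp [yy, sq]

theorem ss_mul_ss : ss * ss = yy := by
  ext t
  rw [BoundedContinuousFunction.mul_apply, ss_apply, yy_apply,
    Real.mul_self_sqrt (one_sub_sq_pos t.2).le]

theorem ext_add (g h : Bd) (t : ℝ) : ext (g + h) t = ext g t + ext h t := by
  by_cases ht : t ∈ Set.Ioo (0:ℝ) 1
  · simp [ext_of_mem _ ht]
  · simp [ext_of_notMem _ ht]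

theorem ext_smul (c : ℝ) (g : Bd) (t : ℝ) : ext (c • g) t = c * ext g t := by
  by_cases ht : t ∈ Set.Ioo (0:ℝ) 1
  · simp [ext_of_mem _ ht]
  · simp [ext_of_notMem _ ht]

theorem aestronglyMeasurable_ext (g : Bd) : AEStronglyMeasurable (ext g) volume := by
  have h1 := (continuousOn_ext g).aestronglyMeasurable (μ := volume) measurableSet_Ioo
  have h2 : (Set.Ioo (0:ℝ) 1).indicator (ext g) = ext g := by
    funext t
    by_cases ht : t ∈ Set.Ioo (0:ℝ) 1
    · rw [Set.indicator_of_mem ht]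
    · rw [Set.indicator_of_notMem ht, ext_of_notMem _ ht]
  rw [← h2]
  exact (aestronglyMeasurable_indicator_iff measurableSet_Ioo).2 h1

/-- The primitive of `g / (1 - t²)`. -/
noncomputable def pr (g : Bd) (t : ℝ) : ℝ := ∫ τ in (0:ℝ)..t, ext g τ / (1 - τ ^ 2)

theorem intervalIntegrable_pr (g : Bd) {t : ℝ} (h0 : 0 ≤ t) (h1 : t < 1) :
    IntervalIntegrable (fun τ => ext g τ / (1 - τ ^ 2)) volume 0 t := by
  have hc : ContinuousOn (fun τ : ℝ => (1 - τ ^ 2)⁻¹) (Set.uIcc 0 t) := by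
    refine ContinuousOn.inv₀ (by fun_prop) fun x hx => ?_
    rw [Set.uIcc_of_le h0] at hx
    nlinarith [hx.1, hx.2]
  have hg : IntervalIntegrable (ext g) volume 0 t := by
    rw [intervalIntegrable_iff]
    exact Measure.integrableOn_of_bounded (M := ‖g‖) (by simp) (aestronglyMeasurable_ext g)
      (ae_of_all _ fun x => abs_ext_le g x)
  simpa only [div_eq_mul_inv] using hg.mul_continuousOn hc

theorem pr_zero (g : Bd) : pr g 0 = 0 := intervalIntegral.integral_same

theorem pr_add (g h : Bd) {t : ℝ} (h0 : 0 ≤ t) (h1 : t < 1) : pr (g + h) t = pr g t + pr h t := by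
  rw [pr, pr, pr, ← intervalIntegral.integral_add (intervalIntegrable_pr g h0 h1)
    (intervalIntegrable_pr h h0 h1)]
  simp only [ext_add, add_div]

theorem pr_smul (c : ℝ) (g : Bd) (t : ℝ) : pr (c • g) t = c * pr g t := by
  rw [pr, pr, ← intervalIntegral.integral_const_mul]
  simp only [ext_smul, mul_div_assoc]

theorem hasDerivAt_pr (g : Bd) (t : Set.Ioo (0:ℝ) 1) :
    HasDerivAt (pr g) (g t / (1 - (t:ℝ) ^ 2)) t := by
  have hy := (one_sub_sq_pos t.2).ne'
  have := intervalIntegral.integral_hasDerivAt_right (intervalIntegrable_pr g t.2.1.le t.2.2)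
    (((aestronglyMeasurable_ext g).mul (by fun_prop : Measurable fun τ : ℝ =>
      (1 - τ ^ 2)⁻¹).aestronglyMeasurable).stronglyMeasurableAtFilter)
    ((continuousAt_ext g t.2).div (by fun_prop) hy)
  refine this.congr_deriv ?_
  rw [ext_of_mem g t.2]

theorem continuousOn_pr (g : Bd) : ContinuousOn (pr g) (Set.Ico 0 1) := by
  intro t ht
  rcases eq_or_lt_of_le ht.1 with h | h
  · have h2 : IntegrableOn (fun τ => ext g τ / (1 - τ ^ 2)) (Set.uIcc 0 (1/2)) volume := by
      rw [Set.uIcc_of_le (by norm_num), integrableOn_Icc_iff_integrableOn_Ioc]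
      exact (intervalIntegrable_iff_integrableOn_Ioc_of_le (by norm_num)).1
        (intervalIntegrable_pr g (by norm_num) (by norm_num))
    have h1 := intervalIntegral.continuousOn_primitive_interval h2
    rw [Set.uIcc_of_le (by norm_num)] at h1
    subst h
    refine (h1 0 (by norm_num)).mono_of_mem_nhdsWithin ?_
    refine mem_nhdsWithin.2 ⟨Set.Iio (1/2), isOpen_Iio, by norm_num, fun x hx => ⟨hx.2.1, ?_⟩⟩
    exact le_of_lt hx.1
  · exact (hasDerivAt_pr g ⟨t, h, ht.2⟩).continuousAt.continuousWithinAt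

/-- Comparison principle: `ψ - pr g` and `ψ + pr g` are nondecreasing. The bounds of the operators
below differ only in the choice of `ψ`. -/
theorem abs_pr_sub_le (g : Bd) {ψ ψ' : ℝ → ℝ} (hψ : ∀ t ∈ Set.Ico (0:ℝ) 1, HasDerivAt ψ (ψ' t) t)
    (hb : ∀ t : Set.Ioo (0:ℝ) 1, |g t| ≤ ψ' t * (1 - (t:ℝ) ^ 2)) {t t' : ℝ} (ht : 0 ≤ t)
    (htt : t ≤ t') (ht' : t' < 1) : |pr g t' - pr g t| ≤ ψ t' - ψ t := by
  have hψc : ContinuousOn ψ (Set.Ico 0 1) := fun t ht => (hψ t ht).continuousAt.continuousWithinAt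
  have hm : ∀ e : ℝ, |e| = 1 → MonotoneOn (fun t => ψ t - e * pr g t) (Set.Ico 0 1) := fun e he => by
    refine monotoneOn_of_deriv_nonneg (convex_Ico 0 1)
      (hψc.sub ((continuousOn_pr g).const_smul e)) ?_ ?_ <;> rw [interior_Ico] <;> intro x hx
    · exact ((hψ x (Set.Ioo_subset_Ico_self hx)).sub
        ((hasDerivAt_pr g ⟨x, hx⟩).const_mul e)).differentiableAt.differentiableWithinAt
    · rw [show deriv (fun t => ψ t - e * pr g t) x = _ from ((hψ x (Set.Ioo_subset_Ico_self hx)).sub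
        ((hasDerivAt_pr g ⟨x, hx⟩).const_mul e)).deriv]
      have h1 := hb ⟨x, hx⟩
      have h2 := one_sub_sq_pos hx
      have h3 : |e * (g ⟨x, hx⟩ / (1 - x ^ 2))| ≤ ψ' x := by
        rw [abs_mul, he, one_mul, abs_div, abs_of_pos h2, div_le_iff₀ h2]
        exact h1
      linarith [le_abs_self (e * (g ⟨x, hx⟩ / (1 - x ^ 2)))]
  have h1 := hm 1 abs_one ⟨ht, htt.trans_lt ht'⟩ ⟨ht.trans htt, ht'⟩ htt
  have h2 := hm (-1) (by simp) ⟨ht, htt.trans_lt ht'⟩ ⟨ht.trans htt, ht'⟩ htt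
  simp only at h1 h2
  rw [abs_le]
  constructor <;> linarith

/-- `t/√(1 - t²)` is a primitive of `(1 - t²)^(-3/2)`. The integrand `1/(1 - t²)` alone would give a
logarithm; half a power of `1 - t²` is given up to absorb it, so that `wop` is bounded. -/
theorem abs_pr_le (g : Bd) (t : Set.Ioo (0:ℝ) 1) :
    |pr g t| ≤ ‖g‖ * (t / √(1 - (t:ℝ) ^ 2)) := by
  have h := abs_pr_sub_le g (ψ := fun t => ‖g‖ * (t / √(1 - t ^ 2)))
    (ψ' := fun t => ‖g‖ * (1 / (√(1 - t ^ 2) * (1 - t ^ 2)))) (fun t ht => ?_) (fun t => ?_)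
    le_rfl t.2.1.le t.2.2
  · simpa [pr_zero] using h
  · have hy : 0 < 1 - t ^ 2 := by nlinarith [ht.1, ht.2]
    have hs := Real.sqrt_pos.2 hy
    have h2 := ((hasDerivAt_id t).div ((((hasDerivAt_id t).fun_pow 2).const_sub 1).sqrt hy.ne')
      hs.ne').const_mul ‖g‖
    refine h2.congr_deriv ?_
    have e := Real.sq_sqrt hy.le
    simp only [id]
    field_simp
    rw [e]
    ring
  · have hy := one_sub_sq_pos t.2
    have hs := Real.sqrt_pos.2 hy
    have hs1 : √(1 - (t:ℝ) ^ 2) ≤ 1 := by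
      rw [Real.sqrt_le_one]; nlinarith [t.2.1]
    rw [mul_assoc, one_div_mul_eq_div, div_mul_cancel_right₀ hy.ne']
    exact (g.norm_coe_le_norm t).trans (le_mul_of_one_le_right (norm_nonneg _)
      ((one_le_inv₀ hs).2 hs1))

theorem abs_pr_yy_le (g : Bd) (t : Set.Ioo (0:ℝ) 1) : |pr (yy * g) t| ≤ ‖g‖ * t := by
  have h := abs_pr_sub_le (yy * g) (ψ := fun t => ‖g‖ * t) (ψ' := fun _ => ‖g‖)
    (fun t ht => by simpa using (hasDerivAt_id t).const_mul ‖g‖) (fun t => ?_) le_rfl t.2.1.le t.2.2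
  · simpa [pr_zero] using h
  · rw [BoundedContinuousFunction.mul_apply, yy_apply, abs_mul, abs_of_pos (one_sub_sq_pos t.2),
      mul_comm]
    exact mul_le_mul_of_nonneg_right (g.norm_coe_le_norm t) (one_sub_sq_pos t.2).le

theorem abs_pr_yy_sq_sub_le (g : Bd) {t t' : ℝ} (ht : 0 ≤ t) (htt : t ≤ t') (ht' : t' < 1) :
    |pr (yy * (yy * g)) t' - pr (yy * (yy * g)) t| ≤ ‖g‖ * (1 - t) ^ 2 := by
  have h := abs_pr_sub_le (yy * (yy * g)) (ψ := fun t => -(‖g‖ * (1 - t) ^ 2))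
    (ψ' := fun t => ‖g‖ * (2 * (1 - t)))
    (fun t ht => by
      refine (((((hasDerivAt_id t).const_sub 1).fun_pow 2).const_mul ‖g‖).neg).congr_deriv ?_
      simp) (fun t => ?_) ht htt ht'
  · have := mul_nonneg (norm_nonneg g) (sq_nonneg (1 - t'))
    linarith
  · have hy := one_sub_sq_pos t.2
    rw [BoundedContinuousFunction.mul_apply, BoundedContinuousFunction.mul_apply, yy_apply, abs_mul,
      abs_mul, abs_of_pos hy, mul_comm]
    refine mul_le_mul_of_nonneg_right ?_ hy.le
    rw [mul_comm]
    exact mul_le_mul (g.norm_coe_le_norm t) (by nlinarith [t.2.1, t.2.2]) hy.le (norm_nonneg _)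

/-- Operators given by bounded kernels. -/
noncomputable def mkOp (P : Bd → ℝ → ℝ) (hadd : ∀ g h, ∀ t ∈ Set.Ioo (0:ℝ) 1,
    P (g + h) t = P g t + P h t) (hsmul : ∀ (c : ℝ) g, ∀ t ∈ Set.Ioo (0:ℝ) 1, P (c • g) t = c * P g t)
    (hc : ∀ g, ContinuousOn (P g) (Set.Ioo 0 1))
    (hb : ∀ g, ∀ t ∈ Set.Ioo (0:ℝ) 1, |P g t| ≤ ‖g‖) : Bd →L[ℝ] Bd :=
  LinearMap.mkContinuous
    { toFun := fun g => BoundedContinuousFunction.ofNormedAddCommGroup (fun t => P g t)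
        (continuousOn_iff_continuous_domRestrict.1 (hc g)) ‖g‖ fun t => hb g t t.2
      map_add' := fun g h => by ext t; exact hadd g h t t.2
      map_smul' := fun c g => by ext t; exact hsmul c g t t.2 } 1 fun g => by
    rw [one_mul]
    exact BoundedContinuousFunction.norm_ofNormedAddCommGroup_le _ (norm_nonneg g)
      (fun t : Set.Ioo (0:ℝ) 1 => hb g t t.2)

theorem continuousOn_pr' (g : Bd) : ContinuousOn (pr g) (Set.Ioo 0 1) :=
  (continuousOn_pr g).mono Set.Ioo_subset_Ico_self

/-- The operator `g ↦ (√(1 - t²) / t) ∫₀ᵗ g / (1 - τ²)`. -/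
noncomputable def wop : Bd →L[ℝ] Bd :=
  mkOp (fun g t => √(1 - t ^ 2) / t * pr g t)
    (fun g h t ht => by rw [pr_add g h ht.1.le ht.2]; ring)
    (fun c g t ht => by rw [pr_smul]; ring)
    (fun g => (((by fun_prop : Continuous fun t : ℝ => √(1 - t ^ 2)).continuousOn.div
      continuousOn_id fun t ht => ht.1.ne').mul (continuousOn_pr' g)))
    (fun g t ht => by
      have h := abs_pr_le g ⟨t, ht⟩
      have hs := Real.sqrt_pos.2 (one_sub_sq_pos ht)
      have ht0 := ht.1
      rw [abs_mul, abs_of_pos (div_pos hs ht0)]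
      refine (mul_le_mul_of_nonneg_left h (div_pos hs ht0).le).trans (le_of_eq ?_)
      field_simp)

theorem wop_apply (g : Bd) (t : Set.Ioo (0:ℝ) 1) :
    wop g t = √(1 - (t:ℝ) ^ 2) / t * pr g t := rfl

/-- The average on `(0, t)`. -/
noncomputable def avg : Bd →L[ℝ] Bd :=
  mkOp (fun g t => 1 / t * pr (yy * g) t)
    (fun g h t ht => by rw [mul_add yy, pr_add _ _ ht.1.le ht.2]; ring)
    (fun c g t ht => by rw [mul_smul_comm, pr_smul]; ring)
    (fun g => ((continuousOn_const.div continuousOn_id fun t ht => ht.1.ne').mul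
      (continuousOn_pr' _)))
    (fun g t ht => by
      have h := abs_pr_yy_le g ⟨t, ht⟩
      have ht0 := ht.1
      rw [abs_mul, abs_of_pos (one_div_pos.2 ht0)]
      refine (mul_le_mul_of_nonneg_left h (one_div_pos.2 ht0).le).trans (le_of_eq ?_)
      field_simp)

theorem avg_apply (g : Bd) (t : Set.Ioo (0:ℝ) 1) : avg g t = 1 / t * pr (yy * g) t := rfl

theorem integrableOn_arcsin :
    IntervalIntegrable (fun t : ℝ => 1 / √(1 - t ^ 2)) volume 0 1 := by
  rw [intervalIntegrable_iff_integrableOn_Ioc_of_le zero_le_one]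
  exact intervalIntegral.integrableOn_deriv_of_nonneg Real.continuous_arcsin.continuousOn
    (fun t ht => Real.hasDerivAt_arcsin (by linarith [ht.1]) (by linarith [ht.2]))
    (fun t _ => by positivity)

theorem intervalIntegrable_int (g : Bd) :
    IntervalIntegrable (fun t : ℝ => ext g t * (1 / √(1 - t ^ 2))) volume 0 1 := by
  refine (integrableOn_arcsin.const_mul ‖g‖).mono_fun
    ((aestronglyMeasurable_ext g).mul (by fun_prop : Measurable fun t : ℝ =>
      1 / √(1 - t ^ 2)).aestronglyMeasurable).restrict (ae_of_all _ fun t => ?_)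
  simp only [norm_mul, norm_norm]
  exact mul_le_mul_of_nonneg_right (abs_ext_le g t) (norm_nonneg _)

/-- The functional `g ↦ ∫₀¹ g / √(1 - t²)`. -/
noncomputable def int : Bd →L[ℝ] ℝ :=
  LinearMap.mkContinuous
    { toFun := fun g => ∫ t in (0:ℝ)..1, ext g t * (1 / √(1 - t ^ 2))
      map_add' := fun g h => by
        rw [← intervalIntegral.integral_add (intervalIntegrable_int g) (intervalIntegrable_int h)]
        simp only [ext_add, add_mul]
      map_smul' := fun c g => by
        simp only [ext_smul, mul_assoc]
        rw [intervalIntegral.integral_const_mul]; rfl }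
    (∫ t in (0:ℝ)..1, 1 / √(1 - t ^ 2)) fun g => by
    refine (intervalIntegral.norm_integral_le_of_norm_le zero_le_one (ae_of_all _ fun t _ => ?_)
      (integrableOn_arcsin.const_mul ‖g‖)).trans (le_of_eq ?_)
    · rw [norm_mul, Real.norm_of_nonneg (by positivity : 0 ≤ 1 / √(1 - t ^ 2))]
      exact mul_le_mul_of_nonneg_right (abs_ext_le g t) (by positivity)
    · rw [intervalIntegral.integral_const_mul, mul_comm]

theorem int_apply (g : Bd) : int g = ∫ t in (0:ℝ)..1, ext g t * (1 / √(1 - t ^ 2)) := rfl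

theorem tendsto_pr (g : Bd) : Tendsto (pr (ss * g)) (𝓝[<] 1) (𝓝 (int g)) := by
  have h := (intervalIntegral.continuousOn_primitive_interval
    ((intervalIntegrable_iff').1 (intervalIntegrable_int g))) 1 Set.right_mem_uIcc
  have h2 := h.tendsto.mono_left (nhdsWithin_mono (s := Set.Ioo (0:ℝ) 1) 1 (by
    rw [Set.uIcc_of_le zero_le_one]; exact Set.Ioo_subset_Icc_self))
  rw [nhdsWithin_Ioo_eq_nhdsLT zero_lt_one] at h2
  rw [int_apply]
  refine h2.congr' ?_
  filter_upwards [Ioo_mem_nhdsLT (zero_lt_one (α := ℝ))] with t ht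
  rw [pr]
  refine intervalIntegral.integral_congr fun τ hτ => ?_
  rw [Set.uIcc_of_le ht.1.le] at hτ
  rcases eq_or_lt_of_le hτ.1 with h0 | h0
  · rw [← h0, ext_of_notMem _ (by simp), ext_of_notMem _ (by simp)]; simp
  · have hm : τ ∈ Set.Ioo (0:ℝ) 1 := ⟨h0, hτ.2.trans_lt ht.2⟩
    have hy := one_sub_sq_pos hm
    have hs := Real.sqrt_pos.2 hy
    rw [ext_of_mem _ hm, ext_of_mem _ hm, BoundedContinuousFunction.mul_apply, ss_apply]
    have e := Real.sq_sqrt hy.le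
    field_simp
    rw [e]

theorem tendsto_pr_yy (g : Bd) : Tendsto (pr (yy * g)) (𝓝[<] 1) (𝓝 (int (ss * g))) := by
  rw [← ss_mul_ss, mul_assoc]
  exact tendsto_pr _

/-- The operator `g ↦ (1 - t²)⁻² ∫ₜ¹ (1 - τ²) g`. -/
noncomputable def tail : Bd →L[ℝ] Bd :=
  mkOp (fun g t => 1 / (1 - t ^ 2) ^ 2 * (int (ss * (yy * g)) - pr (yy * (yy * g)) t))
    (fun g h t ht => by
      simp only [mul_add yy, mul_add ss]
      rw [pr_add _ _ ht.1.le ht.2, map_add]; ring)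
    (fun c g t ht => by
      simp only [mul_smul_comm]
      rw [pr_smul, map_smul, smul_eq_mul]; ring)
    (fun g => ((continuousOn_const.div (by fun_prop) fun t ht =>
      (pow_pos (one_sub_sq_pos ht) 2).ne').mul (continuousOn_const.sub (continuousOn_pr' _))))
    (fun g t ht => by
      have h1 := ((tendsto_pr_yy (yy * g)).sub_const (pr (yy * (yy * g)) t)).abs
      have h2 : |int (ss * (yy * g)) - pr (yy * (yy * g)) t| ≤ ‖g‖ * (1 - t) ^ 2 := by
        refine le_of_tendsto h1 ?_
        filter_upwards [Ioo_mem_nhdsLT ht.2] with t' ht'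
        exact abs_pr_yy_sq_sub_le g ht.1.le ht'.1.le ht'.2
      have hy := pow_pos (one_sub_sq_pos ht) 2
      rw [abs_mul, abs_of_pos (one_div_pos.2 hy), one_div_mul_eq_div, div_le_iff₀ hy]
      refine h2.trans (mul_le_mul_of_nonneg_left ?_ (norm_nonneg _))
      exact pow_le_pow_left₀ (by linarith [ht.2]) (by nlinarith [ht.1, ht.2]) 2)

theorem tail_apply (g : Bd) (t : Set.Ioo (0:ℝ) 1) : tail g t =
    1 / (1 - (t:ℝ) ^ 2) ^ 2 * (int (ss * (yy * g)) - pr (yy * (yy * g)) t) := rfl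

end Bd


/-! ### The defect as a functional of the nonlinearity -/

/-- The space of data `(m, g₁, dg, dk, ζ)`. -/
abbrev Dat := ℝ × ℝ × Bd × Bd × Bd

namespace Bd

/-- `R` is bounded below by a positive constant. -/
def Pos (R : Bd) : Prop := ∃ δ : ℝ, 0 < δ ∧ ∀ t, δ ≤ R t

open Classical in
/-- The inverse square root. -/
noncomputable def rs (R : Bd) : Bd :=
  if h : Pos R then BoundedContinuousFunction.ofNormedAddCommGroup (fun t => 1 / √(R t))
    (continuous_const.div (Real.continuous_sqrt.comp R.continuous) fun t => by
      obtain ⟨δ, hδ, h⟩ := h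
      exact (Real.sqrt_pos.2 (hδ.trans_le (h t))).ne') (1 / √h.choose) fun t => by
    rw [Real.norm_of_nonneg (by positivity)]
    exact div_le_div_of_nonneg_left zero_le_one (Real.sqrt_pos.2 h.choose_spec.1)
      (Real.sqrt_le_sqrt (h.choose_spec.2 t))
  else 0

theorem rs_apply {R : Bd} (h : Pos R) (t : Set.Ioo (0:ℝ) 1) : rs R t = 1 / √(R t) := by
  rw [rs, dif_pos h]; rfl

theorem Pos.pos {R : Bd} (h : Pos R) (t : Set.Ioo (0:ℝ) 1) : 0 < R t := by
  obtain ⟨δ, hδ, h⟩ := h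
  exact hδ.trans_le (h t)

theorem rs_pos {R : Bd} (h : Pos R) (t : Set.Ioo (0:ℝ) 1) : 0 < rs R t := by
  rw [rs_apply h]
  exact one_div_pos.2 (Real.sqrt_pos.2 (h.pos t))

theorem rs_sq_mul {R : Bd} (h : Pos R) (t : Set.Ioo (0:ℝ) 1) : rs R t ^ 2 * R t = 1 := by
  rw [rs_apply h, div_pow, one_pow, Real.sq_sqrt (h.pos t).le, one_div_mul_cancel (h.pos t).ne']

end Bd

namespace Dat

open Bd

/-- The quotient `f(s) / s²`. -/
noncomputable def gg (D : Dat) : Bd := D.2.1 • 1 - tt * tt * D.2.2.1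

/-- The renormalized energy `(s² - 2 F(s)) / (s t)²`. -/
noncomputable def rr (D : Dat) : Bd := 1 + yy * D.2.2.2.1

/-- The weight `R^{-1/2}`. -/
noncomputable def rho (D : Dat) : Bd := rs (rr D)

/-- The value `A(0) / Q(0)`. -/
noncomputable def lam (D : Dat) (c a : ℝ) : ℝ := (c * D.2.1 - a / 2) / (1 - D.1 * D.2.1)

/-- The derivative of `(A - λ Q) / Q'`. -/
noncomputable def omg (D : Dat) (c a : ℝ) : Bd :=
  (a - lam D c a) • 1 + rho D * rho D * (c • D.2.2.1 + (lam D c a * D.1) • (gg D + D.2.2.1))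

/-- The density of `∫ (A (3 Q - 2 f(Q)) + a Q f(Q))`. -/
noncomputable def qq (D : Dat) (c a : ℝ) : Bd :=
  (2 * D.1 ^ 2) • (rho D * (lam D c a • ((3:ℝ) • 1 - (2 * D.1) • (yy * gg D)) +
    (a * D.1) • (yy * gg D) - omg D c a * ((1 / 2 : ℝ) • 1 + tt * tt * rr D)))

/-- The integral `∫₀^∞ (A (3 Q - 2 f(Q)) + a Q f(Q))`. -/
noncomputable def jj (D : Dat) (c a : ℝ) : ℝ := int (ss * (yy * qq D c a))

/-- The coefficient `a_{1,0}`. -/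
noncomputable def acoef (D : Dat) : ℝ := -jj D 1 0 / jj D 0 1

/-- The function `(A - λ Q) / Q' * √(1 - t²) / t`. -/
noncomputable def ww (D : Dat) (a : ℝ) : Bd := wop ((2:ℝ) • (rho D * omg D 1 a))

/-- The density of `b_{1,0}`. -/
noncomputable def xx (D : Dat) (a : ℝ) : Bd :=
  (2 * D.1) • (rho D * ((lam D 1 a + a) • 1 - omg D 1 a))

/-- The coefficient `b_{1,0}`. -/
noncomputable def bb (D : Dat) (a : ℝ) : ℝ := int (ss * xx D a)

/-- The function `A / √(1 - t²)`. -/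
noncomputable def alp (D : Dat) (a : ℝ) : Bd :=
  (lam D 1 a * D.1) • ss - D.1 • (tt * tt * (rho D * rr D) * ww D a)

/-- The function `A' / √(1 - t²)`. -/
noncomputable def alp' (D : Dat) (a : ℝ) : Bd :=
  D.1 • ((1 - D.1 • (yy * gg D)) * (tt * ww D a))
    - D.1 • (ss * tt * (rho D * rr D) * (lam D 1 a • 1 + omg D 1 a))

/-- The function `(P / Q' - ρ M / t) / √(1 - t²)`, where `P = Q' B' - Q'' B`. -/
noncomputable def ups (D : Dat) (a : ℝ) : Bd :=
  ss * (((a - 2 * lam D 1 a) * D.1) • 1 + (1 / D.1) • (rho D * (((2:ℝ) • tt - tt * tt * tt)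
    * tail (qq D 1 a) - avg (yy * qq D 1 a))))
  + D.1 • (rho D * ((1 / 2 : ℝ) • 1 + tt * tt * rr D) * ww D a)

/-- The density of the defect. -/
noncomputable def nn (D : Dat) (a : ℝ) : Bd :=
  (1 / 2 : ℝ) • (ss * D.2.2.2.2 * ((1 + ss * alp D a) * (1 + ss * alp D a) * (1 + ss * alp D a)))
  - alp D a + (2 - 3 / 2 * a) • (ss * (alp D a * alp D a))
  + yy * (alp D a * alp D a * alp D a) - (2 * a * D.1) • ss
  + (3 * a) • (ss * (alp' D a * alp' D a))
  - (3 * a ^ 2 * D.1 ^ 2) • (yy * yy * gg D * alp D a)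
  - (3 / 2 * a ^ 3 * D.1 ^ 2) • (ss * yy)
  + ss * (avg (xx D a) * avg (xx D a) * (1 - D.2.2.2.1 * (rho D * rho D)))
  + (2:ℝ) • (avg (xx D a) * (rho D * ups D a - D.1 • (tt * tt * ww D a)))
  + ss * (ups D a * ups D a - D.1 ^ 2 • (tt * tt * (ww D a * ww D a)))

/-- The defect, for a given value of `a_{1,0}`. -/
noncomputable def dfc (D : Dat) (a : ℝ) : ℝ :=
  int ((2:ℝ) • (rho D * nn D a)) - bb D a ^ 3 / 3 - bb D a ^ 2

/-- The defect. -/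
noncomputable def dd (D : Dat) : ℝ := dfc D (acoef D)

end Dat

/-- The data `D` describe `f`. -/
def Rlz (f : ℝ → ℝ) (D : Dat) : Prop := Realizes f D.1 D.2.1 D.2.2.1 D.2.2.2.1 D.2.2.2.2

/-- The parameter `t` with `Q = m (1 - t²)`. -/
noncomputable def par (Q : ℝ → ℝ) (m x : ℝ) : ℝ := √(1 - Q x / m)

/-! ### The change of variable from `x` to `t` -/

namespace Rlz

open Bd Dat

variable {f Q Q1 : ℝ → ℝ} {D : Dat}

theorem pos_rr (hr : Rlz f D) : Pos (rr D) := by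
  obtain ⟨δ, hδ, h⟩ := hr.hR
  exact ⟨δ, hδ, fun t => by simpa [rr] using h t⟩

theorem rho_pos (hr : Rlz f D) (t : Set.Ioo (0:ℝ) 1) : 0 < rho D t := rs_pos hr.pos_rr t

theorem rho_sq (hr : Rlz f D) (t : Set.Ioo (0:ℝ) 1) :
    rho D t ^ 2 * (1 + (1 - (t:ℝ) ^ 2) * D.2.2.2.1 t) = 1 := by
  have := rs_sq_mul hr.pos_rr t
  simpa [rr, rho] using this

theorem par_sq (hr : Rlz f D) (h : Profile f Q Q1) (h0 : Q 0 = D.1) {x : ℝ} (hx : 0 < x) :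
    par Q D.1 x ∈ Set.Ioo (0:ℝ) 1 ∧ Q x = D.1 * (1 - par Q D.1 x ^ 2) := by
  have hm : 0 < D.1 := hr.hm
  have h1 := h.lt_zero hx
  rw [h0] at h1
  have h2 : Q x / D.1 < 1 := (div_lt_one hm).2 h1
  have h3 : 0 < Q x / D.1 := div_pos (h.pos x) hm
  refine ⟨⟨Real.sqrt_pos.2 (by linarith), ?_⟩, ?_⟩
  · rw [par, Real.sqrt_lt' one_pos]; linarith
  · rw [par, Real.sq_sqrt (by linarith)]
    field_simp
    ring

/-- The third relation is the square root of the energy identity `Q'² = Q²t²R`, with the sign given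
by `Q' < 0` for `x > 0`. -/
theorem facts (hr : Rlz f D) (h : Profile f Q Q1) (h0 : Q 0 = D.1) {x : ℝ} (hx : 0 < x) :
    ∃ t : Set.Ioo (0:ℝ) 1, (t:ℝ) = par Q D.1 x ∧ Q x = D.1 * (1 - (t:ℝ) ^ 2) ∧
      Q1 x * rho D t = -(D.1 * t * (1 - (t:ℝ) ^ 2)) ∧
      f (Q x) = (D.1 * (1 - (t:ℝ) ^ 2)) ^ 2 * (D.2.1 - (t:ℝ) ^ 2 * D.2.2.1 t) ∧
      deriv (deriv f) (Q x) = 2 + (1 - (t:ℝ) ^ 2) * D.2.2.2.2 t := by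
  obtain ⟨h1, h2⟩ := hr.par_sq h h0 hx
  set t : Set.Ioo (0:ℝ) 1 := ⟨par Q D.1 x, h1⟩ with ht
  have h2' : Q x = D.1 * (1 - (t:ℝ) ^ 2) := h2
  refine ⟨t, rfl, h2', ?_, ?_, ?_⟩
  · have h3 := h.energy x
    rw [h2', hr.hk t] at h3
    have h4 := hr.rho_sq t
    have h5 := hr.rho_pos t
    have hm : 0 < D.1 := hr.hm
    have h6 : 0 < D.1 * t * (1 - (t:ℝ) ^ 2) := mul_pos (mul_pos hm t.2.1) (one_sub_sq_pos t.2)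
    have h7 : (Q1 x * rho D t) ^ 2 = (D.1 * t * (1 - (t:ℝ) ^ 2)) ^ 2 := by
      rw [mul_pow, h3]
      linear_combination (D.1 * (1 - (t:ℝ) ^ 2)) ^ 2 * t ^ 2 * h4
    rcases sq_eq_sq_iff_eq_or_eq_neg.1 h7 with h8 | h8
    · have := mul_neg_of_neg_of_pos (h.neg x hx) h5
      linarith
    · exact h8
  · rw [h2']; exact hr.hg t
  · rw [h2']; exact hr.hζ t

/-- This is `dx = 2ρ dt/(1 - t²)`: the source of the factors `2ρ` and of the kernel `1/(1 - t²)` in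
`pr`. -/
theorem hasDerivAt_par (hr : Rlz f D) (h : Profile f Q Q1) (h0 : Q 0 = D.1) {x : ℝ} (hx : 0 < x)
    {t : Set.Ioo (0:ℝ) 1} (ht : (t:ℝ) = par Q D.1 x) :
    HasDerivAt (par Q D.1) ((1 - (t:ℝ) ^ 2) / (2 * rho D t)) x := by
  obtain ⟨t', ht', h1, h2, -, -⟩ := hr.facts h h0 hx
  obtain rfl : t = t' := Subtype.ext (ht.trans ht'.symm)
  have hm : 0 < D.1 := hr.hm
  have ht0 := t.2.1
  have h3 : 1 - Q x / D.1 = (t:ℝ) ^ 2 := by rw [h1]; field_simp; ring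
  refine ((((h.d1 x).div_const D.1).const_sub 1).sqrt (by rw [h3]; positivity)).congr_deriv ?_
  rw [h3, Real.sqrt_sq ht0.le]
  have h5 := hr.rho_pos t
  field_simp
  linear_combination -h2

theorem tendsto_par_zero (hr : Rlz f D) (h : Profile f Q Q1) (h0 : Q 0 = D.1) :
    Tendsto (par Q D.1) (𝓝[>] 0) (𝓝[Set.Ico 0 1] 0) := by
  have hm : D.1 ≠ 0 := (show 0 < D.1 from hr.hm).ne'
  refine tendsto_nhdsWithin_iff.2 ⟨?_, ?_⟩
  · have hc : Continuous (par Q D.1) :=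
      Real.continuous_sqrt.comp (continuous_const.sub (h.continuous_Q.div_const _))
    have := hc.tendsto 0
    rw [show par Q D.1 0 = 0 by rw [par, h0, div_self hm, sub_self, Real.sqrt_zero]] at this
    exact this.mono_left nhdsWithin_le_nhds
  · filter_upwards [self_mem_nhdsWithin] with x hx
    exact Set.Ioo_subset_Ico_self (hr.par_sq h h0 hx).1

theorem tendsto_par_one (hr : Rlz f D) (h : Profile f Q Q1) (h0 : Q 0 = D.1) :
    Tendsto (par Q D.1) atTop (𝓝[<] 1) := by
  refine tendsto_nhdsWithin_iff.2 ⟨?_, ?_⟩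
  · have := (Real.continuous_sqrt.tendsto _).comp ((h.tendsto_Q.div_const D.1).const_sub 1)
    rw [zero_div, sub_zero, Real.sqrt_one] at this
    exact this
  · filter_upwards [eventually_gt_atTop 0] with x hx
    exact (hr.par_sq h h0 hx).1.2

/-- Functions of `x > 0` as primitives in the variable `t`. -/
theorem eq_pr (hr : Rlz f D) (h : Profile f Q Q1) (h0 : Q 0 = D.1) {G G' : ℝ → ℝ} {k : Bd}
    (hG : ∀ x, 0 < x → HasDerivAt G (G' x) x)
    (hG' : ∀ x, 0 < x → ∀ t : Set.Ioo (0:ℝ) 1, (t:ℝ) = par Q D.1 x → 2 * rho D t * G' x = k t)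
    (hG0 : Tendsto G (𝓝[>] 0) (𝓝 0)) {x : ℝ} (hx : 0 < x) : G x = pr k (par Q D.1 x) := by
  have hd : ∀ y ∈ Set.Ioi (0:ℝ), HasDerivAt (fun y => G y - pr k (par Q D.1 y)) 0 y := fun y hy => by
    set t : Set.Ioo (0:ℝ) 1 := ⟨par Q D.1 y, (hr.par_sq h h0 hy).1⟩
    have h1 := (hasDerivAt_pr k t).comp y (hr.hasDerivAt_par h h0 hy (t := t) rfl)
    refine ((hG y hy).sub h1).congr_deriv ?_
    rw [← hG' y hy t rfl]
    have := (one_sub_sq_pos t.2).ne'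
    have := (hr.rho_pos t).ne'
    field_simp
    ring
  have hc : ∀ y ∈ Set.Ioi (0:ℝ), G y - pr k (par Q D.1 y) = G x - pr k (par Q D.1 x) := fun y hy =>
    (convex_Ioi (0:ℝ)).is_const_of_fderivWithin_eq_zero (𝕜 := ℝ)
      (fun z hz => (hd z hz).differentiableAt.differentiableWithinAt)
      (fun z hz => by
        rw [fderivWithin_of_isOpen isOpen_Ioi hz]
        ext
        simp [(hd z hz).hasFDerivAt.fderiv]) hy hx
  have hl : Tendsto (fun y => G y - pr k (par Q D.1 y)) (𝓝[>] 0) (𝓝 (0 - 0)) := by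
    refine hG0.sub ?_
    have := (continuousOn_pr k 0 (by norm_num)).tendsto.comp (hr.tendsto_par_zero h h0)
    rwa [pr_zero] at this
  have hl2 : Tendsto (fun y => G y - pr k (par Q D.1 y)) (𝓝[>] 0)
      (𝓝 (G x - pr k (par Q D.1 x))) := by
    refine tendsto_const_nhds.congr' ?_
    filter_upwards [self_mem_nhdsWithin] with y hy
    exact (hc y hy).symm
  have := tendsto_nhds_unique hl2 hl
  linarith

theorem tendsto_div (h : Profile f Q Q1) : Tendsto (fun x => Q x / Q1 x) atTop (𝓝 (-1)) := by
  have := (h.res_tendsto.inv₀ one_ne_zero).neg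
  rw [inv_one] at this
  refine this.congr fun x => ?_
  rw [resonance, h.deriv_Q, inv_div, div_neg, neg_neg]

/-- The first integral of the equation `ℒ u = c f'(Q) - a (3 Q - 2 f(Q))`. -/
theorem first_integral (h : Profile f Q Q1) {u u' : ℝ → ℝ} {c a : ℝ}
    (hu : ∀ x, HasDerivAt u (u' x) x)
    (hu' : ∀ x, HasDerivAt u' ((1 - deriv f (Q x)) * u x -
      (c * deriv f (Q x) - a * (3 * Q x - 2 * f (Q x)))) x)
    (hb : ExpBdd 1 u) (hb' : ExpBdd 1 u') (x : ℝ) :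
    Q1 x * u' x - (Q x - f (Q x)) * u x
      = -(c * f (Q x)) + a * (3 / 2 * Q x ^ 2 - 2 * prim f (Q x)) := by
  have hfc := h.diff_f.continuous
  refine eq_of_hasDerivAt_eq_of_tendsto (c := 0)
    (g := fun x => Q1 x * u' x - (Q x - f (Q x)) * u x)
    (fun x => ((h.d2 x).mul (hu' x)).sub ((h.hasDerivAt_d2 x).mul (hu x))) (fun x => ?_) ?_ ?_ x
    (h := fun x => -(c * f (Q x)) + a * (3 / 2 * Q x ^ 2 - 2 * prim f (Q x)))
  · refine (((h.hasDerivAt_fQ x).const_mul c).neg.add (((((h.d1 x).fun_pow 2).const_mul (3 / 2)).sub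
      (((hasDerivAt_prim hfc (Q x)).comp x (h.d1 x)).const_mul 2)).const_mul a)).congr_deriv ?_
    push_cast
    ring
  · have := (h.tendsto_Q1.mul (hb'.tendsto_zero one_pos)).sub
      ((h.tendsto_Q.sub h.tendsto_fQ).mul (hb.tendsto_zero one_pos))
    simpa using this
  · have hF : Tendsto (fun x => prim f (Q x)) atTop (𝓝 0) :=
      (h.cls_F (n := 0) h.contDiff_nat).tendsto_zero three_pos
    have := (h.tendsto_fQ.const_mul c).neg.add ((((h.tendsto_Q.pow 2).const_mul (3 / 2)).sub
      (hF.const_mul 2)).const_mul a)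
    simpa using this

end Rlz


theorem Bd.one_apply (t : Set.Ioo (0:ℝ) 1) : (1 : Bd) t = 1 := rfl

namespace Rlz

open Bd Dat

variable {f Q Q1 : ℝ → ℝ} {D : Dat}

theorem lam_mul (hr : Rlz f D) (c a : ℝ) :
    lam D c a * (1 - D.1 * D.2.1) = c * D.2.1 - a / 2 := by
  have : 1 - D.1 * D.2.1 ≠ 0 := by linarith [(show 1 < D.1 * D.2.1 from hr.curv)] |>
    fun (h : 1 - D.1 * D.2.1 < 0) => h.ne
  rw [lam, div_mul_cancel₀ _ this]

theorem gg_apply (t : Set.Ioo (0:ℝ) 1) : gg D t = D.2.1 - (t:ℝ) ^ 2 * D.2.2.1 t := by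
  simp [gg, sq]

theorem rr_apply (t : Set.Ioo (0:ℝ) 1) : rr D t = 1 + (1 - (t:ℝ) ^ 2) * D.2.2.2.1 t := by
  simp [rr]

theorem omg_apply (c a : ℝ) (t : Set.Ioo (0:ℝ) 1) : omg D c a t = a - lam D c a +
    rho D t ^ 2 * (c * D.2.2.1 t + lam D c a * D.1 * (D.2.1 - (t:ℝ) ^ 2 * D.2.2.1 t + D.2.2.1 t)) := by
  simp only [omg, BoundedContinuousFunction.add_apply, BoundedContinuousFunction.mul_apply,
    BoundedContinuousFunction.smul_apply, Bd.one_apply, smul_eq_mul, gg_apply]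
  ring

theorem qq_apply (c a : ℝ) (t : Set.Ioo (0:ℝ) 1) : qq D c a t = 2 * D.1 ^ 2 * (rho D t *
    (lam D c a * (3 - 2 * D.1 * ((1 - (t:ℝ) ^ 2) * gg D t)) + a * D.1 * ((1 - (t:ℝ) ^ 2) * gg D t)
      - omg D c a t * (1 / 2 + (t:ℝ) ^ 2 * rr D t))) := by
  simp [qq, sq]

/-- The even solution `u` of `ℒ u = c f'(Q) - a (3 Q - 2 f(Q))` in the variable `t`. -/
theorem solution_eq (hr : Rlz f D) (h : Profile f Q Q1) (h0 : Q 0 = D.1) {u u' : ℝ → ℝ} {c a : ℝ}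
    (hue : ∀ x, u (-x) = u x) (hu : ∀ x, HasDerivAt u (u' x) x)
    (hu' : ∀ x, HasDerivAt u' ((1 - deriv f (Q x)) * u x -
      (c * deriv f (Q x) - a * (3 * Q x - 2 * f (Q x)))) x)
    (hb : ExpBdd 1 u) (hb' : ExpBdd 1 u') :
    (∀ x, 0 < x → HasDerivAt (fun x => (u x - lam D c a * Q x) / Q1 x)
      ((Q1 x * u' x - (Q x - f (Q x)) * u x - lam D c a * (Q1 x ^ 2 - (Q x - f (Q x)) * Q x)) /
        Q1 x ^ 2) x) ∧
    (∀ x, 0 < x → ∀ t : Set.Ioo (0:ℝ) 1, (t:ℝ) = par Q D.1 x →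
      (Q1 x * u' x - (Q x - f (Q x)) * u x - lam D c a * (Q1 x ^ 2 - (Q x - f (Q x)) * Q x)) /
        Q1 x ^ 2 = omg D c a t) ∧
    Tendsto (fun x => (u x - lam D c a * Q x) / Q1 x) (𝓝[>] 0) (𝓝 0) := by
  have hm : 0 < D.1 := hr.hm
  have hcv : 1 < D.1 * D.2.1 := hr.curv
  have hfm : f D.1 = D.1 ^ 2 * D.2.1 := hr.fm
  have hFm : 2 * prim f D.1 = D.1 ^ 2 := hr.Fm
  have hl := hr.lam_mul c a
  have hI := first_integral h hu hu' hb hb'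
  refine ⟨fun x hx => ?_, fun x hx t ht => ?_, ?_⟩
  · have hQ1 := (h.neg x hx).ne
    refine (((hu x).sub ((h.d1 x).const_mul (lam D c a))).div (h.d2 x) hQ1).congr_deriv ?_
    simp only [Pi.sub_apply]
    ring
  · obtain ⟨t', ht', h1, h2, h3, -⟩ := hr.facts h h0 hx
    obtain rfl : t = t' := Subtype.ext (ht.trans ht'.symm)
    have h4 := hr.rho_sq t
    have hρ := hr.rho_pos t
    have ht0 := t.2.1
    have hy := one_sub_sq_pos t.2
    have hQ1 : Q1 x ^ 2 * rho D t ^ 2 = (D.1 * t * (1 - (t:ℝ) ^ 2)) ^ 2 := by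
      rw [← mul_pow, h2, neg_sq]
    have hQ1' : Q1 x ^ 2 = (D.1 * t * (1 - (t:ℝ) ^ 2)) ^ 2 *
        (1 + (1 - (t:ℝ) ^ 2) * D.2.2.2.1 t) := by
      have : (rho D t) ^ 2 ≠ 0 := by positivity
      apply mul_right_cancel₀ this
      rw [hQ1]
      linear_combination -(D.1 * t * (1 - (t:ℝ) ^ 2)) ^ 2 * h4
    have hE := h.energy x
    rw [hI, div_eq_iff (pow_ne_zero 2 (h.neg x hx).ne), omg_apply]
    have e1 : (rho D t ^ 2 * (c * D.2.2.1 t + lam D c a * D.1 * (D.2.1 - (t:ℝ) ^ 2 * D.2.2.1 t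
      + D.2.2.1 t))) * Q1 x ^ 2 = (c * D.2.2.1 t + lam D c a * D.1 * (D.2.1 - (t:ℝ) ^ 2 * D.2.2.1 t
      + D.2.2.1 t)) * (D.1 * t * (1 - (t:ℝ) ^ 2)) ^ 2 := by rw [← hQ1]; ring
    rw [add_mul, e1]
    have e2 : 2 * prim f (Q x) = Q x ^ 2 - Q1 x ^ 2 := by linarith
    rw [e2, h3, h1]
    linear_combination (D.1 * (1 - (t:ℝ) ^ 2)) ^ 2 * hl
  -- At the origin `Q' = 0`, and the first integral there gives `u(0) = λQ(0)`; this is where `lam`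
  -- comes from. Numerator and denominator both vanish, with slopes `0` and `Q''(0) ≠ 0`.
  · have hu00 := hI 0
    rw [h.Q1_zero, h0, hfm] at hu00
    have hu0 : u 0 = lam D c a * D.1 := by
      have hne : D.1 - D.1 ^ 2 * D.2.1 ≠ 0 := by nlinarith
      apply mul_left_cancel₀ hne
      linear_combination -hu00 - D.1 ^ 2 * hl + a * hFm
    have hle : 𝓝[>] (0:ℝ) ≤ 𝓝[≠] 0 := nhdsWithin_mono _ fun x hx => ne_of_gt hx
    have hu'0 : u' 0 = 0 := odd_zero (odd_deriv_of_even hu hue)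
    have s1 := ((hasDerivAt_iff_tendsto_slope.1 ((hu 0).sub ((h.d1 0).const_mul
      (lam D c a))))).mono_left hle
    rw [hu'0, h.Q1_zero, mul_zero, sub_zero] at s1
    have s2 := ((hasDerivAt_iff_tendsto_slope.1 (h.d2 0))).mono_left hle
    have hne : Q 0 - f (Q 0) ≠ 0 := by linarith [h.curv] |> fun (h : Q 0 - f (Q 0) < 0) => h.ne
    have := s1.div s2 hne
    rw [zero_div] at this
    refine this.congr' ?_
    filter_upwards [self_mem_nhdsWithin] with x hx
    have hx0 : x ≠ 0 := ne_of_gt hx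
    have hQ1 := (h.neg x hx).ne
    simp only [slope_def_field, Pi.div_apply, Pi.sub_apply, h0, hu0, h.Q1_zero, sub_zero]
    rw [div_div_div_cancel_right₀ hx0, sub_self, sub_zero]

/-- The integral `∫₀^∞ (u (3 Q - 2 f(Q)) + a Q f(Q))` in the variable `t`. -/
theorem integral_eq (hr : Rlz f D) (h : Profile f Q Q1) (h0 : Q 0 = D.1) {u u' G : ℝ → ℝ} {c a : ℝ}
    (hue : ∀ x, u (-x) = u x) (hu : ∀ x, HasDerivAt u (u' x) x)
    (hu' : ∀ x, HasDerivAt u' ((1 - deriv f (Q x)) * u x -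
      (c * deriv f (Q x) - a * (3 * Q x - 2 * f (Q x)))) x)
    (hb : ExpBdd 1 u) (hb' : ExpBdd 1 u')
    (hG : ∀ x, HasDerivAt G (u x * (3 * Q x - 2 * f (Q x)) + a * Q x * f (Q x)) x) (hG0 : G 0 = 0) :
    (∀ x, 0 < x → G x = (u x - lam D c a * Q x) / Q1 x * (1 / 2 * Q x ^ 2 + Q1 x ^ 2) +
      pr (yy * (yy * qq D c a)) (par Q D.1 x)) ∧ Tendsto G atTop (𝓝 (jj D c a)) := by
  obtain ⟨hW, hω, hW0⟩ := hr.solution_eq h h0 hue hu hu' hb hb'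
  have key : ∀ x, 0 < x → G x - (u x - lam D c a * Q x) / Q1 x * (1 / 2 * Q x ^ 2 + Q1 x ^ 2) =
      pr (yy * (yy * qq D c a)) (par Q D.1 x) := fun x hx => by
    -- Since `½Q² + Q'²` has derivative `Q'(3Q - 2f(Q))`, subtracting its product with `W = (u -
    -- λQ)/Q'` integrates the term `Q'W(3Q - 2f(Q))` by parts and leaves `W'`, which is the bounded
    -- function `omg`.
    refine hr.eq_pr h h0 (G := fun x => G x - (u x - lam D c a * Q x) / Q1 x *
      (1 / 2 * Q x ^ 2 + Q1 x ^ 2)) (fun x hx => (hG x).sub ((hW x hx).mul ((((h.d1 x).fun_pow 2).const_mul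
      (1 / 2)).add ((h.d2 x).fun_pow 2)))) (fun x hx t ht => ?_) ?_ hx
    · rw [hω x hx t ht]
      obtain ⟨t', ht', h1, h2, h3, -⟩ := hr.facts h h0 hx
      obtain rfl : t = t' := Subtype.ext (ht.trans ht'.symm)
      have hQ1 := (h.neg x hx).ne
      have e1 : Q1 x ^ 2 = (D.1 * t * (1 - (t:ℝ) ^ 2)) ^ 2 * rr D t := by
        have h4 := hr.rho_sq t
        have : (rho D t) ^ 2 ≠ 0 := pow_ne_zero 2 (hr.rho_pos t).ne'
        apply mul_right_cancel₀ this
        rw [← mul_pow, h2, rr_apply]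
        linear_combination -(D.1 * t * (1 - (t:ℝ) ^ 2)) ^ 2 * h4
      rw [BoundedContinuousFunction.mul_apply, BoundedContinuousFunction.mul_apply, yy_apply,
        qq_apply, gg_apply]
      simp only [Nat.cast_ofNat, Nat.add_one_sub_one, pow_one, Pi.add_apply]
      have e2 : (u x - lam D c a * Q x) / Q1 x * (1 / 2 * (2 * Q x * Q1 x) +
        2 * Q1 x * (Q x - f (Q x))) = (u x - lam D c a * Q x) * (3 * Q x - 2 * f (Q x)) := by
        field_simp
        ring
      rw [e2, e1, h3, h1]
      ring
    · have t1 : Tendsto G (𝓝[>] 0) (𝓝 0) := by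
        have := (hG 0).continuousAt.tendsto
        rw [hG0] at this
        exact this.mono_left nhdsWithin_le_nhds
      have t2 : Tendsto (fun x => 1 / 2 * Q x ^ 2 + Q1 x ^ 2) (𝓝[>] 0)
          (𝓝 (1 / 2 * Q 0 ^ 2 + Q1 0 ^ 2)) := by
        have hc : Continuous fun x => 1 / 2 * Q x ^ 2 + Q1 x ^ 2 :=
          ((h.continuous_Q.pow 2).const_smul (1 / 2 : ℝ)).add (h.continuous_Q1.pow 2)
        exact (hc.tendsto 0).mono_left nhdsWithin_le_nhds
      simpa using t1.sub (hW0.mul t2)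
  refine ⟨fun x hx => by linarith [key x hx], ?_⟩
  have t1 := (tendsto_pr_yy (yy * qq D c a)).comp (hr.tendsto_par_one h h0)
  have t2 : Tendsto (fun x => (u x - lam D c a * Q x) * (1 / 2 * Q x * (Q x / Q1 x) + Q1 x)) atTop
      (𝓝 0) := by
    have := ((hb.tendsto_zero one_pos).sub (h.tendsto_Q.const_mul (lam D c a))).mul
      (((h.tendsto_Q.const_mul (1 / 2)).mul (tendsto_div h)).add h.tendsto_Q1)
    simpa using this
  have := t2.add t1
  rw [zero_add] at this
  refine this.congr' ?_
  filter_upwards [eventually_gt_atTop 0] with x hx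
  have hQ1 := (h.neg x hx).ne
  simp only [Function.comp]
  rw [← key x hx]
  field_simp
  ring

/-- The function `u` of `Nondeg` solves the equation with `c = 0` and `a = 1`, so its integral is
`jj D 0 1`. -/
theorem nondeg (hr : Rlz f D) (h : Profile f Q Q1) (h0 : Q 0 = D.1) (hj : jj D 0 1 ≠ 0) :
    Nondeg f Q := by
  intro u u' h1 h2 h3 h4 h5
  have c3 := h.contDiff_nat
  have hQc : Cls 1 0 Q := (h.cls_Q c3).of_le (by omega)
  have hfc : Cls 1 0 fun x => f (Q x) :=
    ((h.cls_f (n := 0) c3).mono (by norm_num)).of_le (by omega)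
  have huc : Cls 1 0 u := ⟨continuous_iff_continuousAt.2 fun x => (h2 x).continuousAt, h4⟩
  have i2 : Cls 1 0 fun x => u x * (3 * Q x - 2 * f (Q x)) + Q x * f (Q x) :=
    (huc.mul' ((h.cls_3Q (n := 0) c3).of_le (by omega)) (by norm_num)).add
      (hQc.mul' hfc (by norm_num))
  have hd := fun x => hasDerivAt_prim i2.continuous x
  obtain ⟨-, hl⟩ := hr.integral_eq h h0 (c := 0) (a := 1) h1 h2
    (fun x => (h3 x).congr_deriv (by ring)) h4 h5 (fun x => (hd x).congr_deriv (by ring))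
    (prim_zero _)
  rw [integral_Ioi_eq_neg hd (i2.integrable one_pos).integrableOn hl, prim_zero, sub_zero]
  exact hj

end Rlz


namespace Rlz

open Bd Dat

variable {f Q Q1 A B M V A₂ B₂ : ℝ → ℝ} {a b γ a₂ b₂ : ℝ} {D : Dat}

theorem lam_linear (c a : ℝ) : lam D c a = c * lam D 1 0 + a * lam D 0 1 := by
  simp only [lam]; ring

theorem jj_linear (D : Dat) (c a : ℝ) : jj D c a = c * jj D 1 0 + a * jj D 0 1 := by
  have : qq D c a = c • qq D 1 0 + a • qq D 0 1 := by
    ext t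
    rw [BoundedContinuousFunction.add_apply, BoundedContinuousFunction.smul_apply,
      BoundedContinuousFunction.smul_apply, smul_eq_mul, smul_eq_mul]
    simp only [qq_apply, omg_apply]
    rw [lam_linear c a]
    ring
  rw [jj, this, mul_add, mul_add, map_add]
  simp only [mul_smul_comm, map_smul, smul_eq_mul]
  rfl

theorem first_eq (hs : FirstSol f Q Q1 A B M V a b) (x : ℝ) :
    HasDerivAt (deriv A) ((1 - deriv f (Q x)) * A x -
      (1 * deriv f (Q x) - a * (3 * Q x - 2 * f (Q x)))) x :=
  (hs.dA1 x).congr_deriv (by rw [hs.eqA]; ring)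

theorem neg_S_eq (hr : Rlz f D) (h : Profile f Q Q1) (h0 : Q 0 = D.1)
    (hs : FirstSol f Q Q1 A B M V a b) :
    (∀ x, 0 < x → -Sfun f Q Q1 A B M a x = (A x - lam D 1 a * Q x) / Q1 x *
      (1 / 2 * Q x ^ 2 + Q1 x ^ 2) + pr (yy * (yy * qq D 1 a)) (par Q D.1 x)) ∧ jj D 1 a = 0 := by
  obtain ⟨h1, h2⟩ := hr.integral_eq h h0 hs.evenA hs.dA (first_eq hs) hs.clsA.expBdd
    hs.clsA.deriv'.expBdd (G := fun x => -Sfun f Q Q1 A B M a x)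
    (fun x => (hs.hasDerivAt_S h x).neg.congr_deriv (by ring)) (by simp only [hs.S_zero h, neg_zero])
  refine ⟨h1, tendsto_nhds_unique h2 ?_⟩
  simpa using (hs.tendsto_S h).neg

theorem eq_acoef (hr : Rlz f D) (hj : jj D 0 1 ≠ 0) (h : Profile f Q Q1) (h0 : Q 0 = D.1)
    (hs : FirstSol f Q Q1 A B M V a b) : a = acoef D := by
  have := (hr.neg_S_eq h h0 hs).2
  rw [jj_linear, one_mul] at this
  rw [acoef, eq_div_iff hj]
  linarith

/-- With `A = λQ + Q'W`, integrating `Q'W` by parts gives the local term `QW` and the density `Q(λ +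
a - W')`. At infinity the local term vanishes and `b` remains. -/
theorem M_eq (hr : Rlz f D) (h : Profile f Q Q1) (h0 : Q 0 = D.1)
    (hs : FirstSol f Q Q1 A B M V a b) :
    (∀ x, 0 < x → M x = Q x * ((A x - lam D 1 a * Q x) / Q1 x) + pr (yy * xx D a) (par Q D.1 x)) ∧
      b = bb D a := by
  obtain ⟨hW, hω, hW0⟩ := hr.solution_eq h h0 hs.evenA hs.dA (first_eq hs) hs.clsA.expBdd
    hs.clsA.deriv'.expBdd
  have key : ∀ x, 0 < x → M x - Q x * ((A x - lam D 1 a * Q x) / Q1 x) =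
      pr (yy * xx D a) (par Q D.1 x) := fun x hx => by
    refine hr.eq_pr h h0 (G := fun x => M x - Q x * ((A x - lam D 1 a * Q x) / Q1 x))
      (fun x hx => (hs.hM x).sub ((h.d1 x).mul (hW x hx))) (fun x hx t ht => ?_) ?_ hx
    · rw [hω x hx t ht]
      obtain ⟨t', ht', h1, h2, h3, -⟩ := hr.facts h h0 hx
      obtain rfl : t = t' := Subtype.ext (ht.trans ht'.symm)
      have hQ1 := (h.neg x hx).ne
      simp only [xx, BoundedContinuousFunction.mul_apply, BoundedContinuousFunction.smul_apply,
        BoundedContinuousFunction.sub_apply, yy_apply, smul_eq_mul, Bd.one_apply]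
      rw [mul_div_cancel₀ _ hQ1, h1]
      ring
    · have t1 : Tendsto M (𝓝[>] 0) (𝓝 0) := by
        have := (hs.hM 0).continuousAt.tendsto
        rw [hs.M0] at this
        exact this.mono_left nhdsWithin_le_nhds
      have t2 : Tendsto Q (𝓝[>] 0) (𝓝 (Q 0)) :=
        (h.continuous_Q.tendsto 0).mono_left nhdsWithin_le_nhds
      simpa using t1.sub (t2.mul hW0)
  refine ⟨fun x hx => by linarith [key x hx], ?_⟩
  have t1 := (tendsto_pr_yy (xx D a)).comp (hr.tendsto_par_one h h0)
  have t2 : Tendsto (fun x => (Q x / Q1 x) * (A x - lam D 1 a * Q x)) atTop (𝓝 0) := by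
    simpa using (tendsto_div h).mul (hs.tendsto_A.sub (h.tendsto_Q.const_mul (lam D 1 a)))
  have t3 := t2.add t1
  rw [zero_add] at t3
  refine tendsto_nhds_unique (hs.tendsto_M h) (t3.congr' ?_)
  filter_upwards [eventually_gt_atTop 0] with x hx
  simp only [Function.comp]
  rw [← key x hx]
  ring

/-- The density of the defect in the variable `t`. -/
theorem density_eq (hr : Rlz f D) (h : Profile f Q Q1) (h0 : Q 0 = D.1)
    (hs : FirstSol f Q Q1 A B M V a b) {x : ℝ} (hx : 0 < x) {t : Set.Ioo (0:ℝ) 1}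
    (ht : (t:ℝ) = par Q D.1 x) :
    brPoly f Q A a x + ((Q1 x * deriv B x - (Q x - f (Q x)) * B x) / Q1 x) ^ 2 - M x ^ 2
      = ss t * nn D a t := by
  obtain ⟨hW, hω, hW0⟩ := hr.solution_eq h h0 hs.evenA hs.dA (first_eq hs) hs.clsA.expBdd
    hs.clsA.deriv'.expBdd
  obtain ⟨hS, hj⟩ := hr.neg_S_eq h h0 hs
  obtain ⟨t', ht', hQ, hQρ, hf, hf2⟩ := hr.facts h h0 hx
  obtain rfl : t = t' := Subtype.ext (ht.trans ht'.symm)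
  have hM := (hr.M_eq h h0 hs).1 x hx
  have hSx := hS x hx
  have hωx := hω x hx t ht
  have hWpr := hr.eq_pr h h0 (k := (2:ℝ) • (rho D * omg D 1 a)) hW (fun x hx t ht => by
    rw [(hr.solution_eq h h0 hs.evenA hs.dA (first_eq hs) hs.clsA.expBdd
      hs.clsA.deriv'.expBdd).2.1 x hx t ht, BoundedContinuousFunction.smul_apply,
      BoundedContinuousFunction.mul_apply, smul_eq_mul, mul_assoc]) hW0 hx
  have hw : ww D a t = √(1 - (t:ℝ) ^ 2) / t * ((A x - lam D 1 a * Q x) / Q1 x) := by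
    rw [ww, wop_apply, hWpr, ht]
  have hX : avg (xx D a) t = 1 / t * pr (yy * xx D a) (par Q D.1 x) := by rw [avg_apply, ht]
  have hT : tail (qq D 1 a) t = 1 / (1 - (t:ℝ) ^ 2) ^ 2 *
      (0 - pr (yy * (yy * qq D 1 a)) (par Q D.1 x)) := by rw [tail_apply, ht, ← jj, hj]
  have hY : avg (yy * qq D 1 a) t = 1 / t * pr (yy * (yy * qq D 1 a)) (par Q D.1 x) := by
    rw [avg_apply, ht]
  have hm : 0 < D.1 := hr.hm
  have ht0 := t.2.1
  have hy := one_sub_sq_pos t.2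
  have hρR := hr.rho_sq t
  have hρ := hr.rho_pos t
  have hs0 := Real.sqrt_pos.2 hy
  have hs2 := Real.sq_sqrt hy.le
  have hQ1 := (h.neg x hx).ne
  have hA : A x = lam D 1 a * Q x + Q1 x * ((A x - lam D 1 a * Q x) / Q1 x) := by
    field_simp
    ring
  have hA' : deriv A x = (lam D 1 a + omg D 1 a t) * Q1 x +
      (Q x - f (Q x)) * ((A x - lam D 1 a * Q x) / Q1 x) := by
    rw [← hωx]
    field_simp
    ring
  have eups : ups D a t = √(1 - (t:ℝ) ^ 2) * ((a - 2 * lam D 1 a) * D.1 + 1 / D.1 * (rho D t *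
      ((2 * t - t * t * t) * tail (qq D 1 a) t - avg (yy * qq D 1 a) t))) +
      D.1 * (rho D t * (1 / 2 + t * t * rr D t) * ww D a t) := by
    simp only [ups, BoundedContinuousFunction.mul_apply, BoundedContinuousFunction.smul_apply,
        BoundedContinuousFunction.sub_apply, BoundedContinuousFunction.add_apply,
        smul_eq_mul, Bd.one_apply, tt_apply, ss_apply]
    ring
  have ealp : alp D a t = lam D 1 a * D.1 * √(1 - (t:ℝ) ^ 2) - D.1 * (t * t * (rho D t * rr D t)
      * ww D a t) := rfl
  have ealp' : alp' D a t = D.1 * ((1 - D.1 * (yy t * gg D t)) * (t * ww D a t)) - D.1 *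
      (√(1 - (t:ℝ) ^ 2) * t * (rho D t * rr D t) * (lam D 1 a * 1 + omg D 1 a t)) := rfl
  have enn : nn D a t = 1 / 2 * (√(1 - (t:ℝ) ^ 2) * D.2.2.2.2 t * ((1 + √(1 - (t:ℝ) ^ 2) * alp D a t)
      * (1 + √(1 - (t:ℝ) ^ 2) * alp D a t) * (1 + √(1 - (t:ℝ) ^ 2) * alp D a t)))
      - alp D a t + (2 - 3 / 2 * a) * (√(1 - (t:ℝ) ^ 2) * (alp D a t * alp D a t))
      + yy t * (alp D a t * alp D a t * alp D a t) - (2 * a * D.1) * √(1 - (t:ℝ) ^ 2)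
      + (3 * a) * (√(1 - (t:ℝ) ^ 2) * (alp' D a t * alp' D a t))
      - (3 * a ^ 2 * D.1 ^ 2) * (yy t * yy t * gg D t * alp D a t)
      - (3 / 2 * a ^ 3 * D.1 ^ 2) * (√(1 - (t:ℝ) ^ 2) * yy t)
      + √(1 - (t:ℝ) ^ 2) * (avg (xx D a) t * avg (xx D a) t * (1 - D.2.2.2.1 t * (rho D t * rho D t)))
      + 2 * (avg (xx D a) t * (rho D t * ups D a t - D.1 * (t * t * ww D a t)))
      + √(1 - (t:ℝ) ^ 2) * (ups D a t * ups D a t - D.1 ^ 2 * (t * t * (ww D a t * ww D a t))) := rfl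
  rw [Sfun] at hSx
  rw [gg_apply, yy_apply] at ealp'
  rw [gg_apply, yy_apply] at enn
  rw [rr_apply] at eups ealp ealp'
  rw [ss_apply, enn, brPoly, hf2]
  clear enn hWpr hW0 hω hωx hW ht ht' hS
  set W := (A x - lam D 1 a * Q x) / Q1 x
  set w := ww D a t
  set X := avg (xx D a) t
  set p := pr (yy * (yy * qq D 1 a)) (par Q D.1 x)
  set P := Q1 x * deriv B x - (Q x - f (Q x)) * B x with hP
  set s := √(1 - (t:ℝ) ^ 2)
  set al := alp D a t
  set al' := alp' D a t
  set up := ups D a t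
  set ρ := rho D t
  set lm := lam D 1 a
  set om := omg D 1 a t
  -- By `2t² - t⁴ + (1 - t²)² = 1` this combination equals `-p/(t(1 - t²)²)`. The tail operator is
  -- used for the singularity at `t = 1`, thanks to `jj D 1 a = 0`, and the average for the one at
  -- `t = 0`.
  set z := (2 * t - t * t * t) * tail (qq D 1 a) t - avg (yy * qq D 1 a) t with hz
  have hsW : s * W = t * w := by rw [hw]; field_simp
  have hz' : z * t * (1 - (t:ℝ) ^ 2) ^ 2 = -p := by
    rw [hz, hT, hY]
    field_simp
    ring
  have hMx : M x = Q x * W + t * X := by rw [hM, hX]; field_simp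
  have hQ1e : Q1 x = -(D.1 * t * (1 - (t:ℝ) ^ 2) * (ρ * (1 + (1 - (t:ℝ) ^ 2) * D.2.2.2.1 t))) := by
    linear_combination (ρ * (1 + (1 - (t:ℝ) ^ 2) * D.2.2.2.1 t)) * hQρ - Q1 x * hρR
  have hQ1s : Q1 x ^ 2 = (D.1 * t * (1 - (t:ℝ) ^ 2)) ^ 2 * (1 + (1 - (t:ℝ) ^ 2) * D.2.2.2.1 t) := by
    rw [hQ1e]
    linear_combination (D.1 * t * (1 - (t:ℝ) ^ 2)) ^ 2 * (1 + (1 - (t:ℝ) ^ 2) * D.2.2.2.1 t) * hρR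
  have eA : A x = s * al := by
    rw [hA, ealp, hQ1e, hQ, ← hs2]
    linear_combination (-(D.1 * t * s * (ρ * (1 + s ^ 2 * D.2.2.2.1 t)))) * hsW
  have eA' : deriv A x = s * al' := by
    rw [hA', ealp', hQ1e, hf, hQ, ← hs2]
    linear_combination D.1 * s * (1 - D.1 * (s ^ 2 * (D.2.1 - t ^ 2 * D.2.2.1 t))) * hsW
  have eM : M x = t * X + D.1 * s * t * w := by
    rw [hMx, hQ, ← hs2]
    linear_combination D.1 * s * hsW
  -- `P` is solved from the definition of `Sfun`, that is `P = -S - MQ - 2AQ' + aQQ'`, so `B` itself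
  -- never enters.
  have eP : P / Q1 x = ρ * X + s * up := by
    rw [div_eq_iff hQ1, eups]
    have e1 : P = W * (1 / 2 * Q x ^ 2 + Q1 x ^ 2) + p - (Q x * W + t * X) * Q x
        - 2 * (lm * Q x + Q1 x * W) * Q1 x + a * Q x * Q1 x := by
      rw [← hA, ← hMx]
      linear_combination hSx
    rw [e1, hQ]
    have e2 : D.1 * (1 / D.1) = 1 := by field_simp
    linear_combination (-X - (1 - (t:ℝ) ^ 2) * z * (1 / D.1) - D.1 * s * (1 / 2 + t * t *
      (1 + (1 - (t:ℝ) ^ 2) * D.2.2.2.1 t)) * w) * hQρ - W * hQ1s - Q1 x * ((a - 2 * lm) * D.1 +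
      1 / D.1 * (ρ * z)) * hs2 + t * (1 - (t:ℝ) ^ 2) ^ 2 * z * e2 + hz' - D.1 ^ 2 *
      (1 - (t:ℝ) ^ 2) * (1 / 2 + t ^ 2 * (1 + (1 - (t:ℝ) ^ 2) * D.2.2.2.1 t)) *
      (s * hsW - W * hs2)
  rw [eP, eM, eA, eA', hf, hQ, ← hs2]
  have hρR' : ρ ^ 2 * (1 + s ^ 2 * D.2.2.2.1 t) = 1 := by rw [hs2]; exact hρR
  have hst : s ^ 2 = 1 - (t:ℝ) ^ 2 := hs2
  linear_combination X ^ 2 * hρR' - X ^ 2 * hst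

/-- For `γ = -b²/2` the limit `b₂ - γb + b²` of the primitive equals `(b₂ + b³/6) + b³/3 + b²`; the
last two terms are subtracted in `dfc`. -/
theorem defect_eq (hr : Rlz f D) (hj : jj D 0 1 ≠ 0) (h : Profile f Q Q1) (h0 : Q 0 = D.1)
    (hs : FirstSol f Q Q1 A B M V a b)
    (ho : SecondSol f Q Q1 A B V A₂ B₂ a (-(1 / 2) * b ^ 2) a₂ b₂) :
    b₂ + 1 / 6 * b ^ 3 = dd D := by
  have hb := (hr.M_eq h h0 hs).2
  have key : ∀ x, 0 < x → Defun f Q Q1 A B M V A₂ B₂ a (-(1 / 2) * b ^ 2) a₂ x =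
      pr (ss * ((2:ℝ) • (rho D * nn D a))) (par Q D.1 x) := fun x hx => by
    refine hr.eq_pr h h0 (fun x hx => ho.hasDerivAt_Defun hs h hx.ne') (fun x hx t ht => ?_)
      (ho.tendsto_Defun_zero hs h) hx
    rw [hr.density_eq h h0 hs hx ht, BoundedContinuousFunction.mul_apply,
      BoundedContinuousFunction.smul_apply, BoundedContinuousFunction.mul_apply, smul_eq_mul]
    ring
  have t1 := (tendsto_pr ((2:ℝ) • (rho D * nn D a))).comp (hr.tendsto_par_one h h0)
  have := tendsto_nhds_unique (ho.tendsto_Defun hs h) (t1.congr' (by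
    filter_upwards [eventually_gt_atTop 0] with x hx
    exact (key x hx).symm))
  rw [dd, ← hr.eq_acoef hj h h0 hs, dfc, ← this, ← hb]
  ring

/-- The defect is well defined, and is given by the functional `Dat.dd`. -/
theorem isDefect_iff (hr : Rlz f D) (hj : jj D 0 1 ≠ 0) (d : ℝ) : IsDefect f d ↔ d = dd D := by
  have key : ∀ d, IsDefect f d → d = dd D := by
    rintro d ⟨Q, A, B, A₂, B₂, a, b, a₂, b₂, hQ, h1, -, h2, rfl⟩
    obtain ⟨h, h0⟩ := Realizes.profile_of_isSoliton hr hQ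
    obtain ⟨M, V, hs⟩ := FirstSol.of_isOmegaSolution h h1
    exact hr.defect_eq hj h h0 hs (.of_isOmegaSolution h hs h2)
  refine ⟨key d, ?_⟩
  rintro rfl
  obtain ⟨Q, Q1, h, h0⟩ := Realizes.exists_profile hr
  have hD := hr.nondeg h h0 hj
  obtain ⟨A, B, M, V, a, b, hs, horth⟩ := exists_firstSol h hD
  obtain ⟨A₂, B₂, a₂, b₂, ho⟩ := exists_secondSol h hD hs (-(1 / 2) * b ^ 2)
  have : IsDefect f (b₂ + 1 / 6 * b ^ 3) := ⟨Q, A, B, A₂, B₂, a, b, a₂, b₂, h.isSoliton,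
    hs.isOmegaSolution h, horth, ho.isOmegaSolution h hs, rfl⟩
  rwa [key _ this] at this

theorem existsUnique (hr : Rlz f D) (hj : jj D 0 1 ≠ 0) : ∃! d, IsDefect f d :=
  ⟨dd D, (hr.isDefect_iff hj _).2 rfl, fun d hd => (hr.isDefect_iff hj d).1 hd⟩

theorem defect_eq_dd (hr : Rlz f D) (hj : jj D 0 1 ≠ 0) : defect f = dd D :=
  (hr.isDefect_iff hj _).1 (Classical.epsilon_spec (hr.existsUnique hj).exists)

end Rlz


/-! ### Smoothness of the defect functional -/

namespace Bd

theorem Pos.eventually {R : Bd} (h : Pos R) : ∀ᶠ S in 𝓝 R, Pos S := by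
  obtain ⟨δ, hδ, h⟩ := h
  filter_upwards [Metric.ball_mem_nhds R (half_pos hδ)] with S hS
  refine ⟨δ / 2, half_pos hδ, fun t => ?_⟩
  have h1 := (S - R).norm_coe_le_norm t
  rw [Metric.mem_ball, dist_eq_norm] at hS
  rw [BoundedContinuousFunction.sub_apply, Real.norm_eq_abs] at h1
  linarith [h t, neg_abs_le (S t - R t)]

theorem Pos.pos_rs {R : Bd} (h : Pos R) : Pos (rs R) := by
  refine ⟨1 / √(‖R‖ + 1), by positivity, fun t => ?_⟩
  rw [rs_apply h]
  have h1 := (le_abs_self _).trans (R.norm_coe_le_norm t)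
  exact one_div_le_one_div_of_le (Real.sqrt_pos.2 (h.pos t)) (Real.sqrt_le_sqrt (by linarith))

theorem Pos.mul_rs {R : Bd} (h : Pos R) : R * (rs R * rs R) = 1 := by
  ext t
  have := rs_sq_mul h t
  simp only [BoundedContinuousFunction.mul_apply, one_apply]
  linarith

theorem Pos.inverse {R : Bd} (h : Pos R) : Ring.inverse R = rs R * rs R := by
  have h1 := h.mul_rs
  exact Ring.inverse_unit ⟨R, rs R * rs R, h1, by rw [mul_comm, h1]⟩

theorem Pos.isUnit {R : Bd} (h : Pos R) : IsUnit R := IsUnit.of_mul_eq_one _ h.mul_rs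

/-- Inversion is smooth in the Banach algebra, and the square root of `1/R` near `rs R` is given by
the inverse function theorem for `S ↦ S * S`, whose derivative at `rs R` is multiplication by the
unit `2 rs R`. Positivity shows that the local inverse is the same branch as `rs`. -/
theorem contDiffAt_rs {R : Bd} (h : Pos R) : ContDiffAt ℝ ∞ rs R := by
  obtain ⟨u, hu⟩ : IsUnit ((2:ℝ) • rs R) := by
    refine IsUnit.of_mul_eq_one ((1 / 2 : ℝ) • (R * rs R)) ?_
    rw [smul_mul_smul_comm, mul_left_comm, h.mul_rs]
    norm_num
  set L : Bd ≃L[ℝ] Bd := ContinuousLinearEquiv.smulLeft u with hL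
  have hc : ContDiffAt ℝ ∞ (fun S : Bd => S * S) (rs R) := contDiffAt_id.mul contDiffAt_id
  have hd : HasFDerivAt (fun S : Bd => S * S) (L : Bd →L[ℝ] Bd) (rs R) := by
    refine ((hasFDerivAt_id (rs R)).mul' (hasFDerivAt_id (rs R))).congr_fderiv ?_
    ext S : 1
    change rs R * S + S * rs R = u • S
    rw [Units.smul_def, hu, smul_eq_mul, mul_comm S, smul_mul_assoc, two_smul]
  have hn : (∞ : WithTop ℕ∞) ≠ 0 := by simp
  have hs := hc.hasStrictFDerivAt' hd hn
  have h1 := hc.to_localInverse hd hn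
  have h2 : ContDiffAt ℝ ∞ (fun S : Bd => Ring.inverse S) R := by
    obtain ⟨v, hv⟩ := h.isUnit
    rw [← hv]
    exact contDiffAt_ringInverse ℝ v
  have e1 : Ring.inverse R = rs R * rs R := h.inverse
  have h3 : ContDiffAt ℝ ∞ (fun S => hc.localInverse hd hn (Ring.inverse S)) R := by
    refine ContDiffAt.comp R (g := hc.localInverse hd hn) ?_ h2
    rw [e1]
    exact h1
  refine h3.congr_of_eventuallyEq ?_
  have e2 : hc.localInverse hd hn (Ring.inverse R) = rs R := by
    rw [e1]
    exact hc.localInverse_apply_image hd hn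
  have t1 : ∀ᶠ S in 𝓝 R, Pos (hc.localInverse hd hn (Ring.inverse S)) :=
    h3.continuousAt.eventually (by beta_reduce; rw [e2]; exact h.pos_rs.eventually)
  have t2 : ∀ᶠ S in 𝓝 R, hc.localInverse hd hn (Ring.inverse S) *
      hc.localInverse hd hn (Ring.inverse S) = Ring.inverse S := by
    have := h2.continuousAt.eventually (p := fun S => hc.localInverse hd hn S *
      hc.localInverse hd hn S = S) (by beta_reduce; rw [e1]; exact hs.eventually_right_inverse)
    exact this
  filter_upwards [h.eventually, t1, t2] with S h1 h2 h3
  rw [h1.inverse] at h3 h2 ⊢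
  ext t
  have h4 := congrArg (fun g : Bd => g t) h3
  simp only [BoundedContinuousFunction.mul_apply] at h4
  exact ((mul_self_inj (h2.pos t).le (rs_pos h1 t).le).1 h4).symm

end Bd

namespace Dat

open Bd

/-- The domain on which the functionals are smooth. -/
structure Reg (D : Dat) : Prop where
  pos : Pos (rr D)
  hm : D.1 ≠ 0
  curv : 1 - D.1 * D.2.1 ≠ 0

variable {D : Dat} {a : Dat → ℝ} {c : ℝ}

theorem contDiff_gg : ContDiff ℝ ∞ gg := by
  unfold gg
  fun_prop

theorem contDiff_rr : ContDiff ℝ ∞ rr := by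
  unfold rr
  fun_prop

theorem Reg.contDiffAt_rho (h : Reg D) : ContDiffAt ℝ ∞ rho D :=
  ContDiffAt.comp D (g := rs) (contDiffAt_rs h.pos) contDiff_rr.contDiffAt

theorem Reg.contDiffAt_lam (h : Reg D) (ha : ContDiffAt ℝ ∞ a D) :
    ContDiffAt ℝ ∞ (fun D => lam D c (a D)) D := by
  unfold lam
  exact ContDiffAt.div (by fun_prop) (by fun_prop) h.curv

theorem Reg.contDiffAt_omg (h : Reg D) (ha : ContDiffAt ℝ ∞ a D) :
    ContDiffAt ℝ ∞ (fun D => omg D c (a D)) D := by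
  have h1 := h.contDiffAt_rho
  have h2 := contDiff_gg.contDiffAt (x := D)
  have h3 := h.contDiffAt_lam (c := c) ha
  unfold omg
  fun_prop

theorem Reg.contDiffAt_qq (h : Reg D) (ha : ContDiffAt ℝ ∞ a D) :
    ContDiffAt ℝ ∞ (fun D => qq D c (a D)) D := by
  have h1 := h.contDiffAt_rho
  have h2 := contDiff_gg.contDiffAt (x := D)
  have h3 := h.contDiffAt_lam (c := c) ha
  have h4 := h.contDiffAt_omg (c := c) ha
  have h5 := contDiff_rr.contDiffAt (x := D)
  unfold qq
  fun_prop

theorem Reg.contDiffAt_jj (h : Reg D) (ha : ContDiffAt ℝ ∞ a D) :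
    ContDiffAt ℝ ∞ (fun D => jj D c (a D)) D := by
  have h1 := h.contDiffAt_qq (c := c) ha
  unfold jj
  fun_prop

theorem Reg.contDiffAt_acoef (h : Reg D) (hj : jj D 0 1 ≠ 0) : ContDiffAt ℝ ∞ acoef D := by
  unfold acoef
  exact ContDiffAt.div (h.contDiffAt_jj contDiffAt_const).neg (h.contDiffAt_jj contDiffAt_const) hj

theorem Reg.contDiffAt_ww (h : Reg D) (ha : ContDiffAt ℝ ∞ a D) :
    ContDiffAt ℝ ∞ (fun D => ww D (a D)) D := by
  have h1 := h.contDiffAt_rho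
  have h4 := h.contDiffAt_omg (c := 1) ha
  unfold ww
  fun_prop

theorem Reg.contDiffAt_xx (h : Reg D) (ha : ContDiffAt ℝ ∞ a D) :
    ContDiffAt ℝ ∞ (fun D => xx D (a D)) D := by
  have h1 := h.contDiffAt_rho
  have h3 := h.contDiffAt_lam (c := 1) ha
  have h4 := h.contDiffAt_omg (c := 1) ha
  unfold xx
  fun_prop

theorem Reg.contDiffAt_alp (h : Reg D) (ha : ContDiffAt ℝ ∞ a D) :
    ContDiffAt ℝ ∞ (fun D => alp D (a D)) D := by
  have h1 := h.contDiffAt_rho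
  have h2 := contDiff_rr.contDiffAt (x := D)
  have h3 := h.contDiffAt_lam (c := 1) ha
  have h4 := h.contDiffAt_ww ha
  unfold alp
  fun_prop

theorem Reg.contDiffAt_alp' (h : Reg D) (ha : ContDiffAt ℝ ∞ a D) :
    ContDiffAt ℝ ∞ (fun D => alp' D (a D)) D := by
  have h1 := h.contDiffAt_rho
  have h2 := contDiff_rr.contDiffAt (x := D)
  have h3 := h.contDiffAt_lam (c := 1) ha
  have h4 := h.contDiffAt_ww ha
  have h5 := h.contDiffAt_omg (c := 1) ha
  have h6 := contDiff_gg.contDiffAt (x := D)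
  unfold alp'
  fun_prop

theorem Reg.contDiffAt_ups (h : Reg D) (ha : ContDiffAt ℝ ∞ a D) :
    ContDiffAt ℝ ∞ (fun D => ups D (a D)) D := by
  have h1 := h.contDiffAt_rho
  have h2 := contDiff_rr.contDiffAt (x := D)
  have h3 := h.contDiffAt_lam (c := 1) ha
  have h4 := h.contDiffAt_ww ha
  have h5 := h.contDiffAt_qq (c := 1) ha
  have h6 : ContDiffAt ℝ ∞ (fun D : Dat => 1 / D.1) D :=
    ContDiffAt.div contDiffAt_const contDiffAt_fst h.hm
  unfold ups
  fun_prop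

theorem Reg.contDiffAt_nn (h : Reg D) (ha : ContDiffAt ℝ ∞ a D) :
    ContDiffAt ℝ ∞ (fun D => nn D (a D)) D := by
  have h1 := h.contDiffAt_rho
  have h2 := contDiff_gg.contDiffAt (x := D)
  have h3 := h.contDiffAt_alp ha
  have h4 := h.contDiffAt_alp' ha
  have h5 := h.contDiffAt_ups ha
  have h6 := h.contDiffAt_ww ha
  have h7 := h.contDiffAt_xx ha
  unfold nn
  fun_prop

theorem Reg.contDiffAt_dfc (h : Reg D) (ha : ContDiffAt ℝ ∞ a D) :
    ContDiffAt ℝ ∞ (fun D => dfc D (a D)) D := by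
  have h1 := h.contDiffAt_rho
  have h2 := h.contDiffAt_nn ha
  have h3 := h.contDiffAt_xx ha
  unfold dfc bb
  fun_prop

theorem Reg.contDiffAt_dd (h : Reg D) (hj : jj D 0 1 ≠ 0) : ContDiffAt ℝ ∞ dd D :=
  h.contDiffAt_dfc (h.contDiffAt_acoef hj)

theorem Reg.eventually (h : Reg D) : ∀ᶠ D' in 𝓝 D, Reg D' := by
  filter_upwards [contDiff_rr.continuous.continuousAt.eventually h.pos.eventually,
    (continuous_fst.continuousAt (x := D)).eventually_ne h.hm,
    (by fun_prop : Continuous fun D : Dat => 1 - D.1 * D.2.1).continuousAt.eventually_ne h.curv]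
    with D' h1 h2 h3
  exact ⟨h1, h2, h3⟩

end Dat


/-! ### The data of the model nonlinearities -/

namespace Bd

/-- The function `y ^ q`, where `y = 1 - t²`. -/
noncomputable def yp (q : ℝ) : Bd := if h : 0 ≤ q then
    BoundedContinuousFunction.ofNormedAddCommGroup (fun t => (1 - (t:ℝ) ^ 2) ^ q)
      ((by fun_prop : Continuous fun t : Set.Ioo (0:ℝ) 1 => 1 - (t:ℝ) ^ 2).rpow_const
        fun _ => Or.inr h) 1 fun t => by
      have := one_sub_sq_pos t.2
      rw [Real.norm_of_nonneg (by positivity)]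
      exact Real.rpow_le_one this.le (by nlinarith [t.2.1]) h
  else 0

theorem yp_apply {q : ℝ} (h : 0 ≤ q) (t : Set.Ioo (0:ℝ) 1) : yp q t = (1 - (t:ℝ) ^ 2) ^ q := by
  rw [yp, dif_pos h]; rfl

/-- The function `(1 - y ^ q) / (1 - y)`, where `y = 1 - t²`. -/
noncomputable def ee (q : ℝ) : Bd := if h : 1 ≤ q then
    BoundedContinuousFunction.ofNormedAddCommGroup
      (fun t => (1 - (1 - (t:ℝ) ^ 2) ^ q) / (t:ℝ) ^ 2)
      ((continuous_const.sub ((by fun_prop : Continuous fun t : Set.Ioo (0:ℝ) 1 =>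
        1 - (t:ℝ) ^ 2).rpow_const fun _ => Or.inr (by linarith))).div (by fun_prop)
        fun t => pow_ne_zero 2 t.2.1.ne') q fun t => by
      have hy := one_sub_sq_pos t.2
      have ht := pow_pos t.2.1 2
      have h1 : (1 - (t:ℝ) ^ 2) ^ q ≤ 1 := Real.rpow_le_one hy.le (by linarith) (by linarith)
      have h2 := one_add_mul_self_le_rpow_one_add (s := -(t:ℝ) ^ 2) (by linarith) h
      rw [← sub_eq_add_neg 1] at h2
      rw [Real.norm_of_nonneg (div_nonneg (by linarith) ht.le), div_le_iff₀ ht]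
      linarith
  else 0

theorem ee_apply {q : ℝ} (h : 1 ≤ q) (t : Set.Ioo (0:ℝ) 1) :
    ee q t = (1 - (1 - (t:ℝ) ^ 2) ^ q) / (t:ℝ) ^ 2 := by
  rw [ee, dif_pos h]; rfl

end Bd

open Bd Dat

/-- The leading coefficient of the renormalized energy, due to the power `p`. -/
noncomputable def kap (p : ℝ) (z : ℝ × ℝ) : ℝ := 2 * z.2 * z.1 ^ (p - 1) / (p + 1)

/-- The leading coefficient of the renormalized energy, due to the cubic term. -/
noncomputable def bet (p : ℝ) (z : ℝ × ℝ) : ℝ := 2 / 3 * z.1 - 1 + kap p z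

/-- The cubic coefficient `μ` for which the soliton of `s² - μ s³ + ν s^p` has maximum `m`, where
`z = (m, ν)`. -/
noncomputable def mus (p : ℝ) (z : ℝ × ℝ) : ℝ := 2 * bet p z / z.1 ^ 2

/-- The data of the nonlinearity `s² - μ s³ + ν s^p` whose soliton has maximum `m`, where
`z = (m, ν)`. -/
noncomputable def dat (p : ℝ) (z : ℝ × ℝ) : Dat :=
  (z.1, 1 - mus p z * z.1 + z.2 * z.1 ^ (p - 2),
    (-(mus p z * z.1)) • 1 + (z.2 * z.1 ^ (p - 2)) • ee (p - 2),
    (-bet p z) • 1 + kap p z • ee (p - 2),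
    (-(6 * mus p z * z.1)) • 1 + (p * (p - 1) * (z.2 * z.1 ^ (p - 2))) • yp (p - 3))

theorem contDiffAt_kap (p : ℝ) {z : ℝ × ℝ} (hz : z.1 ≠ 0) : ContDiffAt ℝ ∞ (kap p) z := by
  have h := (contDiffAt_fst (𝕜 := ℝ) (n := ∞) (p := z)).rpow_const_of_ne (p := p - 1) hz
  unfold kap
  simp only [div_eq_mul_inv]
  fun_prop

theorem contDiffAt_bet (p : ℝ) {z : ℝ × ℝ} (hz : z.1 ≠ 0) : ContDiffAt ℝ ∞ (bet p) z := by
  have h := contDiffAt_kap p hz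
  unfold bet
  fun_prop

theorem contDiffAt_mus (p : ℝ) {z : ℝ × ℝ} (hz : z.1 ≠ 0) : ContDiffAt ℝ ∞ (mus p) z := by
  have h := contDiffAt_bet p hz
  unfold mus
  exact ContDiffAt.div (by fun_prop) (by fun_prop) (pow_ne_zero 2 hz)

theorem contDiffAt_dat (p : ℝ) {z : ℝ × ℝ} (hz : z.1 ≠ 0) : ContDiffAt ℝ ∞ (dat p) z := by
  have h1 := contDiffAt_kap p hz
  have h2 := contDiffAt_bet p hz
  have h3 := contDiffAt_mus p hz
  have h := (contDiffAt_fst (𝕜 := ℝ) (n := ∞) (p := z)).rpow_const_of_ne (p := p - 2) hz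
  unfold dat
  fun_prop

theorem hasDerivAt_modelNonlin {p : ℝ} (hp : 3 ≤ p) (μ ν s : ℝ) :
    HasDerivAt (modelNonlin p μ ν) (2 * s - 3 * μ * s ^ 2 + ν * (p * s ^ (p - 1))) s := by
  unfold modelNonlin
  refine (((hasDerivAt_pow 2 s).sub ((hasDerivAt_pow 3 s).const_mul μ)).add
    ((Real.hasDerivAt_rpow_const (p := p) (Or.inr (by linarith))).const_mul ν)).congr_deriv ?_
  push_cast
  ring

theorem deriv_modelNonlin {p : ℝ} (hp : 3 ≤ p) (μ ν : ℝ) : deriv (modelNonlin p μ ν) =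
    fun s => 2 * s - 3 * μ * s ^ 2 + ν * (p * s ^ (p - 1)) :=
  funext fun s => (hasDerivAt_modelNonlin hp μ ν s).deriv

theorem deriv_deriv_modelNonlin {p : ℝ} (hp : 3 ≤ p) (μ ν s : ℝ) :
    deriv (deriv (modelNonlin p μ ν)) s = 2 - 6 * μ * s + ν * (p * (p - 1) * s ^ (p - 2)) := by
  rw [deriv_modelNonlin hp]
  refine HasDerivAt.deriv (((((hasDerivAt_id s).const_mul 2).sub ((hasDerivAt_pow 2 s).const_mul
    (3 * μ))).add (((Real.hasDerivAt_rpow_const (p := p - 1) (Or.inr (by linarith))).const_mul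
    p).const_mul ν)).congr_deriv ?_)
  rw [show p - 1 - 1 = p - 2 by ring]
  push_cast
  ring

theorem contDiff_modelNonlin {p : ℝ} (hp : 3 ≤ p) (μ ν : ℝ) :
    ContDiff ℝ 3 (modelNonlin p μ ν) := by
  have := Real.contDiff_rpow_const_of_le (n := 3) (p := p) (by exact_mod_cast hp)
  unfold modelNonlin
  fun_prop

theorem prim_modelNonlin {p : ℝ} (hp : 3 ≤ p) (μ ν : ℝ) {s : ℝ} :
    prim (modelNonlin p μ ν) s = s ^ 3 / 3 - μ * s ^ 4 / 4 + ν * s ^ (p + 1) / (p + 1) := by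
  rw [prim, intervalIntegral.integral_eq_sub_of_hasDerivAt
    (f := fun s => s ^ 3 / 3 - μ * s ^ 4 / 4 + ν * s ^ (p + 1) / (p + 1)) (fun s _ => ?_)
    ((contDiff_modelNonlin hp μ ν).continuous.intervalIntegrable _ _)]
  · rw [Real.zero_rpow (by linarith)]; ring
  · refine ((((hasDerivAt_pow 3 s).div_const 3).sub (((hasDerivAt_pow 4 s).const_mul μ).div_const
      4)).add (((Real.hasDerivAt_rpow_const (p := p + 1) (Or.inr (by linarith))).const_mul
      ν).div_const (p + 1))).congr_deriv ?_
    have : p + 1 ≠ 0 := by linarith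
    rw [modelNonlin, show p + 1 - 1 = p by ring]
    push_cast
    field_simp

/-- The definition of `mus` is the equation `2F(m) = m²` solved for `μ`. With `s = my` the quotient
`(s² - 2F(s))/s²` is `1 - (1 + β - κ)y + βy² - κy^(p-1)`; dividing it by `t² = 1 - y` gives `1 +
y(-β + κ (1 - y^(p-2))/(1 - y))`, hence the form of `dk`. -/
theorem rlz_modelNonlin {p : ℝ} (hp : 3 ≤ p) {z : ℝ × ℝ} (hm : 0 < z.1) (hR : Pos (rr (dat p z)))
    (hcurv : 1 < z.1 * (dat p z).2.1) : Rlz (modelNonlin p (mus p z) z.2) (dat p z) := by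
  obtain ⟨m, ν⟩ := z
  simp only at hm
  set μ := mus p (m, ν) with hμ
  set κ := kap p (m, ν) with hκ
  set β := bet p (m, ν) with hβ
  have eμ : μ * m ^ 2 = 2 * β := by rw [hμ, mus]; field_simp; rfl
  have eβ : β = 2 / 3 * m - 1 + κ := rfl
  have eκ : κ * (p + 1) = 2 * ν * m ^ (p - 1) := by
    have : p + 1 ≠ 0 := by linarith
    rw [hκ, kap]; field_simp
  have hp1 : p + 1 ≠ 0 := by linarith
  have pw : ∀ {s : ℝ}, 0 < s → s ^ p = s ^ 2 * s ^ (p - 2) ∧ s ^ (p + 1) = s ^ 2 * s ^ (p - 1) ∧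
      s ^ (p - 1) = s * s ^ (p - 2) ∧ s ^ (p - 2) = s * s ^ (p - 3) := fun {s} hs => by
    refine ⟨?_, ?_, ?_, ?_⟩
    · rw [← Real.rpow_natCast s 2, ← Real.rpow_add hs]; congr 1; push_cast; ring
    · rw [← Real.rpow_natCast s 2, ← Real.rpow_add hs]; congr 1; push_cast; ring
    · rw [← Real.rpow_one_add' hs.le (by linarith)]; congr 1; ring
    · rw [← Real.rpow_one_add' hs.le (by linarith)]; congr 1; ring
  have hE : ∀ {y : ℝ}, 0 < y → (m * y) ^ 2 - 2 * prim (modelNonlin p μ ν) (m * y) =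
      (m * y) ^ 2 * (1 - (1 + β - κ) * y + β * y ^ 2 - κ * (y * y ^ (p - 2))) := fun {y} hy => by
    rw [prim_modelNonlin hp, (pw (mul_pos hm hy)).2.1, Real.mul_rpow hm.le hy.le,
      (pw hy).2.2.1]
    field_simp
    linear_combination 6 * (p + 1) * y ^ 2 * eμ + 12 * y * y ^ (p - 2) * eκ + 12 * (p + 1) * y * eβ
  have one_rpow : (1:ℝ) ^ (p - 2) = 1 := Real.one_rpow _
  constructor
  case f3 => exact contDiff_modelNonlin hp _ _
  case f0 => simp [modelNonlin, Real.zero_rpow (show p ≠ 0 by linarith)]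
  case f1 =>
    rw [deriv_modelNonlin hp]
    simp [Real.zero_rpow (show p - 1 ≠ 0 by linarith)]
  case f2 =>
    rw [deriv_deriv_modelNonlin hp]
    simp [Real.zero_rpow (show p - 2 ≠ 0 by linarith)]
  case hm => exact hm
  case curv => exact hcurv
  case fm =>
    simp only [dat, modelNonlin]
    rw [(pw hm).1]
    ring
  case Fm =>
    have := hE one_pos
    simp only [mul_one, one_rpow] at this
    simp only [dat]
    linear_combination -this
  case hR =>
    obtain ⟨δ, h1, h2⟩ := hR
    exact ⟨δ, h1, fun t => by simpa [rr] using h2 t⟩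
  all_goals
    intro t
    have hy := one_sub_sq_pos t.2
    have ht0 := t.2.1.ne'
    have e1 := ee_apply (q := p - 2) (by linarith) t
    simp only [dat, BoundedContinuousFunction.add_apply, BoundedContinuousFunction.smul_apply,
      one_apply, smul_eq_mul, mul_one, yp_apply (q := p - 3) (by linarith) t, e1]
  case hg =>
    rw [modelNonlin, (pw (mul_pos hm hy)).1, Real.mul_rpow hm.le hy.le]
    field_simp
    ring
  case hk =>
    rw [hE hy, ← hβ, ← hκ]
    field_simp
    ring
  case hζ =>
    rw [deriv_deriv_modelNonlin hp, (pw (mul_pos hm hy)).2.2.2, Real.mul_rpow hm.le hy.le,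
      (pw hm).2.2.2]
    ring


/-! ### Well-posedness near the Gardner nonlinearities -/

open Bd Dat

theorem Bd.int_ss (h : Bd) : int (ss * h) = ∫ t in (0:ℝ)..1, ext h t := by
  rw [int_apply]
  refine intervalIntegral.integral_congr_ae ?_
  rw [Set.uIoc_of_le zero_le_one]
  filter_upwards [(Measure.ae_ne volume (1:ℝ))] with t h1 ht
  have hm : t ∈ Set.Ioo (0:ℝ) 1 := ⟨ht.1, lt_of_le_of_ne ht.2 h1⟩
  have hs := Real.sqrt_pos.2 (one_sub_sq_pos hm)
  rw [ext_of_mem _ hm, ext_of_mem _ hm, BoundedContinuousFunction.mul_apply, ss_apply]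
  field_simp

theorem Bd.int_eq {h : Bd} {G : ℝ → ℝ} (hc : ContinuousOn G (Set.Icc 0 1))
    (hd : ∀ t : Set.Ioo (0:ℝ) 1, HasDerivAt G (h t) t) : int (ss * h) = G 1 - G 0 := by
  rw [int_ss]
  refine intervalIntegral.integral_eq_sub_of_hasDerivAt_of_le zero_le_one hc (fun t ht => ?_) ?_
  · rw [ext_of_mem h ht]; exact hd ⟨t, ht⟩
  · rw [intervalIntegrable_iff]
    exact Measure.integrableOn_of_bounded (M := ‖h‖) (by simp) (aestronglyMeasurable_ext h)
      (ae_of_all _ fun x => abs_ext_le h x)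

theorem kap_zero (p m : ℝ) : kap p (m, 0) = 0 := by simp [kap]

theorem bet_zero (p m : ℝ) : bet p (m, 0) = 2 / 3 * m - 1 := by simp [bet, kap_zero]

theorem mus_zero (p m : ℝ) : mus p (m, 0) = 2 * (2 / 3 * m - 1) / m ^ 2 := by
  simp [mus, bet_zero]

theorem pos_rr_dat {p m : ℝ} (hm3 : m < 3) : Pos (rr (dat p (m, 0))) := by
  refine ⟨min 1 (2 - 2 / 3 * m), lt_min one_pos (by linarith), fun t => ?_⟩
  have hy := one_sub_sq_pos t.2
  have h1 := pow_pos t.2.1 2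
  have e : rr (dat p (m, 0)) t = 1 * (t:ℝ) ^ 2 + (1 - (t:ℝ) ^ 2) * (2 - 2 / 3 * m) := by
    simp [rr, dat, kap_zero, bet_zero]
    ring
  rw [e]
  have h2 := min_le_left 1 (2 - 2 / 3 * m)
  have h3 := min_le_right 1 (2 - 2 / 3 * m)
  nlinarith

theorem curv_dat {p m : ℝ} (hm : 0 < m) (hm3 : m < 3) : 1 < m * (dat p (m, 0)).2.1 := by
  simp only [dat, mus_zero]
  have : m * (1 - 2 * (2 / 3 * m - 1) / m ^ 2 * m + 0 * m ^ (p - 2)) = 2 - m / 3 := by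
    field_simp
    ring
  rw [this]
  linarith

/-- With `β = 2m/3 - 1` the data at `ν = 0` reduce to `R = 1 - βy`, and the density of `jj` has an
elementary primitive, given explicitly; it vanishes at `t = 0`. -/
theorem jj_dat {p m : ℝ} (hm : 0 < m) (hm3 : m < 3) :
    jj (dat p (m, 0)) 0 1 = 9 / 4 * (m / (3 - m)) ^ 2 := by
  obtain ⟨β, rfl⟩ : ∃ β, m = 3 / 2 * (1 + β) := ⟨2 / 3 * m - 1, by ring⟩
  have hb1 : 0 < 1 + β := by linarith
  have hb2 : 0 < 1 - β := by linarith
  set D := dat p (3 / 2 * (1 + β), 0) with hD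
  have hP : Pos (rr D) := pos_rr_dat hm3
  have hmu : mus p (3 / 2 * (1 + β), 0) * (3 / 2 * (1 + β)) = 4 * β / (3 * (1 + β)) := by
    rw [mus_zero]; field_simp; ring
  have hR : ∀ y : ℝ, 0 ≤ y → y ≤ 1 → 0 < 1 - β * y := fun y h0 h1 => by nlinarith
  have key : jj D 0 1 = _ := int_eq (h := yy * qq D 0 1)
    (G := fun t => 9 / 4 * ((1 + β) / (1 - β)) ^ 2 * (t * (1 + (1 - β) * ((1 - t ^ 2) / 2
      - β * (1 - t ^ 2) ^ 2 + β ^ 2 * (1 - t ^ 2) ^ 3)) / √(1 - β * (1 - t ^ 2)))) ?_ ?_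
  · have : 3 - 3 / 2 * (1 + β) = 3 / 2 * (1 - β) := by ring
    rw [key, this]
    simp
    field_simp
  · refine ContinuousOn.mul continuousOn_const (ContinuousOn.div (by fun_prop) (by fun_prop)
      fun t ht => (Real.sqrt_pos.2 (hR _ ?_ ?_)).ne') <;> nlinarith [ht.1, ht.2]
  · intro t
    have hy := one_sub_sq_pos t.2
    have hRt := hR (1 - (t:ℝ) ^ 2) hy.le (by nlinarith [t.2.1])
    have hr := Real.sqrt_pos.2 hRt
    have hr2 := Real.sq_sqrt hRt.le
    have err : rr D t = 1 - β * (1 - (t:ℝ) ^ 2) := by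
      rw [Rlz.rr_apply]; simp [hD, dat, kap_zero, bet_zero]; ring
    have erho : rho D t = 1 / √(1 - β * (1 - (t:ℝ) ^ 2)) := by
      rw [rho, rs_apply hP, err]
    have hgg : gg D t = 1 - 4 * β / (3 * (1 + β)) * (1 - (t:ℝ) ^ 2) := by
      rw [Rlz.gg_apply]; simp [hD, dat, hmu]; ring
    have hdg : D.2.2.1 t = -(4 * β / (3 * (1 + β))) := by simp [hD, dat, hmu]
    have hD1 : D.1 = 3 / 2 * (1 + β) := rfl
    have hD2 : D.2.1 = 1 - 4 * β / (3 * (1 + β)) := by simp [hD, dat, hmu]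
    have hlam : lam D 0 1 = 1 / (1 - β) := by
      rw [lam, hD1, hD2]
      have : 1 - 3 / 2 * (1 + β) * (1 - 4 * β / (3 * (1 + β))) = -(1 - β) / 2 := by
        field_simp; ring
      rw [this]
      field_simp
      ring
    have h1 := (((hasDerivAt_id (t:ℝ)).fun_pow 2).const_sub 1)
    have h2 := (((h1.const_mul β).const_sub 1).sqrt hRt.ne')
    have h3 := (hasDerivAt_id (t:ℝ)).mul ((((h1.div_const 2).sub ((h1.fun_pow 2).const_mul β)).add
      ((h1.fun_pow 3).const_mul (β ^ 2))).const_mul (1 - β) |>.const_add 1)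
    have h4 := (h3.div h2 hr.ne').const_mul (9 / 4 * ((1 + β) / (1 - β)) ^ 2)
    refine h4.congr_deriv ?_
    rw [BoundedContinuousFunction.mul_apply, yy_apply, Rlz.qq_apply, Rlz.omg_apply, hlam, hgg, hdg, hD1, hD2,
      err, erho]
    simp only [id, Pi.mul_apply, Pi.add_apply, Pi.sub_apply]
    set r := √(1 - β * (1 - (t:ℝ) ^ 2))
    field_simp
    rw [hr2]
    push_cast
    ring

theorem reg_dat {p m : ℝ} (hm : 0 < m) (hm3 : m < 3) : Reg (dat p (m, 0)) :=
  ⟨pos_rr_dat hm3, hm.ne', (sub_neg.2 (curv_dat hm hm3)).ne⟩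

theorem jj_dat_ne {p m : ℝ} (hm : 0 < m) (hm3 : m < 3) : jj (dat p (m, 0)) 0 1 ≠ 0 := by
  rw [jj_dat hm hm3]
  have : 0 < 3 - m := by linarith
  positivity

/-- The change of parameters `(m, ν) ↦ (μ, ν)`. -/
noncomputable def psi (p : ℝ) (z : ℝ × ℝ) : ℝ × ℝ := (mus p z, z.2)

/-- The parameters `z = (m, ν)` at which the defect of `s² - μ s³ + ν s^p` is a smooth function of
`(μ, ν)`. -/
structure Good (p : ℝ) (z : ℝ × ℝ) : Prop where
  hm : 0 < z.1
  pos : Pos (rr (dat p z))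
  curv : 1 < z.1 * (dat p z).2.1
  hj : jj (dat p z) 0 1 ≠ 0
  inv : (fderiv ℝ (psi p) z).IsInvertible

theorem contDiffAt_psi (p : ℝ) {z : ℝ × ℝ} (hz : z.1 ≠ 0) : ContDiffAt ℝ ∞ (psi p) z :=
  (contDiffAt_mus p hz).prodMk contDiffAt_snd

namespace Good

variable {p : ℝ} {z : ℝ × ℝ}

theorem reg (h : Good p z) : Reg (dat p z) := ⟨h.pos, h.hm.ne', (sub_neg.2 h.curv).ne⟩

theorem rlz (h : Good p z) (hp : 3 ≤ p) : Rlz (modelNonlin p (mus p z) z.2) (dat p z) :=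
  rlz_modelNonlin hp h.hm h.pos h.curv

theorem eventually (h : Good p z) : ∀ᶠ z' in 𝓝 z, Good p z' := by
  have hd := (contDiffAt_dat p h.hm.ne').continuousAt
  have h1 : ContinuousAt (fun z : ℝ × ℝ => z.1 * (dat p z).2.1) z :=
    continuousAt_fst.mul (continuousAt_fst.comp (continuousAt_snd.comp hd))
  have h2 : ContinuousAt (fun z => jj (dat p z) 0 1) z :=
    ContinuousAt.comp (g := fun D => jj D 0 1) (h.reg.contDiffAt_jj contDiffAt_const).continuousAt hd
  have h3 : ContinuousAt (fderiv ℝ (psi p)) z :=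
    ((contDiffAt_psi p h.hm.ne').fderiv_right (m := 0) (by simp)).continuousAt
  obtain ⟨e, he⟩ := h.inv
  have h4 := h3.eventually (by rw [← he]; exact ContinuousLinearEquiv.nhds e)
  filter_upwards [continuousAt_fst.eventually (lt_mem_nhds h.hm), hd.eventually h.reg.eventually,
    h1.eventually (lt_mem_nhds h.curv), h2.eventually_ne h.hj, h4] with z' a1 a2 a3 a4 a5
  exact ⟨a1, a2.pos, a3, a4, a5⟩

theorem existsUnique (h : Good p z) (hp : 3 ≤ p) :
    ∃! d, IsDefect (modelNonlin p (psi p z).1 (psi p z).2) d :=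
  (h.rlz hp).existsUnique h.hj

theorem defect_eq (h : Good p z) (hp : 3 ≤ p) :
    defect (modelNonlin p (psi p z).1 (psi p z).2) = dd (dat p z) :=
  (h.rlz hp).defect_eq_dd h.hj

/-- Inverse function theorem for the change of parameters; the conditions in `Good` are open, so
they persist along the local inverse. -/
theorem exists_inverse (h : Good p z) : ∃ ψ : ℝ × ℝ → ℝ × ℝ, ContDiffAt ℝ ∞ ψ (psi p z) ∧
    ψ (psi p z) = z ∧ ∀ᶠ w in 𝓝 (psi p z), Good p (ψ w) ∧ psi p (ψ w) = w := by
  obtain ⟨e, he⟩ := h.inv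
  have hc := contDiffAt_psi p h.hm.ne'
  have hn : (∞ : WithTop ℕ∞) ≠ 0 := by simp
  have hd : HasFDerivAt (psi p) (e : ℝ × ℝ →L[ℝ] ℝ × ℝ) z := by
    rw [he]; exact (hc.differentiableAt hn).hasFDerivAt
  have hs := hc.hasStrictFDerivAt' hd hn
  have h0 : hc.localInverse hd hn (psi p z) = z := hc.localInverse_apply_image hd hn
  have h1 := hc.to_localInverse hd hn
  refine ⟨hc.localInverse hd hn, h1, h0, ?_⟩
  have h2 : ∀ᶠ w in 𝓝 (psi p z), psi p (hc.localInverse hd hn w) = w := hs.eventually_right_inverse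
  have h3 : ∀ᶠ w in 𝓝 (psi p z), Good p (hc.localInverse hd hn w) :=
    h1.continuousAt.eventually (by rw [h0]; exact h.eventually)
  exact h3.and h2

theorem contDiffAt_defect (h : Good p z) (hp : 3 ≤ p) :
    ContDiffAt ℝ ∞ (fun w : ℝ × ℝ => defect (modelNonlin p w.1 w.2)) (psi p z) := by
  obtain ⟨ψ, h1, h2, h3⟩ := h.exists_inverse
  have h4 : ContDiffAt ℝ ∞ (fun w => dd (dat p (ψ w))) (psi p z) := by
    have a1 : ContDiffAt ℝ ∞ (dat p) (ψ (psi p z)) := by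
      rw [h2]; exact contDiffAt_dat p h.hm.ne'
    have a2 : ContDiffAt ℝ ∞ dd (dat p (ψ (psi p z))) := by
      rw [h2]; exact h.reg.contDiffAt_dd h.hj
    exact a2.comp (psi p z) (a1.comp (psi p z) h1)
  refine h4.congr_of_eventuallyEq ?_
  filter_upwards [h3] with w hw
  have := hw.1.defect_eq hp
  rwa [hw.2] at this

end Good

/-- The derivative of `(m, ν) ↦ (μ, ν)` is triangular, and at `ν = 0` its diagonal entry is `∂μ/∂m =
(4/m³)(1 - m/3)`, positive exactly for `m < 3`. -/
theorem good_of_lt {p m : ℝ} (hm : 0 < m) (hm3 : m < 3) : Good p (m, 0) := by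
  refine ⟨hm, pos_rr_dat hm3, curv_dat hm hm3, jj_dat_ne hm hm3, ?_⟩
  have hd := (contDiffAt_psi p (z := (m, 0)) hm.ne').differentiableAt (by simp)
  have hd1 := (contDiffAt_mus p (z := (m, 0)) hm.ne').differentiableAt (by simp)
  set L := fderiv ℝ (psi p) (m, 0) with hL
  have hL' : L = (fderiv ℝ (mus p) (m, 0)).prod (.snd ℝ ℝ ℝ) :=
    (hd1.hasFDerivAt.prodMk hasFDerivAt_snd).fderiv
  have h1 : HasDerivAt (fun m => mus p (m, 0)) (fderiv ℝ (mus p) (m, 0) (1, 0)) m :=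
    hd1.hasFDerivAt.comp_hasDerivAt (f := fun m : ℝ => (m, (0:ℝ))) m
      ((hasDerivAt_id m).prodMk (hasDerivAt_const m (0:ℝ)))
  have h2 : HasDerivAt (fun m => mus p (m, 0)) (4 / m ^ 3 * (1 - m / 3)) m := by
    simp only [mus_zero]
    refine (((((hasDerivAt_id m).const_mul (2 / 3)).sub_const 1).const_mul 2).div
      (hasDerivAt_pow 2 m) (pow_ne_zero 2 hm.ne')).congr_deriv ?_
    simp only [id]
    field_simp
    ring
  have h3 := h1.unique h2
  have hinj : Function.Injective L := by
    rw [injective_iff_map_eq_zero]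
    rintro ⟨h, k⟩ hk
    rw [hL', ContinuousLinearMap.prod_apply, Prod.mk_eq_zero] at hk
    obtain ⟨k1, rfl⟩ := hk
    have : ((h, 0) : ℝ × ℝ) = h • (1, 0) := by simp
    rw [this, map_smul, h3, smul_eq_mul, mul_eq_zero] at k1
    rcases k1 with rfl | k1
    · rfl
    · have : 0 < 4 / m ^ 3 * (1 - m / 3) := mul_pos (by positivity) (by linarith)
      exact absurd k1 this.ne'
  exact ⟨(LinearEquiv.ofInjectiveEndo L.toLinearMap hinj).toContinuousLinearEquiv, by ext <;> rfl⟩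

/-- `m` is the root of `μm² - 4m/3 + 2 = 0` that stays bounded as `μ → 0`, in rationalized form so
that `μ = 0` is included. -/
theorem exists_mus_eq (p : ℝ) {μ : ℝ} (hμ : μ < 2 / 9) : ∃ m, 0 < m ∧ m < 3 ∧ psi p (m, 0) = (μ, 0) := by
  set m : ℝ := 3 / (1 + √(1 - 9 / 2 * μ)) with hm
  have h0 : 0 < 1 - 9 / 2 * μ := by linarith
  have h1 := Real.sqrt_pos.2 h0
  have h2 := Real.sq_sqrt h0.le
  refine ⟨m, by positivity, ?_, ?_⟩
  · rw [hm, div_lt_iff₀ (by linarith)]; linarith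
  · rw [psi, mus_zero, Prod.mk.injEq]
    refine ⟨?_, rfl⟩
    rw [hm]
    set r := √(1 - 9 / 2 * μ)
    clear_value r
    field_simp
    linear_combination (-2) * h2


/-! ### The defect of the Gardner nonlinearities -/

open Bd Dat

theorem deriv_eq_of_hasDerivAt {g g' : ℝ → ℝ} (h : ∀ x, HasDerivAt g (g' x) x) : deriv g = g' :=
  funext fun x => (h x).deriv

/-- The two-soliton coefficients of the Gardner nonlinearity are explicit. -/
theorem gardner_solutions {p μ : ℝ} (hp : 3 ≤ p) {Q Q1 : ℝ → ℝ}
    (h : Profile (modelNonlin p μ 0) Q Q1) :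
    FirstSol (modelNonlin p μ 0) Q Q1 (fun x => -4 / 3 * Q x + μ * Q x ^ 2)
        (fun x => -2 * resonance Q x) (fun x => -2 * resonance Q x) (fun _ => 0) (2 / 3) (-2) ∧
      SecondSol (modelNonlin p μ 0) Q Q1 (fun x => -4 / 3 * Q x + μ * Q x ^ 2)
        (fun x => -2 * resonance Q x) (fun _ => 0)
        (fun x => -2 + (4 / 3 + 2 * μ) * Q x - 7 / 3 * μ * Q x ^ 2 + μ ^ 2 * Q x ^ 3)
        (fun x => 4 / 3 * resonance Q x) (2 / 3) (-(1 / 2) * (-2) ^ 2) (-4 / 9 - μ) (4 / 3) := by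
  have hf : ∀ s, modelNonlin p μ 0 s = s ^ 2 - μ * s ^ 3 := fun s => by simp [modelNonlin]
  have hf1 : ∀ s, deriv (modelNonlin p μ 0) s = 2 * s - 3 * μ * s ^ 2 := fun s => by
    rw [deriv_modelNonlin hp]; ring
  have hf2 : deriv (deriv (modelNonlin p μ 0)) = fun s => 2 - 6 * μ * s := funext fun s => by
    rw [deriv_deriv_modelNonlin hp]; ring
  have hf3 : ∀ s, deriv (deriv (deriv (modelNonlin p μ 0))) s = -(6 * μ) := fun s => by
    rw [hf2]
    exact ((((hasDerivAt_id s).const_mul (6 * μ)).const_sub 2).congr_deriv (by ring)).deriv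
  have hE : ∀ x, Q1 x ^ 2 = Q x ^ 2 - 2 / 3 * Q x ^ 3 + μ / 2 * Q x ^ 4 := fun x => by
    rw [h.energy, prim_modelNonlin hp]; ring
  have d1 := h.d1
  have d2 : ∀ x, HasDerivAt Q1 (Q x - (Q x ^ 2 - μ * Q x ^ 3)) x := fun x => by
    rw [← hf]; exact h.d2 x
  have c3 := h.contDiff_nat
  have cQ : Cls 1 3 Q := (h.cls_Q c3).of_le (by omega)
  have cQ2 : Cls 1 3 fun x => Q x ^ 2 :=
    (cQ.mul' cQ (by norm_num)).congr fun x => sq (Q x)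
  have cQ3 : Cls 1 3 fun x => Q x ^ 3 :=
    (cQ2.mul' cQ (by norm_num)).congr fun x => by ring
  have hr : ∀ x, resonance Q x * Q x = -Q1 x := fun x => by
    have := (h.pos x).ne'
    rw [h.resonance_eq]; field_simp
  have hr1 : ∀ x, resonance Q x * Q1 x = -(Q x - 2 / 3 * Q x ^ 2 + μ / 2 * Q x ^ 3) := fun x => by
    have := (h.pos x).ne'
    rw [h.resonance_eq]; field_simp; linear_combination -6 * hE x
  -- Here `-2φ' = A + (2/3)Q`. Hence `M = -2φ = B`, and `V` vanishes identically.
  have dr : ∀ x, HasDerivAt (resonance Q) (1 / 3 * Q x - μ / 2 * Q x ^ 2) x := fun x => by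
    refine (h.hasDerivAt_res x).congr_deriv ?_
    have := (h.pos x).ne'
    rw [hf, prim_modelNonlin hp]
    field_simp
    ring
  have dQ2 : ∀ x, HasDerivAt (fun x => Q x ^ 2) (2 * (Q x * Q1 x)) x := fun x =>
    ((d1 x).fun_pow 2).congr_deriv (by push_cast; ring)
  have dr1 : ∀ x, HasDerivAt (fun x => 1 / 3 * Q x - μ / 2 * Q x ^ 2)
      (1 / 3 * Q1 x - μ * (Q x * Q1 x)) x := fun x =>
    (((d1 x).const_mul (1 / 3)).sub ((dQ2 x).const_mul (μ / 2))).congr_deriv (by ring)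
  have dQQ1 : ∀ x, HasDerivAt (fun x => Q x * Q1 x)
      (2 * Q x ^ 2 - 5 / 3 * Q x ^ 3 + 3 / 2 * μ * Q x ^ 4) x := fun x =>
    ((d1 x).mul (d2 x)).congr_deriv (by linear_combination hE x)
  have dr2 : ∀ x, HasDerivAt (fun x => 1 / 3 * Q1 x - μ * (Q x * Q1 x))
      (1 / 3 * (Q x - (Q x ^ 2 - μ * Q x ^ 3)) -
        μ * (2 * Q x ^ 2 - 5 / 3 * Q x ^ 3 + 3 / 2 * μ * Q x ^ 4)) x := fun x =>
    ((d2 x).const_mul (1 / 3)).sub ((dQQ1 x).const_mul μ)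
  have dA : ∀ x, HasDerivAt (fun x => -4 / 3 * Q x + μ * Q x ^ 2)
      (-4 / 3 * Q1 x + μ * (2 * (Q x * Q1 x))) x := fun x =>
    ((d1 x).const_mul _).add ((dQ2 x).const_mul μ)
  have dA1 : ∀ x, HasDerivAt (fun x => -4 / 3 * Q1 x + μ * (2 * (Q x * Q1 x)))
      (-4 / 3 * (Q x - (Q x ^ 2 - μ * Q x ^ 3)) +
        μ * (2 * (2 * Q x ^ 2 - 5 / 3 * Q x ^ 3 + 3 / 2 * μ * Q x ^ 4))) x := fun x =>
    ((d2 x).const_mul _).add (((dQQ1 x).const_mul 2).const_mul μ)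
  have eB1 := deriv_eq_of_hasDerivAt fun x => (dr x).const_mul (-2)
  have eB2 := deriv_eq_of_hasDerivAt fun x => (dr1 x).const_mul (-2)
  have eB3 := deriv_eq_of_hasDerivAt fun x => (dr2 x).const_mul (-2)
  have eA1 := deriv_eq_of_hasDerivAt dA
  have eA2 := deriv_eq_of_hasDerivAt dA1
  constructor
  · constructor
    case evenA => intro x; simp only [h.even]
    case oddB => intro x; rw [h.res_odd]; ring
    case clsA => exact (cQ.const_mul _).add (cQ2.const_mul _)
    case clsB => exact (cQ.const_mul 0).congr fun x => by ring
    case eqA =>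
      intro x
      rw [eA1, eA2, hf1, hf]
      ring
    case eqB =>
      intro x
      rw [eB1, eB2, hf1, eA1]
      linear_combination (-4 + 6 * μ * Q x) * hr x
    case hM =>
      intro x
      exact ((dr x).const_mul (-2)).congr_deriv (by ring)
    case M0 =>
      have := h.res_odd 0
      rw [neg_zero] at this
      linarith
    case hV => intro x; exact (hasDerivAt_const x (0:ℝ)).congr_deriv (by ring)
    case V_lim => exact tendsto_const_nhds
  · have dA2 : ∀ x, HasDerivAt
        (fun x => -2 + (4 / 3 + 2 * μ) * Q x - 7 / 3 * μ * Q x ^ 2 + μ ^ 2 * Q x ^ 3)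
        ((4 / 3 + 2 * μ) * Q1 x - 7 / 3 * μ * (2 * (Q x * Q1 x)) + μ ^ 2 * (3 * (Q x * (Q x * Q1 x))))
        x := fun x =>
      (((((d1 x).const_mul _).const_add (-2)).sub ((dQ2 x).const_mul _)).add
        (((d1 x).fun_pow 3).const_mul _)).congr_deriv (by push_cast; ring)
    have dA21 : ∀ x, HasDerivAt (fun x => (4 / 3 + 2 * μ) * Q1 x - 7 / 3 * μ * (2 * (Q x * Q1 x)) +
        μ ^ 2 * (3 * (Q x * (Q x * Q1 x)))) ((4 / 3 + 2 * μ) * (Q x - (Q x ^ 2 - μ * Q x ^ 3))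
        - 7 / 3 * μ * (2 * (2 * Q x ^ 2 - 5 / 3 * Q x ^ 3 + 3 / 2 * μ * Q x ^ 4)) +
        μ ^ 2 * (3 * (Q x * (2 * Q x ^ 2 - 5 / 3 * Q x ^ 3 + 3 / 2 * μ * Q x ^ 4)
        + Q x * (Q x ^ 2 - 2 / 3 * Q x ^ 3 + μ / 2 * Q x ^ 4)))) x := fun x =>
      ((((d2 x).const_mul _).sub (((dQQ1 x).const_mul 2).const_mul _)).add
        ((((d1 x).mul (dQQ1 x)).const_mul 3).const_mul _)).congr_deriv
          (by linear_combination 3 * μ ^ 2 * Q x * hE x)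
    have eA21 := deriv_eq_of_hasDerivAt dA2
    have eA22 := deriv_eq_of_hasDerivAt dA21
    have eB21 := deriv_eq_of_hasDerivAt fun x => (dr x).const_mul (4 / 3)
    have eB22 := deriv_eq_of_hasDerivAt fun x => (dr1 x).const_mul (4 / 3)
    constructor
    case evenA => intro x; simp only [h.even]
    case oddB => intro x; rw [h.res_odd]; ring
    case clsA =>
      exact (((cQ.const_mul (4 / 3 + 2 * μ)).sub (cQ2.const_mul (7 / 3 * μ))).add
        (cQ3.const_mul (μ ^ 2))).congr fun x => by ring
    case clsB => exact (cQ.const_mul 0).congr fun x => by ring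
    case eqA =>
      intro x
      rw [eA21, eA22, hf1, hf, Phi, eA1, eA2, eB1, hf2, hf]
      ring
    case eqB =>
      intro x
      have e : linOp (modelNonlin p μ 0) Q (fun x => 4 / 3 * resonance Q x) =
          fun x => 4 / 3 * (resonance Q x + 5 / 3 * Q1 x - 2 * μ * (Q x * Q1 x)) := funext fun x => by
        rw [linOp, eB21, eB22, hf1]
        linear_combination (-(8 / 3) + 4 * μ * Q x) * hr x
      rw [e]
      refine ((((dr x).add ((d2 x).const_mul (5 / 3))).sub ((dQQ1 x).const_mul
        (2 * μ))).const_mul (4 / 3)).congr_deriv ?_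
      rw [eA21, eA22, GPhi, eB1, eB2, eB3, eA1, eA2, hf3, hf2, hf]
      linear_combination (-8 / 3 - 6 * μ + 20 * μ * Q x - 18 * μ ^ 2 * Q x ^ 2) * hr1 x

/-- For these nonlinearities `b₂ + b³/6 = 4/3 - 8/6`. -/
theorem dd_dat_zero {p m : ℝ} (hp : 3 ≤ p) (hm : 0 < m) (hm3 : m < 3) : dd (dat p (m, 0)) = 0 := by
  have hr := (good_of_lt (p := p) hm hm3).rlz hp
  obtain ⟨Q, Q1, h, h0⟩ := Realizes.exists_profile hr
  obtain ⟨h1, h2⟩ := gardner_solutions hp h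
  rw [← hr.defect_eq (jj_dat_ne hm hm3) h h0 h1 h2]
  norm_num


/-! ### The derivative of the defect at the quadratic nonlinearity -/

open Bd Dat

/-! ### Integration by parts for the nonlocal operators -/

namespace Bd

theorem int_eq_of_tendsto {k : Bd} {G : ℝ → ℝ} {l₀ l₁ : ℝ}
    (hd : ∀ t : Set.Ioo (0:ℝ) 1, HasDerivAt G (k t * (1 / √(1 - (t:ℝ) ^ 2))) t)
    (h0 : Tendsto G (𝓝[>] 0) (𝓝 l₀)) (h1 : Tendsto G (𝓝[<] 1) (𝓝 l₁)) : int k = l₁ - l₀ := by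
  rw [int_apply]
  exact intervalIntegral.integral_eq_sub_of_hasDerivAt_of_tendsto zero_lt_one
    (fun t ht => by rw [ext_of_mem k ht]; exact hd ⟨t, ht⟩) (intervalIntegrable_int k) h0 h1

theorem pr_eq {g : Bd} {G : ℝ → ℝ} (hc : ContinuousOn G (Set.Icc 0 1)) (h0 : G 0 = 0)
    (hd : ∀ t : Set.Ioo (0:ℝ) 1, HasDerivAt G (g t / (1 - (t:ℝ) ^ 2)) t) (t : Set.Ioo (0:ℝ) 1) :
    pr g t = G t := by
  rw [pr, intervalIntegral.integral_eq_sub_of_hasDerivAt_of_le t.2.1.le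
    (hc.mono (Set.Icc_subset_Icc_right t.2.2.le)) (fun τ hτ => ?_)
    (intervalIntegrable_pr g t.2.1.le t.2.2), h0, sub_zero]
  have hm : τ ∈ Set.Ioo (0:ℝ) 1 := ⟨hτ.1, hτ.2.trans t.2.2⟩
  rw [ext_of_mem g hm]
  exact hd ⟨τ, hm⟩

theorem tendsto_nhdsGT_zero_of_le {G : ℝ → ℝ} {C : ℝ}
    (h : ∀ t : Set.Ioo (0:ℝ) 1, |G t| ≤ C * t) : Tendsto G (𝓝[>] 0) (𝓝 0) := by
  have h1 : Tendsto (fun t : ℝ => C * t) (𝓝[>] 0) (𝓝 0) := by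
    have : Continuous fun t : ℝ => C * t := by fun_prop
    have := (this.tendsto 0).mono_left (nhdsWithin_le_nhds (s := Set.Ioi 0))
    simpa using this
  refine squeeze_zero_norm' ?_ h1
  filter_upwards [Ioo_mem_nhdsGT (zero_lt_one (α := ℝ))] with t ht
  exact h ⟨t, ht⟩

theorem tendsto_nhdsLT_one_of_le {G : ℝ → ℝ} {C : ℝ}
    (h : ∀ t : Set.Ioo (0:ℝ) 1, |G t| ≤ C * √(1 - (t:ℝ) ^ 2)) : Tendsto G (𝓝[<] 1) (𝓝 0) := by
  have h1 : Tendsto (fun t : ℝ => C * √(1 - t ^ 2)) (𝓝[<] 1) (𝓝 0) := by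
    have : Continuous fun t : ℝ => C * √(1 - t ^ 2) := by fun_prop
    have := (this.tendsto 1).mono_left (nhdsWithin_le_nhds (s := Set.Iio 1))
    simpa using this
  refine squeeze_zero_norm' ?_ h1
  filter_upwards [Ioo_mem_nhdsLT (zero_lt_one (α := ℝ))] with t ht
  exact h ⟨t, ht⟩

theorem sqrt_le (t : Set.Ioo (0:ℝ) 1) : 0 ≤ √(1 - (t:ℝ) ^ 2) ∧
    1 - (t:ℝ) ^ 2 ≤ √(1 - (t:ℝ) ^ 2) ∧ √(1 - (t:ℝ) ^ 2) ≤ 1 := by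
  have hy := one_sub_sq_pos t.2
  have hs2 := Real.sq_sqrt hy.le
  have h1 : √(1 - (t:ℝ) ^ 2) ≤ 1 := by
    rw [Real.sqrt_le_one]; nlinarith [t.2.1]
  have h0 := Real.sqrt_nonneg (1 - (t:ℝ) ^ 2)
  exact ⟨h0, by nlinarith, h1⟩

/-- The operator `q ↦ (t (1 - t²)²)⁻¹ ∫ₜ¹ (1 - τ²) q`, on functions with `∫₀¹ (1 - τ²) q = 0`. -/
noncomputable def zop : Bd →L[ℝ] Bd :=
  ContinuousLinearMap.mul ℝ Bd ((2:ℝ) • tt - tt * tt * tt) ∘L tail -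
    avg ∘L ContinuousLinearMap.mul ℝ Bd yy

theorem zop_apply (q : Bd) : zop q = ((2:ℝ) • tt - tt * tt * tt) * tail q - avg (yy * q) := rfl

/-- Under the vanishing condition the integral over `(t, 1)` is minus the one over `(0, t)`, and the
polynomial identity `2t² - t⁴ + (1 - t²)² = 1` recombines the two operators. -/
theorem zop_mul {q : Bd} (hq : int (ss * (yy * q)) = 0) (t : Set.Ioo (0:ℝ) 1) :
    zop q t * (t * (1 - (t:ℝ) ^ 2) ^ 2) = -pr (yy * (yy * q)) t := by
  have ht := t.2.1.ne'
  have hy := (one_sub_sq_pos t.2).ne'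
  rw [zop_apply, BoundedContinuousFunction.sub_apply, BoundedContinuousFunction.mul_apply,
    tail_apply, avg_apply, hq]
  simp only [BoundedContinuousFunction.sub_apply, BoundedContinuousFunction.mul_apply,
    BoundedContinuousFunction.smul_apply, smul_eq_mul, tt_apply]
  field_simp
  ring

/-- With `p(t) = ∫₀ᵗ (1 - τ²)q`, the function `-p/(2(1 - t²))` has derivative `t² zop q - q/2`. It
vanishes at both ends because it is `zop q` times `t(1 - t²)/2`. -/
theorem int_zop {q : Bd} (hq : int (ss * (yy * q)) = 0) :
    int (ss * (tt * tt * zop q)) = 1 / 2 * int (ss * q) := by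
  have hb : ∀ t : Set.Ioo (0:ℝ) 1, |(-(pr (yy * (yy * q)) t / (2 * (1 - (t:ℝ) ^ 2))))| ≤
      ‖zop q‖ * (t * √(1 - (t:ℝ) ^ 2)) := fun t => by
    have hy := one_sub_sq_pos t.2
    have e : -(pr (yy * (yy * q)) t / (2 * (1 - (t:ℝ) ^ 2))) =
        zop q t * (t * ((1 - (t:ℝ) ^ 2) / 2)) := by
      rw [neg_div', ← zop_mul hq t]
      field_simp
    rw [e, abs_mul, abs_of_pos (mul_pos t.2.1 (half_pos hy))]
    refine mul_le_mul ((zop q).norm_coe_le_norm t) (mul_le_mul_of_nonneg_left ?_ t.2.1.le)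
      (mul_pos t.2.1 (half_pos hy)).le (norm_nonneg _)
    linarith [(sqrt_le t).2.1]
  have key : int (ss * (tt * tt * zop q) - (1 / 2 : ℝ) • (ss * q)) = 0 - 0 := by
    refine int_eq_of_tendsto (G := fun t => -(pr (yy * (yy * q)) t / (2 * (1 - t ^ 2))))
      (fun t => ?_) ?_ ?_
    · have hy := one_sub_sq_pos t.2
      have hs := Real.sqrt_pos.2 hy
      have h1 := ((((hasDerivAt_id (t:ℝ)).fun_pow 2).const_sub 1).const_mul 2)
      have h2 := ((hasDerivAt_pr (yy * (yy * q)) t).div h1 (by simp only [id]; positivity)).neg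
      refine h2.congr_deriv ?_
      have hz := zop_mul hq t
      simp only [BoundedContinuousFunction.sub_apply, BoundedContinuousFunction.mul_apply,
        BoundedContinuousFunction.smul_apply, smul_eq_mul, tt_apply, ss_apply, yy_apply, id]
      rw [show pr (yy * (yy * q)) t = -(zop q t * (t * (1 - (t:ℝ) ^ 2) ^ 2)) by rw [hz, neg_neg]]
      field_simp
      ring
    · refine tendsto_nhdsGT_zero_of_le (C := ‖zop q‖) fun t => (hb t).trans ?_
      exact mul_le_mul_of_nonneg_left (mul_le_of_le_one_right t.2.1.le (sqrt_le t).2.2) (norm_nonneg _)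
    · refine tendsto_nhdsLT_one_of_le (C := ‖zop q‖) fun t => (hb t).trans ?_
      exact mul_le_mul_of_nonneg_left (mul_le_of_le_one_left (sqrt_le t).1 t.2.2.le) (norm_nonneg _)
  rw [map_sub, map_smul, smul_eq_mul] at key
  linarith

/-- The polynomial on the left times `t` is the derivative of `-½y(-3/2 + 12y - (21/2)y²)` with `y =
1 - t²`, so one integration by parts makes the integrand local. The factor `y` kills the growth of
the primitive at `t = 1`. -/
theorem int_wop (h : Bd) : int (tt * tt * wop ((2:ℝ) • h) * ((-(3 / 2) : ℝ) • 1 + (24:ℝ) • yy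
      - (63 / 2 : ℝ) • (yy * yy)))
    = int (ss * (h * ((-(3 / 2) : ℝ) • 1 + (12:ℝ) • yy - (21 / 2 : ℝ) • (yy * yy)))) := by
  have hb : ∀ t : Set.Ioo (0:ℝ) 1, |(-(1 / 2) * ((1 - (t:ℝ) ^ 2) * (-(3 / 2) + 12 * (1 - (t:ℝ) ^ 2)
      - 21 / 2 * (1 - (t:ℝ) ^ 2) ^ 2) * pr ((2:ℝ) • h) t))| ≤
      12 * ‖(2:ℝ) • h‖ * (t * √(1 - (t:ℝ) ^ 2)) := fun t => by
    have hy := one_sub_sq_pos t.2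
    have hs := Real.sqrt_pos.2 hy
    have hs2 := Real.sq_sqrt hy.le
    have hy1 : 1 - (t:ℝ) ^ 2 ≤ 1 := by nlinarith [t.2.1]
    have h1 : |(-(3 / 2) + 12 * (1 - (t:ℝ) ^ 2) - 21 / 2 * (1 - (t:ℝ) ^ 2) ^ 2)| ≤ 24 := by
      rw [abs_le]; constructor <;> nlinarith
    have h2 := abs_pr_le ((2:ℝ) • h) t
    rw [abs_mul, abs_mul, abs_mul, abs_of_pos hy]
    refine (mul_le_mul_of_nonneg_left (mul_le_mul (mul_le_mul_of_nonneg_left h1 hy.le) h2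
      (abs_nonneg _) (by positivity)) (abs_nonneg _)).trans (le_of_eq ?_)
    rw [abs_neg, abs_of_pos (by norm_num : (0:ℝ) < 1 / 2)]
    set s := √(1 - (t:ℝ) ^ 2)
    rw [← hs2]
    field_simp
    ring
  have key : int (tt * tt * wop ((2:ℝ) • h) * ((-(3 / 2) : ℝ) • 1 + (24:ℝ) • yy
      - (63 / 2 : ℝ) • (yy * yy)) - ss * (h * ((-(3 / 2) : ℝ) • 1 + (12:ℝ) • yy -
        (21 / 2 : ℝ) • (yy * yy)))) = 0 - 0 := by
    refine int_eq_of_tendsto (G := fun t => -(1 / 2) * ((1 - t ^ 2) * (-(3 / 2) + 12 * (1 - t ^ 2)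
      - 21 / 2 * (1 - t ^ 2) ^ 2) * pr ((2:ℝ) • h) t)) (fun t => ?_) ?_ ?_
    · have hy := one_sub_sq_pos t.2
      have hs := Real.sqrt_pos.2 hy
      have hs2 := Real.sq_sqrt hy.le
      have ht := t.2.1
      have h1 := (((hasDerivAt_id (t:ℝ)).fun_pow 2).const_sub 1)
      have h2 := ((h1.mul (((h1.const_mul 12).const_add (-(3 / 2))).sub
        ((h1.fun_pow 2).const_mul (21 / 2)))).mul (hasDerivAt_pr ((2:ℝ) • h) t)).const_mul (-(1 / 2))
      refine h2.congr_deriv ?_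
      simp only [BoundedContinuousFunction.sub_apply, BoundedContinuousFunction.mul_apply,
        BoundedContinuousFunction.add_apply, one_apply, wop_apply, Pi.mul_apply, Pi.sub_apply,
        BoundedContinuousFunction.smul_apply, smul_eq_mul, tt_apply, ss_apply, yy_apply, id]
      field_simp
      push_cast
      ring
    · refine tendsto_nhdsGT_zero_of_le (C := 12 * ‖(2:ℝ) • h‖) fun t => (hb t).trans ?_
      exact mul_le_mul_of_nonneg_left (mul_le_of_le_one_right t.2.1.le (sqrt_le t).2.2)
        (by positivity)
    · refine tendsto_nhdsLT_one_of_le (C := 12 * ‖(2:ℝ) • h‖) fun t => (hb t).trans ?_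
      exact mul_le_mul_of_nonneg_left (mul_le_of_le_one_left (sqrt_le t).1 t.2.2.le)
        (by positivity)
  rw [map_sub] at key
  linarith

end Bd


/-! ### Linearization of the functionals along a line of data -/

open Bd Dat

/-- A line of data through those of the quadratic nonlinearity. -/
noncomputable def crv (γ : ℝ) (G K Z : Bd) (κ : ℝ) : Dat :=
  (3 / 2, 1 + κ * γ, κ • G, κ • K, κ • Z)

namespace Crv

variable {γ α : ℝ} {G K Z : Bd} {a : ℝ → ℝ}

theorem crv_zero (p : ℝ) : crv γ G K Z 0 = dat p (3 / 2, 0) := by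
  simp [crv, dat, mus_zero, bet_zero, kap_zero]

theorem reg : Reg (crv γ G K Z 0) := by
  rw [crv_zero 3]; exact reg_dat (by norm_num) (by norm_num)

theorem jj_zero_one : jj (crv γ G K Z 0) 0 1 = 9 / 4 := by
  rw [crv_zero 3, jj_dat (by norm_num) (by norm_num)]; norm_num

theorem contDiff : ContDiff ℝ ∞ (crv γ G K Z) := by
  unfold crv; fun_prop

theorem hasDerivAt {E : Type*} [NormedAddCommGroup E] [NormedSpace ℝ E] {X : Dat → E}
    (hX : ContDiffAt ℝ ∞ X (crv γ G K Z 0)) :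
    HasDerivAt (fun κ => X (crv γ G K Z κ)) (deriv (fun κ => X (crv γ G K Z κ)) 0) 0 :=
  ((hX.differentiableAt (by simp)).comp (0:ℝ)
    (contDiff.differentiable (by simp)).differentiableAt).hasDerivAt

theorem gg_zero : gg (crv γ G K Z 0) = 1 := by
  ext t; simp [gg, crv]

theorem rr_zero : rr (crv γ G K Z 0) = 1 := by
  ext t; simp [rr, crv]

theorem rho_zero : rho (crv γ G K Z 0) = 1 := by
  ext t
  rw [rho, rs_apply reg.pos, rr_zero, one_apply]
  simp

theorem lam_zero (h0 : a 0 = 2 / 3) : lam (crv γ G K Z 0) 1 (a 0) = -4 / 3 := by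
  simp only [lam, crv, h0]
  norm_num

theorem omg_zero (h0 : a 0 = 2 / 3) : omg (crv γ G K Z 0) 1 (a 0) = 0 := by
  rw [omg, gg_zero, rho_zero, lam_zero h0, h0]
  ext t
  simp [crv]
  norm_num

theorem qq_zero (h0 : a 0 = 2 / 3) :
    qq (crv γ G K Z 0) 1 (a 0) = (45 / 2 : ℝ) • yy - (18:ℝ) • 1 := by
  rw [qq, gg_zero, rho_zero, lam_zero h0, omg_zero h0, h0]
  ext t
  simp only [crv, BoundedContinuousFunction.sub_apply, BoundedContinuousFunction.mul_apply,
    BoundedContinuousFunction.add_apply, one_apply, BoundedContinuousFunction.smul_apply,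
    smul_eq_mul, yy_apply, BoundedContinuousFunction.coe_zero, Pi.zero_apply]
  ring

theorem pr_qq_zero (t : Set.Ioo (0:ℝ) 1) :
    pr (yy * (yy * ((45 / 2 : ℝ) • yy - (18:ℝ) • 1))) t = 9 / 2 * (t * (1 - (t:ℝ) ^ 2) ^ 2) := by
  refine pr_eq (G := fun t => 9 / 2 * (t * (1 - t ^ 2) ^ 2)) (by fun_prop) (by simp) (fun t => ?_) t
  have hy := (one_sub_sq_pos t.2).ne'
  refine (((hasDerivAt_id (t:ℝ)).mul ((((hasDerivAt_id (t:ℝ)).fun_pow 2).const_sub 1).fun_pow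
    2)).const_mul (9 / 2)).congr_deriv ?_
  simp only [BoundedContinuousFunction.sub_apply, BoundedContinuousFunction.mul_apply, one_apply,
    BoundedContinuousFunction.smul_apply, smul_eq_mul, yy_apply, id]
  field_simp
  push_cast
  ring

theorem int_qq_zero : int (ss * (yy * ((45 / 2 : ℝ) • yy - (18:ℝ) • 1))) = 0 := by
  rw [int_eq (G := fun t => 9 / 2 * (t * (1 - t ^ 2) ^ 2)) (by fun_prop) fun t => ?_]
  · norm_num
  refine (((hasDerivAt_id (t:ℝ)).mul ((((hasDerivAt_id (t:ℝ)).fun_pow 2).const_sub 1).fun_pow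
    2)).const_mul (9 / 2)).congr_deriv ?_
  simp only [BoundedContinuousFunction.sub_apply, BoundedContinuousFunction.mul_apply, one_apply,
    BoundedContinuousFunction.smul_apply, smul_eq_mul, yy_apply, id]
  push_cast
  ring

theorem acoef_zero : acoef (crv γ G K Z 0) = 2 / 3 := by
  have h1 := qq_zero (γ := γ) (G := G) (K := K) (Z := Z) (a := fun _ => 2 / 3) rfl
  have h2 : jj (crv γ G K Z 0) 1 (2 / 3) = 0 := by
    rw [jj, h1]; exact int_qq_zero
  rw [Rlz.jj_linear, jj_zero_one] at h2
  rw [acoef, jj_zero_one]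
  linarith

theorem zop_zero : zop ((45 / 2 : ℝ) • yy - (18:ℝ) • 1) = (-(9 / 2) : ℝ) • 1 := by
  ext t
  have h := zop_mul int_qq_zero t
  rw [pr_qq_zero] at h
  have ht := t.2.1
  have hy := one_sub_sq_pos t.2
  have h2 : (t:ℝ) * (1 - (t:ℝ) ^ 2) ^ 2 ≠ 0 := by positivity
  rw [BoundedContinuousFunction.smul_apply, one_apply, smul_eq_mul]
  apply mul_right_cancel₀ h2
  rw [h]
  ring

theorem ww_zero (h0 : a 0 = 2 / 3) : ww (crv γ G K Z 0) (a 0) = 0 := by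
  rw [ww, omg_zero h0, mul_zero, smul_zero, map_zero]

theorem xx_zero (h0 : a 0 = 2 / 3) : xx (crv γ G K Z 0) (a 0) = (-2 : ℝ) • 1 := by
  rw [xx, omg_zero h0, rho_zero, lam_zero h0, h0]
  ext t
  simp [crv]
  norm_num

theorem avg_one : avg (1 : Bd) = 1 := by
  ext t
  have : pr (yy * (1 : Bd)) t = t := by
    refine pr_eq (G := id) (by fun_prop) rfl (fun t => (hasDerivAt_id _).congr_deriv ?_) t
    have hy := (one_sub_sq_pos t.2).ne'
    rw [mul_one, yy_apply, div_self hy]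
  have ht := t.2.1.ne'
  rw [avg_apply, this, one_apply, one_div_mul_cancel ht]

theorem avg_zero (h0 : a 0 = 2 / 3) : avg (xx (crv γ G K Z 0) (a 0)) = (-2 : ℝ) • 1 := by
  rw [xx_zero h0, map_smul, avg_one]

theorem bb_zero (h0 : a 0 = 2 / 3) : bb (crv γ G K Z 0) (a 0) = -2 := by
  rw [bb, xx_zero h0, mul_smul_comm, map_smul, int_eq (h := 1) (G := id) continuousOn_id
    fun t => hasDerivAt_id _]
  simp

theorem alp_zero (h0 : a 0 = 2 / 3) : alp (crv γ G K Z 0) (a 0) = (-2 : ℝ) • ss := by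
  rw [alp, ww_zero h0, lam_zero h0, mul_zero, smul_zero, sub_zero]
  norm_num [crv]

theorem alp'_zero (h0 : a 0 = 2 / 3) : alp' (crv γ G K Z 0) (a 0) = (2 : ℝ) • (ss * tt) := by
  rw [alp', ww_zero h0, lam_zero h0, omg_zero h0, rho_zero, rr_zero]
  ext t
  simp [crv]
  ring

theorem ups_eq (D : Dat) (a : ℝ) : ups D a = ss * (((a - 2 * lam D 1 a) * D.1) • 1 + (1 / D.1) •
    (rho D * zop (qq D 1 a))) + D.1 • (rho D * ((1 / 2 : ℝ) • 1 + tt * tt * rr D) * ww D a) := rfl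

theorem ups_zero (h0 : a 0 = 2 / 3) : ups (crv γ G K Z 0) (a 0) = (2 : ℝ) • ss := by
  rw [ups_eq, ww_zero h0, lam_zero h0, rho_zero, qq_zero h0, zop_zero, h0]
  ext t
  simp [crv]
  ring

/-- The derivative of `omg`. -/
noncomputable def om1 (γ α : ℝ) (G K : Bd) : Bd :=
  (-(2 * γ)) • 1 + (2:ℝ) • (yy * K) - G + (3 / 2 * (α + 2 * γ)) • 1 - (2:ℝ) • (γ • 1 - tt * tt * G)

/-- The derivative of `qq`. -/
noncomputable def qq1 (γ α : ℝ) (G K : Bd) : Bd :=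
  (9 / 2 : ℝ) • (-(1 / 2 : ℝ) • (yy * K) * ((5:ℝ) • yy - (4:ℝ) • 1) + (3 * (α + 2 * γ)) • (tt * tt)
    + (3 / 2 * α) • yy + (5:ℝ) • (yy * (γ • 1 - tt * tt * G))
    - om1 γ α G K * ((1 / 2 : ℝ) • 1 + tt * tt))

theorem hasDerivAt_gg : HasDerivAt (fun κ => gg (crv γ G K Z κ)) (γ • 1 - tt * tt * G) 0 := by
  refine (((((hasDerivAt_id (0:ℝ)).mul_const γ).const_add 1).smul_const (1 : Bd)).sub
    (((hasDerivAt_id (0:ℝ)).smul_const G).const_mul (tt * tt))).congr_deriv ?_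
  simp

theorem hasDerivAt_rr : HasDerivAt (fun κ => rr (crv γ G K Z κ)) (yy * K) 0 := by
  refine ((((hasDerivAt_id (0:ℝ)).smul_const K).const_mul yy).const_add 1).congr_deriv ?_
  simp

/-- Differentiate `Rρ² = 1` at `R = ρ = 1`; smoothness of `ρ` is already known. -/
theorem hasDerivAt_rho :
    HasDerivAt (fun κ => rho (crv γ G K Z κ)) (-(1 / 2 : ℝ) • (yy * K)) 0 := by
  have h1 := hasDerivAt (reg (γ := γ) (G := G) (K := K) (Z := Z)).contDiffAt_rho
  refine h1.congr_deriv ?_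
  have h2 := (hasDerivAt_rr (γ := γ) (G := G) (K := K) (Z := Z)).mul (h1.mul h1)
  have h3 : ∀ᶠ κ in 𝓝 (0:ℝ), rr (crv γ G K Z κ) *
      (rho (crv γ G K Z κ) * rho (crv γ G K Z κ)) = 1 := by
    filter_upwards [(contDiff (γ := γ) (G := G) (K := K) (Z := Z)).continuous.continuousAt.eventually
      reg.eventually] with κ hκ
    exact hκ.pos.mul_rs
  have h4 := h2.unique ((hasDerivAt_const (0:ℝ) (1:Bd)).congr_of_eventuallyEq h3)
  simp only [Pi.mul_apply, rho_zero, rr_zero, one_mul, mul_one] at h4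
  set X := deriv (fun κ => rho (crv γ G K Z κ)) 0
  have h5 : (2:ℝ) • X = -(yy * K) := by
    rw [two_smul]; exact (neg_eq_of_add_eq_zero_right h4).symm
  have h6 : X = (1 / 2 : ℝ) • ((2:ℝ) • X) := by rw [smul_smul]; norm_num
  rw [h6, h5]
  ext t
  simp

theorem hasDerivAt_lam (ha : HasDerivAt a α 0) (h0 : a 0 = 2 / 3) :
    HasDerivAt (fun κ => lam (crv γ G K Z κ) 1 (a κ)) (α + 2 * γ) 0 := by
  have h1 := ((hasDerivAt_id (0:ℝ)).mul_const γ).const_add 1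
  refine (((h1.const_mul 1).sub (ha.div_const 2)).div ((h1.const_mul (3 / 2)).const_sub 1)
    (by norm_num)).congr_deriv ?_
  simp only [id, Pi.sub_apply, h0]
  ring

theorem hasDerivAt_omg (ha : HasDerivAt a α 0) (h0 : a 0 = 2 / 3) :
    HasDerivAt (fun κ => omg (crv γ G K Z κ) 1 (a κ)) (om1 γ α G K) 0 := by
  have hl := hasDerivAt_lam (γ := γ) (G := G) (K := K) (Z := Z) ha h0
  have hg := hasDerivAt_gg (γ := γ) (G := G) (K := K) (Z := Z)
  have hρ := hasDerivAt_rho (γ := γ) (G := G) (K := K) (Z := Z)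
  have hG := (hasDerivAt_id (0:ℝ)).smul_const G
  refine (((ha.sub hl).smul_const (1 : Bd)).add ((hρ.mul hρ).mul ((hG.const_smul (1:ℝ)).add
    ((hl.mul_const (3 / 2)).smul (hg.add hG))))).congr_deriv ?_
  simp only [Pi.mul_apply, Pi.add_apply, Pi.smul_apply', id, rho_zero, gg_zero, lam_zero h0, om1]
  ext t
  simp only [BoundedContinuousFunction.sub_apply, BoundedContinuousFunction.mul_apply,
    BoundedContinuousFunction.add_apply, one_apply, BoundedContinuousFunction.smul_apply,
    smul_eq_mul, yy_apply, tt_apply, Pi.smul_apply]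
  ring

theorem hasDerivAt_qq (ha : HasDerivAt a α 0) (h0 : a 0 = 2 / 3) :
    HasDerivAt (fun κ => qq (crv γ G K Z κ) 1 (a κ)) (qq1 γ α G K) 0 := by
  have hl := hasDerivAt_lam (γ := γ) (G := G) (K := K) (Z := Z) ha h0
  have hg := hasDerivAt_gg (γ := γ) (G := G) (K := K) (Z := Z)
  have hρ := hasDerivAt_rho (γ := γ) (G := G) (K := K) (Z := Z)
  have hR := hasDerivAt_rr (γ := γ) (G := G) (K := K) (Z := Z)
  have hω := hasDerivAt_omg (γ := γ) (G := G) (K := K) (Z := Z) ha h0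
  have hy := hg.const_mul yy
  refine ((hρ.mul (((hl.smul ((hy.const_smul (2 * (3 / 2) : ℝ)).const_sub ((3:ℝ) • 1))).add
    ((ha.mul_const (3 / 2)).smul hy)).sub (hω.mul ((hR.const_mul (tt * tt)).const_add
      ((1 / 2 : ℝ) • 1))))).const_smul (2 * (3 / 2) ^ 2 : ℝ)).congr_deriv ?_
  simp only [Pi.mul_apply, Pi.add_apply, Pi.sub_apply, Pi.smul_apply, Pi.smul_apply', rho_zero, gg_zero,
    lam_zero h0, rr_zero, omg_zero h0, qq1]
  rw [h0]
  ext t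
  simp only [BoundedContinuousFunction.sub_apply, BoundedContinuousFunction.mul_apply,
    BoundedContinuousFunction.add_apply, one_apply, BoundedContinuousFunction.smul_apply,
    smul_eq_mul, yy_apply, tt_apply, BoundedContinuousFunction.neg_apply,
    BoundedContinuousFunction.coe_zero, Pi.zero_apply]
  ring

theorem hasDerivAt_ww (ha : HasDerivAt a α 0) (h0 : a 0 = 2 / 3) :
    HasDerivAt (fun κ => ww (crv γ G K Z κ) (a κ)) (wop ((2:ℝ) • om1 γ α G K)) 0 := by
  have hρ := hasDerivAt_rho (γ := γ) (G := G) (K := K) (Z := Z)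
  have hω := hasDerivAt_omg (γ := γ) (G := G) (K := K) (Z := Z) ha h0
  refine (wop.hasFDerivAt.comp_hasDerivAt (0:ℝ) ((hρ.mul hω).const_smul (2:ℝ))).congr_deriv ?_
  rw [omg_zero h0, rho_zero, mul_zero, zero_add, one_mul]

theorem hasDerivAt_alp (ha : HasDerivAt a α 0) (h0 : a 0 = 2 / 3) :
    HasDerivAt (fun κ => alp (crv γ G K Z κ) (a κ)) ((3 / 2 * (α + 2 * γ)) • ss -
      (3 / 2 : ℝ) • (tt * tt * wop ((2:ℝ) • om1 γ α G K))) 0 := by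
  have hl := hasDerivAt_lam (γ := γ) (G := G) (K := K) (Z := Z) ha h0
  have hρ := hasDerivAt_rho (γ := γ) (G := G) (K := K) (Z := Z)
  have hR := hasDerivAt_rr (γ := γ) (G := G) (K := K) (Z := Z)
  have hw := hasDerivAt_ww (γ := γ) (G := G) (K := K) (Z := Z) ha h0
  refine (((hl.mul_const (3 / 2)).smul_const ss).sub ((((hρ.mul hR).const_mul
    (tt * tt)).mul hw).const_smul (3 / 2 : ℝ))).congr_deriv ?_
  simp only [Pi.mul_apply, rho_zero, rr_zero, ww_zero h0, mul_zero, zero_add, mul_one]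
  rw [mul_comm (α + 2 * γ)]

theorem hasDerivAt_alp' (ha : HasDerivAt a α 0) (h0 : a 0 = 2 / 3) :
    HasDerivAt (fun κ => alp' (crv γ G K Z κ) (a κ))
      ((3 / 2 : ℝ) • ((1 - (3 / 2 : ℝ) • yy) * (tt * wop ((2:ℝ) • om1 γ α G K))) -
      (3 / 2 : ℝ) • (ss * tt * ((-(2 / 3) : ℝ) • (yy * K) + (α + 2 * γ) • 1 + om1 γ α G K))) 0 := by
  have hl := hasDerivAt_lam (γ := γ) (G := G) (K := K) (Z := Z) ha h0
  have hg := hasDerivAt_gg (γ := γ) (G := G) (K := K) (Z := Z)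
  have hρ := hasDerivAt_rho (γ := γ) (G := G) (K := K) (Z := Z)
  have hR := hasDerivAt_rr (γ := γ) (G := G) (K := K) (Z := Z)
  have hω := hasDerivAt_omg (γ := γ) (G := G) (K := K) (Z := Z) ha h0
  have hw := hasDerivAt_ww (γ := γ) (G := G) (K := K) (Z := Z) ha h0
  refine ((((((hg.const_mul yy).const_smul (3 / 2 : ℝ)).const_sub 1).mul
    (hw.const_mul tt)).const_smul (3 / 2 : ℝ)).sub ((((hρ.mul hR).const_mul (ss * tt)).mul
    ((hl.smul_const (1 : Bd)).add hω)).const_smul (3 / 2 : ℝ))).congr_deriv ?_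
  simp only [Pi.mul_apply, Pi.add_apply, Pi.smul_apply, rho_zero, gg_zero, lam_zero h0, rr_zero, omg_zero h0,
    ww_zero h0]
  ext t
  simp only [BoundedContinuousFunction.sub_apply, BoundedContinuousFunction.mul_apply,
    BoundedContinuousFunction.add_apply, one_apply, BoundedContinuousFunction.smul_apply,
    smul_eq_mul, yy_apply, tt_apply, BoundedContinuousFunction.neg_apply,
    BoundedContinuousFunction.coe_zero, Pi.zero_apply]
  ring

theorem hasDerivAt_ups (ha : HasDerivAt a α 0) (h0 : a 0 = 2 / 3) :
    HasDerivAt (fun κ => ups (crv γ G K Z κ) (a κ))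
      (ss * ((3 / 2 * (α - 2 * (α + 2 * γ))) • 1 + (3 / 2 : ℝ) • (yy * K)
        + (2 / 3 : ℝ) • zop (qq1 γ α G K)) +
      (3 / 2 : ℝ) • (((1 / 2 : ℝ) • 1 + tt * tt) * wop ((2:ℝ) • om1 γ α G K))) 0 := by
  have hl := hasDerivAt_lam (γ := γ) (G := G) (K := K) (Z := Z) ha h0
  have hρ := hasDerivAt_rho (γ := γ) (G := G) (K := K) (Z := Z)
  have hR := hasDerivAt_rr (γ := γ) (G := G) (K := K) (Z := Z)
  have hq := hasDerivAt_qq (γ := γ) (G := G) (K := K) (Z := Z) ha h0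
  have hw := hasDerivAt_ww (γ := γ) (G := G) (K := K) (Z := Z) ha h0
  have hz := zop.hasFDerivAt.comp_hasDerivAt (0:ℝ) hq
  have h1 : HasDerivAt (fun κ => ups (crv γ G K Z κ) (a κ)) _ 0 :=
    ((((((ha.sub (hl.const_mul 2)).mul_const (3 / 2)).smul_const (1 : Bd)).add
    ((hρ.mul hz).const_smul (1 / (3 / 2) : ℝ))).const_mul ss).add (((hρ.mul
    ((hR.const_mul (tt * tt)).const_add ((1 / 2 : ℝ) • 1))).mul hw).const_smul (3 / 2 : ℝ)))
  refine h1.congr_deriv ?_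
  simp only [Pi.mul_apply, Function.comp_apply, rho_zero, rr_zero, qq_zero h0,
    zop_zero, ww_zero h0]
  ext t
  simp only [BoundedContinuousFunction.mul_apply, BoundedContinuousFunction.add_apply, one_apply,
    BoundedContinuousFunction.smul_apply, smul_eq_mul, yy_apply, tt_apply,
    BoundedContinuousFunction.coe_zero, Pi.zero_apply]
  ring

theorem nn_zero (h0 : a 0 = 2 / 3) : nn (crv γ G K Z 0) (a 0) =
    ss * ((-4 : ℝ) • 1 + (15:ℝ) • yy - (10:ℝ) • (yy * yy)) := by
  rw [nn, gg_zero, rho_zero, alp_zero h0, alp'_zero h0, ups_zero h0, ww_zero h0, avg_zero h0, h0]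
  ext t
  have hs : ss t ^ 2 = 1 - (t:ℝ) ^ 2 := by rw [sq, ← yy_apply, ← ss_mul_ss]; rfl
  simp only [crv, BoundedContinuousFunction.sub_apply, BoundedContinuousFunction.mul_apply,
    BoundedContinuousFunction.add_apply, one_apply, BoundedContinuousFunction.smul_apply,
    smul_eq_mul, yy_apply, tt_apply,
    BoundedContinuousFunction.coe_zero, Pi.zero_apply]
  grind

/-- The derivative of the density of the defect, after integrations by parts. -/
noncomputable def ii (γ α : ℝ) (G K Z : Bd) : Bd :=
  -(1 / 2 : ℝ) • (yy * K) * ((6:ℝ) • (yy * yy) - (13:ℝ) • yy)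
  + (1 / 2 : ℝ) • (Z * ((1 - (2:ℝ) • yy) * (1 - (2:ℝ) • yy) * (1 - (2:ℝ) • yy)))
  + (3 / 2 * (α + 2 * γ)) • (-1 - (4:ℝ) • yy + (9:ℝ) • (yy * yy))
  + α • ((-3:ℝ) • 1 + (3 / 2 : ℝ) • yy + (6:ℝ) • (yy * yy))
  + (6:ℝ) • (yy * yy * (γ • 1 - tt * tt * G))
  - (12:ℝ) • (yy * (tt * tt) * (om1 γ α G K + (α + 2 * γ) • 1))
  - (4:ℝ) • K - (6 * (α - 2 * (α + 2 * γ))) • (tt * tt)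

theorem hasDerivAt_nn (ha : HasDerivAt a α 0) (h0 : a 0 = 2 / 3) :
    HasDerivAt (fun κ => nn (crv γ G K Z κ) (a κ))
      (ss * ii γ α G K Z + (1 / 2 : ℝ) • (yy * K) * nn (crv γ G K Z 0) (a 0) +
        tt * tt * wop ((2:ℝ) • om1 γ α G K) * ((-(3 / 2) : ℝ) • 1 + (24:ℝ) • yy
          - (63 / 2 : ℝ) • (yy * yy)) - (8 / 3 : ℝ) • (ss * (tt * tt * zop (qq1 γ α G K)))) 0 := by
  have hg := hasDerivAt_gg (γ := γ) (G := G) (K := K) (Z := Z)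
  have hρ := hasDerivAt_rho (γ := γ) (G := G) (K := K) (Z := Z)
  have hA := hasDerivAt_alp (γ := γ) (G := G) (K := K) (Z := Z) ha h0
  have hA' := hasDerivAt_alp' (γ := γ) (G := G) (K := K) (Z := Z) ha h0
  have hU := hasDerivAt_ups (γ := γ) (G := G) (K := K) (Z := Z) ha h0
  have hw := hasDerivAt_ww (γ := γ) (G := G) (K := K) (Z := Z) ha h0
  have hl := hasDerivAt_lam (γ := γ) (G := G) (K := K) (Z := Z) ha h0
  have hω := hasDerivAt_omg (γ := γ) (G := G) (K := K) (Z := Z) ha h0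
  have hx := avg.hasFDerivAt.comp_hasDerivAt (0:ℝ) ((hρ.mul (((hl.add ha).smul_const (1 : Bd)).sub
    hω)).const_smul (2 * (3 / 2) : ℝ))
  set X := avg ((2 * (3 / 2) : ℝ) • (_ : Bd)) with hX
  replace hx : HasDerivAt (fun κ => avg (xx (crv γ G K Z κ) (a κ))) X 0 := hx
  have hZ := (hasDerivAt_id (0:ℝ)).smul_const Z
  have hK := (hasDerivAt_id (0:ℝ)).smul_const K
  have hT := ((hA.const_mul ss).const_add 1)
  have h1 : HasDerivAt (fun κ => nn (crv γ G K Z κ) (a κ)) _ 0 :=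
    (((((((((((hZ.const_mul ss).mul ((hT.mul hT).mul hT)).const_smul (1 / 2 : ℝ)).sub hA).add
    (((ha.const_mul (3 / 2)).const_sub 2).smul ((hA.mul hA).const_mul ss))).add
    (((hA.mul hA).mul hA).const_mul yy)).sub (((ha.const_mul 2).mul_const (3 / 2)).smul_const ss)).add
    ((ha.const_mul 3).smul ((hA'.mul hA').const_mul ss))).sub
    ((((ha.fun_pow 2).const_mul 3).mul_const ((3 / 2) ^ 2)).smul ((hg.const_mul (yy * yy)).mul
      hA))).sub
    ((((ha.fun_pow 3).const_mul (3 / 2)).mul_const ((3 / 2) ^ 2)).smul_const (ss * yy))).add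
    (((hx.mul hx).mul ((hK.mul (hρ.mul hρ)).const_sub 1)).const_mul ss)).add
    ((hx.mul ((hρ.mul hU).sub ((hw.const_mul (tt * tt)).const_smul (3 / 2 : ℝ)))).const_smul (2:ℝ))
    |>.add (((hU.mul hU).sub (((hw.mul hw).const_mul (tt * tt)).const_smul ((3 / 2) ^ 2 : ℝ))).const_mul
      ss)
  refine h1.congr_deriv ?_
  -- The variation `X` of the average enters with coefficient `2 · (-2) · ss + 2 · (2 ss) = 0`, so
  -- its value is irrelevant.
  clear_value X
  simp only [Pi.mul_apply, Pi.sub_apply, Pi.smul_apply, id, rho_zero,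
    gg_zero, alp_zero h0, alp'_zero h0, ups_zero h0, ww_zero h0, avg_zero h0, nn_zero h0]
  rw [h0, ii]
  ext t
  have hs : ss t ^ 2 = 1 - (t:ℝ) ^ 2 := by rw [sq, ← yy_apply, ← ss_mul_ss]; rfl
  simp only [BoundedContinuousFunction.sub_apply, BoundedContinuousFunction.mul_apply,
    BoundedContinuousFunction.add_apply, one_apply, BoundedContinuousFunction.smul_apply,
    smul_eq_mul, yy_apply, tt_apply, BoundedContinuousFunction.neg_apply,
    BoundedContinuousFunction.coe_zero, Pi.zero_apply]
  generalize ss t = s at *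
  generalize om1 γ α G K t = o at *
  generalize (zop (qq1 γ α G K)) t = z at *
  generalize (wop ((2:ℝ) • om1 γ α G K)) t = w at *
  generalize X t = x at *
  generalize K t = k at *
  generalize G t = g at *
  generalize Z t = ζ at *
  generalize (t:ℝ) = τ at *
  have h2 : τ ^ 2 = 1 - s ^ 2 := by linarith
  have h4 : τ ^ 4 = (1 - s ^ 2) ^ 2 := by rw [← h2]; ring
  have h6 : τ ^ 6 = (1 - s ^ 2) ^ 3 := by rw [← h2]; ring
  push_cast
  ring_nf
  simp only [h2, h4, h6]
  ring

theorem hasDerivAt_dfc (ha : HasDerivAt a α 0) (h0 : a 0 = 2 / 3) :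
    HasDerivAt (fun κ => dfc (crv γ G K Z κ) (a κ)) (2 * int (ss * (ii γ α G K Z +
      om1 γ α G K * ((-(3 / 2) : ℝ) • 1 + (12:ℝ) • yy - (21 / 2 : ℝ) • (yy * yy)))) -
      16 / 3 * int (ss * (tt * tt * zop (qq1 γ α G K)))) 0 := by
  have hρ := hasDerivAt_rho (γ := γ) (G := G) (K := K) (Z := Z)
  have hn := hasDerivAt_nn (γ := γ) (G := G) (K := K) (Z := Z) ha h0
  have hl := hasDerivAt_lam (γ := γ) (G := G) (K := K) (Z := Z) ha h0
  have hω := hasDerivAt_omg (γ := γ) (G := G) (K := K) (Z := Z) ha h0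
  -- The function `b³/3 + b²` is stationary at `b = -2`, so only the differentiability of `b`
  -- matters, not its derivative.
  have hb : ∃ b', HasDerivAt (fun κ => bb (crv γ G K Z κ) (a κ)) b' 0 :=
    ⟨_, int.hasFDerivAt.comp_hasDerivAt (0:ℝ) (((hρ.mul (((hl.add ha).smul_const
      (1 : Bd)).sub hω)).const_smul (2 * (3 / 2) : ℝ)).const_mul ss)⟩
  obtain ⟨b', hb⟩ := hb
  have h1 : HasDerivAt (fun κ => dfc (crv γ G K Z κ) (a κ)) _ 0 :=
    ((int.hasFDerivAt.comp_hasDerivAt (0:ℝ) ((hρ.mul hn).const_smul (2:ℝ))).sub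
      ((hb.fun_pow 3).div_const 3)).sub (hb.fun_pow 2)
  refine h1.congr_deriv ?_
  rw [bb_zero h0, rho_zero, one_mul]
  -- The variation of `ρ` cancels the multiple of `nn` singled out in `hasDerivAt_nn`.
  have e : -(1 / 2 : ℝ) • (yy * K) * nn (crv γ G K Z 0) (a 0) +
      (ss * ii γ α G K Z + (1 / 2 : ℝ) • (yy * K) * nn (crv γ G K Z 0) (a 0) +
        tt * tt * wop ((2:ℝ) • om1 γ α G K) * ((-(3 / 2) : ℝ) • 1 + (24:ℝ) • yy
          - (63 / 2 : ℝ) • (yy * yy)) - (8 / 3 : ℝ) • (ss * (tt * tt * zop (qq1 γ α G K)))) =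
      ss * ii γ α G K Z + tt * tt * wop ((2:ℝ) • om1 γ α G K) * ((-(3 / 2) : ℝ) • 1 + (24:ℝ) • yy
          - (63 / 2 : ℝ) • (yy * yy)) - (8 / 3 : ℝ) • (ss * (tt * tt * zop (qq1 γ α G K))) := by
    ext t
    simp only [BoundedContinuousFunction.sub_apply, BoundedContinuousFunction.mul_apply,
      BoundedContinuousFunction.add_apply, BoundedContinuousFunction.smul_apply, smul_eq_mul]
    ring
  rw [e, map_smul, map_sub, map_add, int_wop, map_smul, mul_add ss, map_add]
  simp only [smul_eq_mul]
  push_cast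
  ring

/-- The derivative of the defect at the quadratic nonlinearity. -/
theorem exists_hasDerivAt_dd (γ : ℝ) (G K Z : Bd) : ∃ α : ℝ, int (ss * (yy * qq1 γ α G K)) = 0 ∧
    HasDerivAt (fun κ => dd (crv γ G K Z κ)) (2 * int (ss * (ii γ α G K Z +
      om1 γ α G K * ((-(3 / 2) : ℝ) • 1 + (12:ℝ) • yy - (21 / 2 : ℝ) • (yy * yy)) -
      (4 / 3 : ℝ) • qq1 γ α G K))) 0 := by
  have hj : jj (crv γ G K Z 0) 0 1 ≠ 0 := by rw [jj_zero_one]; norm_num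
  have ha := hasDerivAt ((reg (γ := γ) (G := G) (K := K) (Z := Z)).contDiffAt_acoef hj)
  set α := deriv (fun κ => acoef (crv γ G K Z κ)) 0
  have h0 : acoef (crv γ G K Z 0) = 2 / 3 := acoef_zero
  have h1 := int.hasFDerivAt.comp_hasDerivAt (0:ℝ) (((hasDerivAt_qq (γ := γ) (G := G) (K := K)
    (Z := Z) ha h0).const_mul yy).const_mul ss)
  -- By the definition of `acoef`, the solvability condition holds identically near `κ = 0`.
  -- Differentiating it gives the linear equation for `α`, and also the vanishing condition under
  -- which `int_zop` makes the last nonlocal term local.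
  have h2 : ∀ᶠ κ in 𝓝 (0:ℝ), int (ss * (yy * qq (crv γ G K Z κ) 1 (acoef (crv γ G K Z κ)))) = 0 := by
    have hc := (hasDerivAt ((reg (γ := γ) (G := G) (K := K) (Z := Z)).contDiffAt_jj (c := 0)
      (a := fun _ => 1) contDiffAt_const)).continuousAt
    filter_upwards [hc.eventually_ne hj] with κ hκ
    have := Rlz.jj_linear (crv γ G K Z κ) 1 (acoef (crv γ G K Z κ))
    rw [jj] at this
    rw [this, acoef, div_mul_cancel₀ _ hκ]
    ring
  have h3 : int (ss * (yy * qq1 γ α G K)) = 0 :=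
    h1.unique ((hasDerivAt_const (0:ℝ) (0:ℝ)).congr_of_eventuallyEq h2)
  refine ⟨α, h3, (hasDerivAt_dfc ha h0).congr_deriv ?_⟩
  rw [int_zop h3, mul_sub ss, map_sub, mul_smul_comm, map_smul, smul_eq_mul]
  ring

end Crv


open Bd Dat

/-! ### Moments -/

namespace Bd

theorem yp_add_one {q : ℝ} (hq : 0 ≤ q) : yp (q + 1) = yy * yp q := by
  ext t
  rw [BoundedContinuousFunction.mul_apply, yp_apply hq, yp_apply (by linarith), yy_apply,
    Real.rpow_add_one' (one_sub_sq_pos t.2).le (by linarith), mul_comm]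

/-- Recursion of the Beta integral, from the primitive `t(1 - t²)^(q+1)`. -/
theorem int_yp_add_one {q : ℝ} (hq : 0 ≤ q) :
    int (ss * yp (q + 1)) = (2 * q + 2) / (2 * q + 3) * int (ss * yp q) := by
  have h : int (ss * ((2 * q + 3) • yp (q + 1) - (2 * q + 2) • yp q)) = 0 := by
    rw [int_eq (G := fun t => t * (1 - t ^ 2) ^ (q + 1)) ?_ fun t => ?_]
    · simp [Real.zero_rpow (show q + 1 ≠ 0 by linarith)]
    · exact continuousOn_id.mul (Continuous.continuousOn
        ((by fun_prop : Continuous fun t : ℝ => 1 - t ^ 2).rpow_const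
        fun _ => Or.inr (by linarith)))
    have hy := one_sub_sq_pos t.2
    refine ((hasDerivAt_id (t:ℝ)).mul ((((hasDerivAt_id (t:ℝ)).fun_pow 2).const_sub 1).rpow_const
      (Or.inl hy.ne'))).congr_deriv ?_
    simp only [BoundedContinuousFunction.sub_apply, BoundedContinuousFunction.smul_apply,
      smul_eq_mul, yp_apply hq, yp_apply (show 0 ≤ q + 1 by linarith), id]
    rw [show q + 1 - 1 = q by ring, Real.rpow_add_one' hy.le (by linarith)]
    push_cast
    ring
  rw [mul_sub, mul_smul_comm, mul_smul_comm, map_sub, map_smul, map_smul, smul_eq_mul,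
    smul_eq_mul] at h
  have h3 : 2 * q + 3 ≠ 0 := by linarith
  field_simp
  linarith

/-- The primitive is `-(1 - (1 - t²)^(q+1))/t`, extended by 0; Bernoulli's inequality gives its
continuity at the origin. -/
theorem int_ee {q : ℝ} (hq : 0 ≤ q) :
    int (ss * ee (q + 1)) = -1 + 2 * (q + 1) * int (ss * yp q) := by
  have h : int (ss * (ee (q + 1) - (2 * (q + 1)) • yp q)) = -1 := by
    rw [int_eq (G := fun t => if t = 0 then 0 else -(1 - (1 - t ^ 2) ^ (q + 1)) / t) ?_ fun t => ?_]
    · simp [Real.zero_rpow (show q + 1 ≠ 0 by linarith)]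
    · intro t ht
      rcases ht.1.eq_or_lt with rfl | h0
      · have h1 : Tendsto (fun t : ℝ => (q + 1) * t) (𝓝 0) (𝓝 0) := by
          have : Continuous fun t : ℝ => (q + 1) * t := by fun_prop
          simpa using this.tendsto 0
        rw [ContinuousWithinAt, if_pos rfl]
        refine squeeze_zero_norm' (a := fun t => (q + 1) * t) ?_ (h1.mono_left nhdsWithin_le_nhds)
        filter_upwards [self_mem_nhdsWithin] with t ht
        rcases ht.1.eq_or_lt with rfl | h0
        · simp
        have hs : t ^ 2 ≤ 1 := by nlinarith [ht.2]
        have e1 : (1 - t ^ 2) ^ (q + 1) ≤ 1 :=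
          Real.rpow_le_one (by linarith) (by nlinarith) (by linarith)
        have e2 := one_add_mul_self_le_rpow_one_add (s := -t ^ 2) (by linarith)
          (show 1 ≤ q + 1 by linarith)
        rw [← sub_eq_add_neg 1] at e2
        rw [if_neg h0.ne', Real.norm_eq_abs, abs_div, abs_neg, abs_of_pos h0,
          abs_of_nonneg (by linarith), div_le_iff₀ h0]
        nlinarith
      · refine ContinuousAt.continuousWithinAt (ContinuousAt.congr (f := fun t =>
          -(1 - (1 - t ^ 2) ^ (q + 1)) / t) ?_ ?_)
        · exact ((continuous_const.sub ((by fun_prop : Continuous fun t : ℝ => 1 - t ^ 2).rpow_const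
            fun _ => Or.inr (by linarith))).neg.continuousAt).div continuousAt_id h0.ne'
        · filter_upwards [lt_mem_nhds h0] with s hs
          rw [if_neg hs.ne']
    have hy := one_sub_sq_pos t.2
    have ht := t.2.1.ne'
    refine HasDerivAt.congr_of_eventuallyEq (f := fun t : ℝ =>
      -(1 - (1 - t ^ 2) ^ (q + 1)) / t) ?_ ?_
    · refine ((((((hasDerivAt_id (t:ℝ)).fun_pow 2).const_sub 1).rpow_const
        (p := q + 1) (Or.inl hy.ne')).const_sub 1).fun_neg.div (hasDerivAt_id (t:ℝ)) ht).congr_deriv ?_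
      simp only [BoundedContinuousFunction.sub_apply, BoundedContinuousFunction.smul_apply,
        smul_eq_mul, yp_apply hq, ee_apply (show 1 ≤ q + 1 by linarith), id]
      rw [show q + 1 - 1 = q by ring]
      push_cast
      field_simp
      ring
    · filter_upwards [lt_mem_nhds t.2.1] with s hs
      rw [if_neg hs.ne']
  rw [mul_sub, mul_smul_comm, map_sub, map_smul, smul_eq_mul] at h
  linarith

theorem int_poly (c₀ c₁ c₂ c₃ : ℝ) :
    int (ss * (c₀ • 1 + c₁ • yy + c₂ • (yy * yy) + c₃ • (yy * yy * yy))) =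
      c₀ + 2 / 3 * c₁ + 8 / 15 * c₂ + 16 / 35 * c₃ := by
  rw [int_eq (G := fun t => c₀ * t + c₁ * (t - t ^ 3 / 3) + c₂ * (t - 2 * t ^ 3 / 3 + t ^ 5 / 5)
    + c₃ * (t - t ^ 3 + 3 * t ^ 5 / 5 - t ^ 7 / 7)) (by fun_prop) fun t => ?_]
  · norm_num; ring
  have h := fun n : ℕ => (hasDerivAt_id (t:ℝ)).fun_pow n
  refine (((((hasDerivAt_id (t:ℝ)).const_mul c₀).add (((hasDerivAt_id (t:ℝ)).sub
    ((h 3).div_const 3)).const_mul c₁)).add ((((hasDerivAt_id (t:ℝ)).sub (((h 3).const_mul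
    2).div_const 3)).add ((h 5).div_const 5)).const_mul c₂)).add (((((hasDerivAt_id (t:ℝ)).sub
    (h 3)).add (((h 5).const_mul 3).div_const 5)).sub ((h 7).div_const 7)).const_mul
    c₃)).congr_deriv ?_
  simp only [BoundedContinuousFunction.mul_apply, BoundedContinuousFunction.add_apply, one_apply,
    BoundedContinuousFunction.smul_apply, smul_eq_mul, yy_apply, id]
  push_cast
  ring

/-- All non-polynomial moments are expressed through the one with exponent `q + 2`. For `q = p - 3`
this is `p - 1`, the moment that represents the integral of the `p`-th power of the quadratic
soliton. -/
theorem int_moments {q : ℝ} (hq : 0 ≤ q) (c₀ c₁ c₂ c₃ e d₀ d₁ d₂ d₃ : ℝ) :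
    int (ss * ((c₀ • 1 + c₁ • yy + c₂ • (yy * yy) + c₃ • (yy * yy * yy)) + e • ee (q + 1) +
      (d₀ • yp q + d₁ • (yy * yp q) + d₂ • (yy * (yy * yp q)) + d₃ • (yy * (yy * (yy * yp q)))))) =
    c₀ + 2 / 3 * c₁ + 8 / 15 * c₂ + 16 / 35 * c₃ - e +
      (e * (2 * (q + 1)) * ((2 * q + 3) * (2 * q + 5) / ((2 * q + 2) * (2 * q + 4))) +
      d₀ * ((2 * q + 3) * (2 * q + 5) / ((2 * q + 2) * (2 * q + 4))) +
      d₁ * ((2 * q + 5) / (2 * q + 4)) + d₂ + d₃ * ((2 * q + 6) / (2 * q + 7))) *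
      int (ss * yp (q + 2)) := by
  have h1 := int_yp_add_one hq
  have h2 := int_yp_add_one (show 0 ≤ q + 1 by linarith)
  have h3 := int_yp_add_one (show 0 ≤ q + 1 + 1 by linarith)
  rw [← yp_add_one hq, ← yp_add_one (show 0 ≤ q + 1 by linarith),
    ← yp_add_one (show 0 ≤ q + 1 + 1 by linarith)]
  simp only [mul_add ss, map_add, mul_smul_comm, map_smul, smul_eq_mul]
  have h4 := int_poly c₀ c₁ c₂ c₃
  simp only [mul_add ss, map_add, mul_smul_comm, map_smul, smul_eq_mul] at h4
  rw [h4, int_ee hq, h3, show q + 2 = q + 1 + 1 by ring, h2, h1]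
  have e1 : 2 * q + 3 ≠ 0 := by linarith
  have e2 : 2 * q + 5 ≠ 0 := by linarith
  have e3 : 2 * q + 7 ≠ 0 := by linarith
  have e4 : 2 * q + 2 ≠ 0 := by linarith
  have e5 : 2 * q + 4 ≠ 0 := by linarith
  have e6 : 2 * (q + 1) + 3 ≠ 0 := by linarith
  have e7 : 2 * (q + 1 + 1) + 3 ≠ 0 := by linarith
  field_simp
  ring

end Bd

/-- Substitution `t = tanh(x/2)`: the integrand becomes `((3/2)(1 - t²))^p`, and `dx = 2dt/(1 -
t²)`; evenness contributes another factor 2. -/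
theorem integral_sech_rpow {p : ℝ} (hp : 1 ≤ p) :
    ∫ x : ℝ, (3 / (2 * Real.cosh (x / 2) ^ 2)) ^ p = 4 * (3 / 2) ^ p * int (ss * yp (p - 1)) := by
  have e1 : ∀ x : ℝ, 3 / (2 * Real.cosh (x / 2) ^ 2) = 3 / 2 * (1 - Real.tanh (x / 2) ^ 2) :=
    fun x => by rw [one_sub_tanh_sq]; field_simp
  have hd : ∀ x : ℝ, HasDerivAt (fun x => Real.tanh (x / 2))
      (1 / 2 * (1 - Real.tanh (x / 2) ^ 2)) x := fun x =>
    (HasDerivAt.comp x (h₂ := Real.tanh) (h := fun x => x / 2) (hasDerivAt_tanh (x / 2))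
      ((hasDerivAt_id x).div_const 2)).congr_deriv (by ring)
  have hpos : ∀ x : ℝ, 0 < 1 - Real.tanh (x / 2) ^ 2 := fun x => by
    rw [one_sub_tanh_sq]; have := Real.cosh_pos (x / 2); positivity
  have him : (fun x => Real.tanh (x / 2)) '' Set.Ioi 0 = Set.Ioo 0 1 := by
    ext t
    constructor
    · rintro ⟨x, hx, rfl⟩
      have h0 := tanh_pos (half_pos hx)
      exact ⟨h0, by nlinarith [hpos x]⟩
    · intro ht
      have hm : t ∈ Set.Ioo (-1:ℝ) 1 := ⟨by linarith [ht.1], ht.2⟩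
      refine ⟨2 * Real.artanh t, mul_pos two_pos (Real.artanh_pos ht), ?_⟩
      simp only
      rw [mul_div_cancel_left₀ _ two_ne_zero, Real.tanh_artanh hm]
  have h1 : ∫ x : ℝ, (3 / (2 * Real.cosh (x / 2) ^ 2)) ^ p =
      2 * ∫ x in Set.Ioi (0:ℝ), (3 / (2 * Real.cosh (x / 2) ^ 2)) ^ p := by
    rw [← integral_comp_abs (f := fun x => (3 / (2 * Real.cosh (x / 2) ^ 2)) ^ p)]
    congr 1
    ext x
    rcases abs_choice x with h | h
    · rw [h]
    · rw [h, neg_div, Real.cosh_neg]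
  have h2 := integral_image_eq_integral_abs_deriv_smul (measurableSet_Ioi (a := (0:ℝ)))
    (fun x _ => (hd x).hasDerivWithinAt) (fun x _ y _ h => by
      have := Real.tanh_injective h
      linarith) (fun t => 2 * (3 / 2 : ℝ) ^ p * ext (yp (p - 1)) t)
  rw [him] at h2
  have h3 : ∫ x in Set.Ioi (0:ℝ), (3 / (2 * Real.cosh (x / 2) ^ 2)) ^ p =
      ∫ x in Set.Ioi (0:ℝ), |1 / 2 * (1 - Real.tanh (x / 2) ^ 2)| •
        (2 * (3 / 2 : ℝ) ^ p * ext (yp (p - 1)) (Real.tanh (x / 2))) := by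
    refine setIntegral_congr_fun measurableSet_Ioi fun x hx => ?_
    have hm : Real.tanh (x / 2) ∈ Set.Ioo (0:ℝ) 1 := him ▸ ⟨x, hx, rfl⟩
    have h0 := hpos x
    rw [ext_of_mem _ hm, yp_apply (by linarith), e1, Real.mul_rpow (by norm_num) h0.le,
      abs_of_pos (by positivity), smul_eq_mul]
    rw [show p = p - 1 + 1 by ring, Real.rpow_add_one h0.ne']
    ring_nf
  rw [h1, h3, ← h2, integral_const_mul, int_ss, intervalIntegral.integral_of_le zero_le_one,
    integral_Ioc_eq_integral_Ioo]
  ring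

/-! ### The first variation of the defect along the model nonlinearities -/

/-- Both the condition on `α` and the first variation are moments of the type treated in
`int_moments`. After integration `α` has coefficient `9/4` in the former and `-9/4` in the latter,
so their sum is free of `α`. What remains is a rational function of `p` times the moment with
exponent `p - 1`. -/
theorem int_first_variation {p α : ℝ} (hp : 3 ≤ p) {G K Z : Bd}
    (hG : G = (-(4 / 3) : ℝ) • 1 + ((p + 1) / 3) • ee (p - 2)) (hK : K = ee (p - 2) - 1)
    (hZ : Z = (-8 : ℝ) • 1 + ((p + 1) * p * (p - 1) / 3) • yp (p - 3))
    (hα : int (ss * (yy * Crv.qq1 ((p - 3) / 3) α G K)) = 0) :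
    int (ss * (Crv.ii ((p - 3) / 3) α G K Z +
      Crv.om1 ((p - 3) / 3) α G K * ((-(3 / 2) : ℝ) • 1 + (12:ℝ) • yy - (21 / 2 : ℝ) • (yy * yy)) -
      (4 / 3 : ℝ) • Crv.qq1 ((p - 3) / 3) α G K)) =
      -(3 / 2) * (p + 1) * defectCoeff p * int (ss * yp (p - 1)) := by
  have hq : 0 ≤ p - 3 := by linarith
  have hee : ∀ t : Set.Ioo (0:ℝ) 1, ee (p - 2) t =
      (1 - (1 - (t:ℝ) ^ 2) * (1 - (t:ℝ) ^ 2) ^ (p - 3)) / (t:ℝ) ^ 2 := fun t => by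
    rw [ee_apply (by linarith), show p - 2 = p - 3 + 1 by ring,
      Real.rpow_add_one' (one_sub_sq_pos t.2).le (by linarith), mul_comm]
  have e1 : yy * Crv.qq1 ((p - 3) / 3) α G K =
      (((6 - 3 / 4 * p) • 1 + (-21 + 27 / 8 * α + 33 / 4 * p) • yy + (69 / 4 - 15 / 2 * p) • (yy * yy)
        + (-(63 / 4) : ℝ) • (yy * yy * yy)) + (-6 + 3 / 4 * p) • ee (p - 2) +
      ((0:ℝ) • yp (p - 3) + (-6 + 3 / 4 * p) • (yy * yp (p - 3)) + (-(15 / 4) + 3 * p) •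
        (yy * (yy * yp (p - 3))) + (9 / 4 + 9 / 2 * p) • (yy * (yy * (yy * yp (p - 3)))))) := by
    rw [Crv.qq1, Crv.om1, hG, hK]
    ext t
    have ht := t.2.1.ne'
    simp only [BoundedContinuousFunction.sub_apply, BoundedContinuousFunction.mul_apply,
      BoundedContinuousFunction.add_apply, one_apply, BoundedContinuousFunction.smul_apply,
      smul_eq_mul, yy_apply, tt_apply, hee t, yp_apply hq]
    field_simp
    ring
  have e2 : Crv.ii ((p - 3) / 3) α G K Z +
      Crv.om1 ((p - 3) / 3) α G K * ((-(3 / 2) : ℝ) • 1 + (12:ℝ) • yy - (21 / 2 : ℝ) • (yy * yy)) -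
      (4 / 3 : ℝ) • Crv.qq1 ((p - 3) / 3) α G K =
      (((7 / 2 - 21 / 4 * α - 4 * p) • 1 + (54 - 45 / 2 * α - 19 / 2 * p) • yy +
        (-84 + 135 / 4 * α + 35 / 2 * p) • (yy * yy)
        + (28 : ℝ) • (yy * yy * yy)) + (15 / 2 - p) • ee (p - 2) +
      (((p ^ 3 - p) / 6) • yp (p - 3) + (9 - 5 / 2 * p - p ^ 3) • (yy * yp (p - 3)) +
        (3 - 17 / 2 * p + 2 * p ^ 3) • (yy * (yy * yp (p - 3))) +
        (1 + 7 / 3 * p - 4 / 3 * p ^ 3) • (yy * (yy * (yy * yp (p - 3)))))) := by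
    rw [Crv.ii, Crv.qq1, Crv.om1, hG, hK, hZ]
    ext t
    have ht := t.2.1.ne'
    simp only [BoundedContinuousFunction.sub_apply, BoundedContinuousFunction.mul_apply,
      BoundedContinuousFunction.add_apply, one_apply, BoundedContinuousFunction.smul_apply,
      smul_eq_mul, yy_apply, tt_apply, BoundedContinuousFunction.neg_apply, hee t, yp_apply hq]
    field_simp
    ring
  have e3 := fun c₀ c₁ c₂ c₃ e d₀ d₁ d₂ d₃ => int_moments hq c₀ c₁ c₂ c₃ e d₀ d₁ d₂ d₃
  simp only [show p - 3 + 1 = p - 2 by ring, show p - 3 + 2 = p - 1 by ring] at e3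
  rw [e1, e3] at hα
  rw [e2, e3]
  set J := int (ss * yp (p - 1))
  have n4 : p - 1 ≠ 0 := by linarith
  have n5 : p + 1 ≠ 0 := by linarith
  have n6 : p - 2 ≠ 0 := by linarith
  have n7 : p ^ 2 - 1 ≠ 0 := by nlinarith
  have n9 : 2 * p + 1 ≠ 0 := by linarith
  rw [show 2 * (p - 3) + 2 = 2 * (p - 2) by ring, show 2 * (p - 3) + 4 = 2 * (p - 1) by ring,
    show 2 * (p - 3) + 7 = 2 * p + 1 by ring] at hα ⊢
  rw [defectCoeff]
  field_simp at hα ⊢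
  linear_combination -54 * (p ^ 2 - 1) * hα

/-- For `m = 3/2` the constant part of `β` vanishes, so `β = κ`, and all components of the data are
affine in `κ`, itself linear in `ν`. -/
theorem dat_eq_crv {p : ℝ} (hp : 3 ≤ p) (ν : ℝ) : dat p (3 / 2, ν) =
    crv ((p - 3) / 3) ((-(4 / 3) : ℝ) • 1 + ((p + 1) / 3) • ee (p - 2)) (ee (p - 2) - 1)
      ((-8 : ℝ) • 1 + ((p + 1) * p * (p - 1) / 3) • yp (p - 3)) (kap p (3 / 2, ν)) := by
  have hp1 : p + 1 ≠ 0 := by linarith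
  set κ := kap p (3 / 2, ν) with hκ
  have h1 : ν * (3 / 2 : ℝ) ^ (p - 2) = κ * (p + 1) / 3 := by
    rw [hκ, kap]
    simp only
    rw [show p - 1 = p - 2 + 1 by ring, Real.rpow_add_one (by norm_num)]
    field_simp
  have h2 : mus p (3 / 2, ν) = 8 / 9 * κ := by
    rw [mus, bet, ← hκ]; ring
  have h3 : bet p (3 / 2, ν) = κ := by
    rw [bet, ← hκ]; ring
  simp only [dat, crv, h1, h2, h3, ← hκ]
  refine Prod.ext rfl (Prod.ext ?_ (Prod.ext ?_ (Prod.ext ?_ ?_)))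
  · ring
  all_goals
    ext t
    simp only [BoundedContinuousFunction.sub_apply, BoundedContinuousFunction.add_apply, one_apply,
      BoundedContinuousFunction.smul_apply, smul_eq_mul]
    ring

/-- The first variation of the defect of the model nonlinearity at the quadratic one. -/
theorem hasDerivAt_dd_dat {p : ℝ} (hp : 3 ≤ p) : HasDerivAt (fun ν => dd (dat p (3 / 2, ν)))
    (-defectCoeff p * ∫ x : ℝ, (3 / (2 * Real.cosh (x / 2) ^ 2)) ^ p) 0 := by
  obtain ⟨α, h1, h2⟩ := Crv.exists_hasDerivAt_dd ((p - 3) / 3)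
    ((-(4 / 3) : ℝ) • 1 + ((p + 1) / 3) • ee (p - 2)) (ee (p - 2) - 1)
      ((-8 : ℝ) • 1 + ((p + 1) * p * (p - 1) / 3) • yp (p - 3))
  rw [int_first_variation hp rfl rfl rfl h1] at h2
  have h3 : HasDerivAt (fun ν => kap p (3 / 2, ν)) (2 * (3 / 2) ^ (p - 1) / (p + 1)) 0 :=
    ((((hasDerivAt_id (0:ℝ)).const_mul 2).mul_const ((3 / 2 : ℝ) ^ (p - 1))).div_const
      (p + 1)).congr_deriv (by ring)
  refine ((HasDerivAt.comp_of_eq (0:ℝ) h2 h3 (kap_zero p (3 / 2)).symm).congr_of_eventuallyEq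
    (Eventually.of_forall fun ν => by rw [dat_eq_crv hp]; rfl)).congr_deriv ?_
  have hp1 : p + 1 ≠ 0 := by linarith
  rw [integral_sech_rpow (by linarith)]
  have e : (3 / 2 : ℝ) ^ p = (3 / 2) ^ (p - 1) * (3 / 2) := by
    rw [← Real.rpow_add_one (by norm_num), sub_add_cancel]
  rw [e]
  field_simp
  ring


open Bd Dat

/-! ### The expansion of the defect of the model nonlinearities -/

/-- The coefficient of the first order expansion of the defect. -/
noncomputable def slope (p : ℝ) : ℝ :=
  -defectCoeff p * ∫ x : ℝ, (3 / (2 * Real.cosh (x / 2) ^ 2)) ^ p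

theorem good_base (p : ℝ) : Good p (3 / 2, 0) := good_of_lt (by norm_num) (by norm_num)

theorem psi_base (p : ℝ) : psi p (3 / 2, 0) = (0, 0) := by
  simp [psi, mus_zero]

theorem contDiffAt_dd_dat {p : ℝ} {z : ℝ × ℝ} (h : Good p z) :
    ContDiffAt ℝ ∞ (fun z => dd (dat p z)) z :=
  (h.reg.contDiffAt_dd h.hj).comp z (contDiffAt_dat p h.hm.ne')

/-- Strict differentiability is applied to the pair `(m, ν)`, `(m, 0)`. Since the functional
vanishes at the second point, the error is `o(ν)` uniformly in `m` near `3/2`, so no rate for `m →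
3/2` is needed. -/
theorem dd_dat_isLittleO {p : ℝ} (hp : 3 ≤ p) :
    (fun z : ℝ × ℝ => dd (dat p z) - slope p * z.2) =o[𝓝 (3 / 2, 0)] fun z => z.2 := by
  have h := (contDiffAt_dd_dat (good_base p)).hasStrictFDerivAt (by simp)
  set L := fderiv ℝ (fun z => dd (dat p z)) (3 / 2, 0)
  have hL : L (0, 1) = slope p := by
    have h1 : HasDerivAt (fun ν : ℝ => ((3 / 2, ν) : ℝ × ℝ)) (0, 1) 0 :=
      (hasDerivAt_const _ _).prodMk (hasDerivAt_id _)
    exact (h.hasFDerivAt.comp_hasDerivAt (0:ℝ) h1).unique (hasDerivAt_dd_dat hp)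
  have ht : Tendsto (fun z : ℝ × ℝ => (z, ((z.1, 0) : ℝ × ℝ))) (𝓝 (3 / 2, 0))
      (𝓝 ((3 / 2, 0), (3 / 2, 0))) := by
    have : Continuous fun z : ℝ × ℝ => (z, ((z.1, 0) : ℝ × ℝ)) := by fun_prop
    exact this.tendsto (3 / 2, 0)
  have h2 := h.isLittleO.comp_tendsto ht
  refine IsLittleO.of_norm_right (h2.norm_right.congr' ?_ ?_)
  · filter_upwards [(good_base p).eventually.and ((isOpen_lt continuous_fst
      continuous_const).mem_nhds (show (3 / 2 : ℝ) < 3 by norm_num))] with z hz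
    have e : z - (z.1, 0) = z.2 • ((0, 1) : ℝ × ℝ) := by
      ext <;> simp
    simp only [Function.comp_apply]
    rw [e, map_smul, hL, dd_dat_zero hp hz.1.hm hz.2, smul_eq_mul]
    ring
  · refine Eventually.of_forall fun z => ?_
    simp [Prod.norm_def]

/-- The local inverse of the change of parameters keeps `ν = ε` and sends `(μ(ε), ε)` to points
tending to `(3/2, 0)`. Only `μ(ε) → 0` is used, and the first order term does not involve `μ`. -/
theorem defect_expansion {p : ℝ} (hp : 3 ≤ p) {μ : ℝ → ℝ} (hμ : Tendsto μ (𝓝 0) (𝓝 0)) :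
    (fun ε : ℝ => defect (modelNonlin p (μ ε) ε) - slope p * ε) =o[𝓝 0] fun ε : ℝ => ε := by
  obtain ⟨ψ, hψ, h0, hev⟩ := (good_base p).exists_inverse
  rw [psi_base] at hψ h0 hev
  have ht : Tendsto (fun ε : ℝ => (μ ε, ε)) (𝓝 0) (𝓝 (0, 0)) := by
    rw [nhds_prod_eq]; exact hμ.prodMk tendsto_id
  have h1 : Tendsto (fun ε => ψ (μ ε, ε)) (𝓝 0) (𝓝 (3 / 2, 0)) := by
    have := hψ.continuousAt.tendsto
    rw [h0] at this
    exact this.comp ht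
  refine ((dd_dat_isLittleO hp).comp_tendsto h1).congr' ?_ ?_
  all_goals
    filter_upwards [ht.eventually hev] with ε hε
    have e2 : (ψ (μ ε, ε)).2 = ε := congrArg Prod.snd hε.2
    simp only [Function.comp_apply]
  · have := hε.1.defect_eq hp
    rw [hε.2] at this
    rw [this, e2]
  · exact e2

theorem tendsto_muEps {p : ℝ} (hp : 3 ≤ p) (μ₀ : ℝ) : Tendsto (muEps p μ₀) (𝓝 0) (𝓝 0) := by
  have hq : 0 < 1 / (p - 2) := one_div_pos.2 (by linarith)
  have : Continuous (muEps p μ₀) :=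
    continuous_const.mul (continuous_abs.rpow_const fun _ => Or.inr hq.le)
  have h := this.tendsto 0
  rwa [muEps, abs_zero, Real.zero_rpow hq.ne', mul_zero] at h

theorem muEps_neg (p μ₀ ε : ℝ) : -muEps p μ₀ ε = muEps p (-μ₀) ε := by
  simp [muEps]


open Bd Dat

/-! ### Perturbation of the data -/

/-- The mean value inequality on the segment from `m(1 - t²)` to `m`, whose length is `mt²`. -/
theorem Bd.exists_quot {N N' : ℝ → ℝ} {m C : ℝ} (hm : 0 < m)
    (hN : ∀ s ∈ Set.Ioc 0 m, HasDerivAt N (N' s) s) (hb : ∀ s ∈ Set.Ioc 0 m, |N' s| ≤ C) :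
    ∃ k : Bd, ‖k‖ ≤ C * m ∧ ∀ t : Set.Ioo (0:ℝ) 1, (t:ℝ) ^ 2 * k t = N m - N (m * (1 - (t:ℝ) ^ 2)) := by
  have hC : 0 ≤ C := (abs_nonneg _).trans (hb m ⟨hm, le_rfl⟩)
  have hmem : ∀ t : Set.Ioo (0:ℝ) 1, m * (1 - (t:ℝ) ^ 2) ∈ Set.Ioc 0 m := fun t =>
    ⟨mul_pos hm (one_sub_sq_pos t.2), by nlinarith [pow_pos t.2.1 2]⟩
  have hbd : ∀ t : Set.Ioo (0:ℝ) 1,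
      ‖(N m - N (m * (1 - (t:ℝ) ^ 2))) / (t:ℝ) ^ 2‖ ≤ C * m := fun t => by
    have ht := pow_pos t.2.1 2
    have h1 := (convex_Ioc 0 m).norm_image_sub_le_of_norm_hasDerivWithin_le
      (fun s hs => (hN s hs).hasDerivWithinAt) hb (hmem t) (Set.right_mem_Ioc.2 hm)
    rw [norm_div, Real.norm_of_nonneg ht.le, div_le_iff₀ ht]
    refine h1.trans_eq ?_
    rw [Real.norm_of_nonneg (by nlinarith)]
    ring
  refine ⟨BoundedContinuousFunction.ofNormedAddCommGroup
    (fun t => (N m - N (m * (1 - (t:ℝ) ^ 2))) / (t:ℝ) ^ 2) ?_ (C * m) hbd,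
    BoundedContinuousFunction.norm_ofNormedAddCommGroup_le _ (mul_nonneg hC hm.le) hbd, fun t => ?_⟩
  · refine Continuous.div (continuous_const.sub (continuous_iff_continuousAt.2 fun t => ?_))
      (by fun_prop) fun t => pow_ne_zero 2 t.2.1.ne'
    have hc : Continuous fun t : Set.Ioo (0:ℝ) 1 => m * (1 - (t:ℝ) ^ 2) := by fun_prop
    exact ContinuousAt.comp (g := N) (hN _ (hmem t)).continuousAt hc.continuousAt
  · exact mul_div_cancel₀ _ (pow_ne_zero 2 t.2.1.ne')

theorem abs_le_of_abs_deriv_le {g g' : ℝ → ℝ} {m B : ℝ} (hg : ∀ s, HasDerivAt g (g' s) s)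
    (h0 : g 0 = 0) (hb : ∀ s ∈ Set.Icc 0 m, |g' s| ≤ B) {s : ℝ} (hs : s ∈ Set.Icc 0 m) :
    |g s| ≤ B * s := by
  have h1 := (convex_Icc 0 m).norm_image_sub_le_of_norm_hasDerivWithin_le
      (fun s _ => (hg s).hasDerivWithinAt) hb (Set.left_mem_Icc.2 (hs.1.trans hs.2)) hs
  rwa [h0, sub_zero, sub_zero, Real.norm_of_nonneg hs.1] at h1

theorem abs_le_pow_of_abs_deriv_le {g g' : ℝ → ℝ} {m C : ℝ} {k : ℕ} (hC : 0 ≤ C)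
    (hg : ∀ s, HasDerivAt g (g' s) s) (h0 : g 0 = 0)
    (hb : ∀ s ∈ Set.Icc 0 m, |g' s| ≤ C * s ^ k) :
    ∀ s ∈ Set.Icc 0 m, |g s| ≤ C * s ^ (k + 1) := fun s hs => by
  have h1 := abs_le_of_abs_deriv_le (m := s) (B := C * s ^ k) hg h0 (fun r hr =>
    (hb r ⟨hr.1, hr.2.trans hs.2⟩).trans
      (mul_le_mul_of_nonneg_left (pow_le_pow_left₀ hr.1 hr.2 k) hC)) (s := s) ⟨hs.1, le_rfl⟩
  rwa [pow_succ, ← mul_assoc]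

theorem abs_mul_sub_mul_le (a b : ℝ) {u v : ℝ} (hu : 0 ≤ u) (hv : 0 ≤ v) :
    |a * u - b * v| ≤ |a| * u + |b| * v := by
  refine (abs_sub _ _).trans_eq ?_
  rw [abs_mul, abs_mul, abs_of_nonneg hu, abs_of_nonneg hv]

/-- The condition that the primitive of `δ` vanishes at `m` keeps the maximum of the soliton, hence
the variable `t`, unchanged. The bound on `δ''` integrates to bounds for `δ'`, `δ` and the
primitive. The new components of the data are then difference quotients of `δ/s²` and of the
primitive divided by `s³`, with derivatives bounded by `3C` and `4C`, together with `δ''/(1 - t²)`.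
This is the origin of the constants `3m` and `8m²`. -/
theorem Rlz.perturb {h δ : ℝ → ℝ} {D : Dat} (hr : Rlz h D) {C : ℝ} (hC : 0 ≤ C)
    (hδ : ContDiff ℝ 3 δ) (h0 : δ 0 = 0) (h1 : deriv δ 0 = 0)
    (h2 : ∀ s ∈ Set.Icc 0 D.1, |deriv (deriv δ) s| ≤ C * s) (hi : prim δ D.1 = 0) :
    ∃ D' : Dat, ‖D' - D‖ ≤ C * (8 * D.1 ^ 2 + 3 * D.1) ∧
      (Pos (rr D') → 1 < D'.1 * D'.2.1 → Rlz (fun s => h s + δ s) D') := by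
  obtain ⟨m, g₁, dg, dk, ζ⟩ := D
  have hm : 0 < m := hr.hm
  simp only at h2 hi ⊢
  have d0 : ∀ s, HasDerivAt δ (deriv δ s) s := fun s =>
    (hδ.differentiable (by norm_num) s).hasDerivAt
  have c1 : ContDiff ℝ 2 (deriv δ) := hδ.deriv' (n := 2)
  have d1 : ∀ s, HasDerivAt (deriv δ) (deriv (deriv δ) s) s := fun s =>
    (c1.differentiable (by norm_num) s).hasDerivAt
  have c2 : Continuous (deriv (deriv δ)) := (c1.deriv' (n := 1)).continuous
  have b1 := abs_le_pow_of_abs_deriv_le (k := 1) hC d1 h1 (by simpa using h2)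
  have b0 := abs_le_pow_of_abs_deriv_le hC d0 h0 b1
  have dp := hasDerivAt_prim hδ.continuous
  have bp := abs_le_pow_of_abs_deriv_le hC dp (prim_zero δ) b0
  norm_num at b1 b0 bp
  obtain ⟨kg, hkg, ekg⟩ := exists_quot (N := fun s => δ s / s ^ 2) (C := 3 * C) hm
    (fun s hs => (d0 s).div (hasDerivAt_pow 2 s) (pow_ne_zero 2 hs.1.ne')) fun s hs => by
      have hs' := pow_pos hs.1 2
      have e1 := b1 s hs.1.le hs.2
      have e2 := b0 s hs.1.le hs.2
      rw [abs_div, abs_of_pos (show (0:ℝ) < (s ^ 2) ^ 2 by positivity), div_le_iff₀ (by positivity)]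
      refine (abs_mul_sub_mul_le _ _ hs'.le (by have := hs.1; positivity)).trans ?_
      push_cast
      have e3 := mul_le_mul_of_nonneg_right e1 hs'.le
      have e4 := mul_le_mul_of_nonneg_right e2 (by linarith [hs.1] : 0 ≤ 2 * s)
      norm_num
      nlinarith
  obtain ⟨kk, hkk, ekk⟩ := exists_quot (N := fun s => prim δ s / s ^ 3) (C := 4 * C) hm
    (fun s hs => (dp s).div (hasDerivAt_pow 3 s) (pow_ne_zero 3 hs.1.ne')) fun s hs => by
      have hs' := pow_pos hs.1 3
      have e1 := b0 s hs.1.le hs.2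
      have e2 := bp s hs.1.le hs.2
      rw [abs_div, abs_of_pos (show (0:ℝ) < (s ^ 3) ^ 2 by positivity), div_le_iff₀ (by positivity)]
      refine (abs_mul_sub_mul_le _ _ hs'.le (by have := hs.1; positivity)).trans ?_
      push_cast
      have e3 := mul_le_mul_of_nonneg_right e1 hs'.le
      have e4 := mul_le_mul_of_nonneg_right e2 (by positivity : 0 ≤ 3 * s ^ 2)
      nlinarith
  have hbz : ∀ t : Set.Ioo (0:ℝ) 1,
      ‖deriv (deriv δ) (m * (1 - (t:ℝ) ^ 2)) / (1 - (t:ℝ) ^ 2)‖ ≤ C * m := fun t => by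
    have hy := one_sub_sq_pos t.2
    have := h2 (m * (1 - (t:ℝ) ^ 2)) ⟨by positivity, by nlinarith [pow_pos t.2.1 2]⟩
    rw [norm_div, Real.norm_of_nonneg hy.le, div_le_iff₀ hy]
    rwa [mul_assoc]
  obtain ⟨kz, hkz, ekz⟩ : ∃ k : Bd, ‖k‖ ≤ C * m ∧ ∀ t : Set.Ioo (0:ℝ) 1,
      (1 - (t:ℝ) ^ 2) * k t = deriv (deriv δ) (m * (1 - (t:ℝ) ^ 2)) := by
    refine ⟨BoundedContinuousFunction.ofNormedAddCommGroup _
      (Continuous.div (c2.comp (by fun_prop)) (by fun_prop) fun t => (one_sub_sq_pos t.2).ne')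
      (C * m) hbz,
      BoundedContinuousFunction.norm_ofNormedAddCommGroup_le _ (by positivity) hbz, fun t => ?_⟩
    exact mul_div_cancel₀ _ (one_sub_sq_pos t.2).ne'
  refine ⟨(m, g₁ + δ m / m ^ 2, dg + kg, dk + (2 * m) • kk, ζ + kz), ?_, fun hpos hcurv => ?_⟩
  · have hCm : 0 ≤ C * m := by positivity
    have hCm2 : 0 ≤ C * m ^ 2 := by positivity
    simp only [Prod.mk_sub_mk, Prod.norm_mk, sub_self, norm_zero, add_sub_cancel_left]
    refine max_le (by positivity) (max_le ?_ (max_le ?_ (max_le ?_ ?_)))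
    · have := b0 m hm.le le_rfl
      rw [norm_div, Real.norm_of_nonneg (by positivity : 0 ≤ m ^ 2), div_le_iff₀ (by positivity),
        Real.norm_eq_abs]
      nlinarith [mul_nonneg hCm2 (sq_nonneg m), mul_nonneg hCm (sq_nonneg m)]
    · linarith
    · rw [norm_smul, Real.norm_of_nonneg (by positivity)]
      nlinarith
    · linarith
  have hh : ∀ s, HasDerivAt h (deriv h s) s := fun s =>
    (hr.f3.differentiable (by norm_num) s).hasDerivAt
  have hh1 : ∀ s, HasDerivAt (deriv h) (deriv (deriv h) s) s := fun s =>
    ((hr.f3.deriv' (n := 2)).differentiable (by norm_num) s).hasDerivAt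
  have e1 : deriv (fun s => h s + δ s) = fun s => deriv h s + deriv δ s :=
    funext fun s => ((hh s).add (d0 s)).deriv
  have e2 : deriv (fun s => deriv h s + deriv δ s) = fun s => deriv (deriv h) s + deriv (deriv δ) s :=
    funext fun s => ((hh1 s).add (d1 s)).deriv
  have e3 : ∀ s, prim (fun s => h s + δ s) s = prim h s + prim δ s := fun s =>
    intervalIntegral.integral_add (hr.f3.continuous.intervalIntegrable _ _)
      (hδ.continuous.intervalIntegrable _ _)
  have d20 : deriv (deriv δ) 0 = 0 := by
    have := h2 0 ⟨le_rfl, hm.le⟩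
    rw [mul_zero] at this
    exact abs_nonpos_iff.1 this
  constructor
  case f3 => exact hr.f3.add hδ
  case f0 => rw [hr.f0, h0, add_zero]
  case f1 => rw [e1]; simp only; rw [hr.f1, h1, add_zero]
  case f2 => rw [e1, e2]; simp only; rw [hr.f2, d20, add_zero]
  case hm => exact hm
  case curv => exact hcurv
  case fm =>
    have := hr.fm
    simp only at this ⊢
    rw [this]
    field_simp
  case Fm =>
    have := hr.Fm
    simp only at this ⊢
    rw [e3, hi, add_zero, this]
  case hR =>
    obtain ⟨η, a1, a2⟩ := hpos
    exact ⟨η, a1, fun t => by simpa [rr] using a2 t⟩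
  all_goals
    intro t
    have hy := one_sub_sq_pos t.2
    have ht := t.2.1.ne'
    simp only [BoundedContinuousFunction.add_apply, BoundedContinuousFunction.smul_apply, smul_eq_mul]
  case hg =>
    have a1 := hr.hg t
    have a2 := ekg t
    simp only at a1 a2
    have a3 : δ (m * (1 - (t:ℝ) ^ 2)) = (m * (1 - (t:ℝ) ^ 2)) ^ 2 *
        (δ (m * (1 - (t:ℝ) ^ 2)) / (m * (1 - (t:ℝ) ^ 2)) ^ 2) := by field_simp
    rw [a1, a3]
    linear_combination (m * (1 - (t:ℝ) ^ 2)) ^ 2 * a2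
  case hk =>
    have a1 := hr.hk t
    have a2 := ekk t
    simp only [hi, zero_div] at a1 a2
    have a3 : prim δ (m * (1 - (t:ℝ) ^ 2)) = (m * (1 - (t:ℝ) ^ 2)) ^ 3 *
        (prim δ (m * (1 - (t:ℝ) ^ 2)) / (m * (1 - (t:ℝ) ^ 2)) ^ 3) := by field_simp
    rw [e3, a3]
    linear_combination a1 - 2 * (m * (1 - (t:ℝ) ^ 2)) ^ 3 * a2
  case hζ =>
    have a1 := hr.hζ t
    simp only at a1
    rw [e1, e2]
    simp only
    rw [a1, ← ekz]
    ring


open Bd Dat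

/-! ### Nonlinearities close to the model ones -/

/-- `F` is of class `C³` and vanishes to third order at `0`. -/
structure Flat (C : ℝ) (F : ℝ → ℝ) : Prop where
  contDiff : ContDiff ℝ 3 F
  zero : F 0 = 0
  deriv_zero : deriv F 0 = 0
  bound : ∀ s ∈ Set.Icc (0:ℝ) 2, |deriv (deriv F) s| ≤ C * s

/-- Once the lower derivatives vanish, the Taylor polynomial of degree `k` is a single monomial;
being `o(s^k)`, it has zero coefficient. -/
theorem iteratedDeriv_eq_zero {g : ℝ → ℝ} {p : ℕ} (hg : ContDiff ℝ p g)
    (h : Tendsto (fun s : ℝ => g s / |s| ^ p) (𝓝[≠] 0) (𝓝 0)) :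
    ∀ k ≤ p, iteratedDeriv k g 0 = 0 := by
  intro k
  induction k using Nat.strong_induction_on with
  | _ k ih =>
    intro hk
    have h1 := (taylor_isLittleO_univ (x₀ := 0) (n := k) (hg.of_le (by exact_mod_cast hk))).mono
      (nhdsWithin_le_nhds (s := {0}ᶜ))
    have h2 : g =o[𝓝[≠] 0] fun s : ℝ => s ^ k := by
      have h3 : g =o[𝓝[≠] 0] fun s : ℝ => |s| ^ p := by
        refine (isLittleO_iff_tendsto' ?_).2 h
        filter_upwards [self_mem_nhdsWithin] with s hs h0
        exact absurd h0 (pow_ne_zero p (abs_ne_zero.2 hs))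
      refine h3.trans_isBigO (IsBigO.of_bound 1 ?_)
      filter_upwards [nhdsWithin_le_nhds (Metric.ball_mem_nhds (0:ℝ) one_pos)] with s hs
      rw [Metric.mem_ball, dist_zero_right, Real.norm_eq_abs] at hs
      rw [one_mul, norm_pow, norm_pow, Real.norm_eq_abs, abs_abs, Real.norm_eq_abs]
      exact pow_le_pow_of_le_one (abs_nonneg s) hs.le hk
    have h4 : (fun s : ℝ => iteratedDeriv k g 0 / k.factorial * s ^ k) =o[𝓝[≠] 0]
        fun s : ℝ => s ^ k := by
      simp only [sub_zero] at h1
      refine (h2.sub h1).congr_left fun s => ?_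
      rw [taylor_within_apply, Finset.sum_range_succ, Finset.sum_eq_zero fun j hj => ?_]
      · rw [iteratedDerivWithin_univ, smul_eq_mul, sub_zero]
        field_simp
        ring
      · have hj := Finset.mem_range.1 hj
        rw [iteratedDerivWithin_univ, ih j hj (by omega), smul_zero]
    have h5 : Tendsto (fun _ : ℝ => iteratedDeriv k g 0 / k.factorial) (𝓝[≠] 0) (𝓝 0) := by
      refine h4.tendsto_div_nhds_zero.congr' ?_
      filter_upwards [self_mem_nhdsWithin] with s hs
      exact mul_div_cancel_right₀ _ (pow_ne_zero k hs)
    have h6 := tendsto_nhds_unique h5 tendsto_const_nhds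
    rcases div_eq_zero_iff.1 h6.symm with h7 | h7
    · exact h7
    · exact absurd h7 (by positivity)

/-- All derivatives up to order `p` vanish at zero. The bound on the derivative of order `p + 1`
gives a bound `C s` for order `p`, and each further integration on `[0, 2]`, down to order 2, costs
a factor at most 2. -/
theorem flat_of_isLittleO {g : ℝ → ℝ} {p : ℕ} (hp : 3 ≤ p) {C : ℝ}
    (hg : ContDiff ℝ ((p + 1 : ℕ) : ℕ∞) g)
    (h : Tendsto (fun s : ℝ => g s / |s| ^ p) (𝓝[≠] 0) (𝓝 0))
    (hC : ∀ s : ℝ, |s| ≤ 2 → |iteratedDeriv (p + 1) g s| ≤ C) : Flat (C * 2 ^ (p - 2)) g := by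
  have hg' : ContDiff ℝ (p + 1 : ℕ) g := by exact_mod_cast hg
  have hz := iteratedDeriv_eq_zero (hg'.of_le (by exact_mod_cast Nat.le_succ p)) h
  have hC0 : 0 ≤ C := (abs_nonneg _).trans (hC 0 (by simp))
  have hd : ∀ k ≤ p, ∀ s, HasDerivAt (iteratedDeriv k g) (iteratedDeriv (k + 1) g s) s :=
    fun k hk s => by
      rw [iteratedDeriv_succ]
      exact ((hg'.differentiable_iteratedDeriv k (by exact_mod_cast Nat.lt_succ_of_le hk)) s).hasDerivAt
  have hb : ∀ j ≤ p, ∀ s ∈ Set.Icc (0:ℝ) 2, |iteratedDeriv (p - j) g s| ≤ C * 2 ^ j * s := by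
    intro j
    induction j with
    | zero =>
      intro _ s hs
      rw [pow_zero, mul_one]
      exact abs_le_of_abs_deriv_le (hd p le_rfl) (hz p le_rfl)
        (fun r hr => hC r (by rw [abs_of_nonneg hr.1]; exact hr.2)) hs
    | succ j ih =>
      intro hj s hs
      have h1 := hd (p - (j + 1)) (by omega)
      rw [show p - (j + 1) + 1 = p - j by omega] at h1
      refine abs_le_of_abs_deriv_le h1 (hz _ (by omega)) (fun r hr => ?_) hs
      refine (ih (by omega) r hr).trans ?_
      rw [pow_succ, ← mul_assoc]
      exact mul_le_mul_of_nonneg_left hr.2 (by positivity)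
  refine ⟨hg'.of_le (by exact_mod_cast (by omega : 3 ≤ p + 1)), ?_, ?_, fun s hs => ?_⟩
  · simpa using hz 0 (by omega)
  · simpa using hz 1 (by omega)
  · have := hb (p - 2) (by omega) s hs
    rwa [show p - (p - 2) = 2 by omega, iteratedDeriv_succ, iteratedDeriv_one] at this

namespace Flat

variable {C : ℝ} {F : ℝ → ℝ}

theorem hasDerivAt (h : Flat C F) (s : ℝ) : HasDerivAt F (deriv F s) s :=
  (h.contDiff.differentiable (by norm_num) s).hasDerivAt

theorem hasDerivAt' (h : Flat C F) (s : ℝ) : HasDerivAt (deriv F) (deriv (deriv F) s) s :=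
  ((h.contDiff.deriv' (n := 2)).differentiable (by norm_num) s).hasDerivAt

theorem abs_prim_le (h : Flat C F) (hC : 0 ≤ C) {s : ℝ} (hs : s ∈ Set.Icc (0:ℝ) 2) :
    |prim F s| ≤ C * s ^ 4 := by
  have b1 := abs_le_pow_of_abs_deriv_le (k := 1) hC h.hasDerivAt' h.deriv_zero
    (by simpa using h.bound)
  have b0 := abs_le_pow_of_abs_deriv_le hC h.hasDerivAt h.zero b1
  exact abs_le_pow_of_abs_deriv_le hC (hasDerivAt_prim h.contDiff.continuous) (prim_zero F) b0 s hs

/-- The comparison is with the model nonlinearity having cubic coefficient `mus p (m, ε)`, whose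
soliton has maximum `m`. The difference is `bu³ + τF(u)`, and the hypothesis on `m` says that its
primitive vanishes at `m`. This forces `|b| ≤ 4Cτ`, so the second derivative is at most `(6·4 +
1)Cτs`. The constant 950 is `25·38`, with `8m² + 3m ≤ 38` for `m ≤ 2`. -/
theorem perturb_model (h : Flat C F) (hC : 0 ≤ C) {p : ℕ} (hp : 3 ≤ p) {M ε τ m : ℝ} (hτ : 0 ≤ τ)
    (hm2 : m ≤ 2) (hG : Good p (m, ε))
    (hΦ : (M + mus p (m, ε)) * m ^ 4 / 4 + τ * prim F m = 0) :
    ∃ D' : Dat, ‖D' - dat p (m, ε)‖ ≤ 950 * C * τ ∧ (Pos (rr D') → 1 < D'.1 * D'.2.1 →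
      Rlz (fun u => u ^ 2 + M * u ^ 3 + ε * u ^ p + τ * F u) D') := by
  have hm : 0 < m := hG.hm
  set b := M + mus p (m, ε) with hb
  have hCτ : 0 ≤ C * τ := mul_nonneg hC hτ
  have hb1 : |b| ≤ 4 * (C * τ) := by
    have h1 := h.abs_prim_le hC ⟨hm.le, hm2⟩
    have h2 : b * m ^ 4 = -(4 * τ * prim F m) := by linarith
    have h3 : |b| * m ^ 4 = 4 * τ * |prim F m| := by
      have := congrArg abs h2
      rwa [abs_neg, abs_mul, abs_mul, abs_of_pos (pow_pos hm 4),
        abs_of_nonneg (mul_nonneg (by norm_num) hτ)] at this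
    refine le_of_mul_le_mul_right ?_ (pow_pos hm 4)
    rw [h3]
    nlinarith
  have d0 : ∀ s, HasDerivAt (fun s => b * s ^ 3 + τ * F s) (b * (3 * s ^ 2) + τ * deriv F s) s :=
    fun s => ((hasDerivAt_pow 3 s).const_mul b).add ((h.hasDerivAt s).const_mul τ)
  have e0 : deriv (fun s => b * s ^ 3 + τ * F s) = fun s => b * (3 * s ^ 2) + τ * deriv F s :=
    funext fun s => (d0 s).deriv
  have d1 : ∀ s, HasDerivAt (fun s => b * (3 * s ^ 2) + τ * deriv F s)
      (b * (6 * s) + τ * deriv (deriv F) s) s := fun s =>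
    (((((hasDerivAt_pow 2 s).const_mul 3).const_mul b).add
      ((h.hasDerivAt' s).const_mul τ)).congr_deriv (by push_cast; ring))
  obtain ⟨D', h1, h2⟩ := (hG.rlz (by exact_mod_cast hp)).perturb
    (δ := fun s => b * s ^ 3 + τ * F s) (C := 25 * (C * τ)) (by positivity)
    ((contDiff_const.mul (contDiff_id.pow 3)).add (contDiff_const.mul h.contDiff))
    (by simp [h.zero]) (by rw [e0]; simp [h.deriv_zero])
    (fun s hs => by
      have hs' : s ∈ Set.Icc (0:ℝ) 2 := ⟨hs.1, hs.2.trans hm2⟩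
      rw [e0, (d1 s).deriv]
      have a1 := mul_le_mul_of_nonneg_left (h.bound s hs') hτ
      have a2 := mul_le_mul_of_nonneg_right hb1 (by linarith [hs.1] : 0 ≤ 6 * s)
      refine (abs_add_le _ _).trans ?_
      rw [abs_mul, abs_mul τ, abs_of_nonneg hτ, abs_of_nonneg (by linarith [hs.1] : 0 ≤ 6 * s)]
      linarith)
    (by
      have : prim (fun s => b * s ^ 3 + τ * F s) m = b * m ^ 4 / 4 + τ * prim F m := by
        have c0 : Continuous fun s : ℝ => b * s ^ 3 := by fun_prop
        have c1 : Continuous fun s => τ * F s := continuous_const.mul h.contDiff.continuous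
        rw [prim, intervalIntegral.integral_add (c0.intervalIntegrable _ _)
          (c1.intervalIntegrable _ _),
          intervalIntegral.integral_const_mul, intervalIntegral.integral_const_mul, integral_pow]
        rw [prim]
        norm_num
        ring
      exact this.trans hΦ)
  refine ⟨D', h1.trans ?_, fun a1 a2 => ?_⟩
  · have : (dat p (m, ε)).1 = m := rfl
    rw [this]
    nlinarith [mul_le_mul_of_nonneg_left (by nlinarith : 8 * m ^ 2 + 3 * m ≤ 38) hCτ]
  · have e : (fun u => u ^ 2 + M * u ^ 3 + ε * u ^ p + τ * F u) = fun u =>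
        modelNonlin p (mus p (m, ε)) ε u + (b * u ^ 3 + τ * F u) := by
      funext u
      rw [modelNonlin, Real.rpow_natCast, hb]
      ring
    rw [e]
    exact h2 a1 a2

end Flat

/-- The nonlinearities with data close to those of the quadratic one. -/
theorem exists_lipschitz_dd (p : ℝ) : ∃ r K : ℝ, 0 < r ∧ 0 ≤ K ∧
    ∀ D ∈ Metric.ball (dat p (3 / 2, 0)) r, Pos (rr D) ∧ 1 < D.1 * D.2.1 ∧ jj D 0 1 ≠ 0 ∧
      ∀ D' ∈ Metric.ball (dat p (3 / 2, 0)) r, |dd D' - dd D| ≤ K * ‖D' - D‖ := by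
  have hg := good_base p
  obtain ⟨K, V, hV, hK⟩ := ((hg.reg.contDiffAt_dd hg.hj).of_le
    (by simp : (1 : WithTop ℕ∞) ≤ ∞)).exists_lipschitzOnWith
  have h1 : ContinuousAt (fun D : Dat => D.1 * D.2.1) (dat p (3 / 2, 0)) := by fun_prop
  have h2 : ContinuousAt (fun D : Dat => jj D 0 1) (dat p (3 / 2, 0)) :=
    (hg.reg.contDiffAt_jj (c := 0) (a := fun _ => 1) contDiffAt_const).continuousAt
  obtain ⟨r, hr, hsub⟩ := Metric.mem_nhds_iff.1 (inter_mem hV (hg.reg.eventually.and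
    ((h1.eventually (lt_mem_nhds hg.curv)).and (h2.eventually_ne hg.hj))))
  refine ⟨r, K, hr, K.2, fun D hD => ?_⟩
  obtain ⟨b1, b2, b3, b4⟩ := hsub hD
  refine ⟨b2.pos, b3, b4, fun D' hD' => ?_⟩
  have := hK.dist_le_mul D' (hsub hD').1 D b1
  rwa [Real.dist_eq, dist_eq_norm] at this


/-! ### The reduced nonlinearities and the conclusions -/

open Bd Dat

/-- Full neighbourhoods of zero contain `ε = 0`, where the reduced nonlinearity is `u²`; this
settles that case. -/
theorem existsUnique_defect_sq : (∃! d, IsDefect (fun u : ℝ => u ^ 2) d) ∧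
    defect (fun u : ℝ => u ^ 2) = 0 := by
  have e : (fun u : ℝ => u ^ 2) = modelNonlin 3 (psi 3 (3 / 2, 0)).1 (psi 3 (3 / 2, 0)).2 := by
    funext u
    simp [psi_base, modelNonlin]
  have hg := good_base 3
  rw [e]
  exact ⟨hg.existsUnique le_rfl, by
    rw [hg.defect_eq le_rfl, dd_dat_zero le_rfl (by norm_num) (by norm_num)]⟩

/-- A zero of the function which determines the maximum of the soliton. -/
theorem exists_maximum {p : ℝ} {C : ℝ} {M τ : ℝ → ℝ} {F : ℝ → ℝ → ℝ} {s : Set ℝ} (hC : 0 ≤ C)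
    (hF : ∀ ε ∈ s, Flat C (F ε)) (hM : Tendsto M (𝓝 0) (𝓝 0)) (hτ : Tendsto τ (𝓝 0) (𝓝 0))
    {η : ℝ} (h0 : 0 < η) (h1 : η ≤ 1 / 2) :
    ∀ᶠ ε in 𝓝 0, ε ∈ s → ∃ m, |m - 3 / 2| ≤ η ∧
      (M ε + mus p (m, ε)) * m ^ 4 / 4 + τ ε * prim (F ε) m = 0 := by
  have key : ∀ m ∈ Set.Icc (1:ℝ) 2, Tendsto
      (fun ε => (M ε + mus p (m, ε)) * m ^ 4 / 4 + |τ ε| * (C * m ^ 4)) (𝓝 0)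
        (𝓝 (2 * (2 / 3 * m - 1) / m ^ 2 * m ^ 4 / 4)) ∧
      Tendsto (fun ε => (M ε + mus p (m, ε)) * m ^ 4 / 4 - |τ ε| * (C * m ^ 4)) (𝓝 0)
        (𝓝 (2 * (2 / 3 * m - 1) / m ^ 2 * m ^ 4 / 4)) := fun m hm => by
    have a1 : Tendsto (fun ε => mus p (m, ε)) (𝓝 0) (𝓝 (mus p (m, 0))) := by
      have := (contDiffAt_mus p (z := (m, 0)) (by simp only; linarith [hm.1])).continuousAt.tendsto
      refine this.comp ?_
      exact (Continuous.prodMk_right m).tendsto 0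
    have a2 := (((hM.add a1).mul_const (m ^ 4)).div_const 4)
    have a3 := (hτ.abs.mul_const (C * m ^ 4))
    rw [mus_zero, zero_add] at a2
    rw [abs_zero, zero_mul] at a3
    exact ⟨by simpa using a2.add a3, by simpa using a2.sub a3⟩
  -- In the limit `ε → 0` the function to be annihilated is `(m²/3)(m - 3/2)`, with opposite signs
  -- at `3/2 - η` and `3/2 + η`. The remaining terms tend to zero at these two points, using the
  -- bound `C m⁴` for the primitive of `F`.
  have k1 := (key (3 / 2 - η) ⟨by linarith, by linarith⟩).1
  have k2 := (key (3 / 2 + η) ⟨by linarith, by linarith⟩).2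
  have s1 : 2 * (2 / 3 * (3 / 2 - η) - 1) / (3 / 2 - η) ^ 2 * (3 / 2 - η) ^ 4 / 4 < 0 := by
    have : 0 < 3 / 2 - η := by linarith
    have e : 2 * (2 / 3 * (3 / 2 - η) - 1) / (3 / 2 - η) ^ 2 * (3 / 2 - η) ^ 4 / 4 =
      -(η * (3 / 2 - η) ^ 2 / 3) := by field_simp; ring
    rw [e, neg_lt_zero]
    positivity
  have s2 : 0 < 2 * (2 / 3 * (3 / 2 + η) - 1) / (3 / 2 + η) ^ 2 * (3 / 2 + η) ^ 4 / 4 := by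
    have e : 2 * (2 / 3 * (3 / 2 + η) - 1) / (3 / 2 + η) ^ 2 * (3 / 2 + η) ^ 4 / 4 =
      η * (3 / 2 + η) ^ 2 / 3 := by field_simp; ring
    rw [e]
    positivity
  filter_upwards [k1.eventually (gt_mem_nhds s1), k2.eventually (lt_mem_nhds s2)] with ε b1 b2 hε
  have hf := hF ε hε
  have hp : ∀ m ∈ Set.Icc (1:ℝ) 2, |τ ε * prim (F ε) m| ≤ |τ ε| * (C * m ^ 4) := fun m hm => by
    rw [abs_mul]
    exact mul_le_mul_of_nonneg_left (hf.abs_prim_le hC ⟨by linarith [hm.1], hm.2⟩) (abs_nonneg _)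
  have p1 := (abs_le.1 (hp (3 / 2 - η) ⟨by linarith, by linarith⟩)).2
  have p2 := (abs_le.1 (hp (3 / 2 + η) ⟨by linarith, by linarith⟩)).1
  have hc : ContinuousOn (fun m => (M ε + mus p (m, ε)) * m ^ 4 / 4 + τ ε * prim (F ε) m)
      (Set.Icc (3 / 2 - η) (3 / 2 + η)) := fun m hm => by
    refine ContinuousAt.continuousWithinAt ?_
    have a1 : ContinuousAt (fun m => mus p (m, ε)) m :=
      ContinuousAt.comp (g := mus p) (f := fun m => (m, ε))
        (contDiffAt_mus p (z := (m, ε)) (by simp only; linarith [hm.1])).continuousAt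
        (Continuous.prodMk_left ε).continuousAt
    have a2 : ContinuousAt (prim (F ε)) m :=
      (hasDerivAt_prim hf.contDiff.continuous m).continuousAt
    fun_prop
  have hI := intermediate_value_Icc (show 3 / 2 - η ≤ 3 / 2 + η by linarith) hc
  obtain ⟨m, hm, hz⟩ := @hI 0 ⟨by linarith, by linarith⟩
  exact ⟨m, abs_le.2 ⟨by linarith [hm.1], by linarith [hm.2]⟩, hz⟩

/-- For small `ε` the maximum `m` is close to `3/2`, and the data of the reduced nonlinearity lie
within `O(τ)` of `dat p (m, ε)`, where `τ = |ε|^(1/(p-2)) |ε|`. The local Lipschitz bound for `dd`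
makes this an error `o(ε)`, and `dd_dat_isLittleO` treats the model part, uniformly in `m`. -/
theorem reduced_expansion {p : ℕ} (hp : 3 ≤ p) (μ₀ : ℝ) {f₁ : ℝ → ℝ → ℝ} {ε₁ C : ℝ} (hε₁ : 0 < ε₁)
    (hC : 0 ≤ C) (hF : ∀ ε : ℝ, 0 < |ε| → |ε| < ε₁ → Flat C (f₁ ε)) {c : ℝ} (hc : 0 < c) :
    ∀ᶠ ε in 𝓝 (0 : ℝ), (∃! d : ℝ, IsDefect (reducedNonlin p μ₀ f₁ ε) d) ∧
      |defect (reducedNonlin p μ₀ f₁ ε) - slope p * ε| ≤ c * |ε| := by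
  have hp' : (3:ℝ) ≤ p := by exact_mod_cast hp
  have hq : 0 < 1 / ((p:ℝ) - 2) := one_div_pos.2 (by linarith)
  obtain ⟨r, K, hr, hK, hV⟩ := exists_lipschitz_dd p
  have hd := (contDiffAt_dat p (z := (3 / 2, 0)) (by norm_num)).continuousAt.eventually
    (Metric.ball_mem_nhds _ (half_pos hr))
  have hev := (hd.and (good_base p).eventually).and ((dd_dat_isLittleO hp').bound (half_pos hc))
  obtain ⟨η, hη, hsub⟩ := Metric.eventually_nhds_iff.1 hev
  have hpow : ∀ x : ℝ, 0 < x → Tendsto (fun ε : ℝ => |ε| ^ x) (𝓝 0) (𝓝 0) := fun x hx => by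
    have : Continuous fun ε : ℝ => |ε| ^ x := continuous_abs.rpow_const fun _ => Or.inr hx.le
    have h := this.tendsto 0
    rwa [abs_zero, Real.zero_rpow hx.ne'] at h
  have hτ := hpow (1 + 1 / ((p:ℝ) - 2)) (by linarith)
  have hmax := exists_maximum (p := p) (s := {ε | 0 < |ε| ∧ |ε| < ε₁}) hC (fun ε h => hF ε h.1 h.2)
    (tendsto_muEps hp' μ₀) hτ (η := min (η / 2) (1 / 2)) (by positivity) (min_le_right _ _)
  have t1 := hτ.const_mul (950 * C)
  have t2 := (hpow _ hq).const_mul (K * (950 * C))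
  rw [mul_zero] at t1 t2
  filter_upwards [hmax, Metric.ball_mem_nhds (0:ℝ) hη, Metric.ball_mem_nhds (0:ℝ) hε₁,
    t1.eventually (gt_mem_nhds (half_pos hr)), t2.eventually (gt_mem_nhds (half_pos hc))]
    with ε e1 e2 e3 e4 e5
  rw [Metric.mem_ball, dist_zero_right, Real.norm_eq_abs] at e2 e3
  rcases eq_or_ne ε 0 with rfl | hε
  · have e : reducedNonlin p μ₀ f₁ 0 = fun u : ℝ => u ^ 2 := by
      funext u
      simp only [reducedNonlin, muEps, abs_zero, Real.zero_rpow hq.ne',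
        Real.zero_rpow (show 1 + 1 / ((p:ℝ) - 2) ≠ 0 by linarith)]
      ring
    rw [e, existsUnique_defect_sq.2]
    exact ⟨existsUnique_defect_sq.1, by simp⟩
  have hε0 := abs_pos.2 hε
  obtain ⟨m, hm, hΦ⟩ := e1 ⟨hε0, e3⟩
  have hm1 := hm.trans (min_le_left _ _)
  have hm2 := (abs_le.1 (hm.trans (min_le_right _ _))).2
  obtain ⟨⟨g1, g2⟩, g3⟩ := hsub (y := (m, ε)) (by
    rw [Prod.dist_eq, Real.dist_eq, Real.dist_eq, sub_zero]
    exact max_lt (by simp only; linarith) e2)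
  set τ := |ε| ^ (1 + 1 / ((p:ℝ) - 2)) with hτdef
  have hτ0 : 0 ≤ τ := by positivity
  obtain ⟨D', h1, h2⟩ := (hF ε hε0 e3).perturb_model hC hp hτ0 (by linarith) g2 hΦ
  have hD : dat p (m, ε) ∈ Metric.ball (dat p (3 / 2, 0)) r :=
    Metric.ball_subset_ball (half_le_self hr.le) g1
  have hD' : D' ∈ Metric.ball (dat p (3 / 2, 0)) r := by
    have h3 := (dist_eq_norm D' (dat p (m, ε))).le.trans h1
    exact (dist_triangle _ _ _).trans_lt
      ((add_lt_add (h3.trans_lt e4) g1).trans_eq (add_halves r))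
  obtain ⟨a1, a2, a3, -⟩ := hV D' hD'
  have hR : Rlz (reducedNonlin p μ₀ f₁ ε) D' := h2 a1 a2
  refine ⟨hR.existsUnique a3, ?_⟩
  rw [hR.defect_eq_dd a3]
  have b1 := (hV _ hD).2.2.2 D' hD'
  rw [Real.norm_eq_abs, Real.norm_eq_abs] at g3
  have e6 : τ = |ε| ^ (1 / ((p:ℝ) - 2)) * |ε| := by
    rw [hτdef, add_comm, Real.rpow_add_one hε0.ne']
  have b2 : K * ‖D' - dat p (m, ε)‖ ≤ c / 2 * |ε| := by
    refine (mul_le_mul_of_nonneg_left h1 hK).trans ?_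
    rw [e6]
    calc K * (950 * C * (|ε| ^ (1 / ((p:ℝ) - 2)) * |ε|))
        = K * (950 * C) * |ε| ^ (1 / ((p:ℝ) - 2)) * |ε| := by ring
      _ ≤ c / 2 * |ε| := mul_le_mul_of_nonneg_right e5.le hε0.le
  have b3 := abs_add_le (dd D' - dd (dat p (m, ε))) (dd (dat p (m, ε)) - slope p * ε)
  rw [sub_add_sub_cancel] at b3
  simp only at g3
  linarith

/-- The open set is the image of the good parameters under the change of parameters; the inverse
function theorem shows that it is open. -/
theorem model_regular {p : ℝ} (hp : 3 ≤ p) : ∃ U : Set (ℝ × ℝ), IsOpen U ∧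
    (∀ μ : ℝ, μ < 2 / 9 → (μ, (0 : ℝ)) ∈ U) ∧
    (∀ z ∈ U, ∃! d : ℝ, IsDefect (modelNonlin p z.1 z.2) d) ∧
    ContDiffOn ℝ ∞ (fun z : ℝ × ℝ => defect (modelNonlin p z.1 z.2)) U := by
  refine ⟨{w | ∃ z, Good p z ∧ psi p z = w}, ?_, fun μ hμ => ?_, ?_, ?_⟩
  · rw [isOpen_iff_mem_nhds]
    rintro w ⟨z, hz, rfl⟩
    obtain ⟨ψ, -, -, h⟩ := hz.exists_inverse
    filter_upwards [h] with w hw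
    exact ⟨ψ w, hw⟩
  · obtain ⟨m, h1, h2, h3⟩ := exists_mus_eq p hμ
    exact ⟨(m, 0), good_of_lt h1 h2, h3⟩
  · rintro w ⟨z, hz, rfl⟩
    exact hz.existsUnique hp
  · rintro w ⟨z, hz, rfl⟩
    exact (hz.contDiffAt_defect hp).contDiffWithinAt

theorem defect_model_zero {p : ℝ} (hp : 3 ≤ p) {μ : ℝ} (hμ : μ < 2 / 9) :
    defect (modelNonlin p μ 0) = 0 := by
  obtain ⟨m, h1, h2, h3⟩ := exists_mus_eq p hμ
  have := (good_of_lt (p := p) h1 h2).defect_eq hp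
  rwa [h3, dd_dat_zero hp h1 h2] at this

end GKdV

theorem mainTheorem6 :
    -- the defect of the model nonlinearities, for every real exponent `p ≥ 3`
    (∀ p : ℝ, 3 ≤ p →
      -- (1) for every `μ < 2/9` and all small `ν` the defect is well defined and smooth in `(μ, ν)`,
      -- and it vanishes when `ν = 0`
      ((∃ U : Set (ℝ × ℝ), IsOpen U ∧ (∀ μ : ℝ, μ < 2 / 9 → (μ, (0 : ℝ)) ∈ U) ∧
          (∀ z ∈ U, ∃! d : ℝ, GKdV.IsDefect (GKdV.modelNonlin p z.1 z.2) d) ∧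
          ContDiffOn ℝ ∞ (fun z : ℝ × ℝ => GKdV.defect (GKdV.modelNonlin p z.1 z.2)) U) ∧
        ∀ μ : ℝ, μ < 2 / 9 → GKdV.defect (GKdV.modelNonlin p μ 0) = 0) ∧
      -- (2) the first order expansion of `d_{μ(ε), ε}`
      ∀ μ₀ : ℝ,
        (fun ε : ℝ => GKdV.defect (GKdV.modelNonlin p (GKdV.muEps p μ₀ ε) ε) -
            -ε * GKdV.defectCoeff p * ∫ x : ℝ, (3 / (2 * Real.cosh (x / 2) ^ 2)) ^ p)
          =o[𝓝 0] (fun ε : ℝ => ε)) ∧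
    -- (3) the reduction `d(ε) = d_{μ(ε), ε} + o(ε)`, for either sign of the cubic coefficient
    (∀ p : ℕ, 3 ≤ p → ∀ (μ₀ : ℝ) (f₁ : ℝ → ℝ → ℝ) (ε₁ : ℝ), 0 < ε₁ →
      (∀ ε : ℝ, 0 < |ε| → |ε| < ε₁ → ContDiff ℝ ((p + 1 : ℕ) : ℕ∞) (f₁ ε)) →
      (∀ ε : ℝ, 0 < |ε| → |ε| < ε₁ →
        Tendsto (fun s : ℝ => f₁ ε s / |s| ^ p) (𝓝[≠] 0) (𝓝 0)) →
      (∀ R : ℝ, ∃ C : ℝ, ∀ ε : ℝ, 0 < |ε| → |ε| < ε₁ → ∀ s : ℝ, |s| ≤ R →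
        |iteratedDeriv (p + 1) (f₁ ε) s| ≤ C) →
      (∀ᶠ ε in 𝓝 (0 : ℝ), ∃! d : ℝ, GKdV.IsDefect (GKdV.reducedNonlin p μ₀ f₁ ε) d) ∧
      (fun ε : ℝ => GKdV.defect (GKdV.reducedNonlin p μ₀ f₁ ε) -
          GKdV.defect (GKdV.modelNonlin p (GKdV.muEps p μ₀ ε) ε))
        =o[𝓝 0] (fun ε : ℝ => ε) ∧
      (fun ε : ℝ => GKdV.defect (GKdV.reducedNonlin p μ₀ f₁ ε) -
          GKdV.defect (GKdV.modelNonlin p (-GKdV.muEps p μ₀ ε) ε))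
        =o[𝓝 0] (fun ε : ℝ => ε)) := by
  refine ⟨fun p hp => ⟨⟨GKdV.model_regular hp, fun μ hμ => GKdV.defect_model_zero hp hμ⟩, fun μ₀ => ?_⟩,
    fun p hp μ₀ f₁ ε₁ hε₁ h1 h2 h3 => ?_⟩
  · refine (GKdV.defect_expansion hp (GKdV.tendsto_muEps hp μ₀)).congr_left fun ε => ?_
    rw [GKdV.slope]
    ring
  · have hp' : (3:ℝ) ≤ p := by exact_mod_cast hp
    obtain ⟨C, hC⟩ := h3 2
    have hF : ∀ ε : ℝ, 0 < |ε| → |ε| < ε₁ → GKdV.Flat (|C| * 2 ^ (p - 2)) (f₁ ε) :=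
      fun ε e1 e2 => GKdV.flat_of_isLittleO hp (h1 ε e1 e2) (h2 ε e1 e2)
        fun s hs => (hC ε e1 e2 s hs).trans (le_abs_self C)
    have key := fun c (hc : (0:ℝ) < c) =>
      GKdV.reduced_expansion hp μ₀ hε₁ (by positivity) hF hc
    have hr : (fun ε : ℝ => GKdV.defect (GKdV.reducedNonlin p μ₀ f₁ ε) - GKdV.slope p * ε)
        =o[𝓝 0] fun ε : ℝ => ε := by
      refine isLittleO_iff.2 fun c hc => ?_
      filter_upwards [key c hc] with ε hε
      exact hε.2
    -- Both model defects have the same first order term as the reduced one, whatever the sign of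
    -- the cubic coefficient; the two claims follow by subtraction.
    refine ⟨(key 1 one_pos).mono fun ε hε => hε.1, ?_, ?_⟩
    · refine (hr.sub (GKdV.defect_expansion hp' (GKdV.tendsto_muEps hp' μ₀))).congr_left fun ε => ?_
      ring
    · refine (hr.sub (GKdV.defect_expansion hp' (GKdV.tendsto_muEps hp' (-μ₀)))).congr_left
        fun ε => ?_
      rw [← GKdV.muEps_neg]
      ring
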